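/- Let $d\in\{2,3\}$ and let $\Omega\subset\mathbb R^d$ be a bounded domain (nonempty, open, connected) with Lipschitz boundary. Write $H=L^2(\Omega)$, $V=H^1(\Omega)$, $V'$ for the dual of $V$, $(\cdot,\cdot)$ for the inner product of $H$, and embed $H$ into $V'$ by $u\mapsto(u,\cdot)$. Kernel. Let $J\in W^{1,1}(\mathbb R^d)$ satisfy $J(-x)=J(x)$ for a.e. $x$, and let $a(x)=\int_\Omega J(x-y)\,dy\ge 0$ for a.e. $x\in\Omega$. Put $(J*u)(x)=\int_\Omega J(x-y)u(y)\,dy$. Potential. Let $q\ge1$ be an integer and $F=F_1+F_2$ on $(-1,1)$, where $F_1\in C^{2+2q}(-1,1)$, $F_2\in C^2[-1,1]$, and: (i) there are $c_1>0$ and $\epsilon_0\in(0,1)$ with $F_1^{(2+2q)}\ge c_1$ on $(-1,-1+\epsilon_0]\cup[1-\epsilon_0,1)$; (ii) there is $\epsilon_0\in(0,1)$ such that $F_1^{(k)}\ge0$ on $[1-\epsilon_0,1)$ for $k=0,\dots,2+2q$, and $F_1^{(2j+2)}\ge0$, $F_1^{(2j+1)}\le0$ on $(-1,-1+\epsilon_0]$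 for $j=0,\dots,q$; (iii) there is $\epsilon_0\in(0,1)$ such that $F_1^{(2+2q)}$ is non-decreasing on $[1-\epsilon_0,1)$ and non-increasing on $(-1,-1+\epsilon_0]$; (iv) there are $\alpha_1,\beta\in\mathbb R$ with $\alpha_1+\beta>-\min_{[-1,1]}F_2''$, $F_1''\ge\alpha_1$ on $(-1,1)$ and $a\ge\beta$ a.e. in $\Omega$; (v) $F'(s)\to\pm\infty$ as $s\to\pm1$. Extend $F$ to $\pm1$ by its limits in $(-\infty,+\infty]$ and by $+\infty$ outside $[-1,1]$; in particular $F(u)\in L^1(\Omega)$ implies $|u|\le1$ a.e. in $\Omega$. Define $$\mathcal E(u)=\tfrac14\int_\Omega\int_\Omega J(x-y)(u(x)-u(y))^2\,dx\,dy+\int_\Omega F(u(x))\,dx .$$ Let $\alpha\ge0$, and let $\varphi_0\in L^\infty(\Omega)$ satisfy $\left|\frac1{|\Omega|}\int_\Omega\varphi_0\right|<1$ and $F(\varphi_0)\in L^1(\Omega)$. For $T>0$, a weak solution on $[0,T]$ of $$\partial_t\varphi=\Delta\mu,\qquad \mu=a\varphi-J*\varphi+F'(\varphi)+\alpha\,\partial_t\varphi,\qquad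 \partial_{\mathbf n}\mu|_{\partial\Omega}=0,\qquad \varphi(0)=\varphi_0$$ is a function $\varphi\in L^\infty(0,T;H)\cap L^\infty(0,T;L^{2+2q}(\Omega))$ with $\partial_t\varphi\in L^2(0,T;V')$, $\sqrt\alpha\,\partial_t\varphi\in L^2(0,T;H)$, $|\varphi|<1$ a.e. in $\Omega\times(0,T)$ and $\mu\in L^2(0,T;V)$ for the $\mu$ above, such that for every $\psi\in V$ $$\langle\partial_t\varphi,\psi\rangle+\int_\Omega\nabla\mu\cdot\nabla\psi\,dx=0\quad\text{for a.e. }t\in(0,T),$$ and such that $\varphi(0)=\varphi_0$, where $\varphi$ is identified with its representative in $C([0,T];V')$, whose values $\varphi(t)$ lie in $H$ for every $t$. Theorem. For every $T>0$ there exists a weak solution on $[0,T]$, and it is unique. Hence the solutions on the intervals $[0,T]$ are restrictions of one function $\varphi$ on $[0,\infty)$. Moreover, for all $t\ge0$, $(\varphi(t),1)=(\varphi_0,1)$, $F(\varphi(t))\in L^1(\Omega)$, and $$\mathcal E(\varphi(t))+\int_0^t\left(\|\nabla\mu(s)\|_H^2+\alpha\|\partial_t\varphi(s)\|_H^2\right)ds=\mathcal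 E(\varphi_0).$$ -/

import Mathlib

open MeasureTheory Set Filter Topology
open scoped ContDiff NNReal ENNReal

noncomputable section

namespace NonlocalCH

/-- Euclidean space `ℝ^d`. -/
abbrev E (d : ℕ) := EuclideanSpace ℝ (Fin d)

/-- The boundary of `Ω` is locally the graph of a Lipschitz function: near each boundary point, in
suitable orthonormal coordinates with last axis `ν`, the set `Ω` is exactly the part lying strictly
below the graph of a Lipschitz function of the component orthogonal to `ν`. -/
def HasLipschitzBoundary {d : ℕ} (Ω : Set (E d)) : Prop :=
  ∀ p ∈ frontier Ω, ∃ (ν : E d) (r : ℝ) (K : ℝ≥0) (γ : E d → ℝ),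
    ‖ν‖ = 1 ∧ 0 < r ∧ LipschitzWith K γ ∧
      ∀ x ∈ Metric.ball p r, x ∈ Ω ↔ inner ℝ ν x < γ (x - inner ℝ ν x • ν)

/-- A bounded domain (nonempty connected open set) with Lipschitz boundary. -/
structure IsBoundedLipschitzDomain {d : ℕ} (Ω : Set (E d)) : Prop where
  isOpen : IsOpen Ω
  isConnected : IsConnected Ω
  isBounded : Bornology.IsBounded Ω
  lipschitz : HasLipschitzBoundary Ω

/-- `G` is the weak (distributional) gradient of `u` in `Ω`. It is used only for locally integrable
`u` and `G`. -/
def HasWeakGradient {d : ℕ} (Ω : Set (E d)) (u : E d → ℝ) (G : E d → E d) : Prop :=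
  ∀ ψ : E d → ℝ, ContDiff ℝ ∞ ψ → HasCompactSupport ψ → tsupport ψ ⊆ Ω →
    ∀ e : E d, ∫ x in Ω, u x * fderiv ℝ ψ x e = -∫ x in Ω, inner ℝ (G x) e * ψ x

/-- `J ∈ W^{1,1}(ℝ^d)`. -/
def MemW11 {d : ℕ} (J : E d → ℝ) : Prop :=
  Integrable J ∧ ∃ G : E d → E d, Integrable G ∧ HasWeakGradient univ J G

/-- The space `H = L²(Ω)`. -/
abbrev H {d : ℕ} (Ω : Set (E d)) := Lp ℝ 2 (volume.restrict Ω)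

/-- The space `L²(Ω; ℝ^d)`. -/
abbrev HVec {d : ℕ} (Ω : Set (E d)) := Lp (E d) 2 (volume.restrict Ω)

lemma integrable_mul_fderiv {d : ℕ} {Ω : Set (E d)} (u : H Ω) {ψ : E d → ℝ}
    (h1 : ContDiff ℝ ∞ ψ) (h2 : HasCompactSupport ψ) (e : E d) :
    Integrable (fun x => u x * fderiv ℝ ψ x e) (volume.restrict Ω) := by
  have hc : Continuous fun x => fderiv ℝ ψ x e :=
    (h1.continuous_fderiv (by simp)).clm_apply continuous_const
  have hs : HasCompactSupport fun x => fderiv ℝ ψ x e := h2.fderiv_apply (𝕜 := ℝ) e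
  have hm : MemLp (fun x => fderiv ℝ ψ x e) 2 (volume.restrict Ω) :=
    (hc.memLp_of_hasCompactSupport hs).restrict Ω
  exact (Lp.memLp u).integrable_mul hm

lemma integrable_inner_mul {d : ℕ} {Ω : Set (E d)} (G : HVec Ω) {ψ : E d → ℝ}
    (h1 : ContDiff ℝ ∞ ψ) (h2 : HasCompactSupport ψ) (e : E d) :
    Integrable (fun x => inner ℝ (G x) e * ψ x) (volume.restrict Ω) := by
  have hm : MemLp ψ 2 (volume.restrict Ω) :=
    (h1.continuous.memLp_of_hasCompactSupport h2).restrict Ω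
  have hG : MemLp (fun x => inner ℝ (G x) e) 2 (volume.restrict Ω) :=
    (Lp.memLp G).inner_const e
  exact hG.integrable_mul hm

/-- The Sobolev space `V = H¹(Ω)`, realized as the space of pairs `(u, ∇u)` with `u ∈ L²(Ω)` whose
weak gradient `∇u` is in `L²(Ω; ℝ^d)`; the norm is `‖u‖² + ‖∇u‖²` under the square root. -/
def V {d : ℕ} (Ω : Set (E d)) : Submodule ℝ (WithLp 2 (H Ω × HVec Ω)) where
  carrier := {p | HasWeakGradient Ω p.fst p.snd}
  zero_mem' := by
    intro ψ h1 h2 _ e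
    have a1 : ∫ x in Ω, (0 : H Ω) x * fderiv ℝ ψ x e = 0 := by
      rw [← integral_zero (E d) ℝ (μ := volume.restrict Ω)]
      refine integral_congr_ae ?_
      filter_upwards [Lp.coeFn_zero ℝ 2 (volume.restrict Ω)] with x hx
      rw [hx, Pi.zero_apply, zero_mul]
    have a2 : ∫ x in Ω, inner ℝ ((0 : HVec Ω) x) e * ψ x = 0 := by
      rw [← integral_zero (E d) ℝ (μ := volume.restrict Ω)]
      refine integral_congr_ae ?_
      filter_upwards [Lp.coeFn_zero (E d) 2 (volume.restrict Ω)] with x hx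
      rw [hx, Pi.zero_apply, inner_zero_left, zero_mul]
    rw [WithLp.zero_fst, WithLp.zero_snd, a1, a2, neg_zero]
  add_mem' := by
    intro p p' hp hp' ψ h1 h2 h3 e
    have b1 : ∫ x in Ω, (p + p').fst x * fderiv ℝ ψ x e =
        (∫ x in Ω, p.fst x * fderiv ℝ ψ x e) + ∫ x in Ω, p'.fst x * fderiv ℝ ψ x e := by
      rw [← integral_add (integrable_mul_fderiv _ h1 h2 e) (integrable_mul_fderiv _ h1 h2 e)]
      refine integral_congr_ae ?_
      filter_upwards [Lp.coeFn_add p.fst p'.fst] with x hx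
      rw [WithLp.add_fst, hx, Pi.add_apply, add_mul]
    have b2 : ∫ x in Ω, inner ℝ ((p + p').snd x) e * ψ x =
        (∫ x in Ω, inner ℝ (p.snd x) e * ψ x) + ∫ x in Ω, inner ℝ (p'.snd x) e * ψ x := by
      rw [← integral_add (integrable_inner_mul _ h1 h2 e) (integrable_inner_mul _ h1 h2 e)]
      refine integral_congr_ae ?_
      filter_upwards [Lp.coeFn_add p.snd p'.snd] with x hx
      rw [WithLp.add_snd, hx, Pi.add_apply, inner_add_left, add_mul]
    rw [b1, b2, hp ψ h1 h2 h3 e, hp' ψ h1 h2 h3 e, neg_add]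
  smul_mem' := by
    intro c p hp ψ h1 h2 h3 e
    have b1 : ∫ x in Ω, (c • p).fst x * fderiv ℝ ψ x e =
        c * ∫ x in Ω, p.fst x * fderiv ℝ ψ x e := by
      rw [← integral_const_mul]
      refine integral_congr_ae ?_
      filter_upwards [Lp.coeFn_smul c p.fst] with x hx
      rw [WithLp.smul_fst, hx, Pi.smul_apply, smul_eq_mul, mul_assoc]
    have b2 : ∫ x in Ω, inner ℝ ((c • p).snd x) e * ψ x =
        c * ∫ x in Ω, inner ℝ (p.snd x) e * ψ x := by
      rw [← integral_const_mul]
      refine integral_congr_ae ?_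
      filter_upwards [Lp.coeFn_smul c p.snd] with x hx
      rw [WithLp.smul_snd, hx, Pi.smul_apply, real_inner_smul_left, mul_assoc]
    rw [b1, b2, hp ψ h1 h2 h3 e, mul_neg]

/-- The dual space `V'` of `V = H¹(Ω)`, with the dual norm. -/
abbrev VDual {d : ℕ} (Ω : Set (E d)) := V Ω →L[ℝ] ℝ

/-- The inclusion of `V` into `H`. -/
def toH {d : ℕ} (Ω : Set (E d)) : V Ω →L[ℝ] H Ω :=
  (ContinuousLinearMap.fst ℝ (H Ω) (HVec Ω)).comp
    ((WithLp.prodContinuousLinearEquiv 2 ℝ (H Ω) (HVec Ω)).toContinuousLinearMap.comp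
      (V Ω).subtypeL)

/-- The weak gradient on `V`. -/
def grad {d : ℕ} (Ω : Set (E d)) : V Ω →L[ℝ] HVec Ω :=
  (ContinuousLinearMap.snd ℝ (H Ω) (HVec Ω)).comp
    ((WithLp.prodContinuousLinearEquiv 2 ℝ (H Ω) (HVec Ω)).toContinuousLinearMap.comp
      (V Ω).subtypeL)

/-- The canonical embedding of `H` into `V'`: an element `u` acts by `v ↦ (u, v)` in `L²(Ω)`. -/
def toDual {d : ℕ} (Ω : Set (E d)) (u : H Ω) : VDual Ω :=
  (innerSL ℝ u).comp (toH Ω)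

/-- The restricted convolution `(J * u)(x) = ∫_Ω J(x - y) u(y) dy`. -/
def conv {d : ℕ} (Ω : Set (E d)) (J u : E d → ℝ) (x : E d) : ℝ :=
  ∫ y in Ω, J (x - y) * u y

/-- The function `a(x) = ∫_Ω J(x - y) dy`. -/
def aFun {d : ℕ} (Ω : Set (E d)) (J : E d → ℝ) (x : E d) : ℝ :=
  ∫ y in Ω, J (x - y)

/-- The assumptions on the interaction kernel. -/
structure IsAdmissibleKernel {d : ℕ} (Ω : Set (E d)) (J : E d → ℝ) : Prop where
  memW11 : MemW11 J
  even : ∀ᵐ x, J (-x) = J x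
  nonneg : ∀ᵐ x ∂volume.restrict Ω, 0 ≤ aFun Ω J x

/-- The assumptions on the singular potential `F = F₁ + F₂` on `(-1, 1)`, with exponent `q`. The
condition `convex` also involves the kernel, through `a`. -/
structure IsAdmissiblePotential {d : ℕ} (Ω : Set (E d)) (J : E d → ℝ) (q : ℕ) (F₁ F₂ : ℝ → ℝ) :
    Prop where
  smooth₁ : ContDiffOn ℝ ((2 + 2 * q : ℕ) : WithTop ℕ∞) F₁ (Ioo (-1) 1)
  smooth₂ : ContDiffOn ℝ 2 F₂ (Icc (-1) 1)
  top_deriv_pos : ∃ c₁ > (0 : ℝ), ∃ ε₀ ∈ Ioo (0 : ℝ) 1,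
    ∀ s ∈ Ioc (-1) (-1 + ε₀) ∪ Ico (1 - ε₀) 1, c₁ ≤ iteratedDeriv (2 + 2 * q) F₁ s
  deriv_signs : ∃ ε₀ ∈ Ioo (0 : ℝ) 1,
    (∀ k ≤ 2 + 2 * q, ∀ s ∈ Ico (1 - ε₀) 1, 0 ≤ iteratedDeriv k F₁ s) ∧
    (∀ j ≤ q, ∀ s ∈ Ioc (-1) (-1 + ε₀),
      0 ≤ iteratedDeriv (2 * j + 2) F₁ s ∧ iteratedDeriv (2 * j + 1) F₁ s ≤ 0)
  top_deriv_mono : ∃ ε₀ ∈ Ioo (0 : ℝ) 1,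
    MonotoneOn (iteratedDeriv (2 + 2 * q) F₁) (Ico (1 - ε₀) 1) ∧
    AntitoneOn (iteratedDeriv (2 + 2 * q) F₁) (Ioc (-1) (-1 + ε₀))
  convex : ∃ α₁ β m : ℝ,
    IsLeast (iteratedDerivWithin 2 F₂ (Icc (-1) 1) '' Icc (-1) 1) m ∧ -m < α₁ + β ∧
    (∀ s ∈ Ioo (-1 : ℝ) 1, α₁ ≤ iteratedDeriv 2 F₁ s) ∧
    ∀ᵐ x ∂volume.restrict Ω, β ≤ aFun Ω J x
  deriv_right : Tendsto (deriv fun s => F₁ s + F₂ s) (𝓝[<] 1) atTop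
  deriv_left : Tendsto (deriv fun s => F₁ s + F₂ s) (𝓝[>] (-1)) atBot

/-- The potential on `(-1, 1)`, extended to `±1` by its limits (which exist and are real or `+∞` for
an admissible potential) and by `+∞` outside `[-1, 1]`. -/
def extPotential (F : ℝ → ℝ) (s : ℝ) : EReal :=
  open Classical in
  if s ∈ Icc (-1 : ℝ) 1 then extendFrom (Ioo (-1 : ℝ) 1) (fun r => (F r : EReal)) s else ⊤

/-- `F(u) ∈ L¹(Ω)`; in particular `|u| ≤ 1` a.e. in `Ω`. -/
def PotentialInL1 {d : ℕ} (Ω : Set (E d)) (F : ℝ → ℝ) (u : E d → ℝ) : Prop :=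
  (∀ᵐ x ∂volume.restrict Ω, extPotential F (u x) ≠ ⊤) ∧
    Integrable (fun x => (extPotential F (u x)).toReal) (volume.restrict Ω)

/-- The nonlocal free energy. -/
def energy {d : ℕ} (Ω : Set (E d)) (J : E d → ℝ) (F : ℝ → ℝ) (u : E d → ℝ) : ℝ :=
  1 / 4 * (∫ x in Ω, ∫ y in Ω, J (x - y) * (u x - u y) ^ 2) +
    ∫ x in Ω, (extPotential F (u x)).toReal

/-- `w` is the weak (distributional) derivative on `(0, T)` of the `V'`-valued function `φ`. -/
def HasWeakTimeDeriv {d : ℕ} (Ω : Set (E d)) (T : ℝ) (φ : ℝ → H Ω) (w : ℝ → VDual Ω) : Prop :=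
  ∀ θ : ℝ → ℝ, ContDiff ℝ ∞ θ → HasCompactSupport θ → tsupport θ ⊆ Ioo 0 T →
    ∫ t in Ioo 0 T, deriv θ t • toDual Ω (φ t) = -∫ t in Ioo 0 T, θ t • w t

/-- `φ` is a weak solution on `[0, T]` with initial datum `φ₀`, where `w = ∂ₜφ` as an element of
`L²(0, T; V')`, `h = √α ∂ₜφ` as an element of `L²(0, T; H)`, and `μ` is the chemical potential.

As usual `φ` denotes the representative that is continuous with values in `V'` (it exists because
`∂ₜφ ∈ L²(0, T; V')`), which gives a meaning to `φ(t)` for every `t`. Since `φ` is a function of time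
with values in `L²(Ω)`, a property holds a.e. in `Ω × (0, T)` when it holds for a.e. `t`, for a.e.
`x`. -/
structure IsWeakSolution {d : ℕ} (Ω : Set (E d)) (J : E d → ℝ) (F : ℝ → ℝ) (q : ℕ) (α : ℝ)
    (φ₀ : E d → ℝ) (T : ℝ) (φ : ℝ → H Ω) (w : ℝ → VDual Ω) (h : ℝ → H Ω) (μ : ℝ → V Ω) :
    Prop where
  memH : MemLp φ ∞ (volume.restrict (Ioo 0 T))
  memLq : ∃ C : ℝ≥0, ∀ᵐ t ∂volume.restrict (Ioo 0 T),
    eLpNorm (φ t) ((2 + 2 * q : ℕ) : ℝ≥0∞) (volume.restrict Ω) ≤ C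
  weakDeriv : HasWeakTimeDeriv Ω T φ w
  deriv_memDual : MemLp w 2 (volume.restrict (Ioo 0 T))
  sqrt_deriv_memH : MemLp h 2 (volume.restrict (Ioo 0 T))
  sqrt_deriv_eq : ∀ᵐ t ∂volume.restrict (Ioo 0 T), toDual Ω (h t) = √α • w t
  mu_memV : MemLp μ 2 (volume.restrict (Ioo 0 T))
  mu_eq : ∀ᵐ t ∂volume.restrict (Ioo 0 T), ∀ᵐ x ∂volume.restrict Ω,
    toH Ω (μ t) x = aFun Ω J x * φ t x - conv Ω J (φ t) x + deriv F (φ t x) + √α * h t x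
  abs_lt_one : ∀ᵐ t ∂volume.restrict (Ioo 0 T), ∀ᵐ x ∂volume.restrict Ω, |φ t x| < 1
  weakForm : ∀ v : V Ω, ∀ᵐ t ∂volume.restrict (Ioo 0 T),
    w t v + inner ℝ (grad Ω (μ t)) (grad Ω v) = 0
  continuous : ContinuousOn (fun t => toDual Ω (φ t)) (Icc 0 T)
  initial : ∀ᵐ x ∂volume.restrict Ω, φ 0 x = φ₀ x

end NonlocalCH

end

open NonlocalCH

set_option linter.unusedSectionVars false

namespace NonlocalCH

/-! ### Global solvability of Lipschitz differential equations in a Banach space -/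

section ODE

/-! The system is a gradient flow. Let P be the orthogonal projection of L²(Ω) onto functions of
mean zero and N the inverse Neumann Laplacian on these. The mean of φ is conserved, and eliminating
μ turns the system into (N + α) ∂ₜφ + P(Kφ + b(φ)) = 0. Here κ = α₁ + min F₂'' is a lower bound for
F'', the function b(s) = F'(s) - κ s is nondecreasing on (-1, 1) with infinite limits at the ends,
and Kφ = (a + κ)φ - J*φ. With L u = (∇N u, √α P u) the operator acting on the velocity is L*L, and
‖L ∂ₜφ‖² is the dissipation ‖∇μ‖² + α‖∂ₜφ‖². Since a + κ ≥ c > 0 and convolution with J ∈ W^{1,1}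
maps L² into H¹, K is coercive on mean-zero functions up to a multiple of ‖L u‖²
(`SobolevTriple.coercive_sub`). These properties are abstracted in `FlowData`.

Existence: b is replaced by its Yosida approximation and a term ε v' is added, which leaves a
Lipschitz differential equation (`exists_isApprox`). The energy bounds L v' and √ε v' in L² in time.
Because the mean lies strictly inside (-1, 1), the whole nonlinearity is bounded by its mean-zero
part (`exists_le_mul_sub`, `abs_inner_one_le`), hence by the equation. Monotonicity then makes the
regularized flows Cauchy at rate √ε + √δ (`exists_cauchy_bound`); linear terms pass to weak limits
and the nonlinear one by Minty's argument (`ae_rel_of_weakTendsto`). The limit inclusion forces |φ|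
< 1 almost everywhere.

Uniqueness: the difference of two solutions, measured by ‖L ·‖², satisfies a Grönwall inequality,
and L is injective on mean-zero functions (`IsSolution.unique`).

Energy: lower semicontinuity gives the inequality ≤. Restarting the flow at a later time and using
uniqueness shows that the energy decreases. The subgradient inequality between the times s and s +
h, integrated in s and divided by h, gives the reverse inequality as h tends to 0
(`exists_solution_energy`). The abstract energy, a supremum of Moreau envelopes, is the given one
because the envelopes increase to the extended potential (`hasEnergy_iff`).

The inverse Neumann Laplacian rests on the Poincaré inequality, which is proved by translating
functions along segments inside Ω: inside balls, along chains of balls, and inward from the boundary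
graph. Finally, weak solutions and solutions of the abstract flow are translated into each other,
distributional time derivatives being converted into integrals by the lemma of du Bois-Reymond. -/

lemma integral_exp_mul_le {k : ℝ} (hk : 0 < k) (t : ℝ) :
    ∫ s in (0 : ℝ)..t, Real.exp (k * s) ≤ Real.exp (k * t) / k := by
  have h : ∀ s ∈ uIcc 0 t, HasDerivAt (fun s => Real.exp (k * s) / k) (Real.exp (k * s)) s := by
    intro s _
    have : HasDerivAt (fun s => Real.exp (k * s) / k) (Real.exp (k * s) * (k * 1) / k) s :=
      (((hasDerivAt_id s).const_mul k).exp).div_const k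
    rwa [mul_one, mul_div_assoc, div_self hk.ne', mul_one] at this
  rw [intervalIntegral.integral_eq_sub_of_hasDerivAt h
    (Continuous.intervalIntegrable (by fun_prop) _ _)]
  have : 0 ≤ Real.exp (k * 0) / k := by positivity
  linarith

variable {X : Type*} [NormedAddCommGroup X] [NormedSpace ℝ X] [CompleteSpace X]

/-- The weight gains a factor 1 / k uniformly in time; taking k large turns the Picard map into a
contraction on the whole half-line. -/
lemma norm_exp_smul_add_integral_le {k : ℝ} (hk : 0 < k) {M : ℝ} {g : ℝ → X}
    (hg : ∀ s, 0 ≤ s → ‖g s‖ ≤ M * Real.exp (k * s)) {t : ℝ} (ht : 0 ≤ t) :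
    ‖Real.exp (-(k * t)) • ∫ s in (0 : ℝ)..t, g s‖ ≤ M / k := by
  have hM : 0 ≤ M := by simpa using (norm_nonneg _).trans (hg 0 le_rfl)
  have h1 : ‖∫ s in (0 : ℝ)..t, g s‖ ≤ ∫ s in (0 : ℝ)..t, M * Real.exp (k * s) := by
    refine intervalIntegral.norm_integral_le_of_norm_le ht ?_
      (Continuous.intervalIntegrable (by fun_prop) _ _)
    exact Eventually.of_forall fun s hs => hg s hs.1.le
  rw [intervalIntegral.integral_const_mul] at h1
  have h2 := mul_le_mul_of_nonneg_left (integral_exp_mul_le hk t) hM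
  rw [norm_smul, Real.norm_of_nonneg (Real.exp_pos _).le]
  calc _ ≤ Real.exp (-(k * t)) * (M * (Real.exp (k * t) / k)) :=
        mul_le_mul_of_nonneg_left (h1.trans h2) (Real.exp_pos _).le
    _ = M / k := by
      rw [Real.exp_neg]; field_simp

/-- A globally Lipschitz autonomous ordinary differential equation has a solution for all positive
times. -/
theorem exists_forall_hasDerivAt_of_lipschitzWith {f : X → X} {K : ℝ≥0} (hf : LipschitzWith K f)
    (x₀ : X) :
    ∃ v : ℝ → X, v 0 = x₀ ∧ Continuous v ∧ ∀ t, 0 ≤ t → HasDerivAt v (f (v t)) t := by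
  -- With this rate the Picard map has Lipschitz constant K / k ≤ 1 / 2.
  set k : ℝ := 2 * K + 1 with hk
  have hk0 : 0 < k := by positivity
  have hfc := hf.continuous
  have hcont : ∀ g : BoundedContinuousFunction ℝ X,
      Continuous fun s : ℝ => f (Real.exp (k * max s 0) • g s) := fun g => by
    have := g.continuous
    fun_prop
  have hint : ∀ (g : BoundedContinuousFunction ℝ X) a b,
      IntervalIntegrable (fun s : ℝ => f (Real.exp (k * max s 0) • g s)) volume a b :=
    fun g a b => (hcont g).intervalIntegrable _ _
  have hprim : ∀ g : BoundedContinuousFunction ℝ X,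
      Continuous fun t : ℝ => ∫ s in (0 : ℝ)..t, f (Real.exp (k * max s 0) • g s) := fun g =>
    intervalIntegral.continuous_primitive (hint g) 0
  have hbound : ∀ (g : BoundedContinuousFunction ℝ X) (t : ℝ),
      ‖Real.exp (-(k * max t 0)) • (x₀ + ∫ s in (0 : ℝ)..(max t 0),
        f (Real.exp (k * max s 0) • g s))‖ ≤ ‖x₀‖ + (‖f 0‖ + K * ‖g‖) / k := by
    intro g t
    have ht : 0 ≤ max t 0 := le_max_right _ _
    rw [smul_add]
    refine (norm_add_le _ _).trans (add_le_add ?_ ?_)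
    · rw [norm_smul, Real.norm_of_nonneg (Real.exp_pos _).le]
      refine mul_le_of_le_one_left (norm_nonneg _) (Real.exp_le_one_iff.2 ?_)
      have := mul_nonneg hk0.le ht
      linarith
    · refine norm_exp_smul_add_integral_le hk0 (fun s hs => ?_) ht
      rw [max_eq_left hs]
      have h1 : ‖f (Real.exp (k * s) • g s)‖ ≤ ‖f 0‖ + K * ‖Real.exp (k * s) • g s‖ := by
        have := hf.norm_sub_le (Real.exp (k * s) • g s) 0
        rw [sub_zero] at this
        have h2 := norm_le_norm_add_norm_sub' (f (Real.exp (k * s) • g s)) (f 0)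
        linarith
      rw [norm_smul, Real.norm_of_nonneg (Real.exp_pos _).le] at h1
      have h3 : 1 ≤ Real.exp (k * s) := Real.one_le_exp (by positivity)
      have h4 := g.norm_coe_le_norm s
      have h5 : (K : ℝ) * (Real.exp (k * s) * ‖g s‖) ≤ K * (Real.exp (k * s) * ‖g‖) := by gcongr
      have h6 := le_mul_of_one_le_right (norm_nonneg (f 0)) h3
      linarith
  -- The unknown is g(t) = exp(-k t) v(t), which stays bounded even though v may grow exponentially.
  -- Replacing t by `max t 0` makes the image constant at negative times.
  let Φ : BoundedContinuousFunction ℝ X → BoundedContinuousFunction ℝ X := fun g =>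
    BoundedContinuousFunction.ofNormedAddCommGroup
      (fun t => Real.exp (-(k * max t 0)) • (x₀ + ∫ s in (0 : ℝ)..(max t 0),
        f (Real.exp (k * max s 0) • g s)))
      (by
        have := (hprim g).comp (continuous_id.max continuous_const : Continuous fun t : ℝ => max t 0)
        exact (Real.continuous_exp.comp (by fun_prop)).smul (continuous_const.add this))
      _ (hbound g)
  have hΦ : ContractingWith (1 / 2) Φ := by
    refine ⟨by rw [← NNReal.coe_lt_coe]; norm_num, LipschitzWith.of_dist_le_mul fun g g' => ?_⟩
    rw [BoundedContinuousFunction.dist_le (by positivity)]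
    intro t
    have ht : 0 ≤ max t 0 := le_max_right _ _
    rw [dist_eq_norm]
    have e : Φ g t - Φ g' t = Real.exp (-(k * max t 0)) • ∫ s in (0 : ℝ)..(max t 0),
        (f (Real.exp (k * max s 0) • g s) - f (Real.exp (k * max s 0) • g' s)) := by
      rw [intervalIntegral.integral_sub (hint g _ _) (hint g' _ _)]
      change Real.exp (-(k * max t 0)) •
            (x₀ + ∫ s in (0 : ℝ)..(max t 0), f (Real.exp (k * max s 0) • g s))
          - Real.exp (-(k * max t 0)) •
            (x₀ + ∫ s in (0 : ℝ)..(max t 0), f (Real.exp (k * max s 0) • g' s)) = _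
      rw [← smul_sub, add_sub_add_left_eq_sub]
    rw [e]
    refine (norm_exp_smul_add_integral_le (M := K * dist g g') hk0 (fun s hs => ?_) ht).trans ?_
    · rw [max_eq_left hs]
      refine (hf.norm_sub_le _ _).trans ?_
      rw [← smul_sub, norm_smul, Real.norm_of_nonneg (Real.exp_pos _).le, ← dist_eq_norm]
      have := BoundedContinuousFunction.dist_coe_le_dist (f := g) (g := g') s
      calc (K : ℝ) * (Real.exp (k * s) * dist (g s) (g' s))
          ≤ K * (Real.exp (k * s) * dist g g') := by gcongr
        _ = _ := by ring
    · rw [div_le_iff₀ hk0]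
      have h1 : 0 ≤ dist g g' := dist_nonneg
      have : ((1 / 2 : ℝ≥0) : ℝ) = 1 / 2 := by norm_num
      rw [this, hk]
      nlinarith [K.2]
  have hΦ' := hΦ.fixedPoint_isFixedPt
  set g := hΦ.fixedPoint with hgdef
  refine ⟨fun t => x₀ + ∫ s in (0 : ℝ)..t, f (Real.exp (k * max s 0) • g s), by simp,
    continuous_const.add (hprim g), fun t ht => ?_⟩
  have hval : x₀ + ∫ s in (0 : ℝ)..t, f (Real.exp (k * max s 0) • g s)
      = Real.exp (k * max t 0) • g t := by
    have h1 : Φ g t = g t := by rw [hΦ']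
    rw [← h1]
    change _ = Real.exp (k * max t 0) • (Real.exp (-(k * max t 0)) •
      (x₀ + ∫ s in (0 : ℝ)..(max t 0), f (Real.exp (k * max s 0) • g s)))
    rw [smul_smul, ← Real.exp_add, add_neg_cancel, Real.exp_zero, one_smul, max_eq_left ht]
  beta_reduce
  rw [hval]
  exact (intervalIntegral.integral_hasDerivAt_right (hint g _ _)
    ((hcont g).stronglyMeasurableAtFilter _ _) (hcont g).continuousAt).const_add x₀

end ODE

/-! ### Weak convergence in Hilbert spaces along filters -/

section WeakLimits

variable {X Y : Type*} [NormedAddCommGroup X] [InnerProductSpace ℝ X] [CompleteSpace X]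
  [NormedAddCommGroup Y] [InnerProductSpace ℝ Y] [CompleteSpace Y]

/-- Weak convergence in a Hilbert space. -/
def WeakTendsto {ι : Type*} (x : ι → X) (l : Filter ι) (a : X) : Prop :=
  ∀ g : X, Tendsto (fun i => inner ℝ (x i) g) l (𝓝 (inner ℝ a g))

lemma WeakTendsto.map {ι : Type*} {x : ι → X} {l : Filter ι} {a : X} (h : WeakTendsto x l a)
    (T : X →L[ℝ] Y) : WeakTendsto (fun i => T (x i)) l (T a) := fun g => by
  simpa only [ContinuousLinearMap.adjoint_inner_right] using h (T.adjoint g)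

lemma WeakTendsto.add {ι : Type*} {x y : ι → X} {l : Filter ι} {a b : X} (h : WeakTendsto x l a)
    (h' : WeakTendsto y l b) : WeakTendsto (fun i => x i + y i) l (a + b) := fun g => by
  simpa only [inner_add_left] using (h g).add (h' g)

lemma WeakTendsto.unique {ι : Type*} {x : ι → X} {l : Filter ι} [l.NeBot] {a b : X}
    (h : WeakTendsto x l a) (h' : WeakTendsto x l b) : a = b :=
  ext_inner_right ℝ fun g => tendsto_nhds_unique (h g) (h' g)

lemma weakTendsto_of_tendsto {ι : Type*} {x : ι → X} {l : Filter ι} {a : X}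
    (h : Tendsto x l (𝓝 a)) : WeakTendsto x l a := fun _ => h.inner tendsto_const_nhds

/-- A bounded family in a Hilbert space converges weakly along any ultrafilter. -/
theorem exists_weakTendsto {ι : Type*} (U : Ultrafilter ι) {x : ι → X} {C : ℝ}
    (hx : ∀ i, ‖x i‖ ≤ C) : ∃ a, WeakTendsto x U a ∧ ‖a‖ ≤ C := by
  have hb : ∀ g i, |inner ℝ (x i) g| ≤ C * ‖g‖ := fun g i =>
    (abs_real_inner_le_norm _ _).trans (by gcongr; exact hx i)
  -- Each scalar family lies in a compact interval, so it converges along the ultrafilter. The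
  -- limits form a bounded linear functional, represented by Riesz's theorem.
  have hlim : ∀ g, ∃ r, Tendsto (fun i => inner ℝ (x i) g) U (𝓝 r) := fun g => by
    have hK : IsCompact (Icc (-(C * ‖g‖)) (C * ‖g‖)) := isCompact_Icc
    obtain ⟨r, -, hr⟩ := hK.ultrafilter_le_nhds (U.map fun i => inner ℝ (x i) g) (by
      rw [le_principal_iff]
      exact Ultrafilter.mem_map.2 (Eventually.of_forall fun i => abs_le.1 (hb g i)))
    exact ⟨r, hr⟩
  choose φ hφ using hlim
  have hφb : ∀ g, ‖φ g‖ ≤ C * ‖g‖ := fun g => by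
    have h := (hφ g).norm
    exact le_of_tendsto h (Eventually.of_forall (hb g))
  let φl : X →ₗ[ℝ] ℝ :=
    { toFun := φ
      map_add' := fun g g' => tendsto_nhds_unique (hφ _) (by
        simpa only [inner_add_right] using (hφ g).add (hφ g'))
      map_smul' := fun c g => tendsto_nhds_unique (hφ _) (by
        simp only [real_inner_smul_right]
        exact (hφ g).const_mul c) }
  let φc : X →L[ℝ] ℝ := φl.mkContinuous C hφb
  have hC : 0 ≤ C := by
    obtain ⟨i⟩ : Nonempty ι := by
      by_contra h
      rw [not_nonempty_iff] at h
      exact U.neBot.ne (Filter.filter_eq_bot_of_isEmpty _)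
    exact (norm_nonneg _).trans (hx i)
  refine ⟨(InnerProductSpace.toDual ℝ X).symm φc, fun g => ?_, ?_⟩
  · rw [InnerProductSpace.toDual_symm_apply]
    exact hφ g
  · rw [LinearIsometryEquiv.norm_map]
    exact φl.mkContinuous_norm_le hC hφb

/-- If a bounded family in the range of an orthogonal projection `P` is sent to a null family by an
operator which is injective on that range, then it converges weakly to zero. -/
theorem weakTendsto_zero_of_map {ι : Type*} {l : Filter ι} {L : X →L[ℝ] Y} {P : X →L[ℝ] X}
    (hPs : ∀ u v, inner ℝ (P u) v = inner ℝ u (P v))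
    (hL : ∀ u, L u = 0 → P u = 0) {x : ι → X} {C : ℝ}
    (hx : ∀ᶠ i in l, ‖x i‖ ≤ C) (hP : ∀ᶠ i in l, P (x i) = x i)
    (hLx : Tendsto (fun i => L (x i)) l (𝓝 0)) : WeakTendsto x l 0 := by
  intro g
  rw [inner_zero_left, tendsto_iff_ultrafilter]
  -- Along any ultrafilter finer than `l` a weak limit a exists; L a = 0 gives P a = 0, and since
  -- the family lies in the range of P its limit against every g is zero.
  intro U hU
  obtain ⟨a, ha, -⟩ : ∃ a, WeakTendsto x U a ∧ ‖a‖ ≤ max C 0 := by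
    classical
    -- The bound holds only eventually, so the family is set to zero where it fails.
    obtain ⟨a, ha, hb⟩ := exists_weakTendsto U (x := fun i => if ‖x i‖ ≤ C then x i else 0)
      (C := max C 0) (fun i => by
        split_ifs with h
        · exact h.trans (le_max_left _ _)
        · simp)
    refine ⟨a, fun g => (ha g).congr' ?_, hb⟩
    filter_upwards [hU hx] with i hi
    rw [if_pos hi]
  have hLa : L a = 0 := (ha.map L).unique (weakTendsto_of_tendsto (hLx.mono_left hU))
  have h0 : P a = 0 := hL a hLa
  have h1 := ha (P g)
  rw [← hPs, h0, inner_zero_left] at h1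
  refine h1.congr' ?_
  filter_upwards [hU hP] with i hi
  rw [← hPs, hi]

end WeakLimits

/-! ### Chain rule for squared norms and a Grönwall lemma -/

section AbsolutelyContinuous

variable {X : Type*} [NormedAddCommGroup X] [InnerProductSpace ℝ X] [CompleteSpace X]

lemma absolutelyContinuousOnInterval_of_dist_le {f g : ℝ → ℝ} {a b C : ℝ}
    (hg : AbsolutelyContinuousOnInterval g a b)
    (h : ∀ x ∈ uIcc a b, ∀ y ∈ uIcc a b, dist (f x) (f y) ≤ C * dist (g x) (g y)) :
    AbsolutelyContinuousOnInterval f a b := by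
  have h1 := hg.const_mul C
  rw [absolutelyContinuousOnInterval_iff] at hg ⊢
  intro ε hε
  obtain ⟨δ, hδ, hd⟩ := hg (ε / (|C| + 1)) (by positivity)
  refine ⟨δ, hδ, fun E hE hlen => ?_⟩
  have h2 := hd E hE hlen
  have h3 : ∀ i ∈ Finset.range E.1, dist (f (E.2 i).1) (f (E.2 i).2)
      ≤ (|C| + 1) * dist (g (E.2 i).1) (g (E.2 i).2) := fun i hi => by
    have hm := hE.1 i hi
    refine (h _ hm.1 _ hm.2).trans ?_
    gcongr
    linarith [le_abs_self C]
  calc _ ≤ _ := Finset.sum_le_sum h3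
    _ = (|C| + 1) * ∑ i ∈ Finset.range E.1, dist (g (E.2 i).1) (g (E.2 i).2) := by
      rw [Finset.mul_sum]
    _ < (|C| + 1) * (ε / (|C| + 1)) := by gcongr
    _ = ε := by field_simp

/-- The chain rule for the squared norm of an indefinite Bochner integral. -/
theorem norm_sq_integral_eq {ζ : ℝ → X} {T : ℝ} (hT : 0 ≤ T)
    (hζ : IntervalIntegrable ζ volume 0 T) :
    ‖∫ s in (0 : ℝ)..T, ζ s‖ ^ 2
      = 2 * ∫ t in (0 : ℝ)..T, inner ℝ (ζ t) (∫ s in (0 : ℝ)..t, ζ s) := by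
  set z : ℝ → X := fun t => ∫ s in (0 : ℝ)..t, ζ s with hz
  set R : ℝ := ∫ s in (0 : ℝ)..T, ‖ζ s‖ with hR
  have hsub : ∀ t ∈ uIcc 0 T, IntervalIntegrable ζ volume 0 t := fun t ht =>
    hζ.mono_set (uIcc_subset_uIcc_left ht)
  have hzR : ∀ t ∈ uIcc 0 T, ‖z t‖ ≤ R := fun t ht => by
    have ht' := (uIcc_of_le hT) ▸ ht
    refine (intervalIntegral.norm_integral_le_integral_norm ht'.1).trans ?_
    exact intervalIntegral.integral_mono_interval le_rfl ht'.1 ht'.2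
      (Eventually.of_forall fun s => norm_nonneg _) hζ.norm
  -- The squared norm is Lipschitz relative to the absolutely continuous primitive of ‖ζ‖. It is
  -- therefore absolutely continuous, and its almost everywhere derivative determines it.
  have hd : ∀ x ∈ uIcc 0 T, ∀ y ∈ uIcc 0 T, dist (‖z x‖ ^ 2) (‖z y‖ ^ 2)
      ≤ (2 * R) * dist (∫ s in (0 : ℝ)..x, ‖ζ s‖) (∫ s in (0 : ℝ)..y, ‖ζ s‖) := by
    intro x hx y hy
    have h1 : ‖z x - z y‖ ≤ |(∫ s in (0 : ℝ)..x, ‖ζ s‖) - ∫ s in (0 : ℝ)..y, ‖ζ s‖| := by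
      rw [hz]
      simp only
      rw [intervalIntegral.integral_interval_sub_left (hsub x hx) (hsub y hy),
        intervalIntegral.integral_interval_sub_left (hsub x hx).norm (hsub y hy).norm]
      exact intervalIntegral.norm_integral_le_abs_integral_norm
    rw [Real.dist_eq, Real.dist_eq]
    have h2 : ‖z x‖ ^ 2 - ‖z y‖ ^ 2 = (‖z x‖ + ‖z y‖) * (‖z x‖ - ‖z y‖) := by ring
    rw [h2, abs_mul, abs_of_nonneg (by positivity)]
    have h3 := abs_norm_sub_norm_le (z x) (z y)
    have := hzR x hx
    have := hzR y hy
    exact mul_le_mul (by linarith) (h3.trans h1) (abs_nonneg _) (by linarith [norm_nonneg (z x)])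
  have hac : AbsolutelyContinuousOnInterval (fun t => ‖z t‖ ^ 2) 0 T :=
    absolutelyContinuousOnInterval_of_dist_le
      (hζ.norm.absolutelyContinuousOnInterval_intervalIntegral (c := 0) (by simp)) hd
  have h := hac.integral_deriv_eq_sub
  have hz0 : z 0 = 0 := by simp [hz]
  simp only [hz0, norm_zero] at h
  change ‖z T‖ ^ 2 = 2 * ∫ t in (0 : ℝ)..T, inner ℝ (ζ t) (z t)
  have h' : ∫ t in (0 : ℝ)..T, deriv (fun t => ‖z t‖ ^ 2) t
      = ∫ t in (0 : ℝ)..T, 2 * inner ℝ (ζ t) (z t) := by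
    refine intervalIntegral.integral_congr_ae ?_
    filter_upwards [hζ.ae_hasDerivAt_integral] with t ht htm
    have := (ht (uIoc_subset_uIcc htm) 0 (by simp)).norm_sq
    rw [this.deriv, real_inner_comm]
  rw [← intervalIntegral.integral_const_mul, ← h', h]
  simp

/-- The integral form of Grönwall's inequality with zero data. -/
theorem eq_zero_of_le_integral {g : ℝ → ℝ} {C T : ℝ} (hT : 0 ≤ T) (hg : ContinuousOn g (Icc 0 T))
    (hg0 : ∀ t ∈ Icc 0 T, 0 ≤ g t) (hC : 0 ≤ C)
    (h : ∀ t ∈ Icc 0 T, g t ≤ C * ∫ s in (0 : ℝ)..t, g s) : ∀ t ∈ Icc 0 T, g t = 0 := by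
  have hint : IntervalIntegrable g volume 0 T :=
    ContinuousOn.intervalIntegrable (by rwa [uIcc_of_le hT])
  -- Grönwall's inequality is applied to the primitive G of g, for which G' = g ≤ C G and G(0) = 0.
  have hG : ∀ t ∈ Icc 0 T, ‖∫ s in (0 : ℝ)..t, g s‖ ≤ gronwallBound 0 C 0 (t - 0) := by
    refine norm_le_gronwallBound_of_norm_deriv_right_le (f' := g) ?_ ?_ (by simp) ?_
    · have := intervalIntegral.continuousOn_primitive_interval' hint (by simp : (0 : ℝ) ∈ uIcc 0 T)
      rwa [uIcc_of_le hT] at this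
    · intro t ht
      have h1 : IntervalIntegrable g volume 0 t :=
        hint.mono_set (uIcc_subset_uIcc_left (by rw [uIcc_of_le hT]; exact Ico_subset_Icc_self ht))
      have hc : ContinuousWithinAt g (Ici t) t := by
        have := hg t (Ico_subset_Icc_self ht)
        refine (this.mono (s := Icc t T) (Icc_subset_Icc_left ht.1)).mono_of_mem_nhdsWithin ?_
        exact Icc_mem_nhdsGE ht.2
      refine intervalIntegral.integral_hasDerivWithinAt_right h1 ?_
        (hc.mono Ioi_subset_Ici_self)
      refine ⟨Ioc t T, Ioc_mem_nhdsGT ht.2, ?_⟩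
      exact ((hg.mono (Ioc_subset_Icc_self.trans
        (Icc_subset_Icc_left ht.1))).aestronglyMeasurable measurableSet_Ioc)
    · intro t ht
      have ht' := Ico_subset_Icc_self ht
      rw [add_zero, Real.norm_of_nonneg (hg0 t ht')]
      refine (h t ht').trans ?_
      gcongr
      exact le_abs_self _
  intro t ht
  have h1 := hG t ht
  have h2 : gronwallBound 0 C 0 (t - 0) = 0 := by
    simp [gronwallBound_ε0]
  rw [h2] at h1
  have h3 : ∫ s in (0 : ℝ)..t, g s = 0 := norm_le_zero_iff.1 h1
  have h4 := h t ht
  rw [h3, mul_zero] at h4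
  exact le_antisymm h4 (hg0 t ht)

end AbsolutelyContinuous

end NonlocalCH

/-! ### Abstract gradient flows: the regularized problem and its estimates -/

namespace NonlocalCH

/-- The data of an abstract gradient flow `L* (L u)' + P (K u + A u) = 0`: the operator `L` defines
the metric, `P` is the orthogonal projection onto the admissible directions, `K` is a self-adjoint
operator that is coercive up to the metric, and `A ε`, `Ψ ε` are the Yosida approximations of a
subdifferential and the Moreau envelopes of its potential. -/
structure FlowData (X Y : Type*) [NormedAddCommGroup X] [InnerProductSpace ℝ X] [CompleteSpace X]
    [NormedAddCommGroup Y] [InnerProductSpace ℝ Y] [CompleteSpace Y] where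
  L : X →L[ℝ] Y
  P : X →L[ℝ] X
  K : X →L[ℝ] X
  m : X
  A : ℝ → X → X
  Ψ : ℝ → X → ℝ
  c : ℝ
  C : ℝ
  C₁ : ℝ
  ε₀ : ℝ
  c_pos : 0 < c
  C_nonneg : 0 ≤ C
  ε₀_pos : 0 < ε₀
  ε₀_le_one : ε₀ ≤ 1
  P_symm : ∀ u v, inner ℝ (P u) v = inner ℝ u (P v)
  P_idem : ∀ u, P (P u) = P u
  L_P : ∀ u, L (P u) = L u
  L_inj : ∀ u, L u = 0 → P u = 0
  K_symm : ∀ u v, inner ℝ (K u) v = inner ℝ u (K v)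
  K_coercive : ∀ u, P u = u → c * ‖u‖ ^ 2 - C * ‖L u‖ ^ 2 ≤ inner ℝ (K u) u
  A_mono : ∀ ε δ, 0 < ε → 0 < δ → ∀ u v,
    0 ≤ inner ℝ (A ε u - A δ v) ((u - ε • A ε u) - (v - δ • A δ v))
  A_resolvent : ∀ ε δ, 0 < ε → 0 < δ → ∀ u, A δ (u + (δ - ε) • A ε u) = A ε u
  Ψ_subgrad : ∀ ε, 0 < ε → ∀ u v, Ψ ε u + inner ℝ (A ε u) (v - u) ≤ Ψ ε v
  Ψ_anti : ∀ ε δ, 0 < ε → ε ≤ δ → ∀ u, Ψ δ u ≤ Ψ ε u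
  Ψ_coercive : ∀ ε, 0 < ε → ε ≤ ε₀ → ∀ u, ‖u‖ ^ 2 - C₁ ≤ 1 / 2 * inner ℝ (K u) u + Ψ ε u
  A_bound : ∀ R, ∃ C', 0 ≤ C' ∧ ∀ ε, 0 < ε → ε ≤ ε₀ → ∀ u, ‖u‖ ≤ R → P u = u - m →
    ‖A ε u‖ ≤ C' * (1 + ‖P (A ε u)‖)

namespace FlowData

variable {X Y : Type*} [NormedAddCommGroup X] [InnerProductSpace ℝ X] [CompleteSpace X]
  [NormedAddCommGroup Y] [InnerProductSpace ℝ Y] [CompleteSpace Y] (D : FlowData X Y)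

/-- Monotonicity with equal parameters reads ε‖A u - A v‖² ≤ (A u - A v, u - v). -/
lemma A_lipschitz {ε : ℝ} (hε : 0 < ε) (u v : X) : ‖D.A ε u - D.A ε v‖ ≤ ε⁻¹ * ‖u - v‖ := by
  have h := D.A_mono ε ε hε hε u v
  have e : (u - ε • D.A ε u) - (v - ε • D.A ε v) = (u - v) - ε • (D.A ε u - D.A ε v) := by
    rw [smul_sub]; abel
  rw [e, inner_sub_right, real_inner_smul_right, real_inner_self_eq_norm_sq] at h
  have h1 := real_inner_le_norm (D.A ε u - D.A ε v) (u - v)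
  rw [← div_eq_inv_mul, le_div_iff₀ hε]
  by_contra hlt
  push Not at hlt
  have h2 : 0 < ‖D.A ε u - D.A ε v‖ := by
    by_contra h0
    have : ‖D.A ε u - D.A ε v‖ = 0 := le_antisymm (not_lt.1 h0) (norm_nonneg _)
    rw [this, zero_mul] at hlt
    exact absurd hlt (not_lt.2 (norm_nonneg _))
  nlinarith

lemma A_lipschitzWith {ε : ℝ} (hε : 0 < ε) : LipschitzWith (Real.toNNReal ε⁻¹) (D.A ε) :=
  LipschitzWith.of_dist_le_mul fun u v => by
    rw [dist_eq_norm, dist_eq_norm, Real.coe_toNNReal _ (inv_nonneg.2 hε.le)]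
    exact D.A_lipschitz hε u v

/-- The regularized energy. -/
noncomputable def energyReg (ε : ℝ) (u : X) : ℝ := 1 / 2 * inner ℝ (D.K u) u + D.Ψ ε u

/-- The subgradient inequalities at u and at v trap the first-order remainder between 0 and (A v - A
u, v - u), which is at most ε⁻¹‖v - u‖² by the Lipschitz bound. -/
lemma hasFDerivAt_Ψ {ε : ℝ} (hε : 0 < ε) (u : X) :
    HasFDerivAt (D.Ψ ε) (innerSL ℝ (D.A ε u)) u := by
  rw [hasFDerivAt_iff_isLittleO]
  refine (Asymptotics.IsBigO.of_bound ε⁻¹ ?_).trans_isLittleO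
    (Asymptotics.isLittleO_pow_sub_sub u one_lt_two)
  refine Eventually.of_forall fun v => ?_
  have h1 := D.Ψ_subgrad ε hε u v
  have h2 := D.Ψ_subgrad ε hε v u
  have h3 := real_inner_le_norm (D.A ε v - D.A ε u) (v - u)
  have h4 := mul_le_mul_of_nonneg_right (D.A_lipschitz hε v u) (norm_nonneg (v - u))
  rw [inner_sub_left] at h3
  have h5 : inner ℝ (D.A ε v) (u - v) = - inner ℝ (D.A ε v) (v - u) := by
    rw [← inner_neg_right, neg_sub]
  rw [Real.norm_eq_abs, norm_pow, norm_norm, innerSL_apply_apply, abs_of_nonneg (by linarith)]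
  nlinarith

lemma hasDerivAt_energyReg {ε : ℝ} (hε : 0 < ε) {v : ℝ → X} {v' : X} {t : ℝ}
    (hv : HasDerivAt v v' t) :
    HasDerivAt (fun t => D.energyReg ε (v t)) (inner ℝ (D.K (v t) + D.A ε (v t)) v') t := by
  have h1 := ((D.K.hasFDerivAt.comp_hasDerivAt t hv).inner ℝ hv).const_mul (1 / 2 : ℝ)
  have h2 := (D.hasFDerivAt_Ψ hε (v t)).comp_hasDerivAt t hv
  refine (h1.add h2).congr_deriv ?_
  simp only [Function.comp, innerSL_apply_apply, inner_add_left, D.K_symm v' (v t)]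
  rw [real_inner_comm (D.K (v t)) v']
  ring

/-- `v` solves the regularized flow with parameter `ε` and initial value `u₀`. -/
structure IsApprox (ε : ℝ) (u₀ : X) (v v' : ℝ → X) : Prop where
  cont : Continuous v
  cont' : Continuous v'
  init : v 0 = u₀
  proj' : ∀ t, D.P (v' t) = v' t
  proj : ∀ t, 0 ≤ t → D.P (v t) = v t - D.m
  deriv : ∀ t, 0 ≤ t → HasDerivAt v (v' t) t
  eqn : ∀ t, D.L.adjoint (D.L (v' t)) + ε • v' t + D.P (D.K (v t) + D.A ε (v t)) = 0

lemma P_adjoint (y : Y) : D.P (D.L.adjoint y) = D.L.adjoint y :=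
  ext_inner_right ℝ fun u => by
    rw [D.P_symm, ContinuousLinearMap.adjoint_inner_left, ContinuousLinearMap.adjoint_inner_left,
      D.L_P]

/-- L*L + ε is coercive, hence invertible by Lax–Milgram, so the regularized equation can be solved
for v' with a globally Lipschitz right-hand side. -/
theorem exists_isApprox {ε : ℝ} (hε : 0 < ε) {u₀ : X} (hu₀ : D.P u₀ = u₀ - D.m) :
    ∃ v v', D.IsApprox ε u₀ v v' := by
  let T : X →L[ℝ] X := D.L.adjoint.comp D.L + ε • ContinuousLinearMap.id ℝ X
  have hT : ∀ u, T u = D.L.adjoint (D.L u) + ε • u := fun u => rfl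
  have hco : IsCoercive ((innerSL ℝ).comp T : X →L[ℝ] X →L[ℝ] ℝ) := by
    refine ⟨ε, hε, fun u => ?_⟩
    rw [ContinuousLinearMap.comp_apply, innerSL_apply_apply, hT, inner_add_left,
      ContinuousLinearMap.adjoint_inner_left, real_inner_smul_left, real_inner_self_eq_norm_sq,
      real_inner_self_eq_norm_sq]
    nlinarith [sq_nonneg ‖D.L u‖]
  let S := hco.continuousLinearEquivOfBilin
  have hS : ∀ u, S u = T u := fun u => ext_inner_right ℝ fun w => by
    rw [hco.continuousLinearEquivOfBilin_apply]
    rfl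
  have hSinv : ∀ g, T (S.symm g) = g := fun g => by rw [← hS, S.apply_symm_apply]
  let f : X → X := fun u => S.symm (-D.P (D.K u + D.A ε u))
  have hA := D.A_lipschitzWith hε
  obtain ⟨k, hf⟩ : ∃ k, LipschitzWith k f :=
    ⟨_, (S.symm : X →L[ℝ] X).lipschitz.comp ((D.P.lipschitz.comp (D.K.lipschitz.add hA)).neg)⟩
  obtain ⟨v, h0, hvc, hv⟩ := exists_forall_hasDerivAt_of_lipschitzWith hf u₀
  have heq : ∀ u, T (f u) = -D.P (D.K u + D.A ε u) := fun u => hSinv _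
  -- Both L* and the right-hand side take values in the range of P; applying P to the equation
  -- leaves ε P(f u) = ε f u.
  have hPf : ∀ u, D.P (f u) = f u := fun u => by
    have h1 := heq u
    have h2 := congrArg D.P h1
    rw [map_neg, D.P_idem, ← h1, hT, map_add, D.P_adjoint, map_smul] at h2
    exact smul_right_injective X hε.ne' (add_left_cancel h2)
  refine ⟨v, fun t => f (v t), hvc, hf.continuous.comp hvc, h0, fun t => hPf _, fun t ht => ?_, hv,
    fun t => ?_⟩
  · have hc : ∀ x ∈ Icc 0 t, D.P (v x) - v x = D.P (v 0) - v 0 := by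
      refine constant_of_has_deriv_right_zero (by fun_prop) fun x hx => ?_
      have h1 := hv x hx.1
      have h2 := (D.P.hasFDerivAt.comp_hasDerivAt x h1).sub h1
      rw [hPf, sub_self] at h2
      exact h2.hasDerivWithinAt
    have := hc t ⟨ht, le_rfl⟩
    rw [h0, hu₀, sub_sub_cancel_left] at this
    rw [eq_add_of_sub_eq this]
    abel
  · have := heq (v t)
    rw [hT] at this
    rw [this]
    abel

variable {D}

namespace IsApprox

variable {ε : ℝ} {u₀ : X} {v v' : ℝ → X}

/-- The regularized dissipation. -/
lemma inner_eq (h : D.IsApprox ε u₀ v v') (t : ℝ) (w : X) (hw : D.P w = w) :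
    inner ℝ (D.K (v t) + D.A ε (v t)) w
      = -inner ℝ (D.L (v' t)) (D.L w) - ε * inner ℝ (v' t) w := by
  have h1 := congrArg (fun z => inner ℝ z w) (h.eqn t)
  simp only [inner_add_left, inner_zero_left, ContinuousLinearMap.adjoint_inner_left,
    real_inner_smul_left, D.P_symm, hw] at h1 ⊢
  linarith

lemma energy_eq (h : D.IsApprox ε u₀ v v') (hε : 0 < ε) {t : ℝ} (ht : 0 ≤ t) :
    D.energyReg ε (v t) + ∫ s in (0 : ℝ)..t, (‖D.L (v' s)‖ ^ 2 + ε * ‖v' s‖ ^ 2)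
      = D.energyReg ε u₀ := by
  have hc := h.cont
  have hc' := h.cont'
  have h1 : ∀ s ∈ uIcc 0 t, HasDerivAt (fun s => -D.energyReg ε (v s))
      (‖D.L (v' s)‖ ^ 2 + ε * ‖v' s‖ ^ 2) s := fun s hs => by
    rw [uIcc_of_le ht] at hs
    have := (D.hasDerivAt_energyReg hε (h.deriv s hs.1)).neg
    rw [h.inner_eq s _ (h.proj' s), real_inner_self_eq_norm_sq, real_inner_self_eq_norm_sq] at this
    exact this.congr_deriv (by ring)
  rw [intervalIntegral.integral_eq_sub_of_hasDerivAt h1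
    (Continuous.intervalIntegrable (by fun_prop) _ _), h.init]
  ring

/-- The density which dominates all error terms of the regularized flow. -/
lemma integral_le (h : D.IsApprox ε u₀ v v') (hε : 0 < ε) (hε' : ε ≤ D.ε₀) {M : ℝ}
    (hM : D.energyReg ε u₀ + D.C₁ ≤ M) {t : ℝ} (ht : 0 ≤ t) :
    ∫ s in (0 : ℝ)..t, (‖D.L (v' s)‖ ^ 2 + ε * ‖v' s‖ ^ 2) ≤ M := by
  have h1 := h.energy_eq hε ht
  have h2 := D.Ψ_coercive ε hε hε' (v t)
  have h3 : D.energyReg ε (v t) = 1 / 2 * inner ℝ (D.K (v t)) (v t) + D.Ψ ε (v t) := rfl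
  have := sq_nonneg ‖v t‖
  linarith

lemma norm_sq_le (h : D.IsApprox ε u₀ v v') (hε : 0 < ε) (hε' : ε ≤ D.ε₀) {M : ℝ}
    (hM : D.energyReg ε u₀ + D.C₁ ≤ M) {t : ℝ} (ht : 0 ≤ t) : ‖v t‖ ^ 2 ≤ M := by
  have h1 := h.energy_eq hε ht
  have h2 := D.Ψ_coercive ε hε hε' (v t)
  have h3 : D.energyReg ε (v t) = 1 / 2 * inner ℝ (D.K (v t)) (v t) + D.Ψ ε (v t) := rfl
  have : 0 ≤ ∫ s in (0 : ℝ)..t, (‖D.L (v' s)‖ ^ 2 + ε * ‖v' s‖ ^ 2) :=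
    intervalIntegral.integral_nonneg ht fun s _ => by positivity
  linarith

/-- The constant 1 is included in the density so that bounded quantities are dominated as well; the
exponential weight makes it integrable on the half-line. -/
lemma integral_exp_le (h : D.IsApprox ε u₀ v v') (hε : 0 < ε) (hε' : ε ≤ D.ε₀) {M : ℝ}
    (hM : D.energyReg ε u₀ + D.C₁ ≤ M) {k : ℝ} (hk : 0 < k) {t : ℝ} (ht : 0 ≤ t) :
    ∫ s in (0 : ℝ)..t, Real.exp (-(k * s)) * (1 + ‖D.L (v' s)‖ ^ 2 + ε * ‖v' s‖ ^ 2)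
      ≤ 1 / k + M := by
  have hc := h.cont
  have hc' := h.cont'
  have h1 : ∫ s in (0 : ℝ)..t, Real.exp (-(k * s)) ≤ 1 / k := by
    have hd : ∀ s ∈ uIcc 0 t, HasDerivAt (fun s => -(Real.exp (-(k * s)) / k))
        (Real.exp (-(k * s))) s := fun s _ => by
      have : HasDerivAt (fun s => -(Real.exp (-(k * s)) / k))
          (-(Real.exp (-(k * s)) * -(k * 1) / k)) s :=
        ((((hasDerivAt_id s).const_mul k).neg.exp).div_const k).neg
      refine this.congr_deriv ?_
      field_simp
    rw [intervalIntegral.integral_eq_sub_of_hasDerivAt hd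
      (Continuous.intervalIntegrable (by fun_prop) _ _)]
    have : 0 ≤ Real.exp (-(k * t)) / k := by positivity
    simp only [mul_zero, neg_zero, Real.exp_zero]
    linarith
  have h2 : ∫ s in (0 : ℝ)..t, Real.exp (-(k * s)) * (‖D.L (v' s)‖ ^ 2 + ε * ‖v' s‖ ^ 2)
      ≤ ∫ s in (0 : ℝ)..t, (‖D.L (v' s)‖ ^ 2 + ε * ‖v' s‖ ^ 2) := by
    refine intervalIntegral.integral_mono_on ht
      (Continuous.intervalIntegrable (by fun_prop) _ _)
      (Continuous.intervalIntegrable (by fun_prop) _ _) fun s hs => ?_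
    refine mul_le_of_le_one_left (by positivity) (Real.exp_le_one_iff.2 ?_)
    have := mul_nonneg hk.le hs.1
    linarith
  have h3 := h.integral_le hε hε' hM ht
  have h4 : ∫ s in (0 : ℝ)..t, Real.exp (-(k * s)) * (1 + ‖D.L (v' s)‖ ^ 2 + ε * ‖v' s‖ ^ 2)
      = (∫ s in (0 : ℝ)..t, Real.exp (-(k * s)))
        + ∫ s in (0 : ℝ)..t, Real.exp (-(k * s)) * (‖D.L (v' s)‖ ^ 2 + ε * ‖v' s‖ ^ 2) := by
    rw [← intervalIntegral.integral_add (Continuous.intervalIntegrable (by fun_prop) _ _)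
      (Continuous.intervalIntegrable (by fun_prop) _ _)]
    refine intervalIntegral.integral_congr fun s _ => ?_
    ring
  linarith

end IsApprox

variable (D)

/-- The equation expresses P(A v) through K v, L*(L v') and ε v', and `A_bound` recovers all of A v
from this part. As ε ≤ 1, ε²‖v'‖² is controlled by the dissipation ε‖v'‖². -/
theorem exists_norm_A_sq_le (M : ℝ) : ∃ C', 0 ≤ C' ∧ ∀ ε u₀ v v', 0 < ε → ε ≤ D.ε₀ →
    D.IsApprox ε u₀ v v' → D.energyReg ε u₀ + D.C₁ ≤ M → ∀ t, 0 ≤ t →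
    ‖D.A ε (v t)‖ ^ 2 ≤ C' * (1 + ‖D.L (v' t)‖ ^ 2 + ε * ‖v' t‖ ^ 2) := by
  obtain ⟨a, ha, hA⟩ := D.A_bound (√M)
  set b := ‖D.P‖ * (‖D.K‖ * √M) with hb
  have hb0 : 0 ≤ b := by positivity
  refine ⟨a ^ 2 * (3 * ((1 + b) ^ 2 + ‖D.L.adjoint‖ ^ 2 + 1)), by positivity,
    fun ε u₀ v v' hε hε' h hM t ht => ?_⟩
  have hv : ‖v t‖ ≤ √M := Real.le_sqrt_of_sq_le (h.norm_sq_le hε hε' hM ht)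
  have h1 := hA ε hε hε' (v t) hv (h.proj t ht)
  have h2 : D.P (D.A ε (v t)) = -(D.P (D.K (v t)) + D.L.adjoint (D.L (v' t)) + ε • v' t) := by
    have := h.eqn t
    rw [map_add] at this
    rw [eq_neg_iff_add_eq_zero, ← this]
    abel
  have h3 : ‖D.P (D.A ε (v t))‖ ≤ b + ‖D.L.adjoint‖ * ‖D.L (v' t)‖ + ε * ‖v' t‖ := by
    rw [h2, norm_neg]
    refine (norm_add_le _ _).trans (add_le_add ((norm_add_le _ _).trans (add_le_add ?_ ?_)) ?_)
    · refine (D.P.le_opNorm _).trans ?_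
      rw [hb]
      gcongr
      exact (D.K.le_opNorm _).trans (by gcongr)
    · exact D.L.adjoint.le_opNorm _
    · rw [norm_smul, Real.norm_of_nonneg hε.le]
  have h4 : ‖D.A ε (v t)‖ ≤ a * ((1 + b) + ‖D.L.adjoint‖ * ‖D.L (v' t)‖ + ε * ‖v' t‖) :=
    h1.trans (mul_le_mul_of_nonneg_left (by linarith) ha)
  have h5 := pow_le_pow_left₀ (norm_nonneg _) h4 2
  rw [mul_pow] at h5
  refine h5.trans ?_
  rw [mul_assoc]
  refine mul_le_mul_of_nonneg_left ?_ (sq_nonneg a)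
  have hε1 : ε ≤ 1 := hε'.trans D.ε₀_le_one
  have h6 : ε ^ 2 * ‖v' t‖ ^ 2 ≤ ε * ‖v' t‖ ^ 2 := by
    refine mul_le_mul_of_nonneg_right ?_ (sq_nonneg _)
    nlinarith
  have h7 : ((1 + b) + ‖D.L.adjoint‖ * ‖D.L (v' t)‖ + ε * ‖v' t‖) ^ 2
      ≤ 3 * ((1 + b) ^ 2 + ‖D.L.adjoint‖ ^ 2 * ‖D.L (v' t)‖ ^ 2 + ε ^ 2 * ‖v' t‖ ^ 2) := by
    nlinarith [sq_nonneg ((1 + b) - ‖D.L.adjoint‖ * ‖D.L (v' t)‖), sq_nonneg ((1 + b) - ε * ‖v' t‖),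
      sq_nonneg (‖D.L.adjoint‖ * ‖D.L (v' t)‖ - ε * ‖v' t‖)]
  refine h7.trans ?_
  rw [mul_assoc]
  refine mul_le_mul_of_nonneg_left ?_ (by norm_num)
  have i1 := sq_nonneg (1 + b)
  have i2 := sq_nonneg ‖D.L.adjoint‖
  have i3 := sq_nonneg ‖D.L (v' t)‖
  have i4 : 0 ≤ ε * ‖v' t‖ ^ 2 := by positivity
  nlinarith [mul_nonneg i1 i3, mul_nonneg i1 i4, mul_nonneg i2 i4]

/-- The difference of two regularized flows is small, in the metric uniformly in time and in the
underlying space in the mean. -/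
theorem exists_cauchy_bound (M : ℝ) : ∃ C', 0 ≤ C' ∧ ∀ ε δ u₀ v v' w w', 0 < ε → ε ≤ D.ε₀ →
    0 < δ → δ ≤ D.ε₀ → D.IsApprox ε u₀ v v' → D.IsApprox δ u₀ w w' →
    D.energyReg ε u₀ + D.C₁ ≤ M → D.energyReg δ u₀ + D.C₁ ≤ M → ∀ t, 0 ≤ t →
    Real.exp (-((2 * D.C + 1) * t)) * ‖D.L (v t - w t)‖ ^ 2
      + 2 * D.c * ∫ s in (0 : ℝ)..t, Real.exp (-((2 * D.C + 1) * s)) * ‖v s - w s‖ ^ 2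
      ≤ C' * (√ε + √δ) := by
  obtain ⟨a, ha, hA⟩ := D.exists_norm_A_sq_le M
  set R := √M with hR
  have hR0 : 0 ≤ R := Real.sqrt_nonneg _
  -- The rate 2 C absorbs the metric term in `K_coercive`; the added 1 keeps k positive.
  set k := 2 * D.C + 1 with hk
  have hk0 : 0 < k := by have := D.C_nonneg; positivity
  -- The Yosida error contributes a and the terms ε v', δ w' contribute 2 R because ‖v - w‖ ≤ 2 R;
  -- both are doubled by the derivative of the squared norm.
  set η := 2 * a + 4 * R with hη
  have hη0 : 0 ≤ η := by positivity
  refine ⟨η * (2 * (1 / k + max M 0)), by positivity,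
    fun ε δ u₀ v v' w w' hε hε' hδ hδ' hv hw hMv hMw t ht => ?_⟩
  have cv := hv.cont
  have cv' := hv.cont'
  have cw := hw.cont
  have cw' := hw.cont'
  set ωv : ℝ → ℝ := fun s => 1 + ‖D.L (v' s)‖ ^ 2 + ε * ‖v' s‖ ^ 2 with hωv
  set ωw : ℝ → ℝ := fun s => 1 + ‖D.L (w' s)‖ ^ 2 + δ * ‖w' s‖ ^ 2 with hωw
  have cωv : Continuous ωv := by fun_prop
  have cωw : Continuous ωw := by fun_prop
  have pωv : ∀ s, 1 ≤ ωv s := fun s => by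
    have : 0 ≤ ‖D.L (v' s)‖ ^ 2 + ε * ‖v' s‖ ^ 2 := by positivity
    simp only [hωv]; linarith
  have pωw : ∀ s, 1 ≤ ωw s := fun s => by
    have : 0 ≤ ‖D.L (w' s)‖ ^ 2 + δ * ‖w' s‖ ^ 2 := by positivity
    simp only [hωw]; linarith
  set κ := √ε + √δ with hκ
  have hκ0 : 0 ≤ κ := by positivity
  set q : ℝ → ℝ := fun s => Real.exp (-(k * s)) *
    (2 * D.c * ‖v s - w s‖ ^ 2 - η * κ * (ωv s + ωw s)) with hq
  have cq : Continuous q := by fun_prop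
  -- Since 2 √e x ≤ 1 + e x², the term ε‖v'‖ is of order √ε times the dissipation density. This is
  -- the source of the rate.
  have sqrt_bound : ∀ (e : ℝ), 0 < e → ∀ x : ℝ, 0 ≤ x → ∀ y : ℝ, 0 ≤ y →
      e * x ≤ √e * (1 + y + e * x ^ 2) := fun e he x hx y hy => by
    have h1 : √e * √e = e := Real.mul_self_sqrt he.le
    have h2 : √e * x ≤ 1 + y + e * x ^ 2 := by nlinarith [sq_nonneg (√e * x - 1)]
    calc e * x = √e * (√e * x) := by rw [← mul_assoc, h1]
      _ ≤ _ := mul_le_mul_of_nonneg_left h2 (Real.sqrt_nonneg _)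
  have le_sqrt : ∀ e : ℝ, 0 < e → e ≤ D.ε₀ → e ≤ √e := fun e he he' => by
    refine Real.le_sqrt_of_sq_le ?_
    nlinarith [he'.trans D.ε₀_le_one]
  have key : ∀ s, 0 ≤ s → 2 * inner ℝ (D.L (v s - w s)) (D.L (v' s - w' s))
      ≤ k * ‖D.L (v s - w s)‖ ^ 2 - 2 * D.c * ‖v s - w s‖ ^ 2 + η * κ * (ωv s + ωw s) := by
    intro s hs
    have hP : D.P (v s - w s) = v s - w s := by
      rw [map_sub, hv.proj s hs, hw.proj s hs]; abel
    have e1 := hv.inner_eq s _ hP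
    have e2 := hw.inner_eq s _ hP
    set d := v s - w s with hd
    have e3 := D.K_coercive d hP
    have e4 : inner ℝ (D.K (v s) + D.A ε (v s)) d - inner ℝ (D.K (w s) + D.A δ (w s)) d
        = inner ℝ (D.K d) d + inner ℝ (D.A ε (v s) - D.A δ (w s)) d := by
      rw [hd, map_sub]
      simp only [inner_add_left, inner_sub_left]
      ring
    have e5 : inner ℝ (D.L d) (D.L (v' s - w' s))
        = inner ℝ (D.L (v' s)) (D.L d) - inner ℝ (D.L (w' s)) (D.L d) := by
      rw [real_inner_comm, map_sub D.L (v' s), inner_sub_left]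
    have e6 := D.A_mono ε δ hε hδ (v s) (w s)
    have e7 : (v s - ε • D.A ε (v s)) - (w s - δ • D.A δ (w s))
        = d - (ε • D.A ε (v s) - δ • D.A δ (w s)) := by rw [hd]; abel
    rw [e7, inner_sub_right] at e6
    -- Monotonicity holds at the resolvents, not at v and w. When the correction is expanded the two
    -- squares have a favourable sign, and only the cross term, of size ε + δ, remains.
    have e8 : inner ℝ (D.A ε (v s) - D.A δ (w s)) (ε • D.A ε (v s) - δ • D.A δ (w s))
        ≥ -((ε + δ) * (‖D.A ε (v s)‖ * ‖D.A δ (w s)‖)) := by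
      have f1 := real_inner_le_norm (D.A ε (v s)) (D.A δ (w s))
      simp only [inner_sub_left, inner_sub_right, real_inner_smul_right,
        real_inner_self_eq_norm_sq, real_inner_comm (D.A ε (v s)) (D.A δ (w s))]
      have g1 : 0 ≤ ε * ‖D.A ε (v s)‖ ^ 2 := by positivity
      have g2 : 0 ≤ δ * ‖D.A δ (w s)‖ ^ 2 := by positivity
      rw [real_inner_comm] at f1
      have g3 : (ε + δ) * inner ℝ (D.A δ (w s)) (D.A ε (v s))
          ≤ (ε + δ) * (‖D.A ε (v s)‖ * ‖D.A δ (w s)‖) :=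
        mul_le_mul_of_nonneg_left f1 (by positivity)
      rw [real_inner_comm] at g3
      linarith
    have e9 : ‖D.A ε (v s)‖ * ‖D.A δ (w s)‖ ≤ a * (ωv s + ωw s) := by
      have f1 := hA ε u₀ v v' hε hε' hv hMv s hs
      have f2 := hA δ u₀ w w' hδ hδ' hw hMw s hs
      have f3 : 0 ≤ a * (ωv s + ωw s) := mul_nonneg ha (by linarith [pωv s, pωw s])
      simp only [hωv, hωw] at f3 ⊢
      nlinarith [sq_nonneg (‖D.A ε (v s)‖ - ‖D.A δ (w s)‖)]
    have e10 : (ε + δ) * (‖D.A ε (v s)‖ * ‖D.A δ (w s)‖) ≤ κ * (a * (ωv s + ωw s)) := by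
      refine mul_le_mul ?_ e9 (by positivity) hκ0
      exact add_le_add (le_sqrt ε hε hε') (le_sqrt δ hδ hδ')
    have hd2 : ‖d‖ ≤ 2 * R := by
      have n1 : ‖v s‖ ≤ R := Real.le_sqrt_of_sq_le (hv.norm_sq_le hε hε' hMv hs)
      have n2 : ‖w s‖ ≤ R := Real.le_sqrt_of_sq_le (hw.norm_sq_le hδ hδ' hMw hs)
      have := norm_sub_le (v s) (w s)
      linarith
    have e11 : ε * |inner ℝ (v' s) d| ≤ 2 * R * (√ε * ωv s) := by
      have f1 := abs_real_inner_le_norm (v' s) d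
      have f2 := sqrt_bound ε hε ‖v' s‖ (norm_nonneg _) _ (sq_nonneg ‖D.L (v' s)‖)
      calc ε * |inner ℝ (v' s) d| ≤ ε * (‖v' s‖ * (2 * R)) := by
            refine mul_le_mul_of_nonneg_left (f1.trans ?_) hε.le
            gcongr
        _ = 2 * R * (ε * ‖v' s‖) := by ring
        _ ≤ _ := mul_le_mul_of_nonneg_left f2 (by positivity)
    have e12 : δ * |inner ℝ (w' s) d| ≤ 2 * R * (√δ * ωw s) := by
      have f1 := abs_real_inner_le_norm (w' s) d
      have f2 := sqrt_bound δ hδ ‖w' s‖ (norm_nonneg _) _ (sq_nonneg ‖D.L (w' s)‖)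
      calc δ * |inner ℝ (w' s) d| ≤ δ * (‖w' s‖ * (2 * R)) := by
            refine mul_le_mul_of_nonneg_left (f1.trans ?_) hδ.le
            gcongr
        _ = 2 * R * (δ * ‖w' s‖) := by ring
        _ ≤ _ := mul_le_mul_of_nonneg_left f2 (by positivity)
    have e13 : √ε * ωv s + √δ * ωw s ≤ κ * (ωv s + ωw s) := by
      have s1 := mul_nonneg (Real.sqrt_nonneg δ) (zero_le_one.trans (pωv s))
      have s2 := mul_nonneg (Real.sqrt_nonneg ε) (zero_le_one.trans (pωw s))
      rw [hκ]
      linarith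
    have e14 : 2 * R * (√ε * ωv s + √δ * ωw s) ≤ 2 * R * (κ * (ωv s + ωw s)) :=
      mul_le_mul_of_nonneg_left e13 (by positivity)
    have e15 : -(ε * inner ℝ (v' s) d) ≤ ε * |inner ℝ (v' s) d| := by
      have := mul_le_mul_of_nonneg_left (neg_abs_le (inner ℝ (v' s) d)) hε.le
      linarith
    have e16 : δ * inner ℝ (w' s) d ≤ δ * |inner ℝ (w' s) d| :=
      mul_le_mul_of_nonneg_left (le_abs_self _) hδ.le
    have e17 := sq_nonneg ‖D.L d‖
    have e18 : η * κ * (ωv s + ωw s) = 2 * (κ * (a * (ωv s + ωw s)))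
        + 2 * (2 * R * (κ * (ωv s + ωw s))) := by rw [hη]; ring
    rw [e5, e18, hk]
    linarith
  -- Multiplied by exp(-k s), `key` says that G' ≤ 0, and G(0) = 0 because both flows start at the
  -- same point.
  set G : ℝ → ℝ := fun s => Real.exp (-(k * s)) * ‖D.L (v s - w s)‖ ^ 2
    + ∫ r in (0 : ℝ)..s, q r with hG
  have hGd : ∀ s, 0 ≤ s → HasDerivAt G
      (Real.exp (-(k * s)) * -(k * 1) * ‖D.L (v s - w s)‖ ^ 2
        + Real.exp (-(k * s)) * (2 * inner ℝ (D.L (v s - w s)) (D.L (v' s - w' s))) + q s) s := by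
    intro s hs
    have d1 : HasDerivAt (fun s => Real.exp (-(k * s))) (Real.exp (-(k * s)) * -(k * 1)) s :=
      ((hasDerivAt_id s).const_mul k).neg.exp
    have d2 := (D.L.hasFDerivAt.comp_hasDerivAt s ((hv.deriv s hs).sub (hw.deriv s hs))).norm_sq
    have d3 := intervalIntegral.integral_hasDerivAt_right (cq.intervalIntegrable 0 s)
      (cq.stronglyMeasurableAtFilter _ _) cq.continuousAt
    exact (d1.mul d2).add d3
  have hanti : AntitoneOn G (Ici 0) := by
    refine antitoneOn_of_deriv_nonpos (convex_Ici 0)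
      (fun s hs => (hGd s hs).continuousAt.continuousWithinAt)
      (fun s hs => (hGd s (interior_subset hs)).differentiableAt.differentiableWithinAt)
      fun s hs => ?_
    have hs' : 0 ≤ s := interior_subset hs
    rw [(hGd s hs').deriv]
    have := mul_le_mul_of_nonneg_left (key s hs') (Real.exp_pos (-(k * s))).le
    simp only [hq]
    linarith
  have hG0 : G 0 = 0 := by simp [hG, hv.init, hw.init]
  have hGt : G t ≤ 0 := hG0 ▸ hanti (mem_Ici.2 le_rfl) (mem_Ici.2 ht) ht
  have hsplit : ∫ r in (0 : ℝ)..t, q r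
      = 2 * D.c * (∫ s in (0 : ℝ)..t, Real.exp (-(k * s)) * ‖v s - w s‖ ^ 2)
        - η * κ * ((∫ s in (0 : ℝ)..t, Real.exp (-(k * s)) * ωv s)
          + ∫ s in (0 : ℝ)..t, Real.exp (-(k * s)) * ωw s) := by
    rw [← intervalIntegral.integral_add (Continuous.intervalIntegrable (by fun_prop) _ _)
      (Continuous.intervalIntegrable (by fun_prop) _ _), ← intervalIntegral.integral_const_mul,
      ← intervalIntegral.integral_const_mul,
      ← intervalIntegral.integral_sub (Continuous.intervalIntegrable (by fun_prop) _ _)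
      (Continuous.intervalIntegrable (by fun_prop) _ _)]
    refine intervalIntegral.integral_congr fun s _ => ?_
    simp only [hq]
    ring
  have b1 := hv.integral_exp_le hε hε' hMv hk0 ht
  have b2 := hw.integral_exp_le hδ hδ' hMw hk0 ht
  have b3 : η * κ * ((∫ s in (0 : ℝ)..t, Real.exp (-(k * s)) * ωv s)
      + ∫ s in (0 : ℝ)..t, Real.exp (-(k * s)) * ωw s) ≤ η * κ * (2 * (1 / k + max M 0)) := by
    refine mul_le_mul_of_nonneg_left ?_ (by positivity)
    have := le_max_left M 0
    simp only [hωv, hωw]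
    linarith
  have b4 : η * (2 * (1 / k + max M 0)) * κ = η * κ * (2 * (1 / k + max M 0)) := by ring
  rw [b4]
  simp only [hG, hsplit] at hGt
  linarith

end FlowData

end NonlocalCH

/-! ### The exponentially weighted time measure -/

namespace NonlocalCH

section ExpMeasure

/-- The measure with density `exp (-k t)` on the half-line `(0, ∞)`. -/
noncomputable def expMeasure (k : ℝ) : Measure ℝ :=
  (volume.restrict (Ioi 0)).withDensity fun t => ENNReal.ofReal (Real.exp (-(k * t)))

lemma measurable_expDensity (k : ℝ) :
    Measurable fun t : ℝ => ENNReal.ofReal (Real.exp (-(k * t))) := by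
  fun_prop

lemma isFiniteMeasure_expMeasure {k : ℝ} (hk : 0 < k) : IsFiniteMeasure (expMeasure k) := by
  refine isFiniteMeasure_withDensity_ofReal ?_
  have := (exp_neg_integrableOn_Ioi 0 hk).2
  simpa only [neg_mul] using this

lemma ae_expMeasure_iff (k : ℝ) {p : ℝ → Prop} :
    (∀ᵐ t ∂expMeasure k, p t) ↔ ∀ᵐ t ∂volume.restrict (Ioi 0), p t := by
  rw [expMeasure, ae_withDensity_iff (measurable_expDensity k)]
  refine eventually_congr (Eventually.of_forall fun t => ?_)
  simp [Real.exp_pos]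

variable {X : Type*} [NormedAddCommGroup X] [InnerProductSpace ℝ X] [CompleteSpace X]

lemma integral_expMeasure (k : ℝ) (g : ℝ → X) :
    ∫ t, g t ∂expMeasure k = ∫ t in Ioi 0, Real.exp (-(k * t)) • g t := by
  rw [expMeasure, integral_withDensity_eq_integral_toReal_smul (measurable_expDensity k)
    (Eventually.of_forall fun _ => ENNReal.ofReal_lt_top)]
  simp only [ENNReal.toReal_ofReal (Real.exp_pos _).le]

lemma restrict_Ioc_le_expMeasure {k : ℝ} (hk : 0 < k) (T : ℝ) :
    volume.restrict (Ioc 0 T) ≤ ENNReal.ofReal (Real.exp (k * T)) • expMeasure k := by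
  refine Measure.le_iff.2 fun s hs => ?_
  rw [Measure.smul_apply, expMeasure, withDensity_apply _ hs, smul_eq_mul,
    ← lintegral_const_mul _ (measurable_expDensity k), Measure.restrict_restrict hs,
    Measure.restrict_apply hs]
  calc volume (s ∩ Ioc 0 T) = ∫⁻ _ in s ∩ Ioc 0 T, 1 := by simp
    _ ≤ ∫⁻ t in s ∩ Ioc 0 T, ENNReal.ofReal (Real.exp (k * T))
          * ENNReal.ofReal (Real.exp (-(k * t))) := by
        refine setLIntegral_mono' (hs.inter measurableSet_Ioc) fun t ht => ?_
        rw [← ENNReal.ofReal_mul (Real.exp_pos _).le, ← Real.exp_add, ENNReal.one_le_ofReal]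
        refine Real.one_le_exp ?_
        have := mul_le_mul_of_nonneg_left ht.2.2 hk.le
        linarith
    _ ≤ _ := lintegral_mono_set (inter_subset_inter_right _ fun t ht => ht.1)

lemma memLp_restrict_Ioc {k : ℝ} (hk : 0 < k) {f : ℝ → X} {p : ℝ≥0∞}
    (hf : MemLp f p (expMeasure k)) (T : ℝ) : MemLp f p (volume.restrict (Ioc 0 T)) :=
  hf.of_measure_le_smul ENNReal.ofReal_ne_top (restrict_Ioc_le_expMeasure hk T)

lemma integrable_expMeasure_of_bound {k : ℝ} {F : ℝ → ℝ} (hF : Continuous F)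
    (hF0 : ∀ t, 0 ≤ F t) {B : ℝ}
    (hB : ∀ t, 0 ≤ t → ∫ s in (0 : ℝ)..t, Real.exp (-(k * s)) * F s ≤ B) :
    Integrable F (expMeasure k) ∧ ∫ t, F t ∂expMeasure k ≤ B := by
  have hc : Continuous fun s => Real.exp (-(k * s)) * F s := by fun_prop
  have hi : IntegrableOn (fun s => Real.exp (-(k * s)) * F s) (Ioi 0) := by
    refine integrableOn_Ioi_of_intervalIntegral_norm_bounded (l := atTop) (b := id) B 0
      (fun t => (hc.integrableOn_Icc).mono_set Ioc_subset_Icc_self) tendsto_id ?_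
    filter_upwards [eventually_ge_atTop 0] with t ht
    refine le_trans (le_of_eq ?_) (hB t ht)
    refine intervalIntegral.integral_congr fun s _ => ?_
    exact Real.norm_of_nonneg (mul_nonneg (Real.exp_pos _).le (hF0 s))
  constructor
  · rw [expMeasure, integrable_withDensity_iff_integrable_smul' (measurable_expDensity k)
      (Eventually.of_forall fun _ => ENNReal.ofReal_lt_top)]
    simp only [ENNReal.toReal_ofReal (Real.exp_pos _).le, smul_eq_mul]
    exact hi
  · rw [integral_expMeasure]
    refine le_of_tendsto (intervalIntegral_tendsto_integral_Ioi 0 hi tendsto_id) ?_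
    filter_upwards [eventually_ge_atTop 0] with t ht using hB t ht

/-- The factor exp(k t), cut off at T, cancels the weight, so these test functions turn weak
convergence in the weighted space into convergence of unweighted integrals over [0, T]. -/
lemma memLp_indicator_exp_smul {k : ℝ} (hk : 0 < k) {g : ℝ → X} (hg : MemLp g 2 (expMeasure k))
    (T : ℝ) : MemLp ((Ioc 0 T).indicator fun t => Real.exp (k * t) • g t) 2 (expMeasure k) := by
  have hc : Continuous fun t => Real.exp (k * t) := by fun_prop
  refine hg.of_le_mul (c := Real.exp (k * T))
    ((hc.aestronglyMeasurable.smul hg.1).indicator measurableSet_Ioc)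
    (Eventually.of_forall fun t => ?_)
  by_cases ht : t ∈ Ioc 0 T
  · rw [indicator_of_mem ht, norm_smul, Real.norm_of_nonneg (Real.exp_pos _).le]
    gcongr
    exact ht.2
  · rw [indicator_of_notMem ht, norm_zero]
    positivity

lemma integral_inner_indicator (k : ℝ) (f g : ℝ → X) {T : ℝ} (hT : 0 ≤ T) :
    ∫ t, inner ℝ (f t) ((Ioc 0 T).indicator (fun t => Real.exp (k * t) • g t) t) ∂expMeasure k
      = ∫ t in (0 : ℝ)..T, inner ℝ (f t) (g t) := by
  rw [integral_expMeasure, intervalIntegral.integral_of_le hT]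
  have h : ∀ t, Real.exp (-(k * t)) • inner ℝ (f t)
      ((Ioc 0 T).indicator (fun t => Real.exp (k * t) • g t) t)
      = (Ioc 0 T).indicator (fun t => inner ℝ (f t) (g t)) t := fun t => by
    by_cases ht : t ∈ Ioc 0 T
    · rw [indicator_of_mem ht, indicator_of_mem ht, real_inner_smul_right, smul_eq_mul,
        ← mul_assoc, ← Real.exp_add, neg_add_cancel, Real.exp_zero, one_mul]
    · rw [indicator_of_notMem ht, indicator_of_notMem ht, inner_zero_right, smul_zero]
  simp_rw [h]
  rw [integral_indicator measurableSet_Ioc, Measure.restrict_restrict measurableSet_Ioc,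
    inter_eq_self_of_subset_left Ioc_subset_Ioi_self]

lemma norm_sq_toLp {μ : Measure ℝ} {f : ℝ → X} (hf : MemLp f 2 μ) :
    ‖hf.toLp f‖ ^ 2 = ∫ t, ‖f t‖ ^ 2 ∂μ := by
  rw [← real_inner_self_eq_norm_sq, L2.inner_def]
  refine integral_congr_ae ?_
  filter_upwards [hf.coeFn_toLp] with t ht
  rw [ht, real_inner_self_eq_norm_sq]

lemma memLp_of_norm_sq_le {μ : Measure ℝ} {f : ℝ → X} {F : ℝ → ℝ} {b : ℝ} (hF : Integrable F μ)
    (hf : AEStronglyMeasurable f μ) (h : ∀ᵐ t ∂μ, ‖f t‖ ^ 2 ≤ b * F t) : MemLp f 2 μ := by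
  rw [memLp_two_iff_integrable_sq_norm hf]
  refine (hF.const_mul b).mono' (hf.norm.pow 2) (h.mono fun t ht => ?_)
  rwa [Real.norm_of_nonneg (by positivity)]

lemma norm_sq_toLp_le {μ : Measure ℝ} {f : ℝ → X} {F : ℝ → ℝ} {b B : ℝ} (hF : Integrable F μ)
    (hB : ∫ t, F t ∂μ ≤ B) (hb : 0 ≤ b) (hf : MemLp f 2 μ)
    (h : ∀ᵐ t ∂μ, ‖f t‖ ^ 2 ≤ b * F t) : ‖hf.toLp f‖ ^ 2 ≤ b * B := by
  rw [norm_sq_toLp]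
  calc ∫ t, ‖f t‖ ^ 2 ∂μ ≤ ∫ t, b * F t ∂μ :=
        integral_mono_ae ((memLp_two_iff_integrable_sq_norm hf.1).1 hf) (hF.const_mul b) h
    _ = b * ∫ t, F t ∂μ := integral_const_mul _ _
    _ ≤ b * B := mul_le_mul_of_nonneg_left hB hb

lemma inner_toLp {μ : Measure ℝ} {f g : ℝ → X} (hf : MemLp f 2 μ) (hg : MemLp g 2 μ) :
    inner ℝ (hf.toLp f) (hg.toLp g) = ∫ t, inner ℝ (f t) (g t) ∂μ := by
  rw [L2.inner_def]
  refine integral_congr_ae ?_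
  filter_upwards [hf.coeFn_toLp, hg.coeFn_toLp] with t ht ht'
  rw [ht, ht']

lemma integrable_inner_of_memLp {μ : Measure ℝ} {f g : ℝ → X} (hf : MemLp f 2 μ)
    (hg : MemLp g 2 μ) : Integrable (fun t => inner ℝ (f t) (g t)) μ := by
  refine (L2.integrable_inner (𝕜 := ℝ) (hf.toLp f) (hg.toLp g)).congr ?_
  filter_upwards [hf.coeFn_toLp, hg.coeFn_toLp] with t ht ht'
  rw [ht, ht']

/-- Weak convergence in the weighted space implies convergence of integrals over bounded
intervals. -/
lemma tendsto_integral_inner {ι : Type*} {l : Filter ι} {k : ℝ} (hk : 0 < k) {f : ι → ℝ → X}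
    (hf : ∀ i, MemLp (f i) 2 (expMeasure k)) {a : Lp X 2 (expMeasure k)}
    (h : WeakTendsto (fun i => (hf i).toLp (f i)) l a) {g : ℝ → X}
    (hg : MemLp g 2 (expMeasure k)) {T : ℝ} (hT : 0 ≤ T) :
    Tendsto (fun i => ∫ t in (0 : ℝ)..T, inner ℝ (f i t) (g t)) l
      (𝓝 (∫ t in (0 : ℝ)..T, inner ℝ (a t) (g t))) := by
  have h1 := h ((memLp_indicator_exp_smul hk hg T).toLp _)
  have h2 : a = (Lp.memLp a).toLp a := (Lp.toLp_coeFn a (Lp.memLp a)).symm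
  rw [h2] at h1
  simp only [inner_toLp, integral_inner_indicator k _ g hT] at h1
  exact h1

end ExpMeasure

/-- A weakly convergent bounded family paired with a strongly convergent one: replacing z i by its
limit b costs at most C‖z i - b‖. -/
lemma WeakTendsto.tendsto_inner {ι Z : Type*} [NormedAddCommGroup Z] [InnerProductSpace ℝ Z]
    {x z : ι → Z} {l : Filter ι} {a b : Z} {C : ℝ}
    (h : WeakTendsto x l a) (hC : ∀ᶠ i in l, ‖x i‖ ≤ C) (h' : Tendsto z l (𝓝 b)) :
    Tendsto (fun i => inner ℝ (x i) (z i)) l (𝓝 (inner ℝ a b)) := by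
  have h1 : Tendsto (fun i => inner ℝ (x i) (z i - b)) l (𝓝 0) := by
    have h2 : Tendsto (fun i => C * ‖z i - b‖) l (𝓝 0) := by
      simpa using ((h'.sub_const b).norm).const_mul C
    refine squeeze_zero_norm' ?_ h2
    filter_upwards [hC] with i hi
    exact (norm_inner_le_norm _ _).trans (by gcongr)
  have h3 := (h b).add h1
  rw [add_zero] at h3
  refine h3.congr fun i => ?_
  rw [← inner_add_right, add_sub_cancel]

lemma intervalIntegral_inner_const {Y : Type*} [NormedAddCommGroup Y] [InnerProductSpace ℝ Y]
    [CompleteSpace Y] {f : ℝ → Y} {a b : ℝ} (hf : IntervalIntegrable f volume a b) (η : Y) :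
    ∫ s in a..b, inner ℝ (f s) η = inner ℝ (∫ s in a..b, f s) η := by
  have := (innerSL ℝ η).intervalIntegral_comp_comm hf
  simp only [innerSL_apply_apply] at this
  rw [real_inner_comm, ← this]
  exact intervalIntegral.integral_congr fun s _ => real_inner_comm _ _

/-! ### Passage to the limit in the regularized flows -/

namespace FlowData

variable {X Y : Type*} [NormedAddCommGroup X] [InnerProductSpace ℝ X] [CompleteSpace X]
  [NormedAddCommGroup Y] [InnerProductSpace ℝ Y] [CompleteSpace Y] (D : FlowData X Y)

/-- The regularized energy is convex up to C / 2 times the squared metric. Along admissible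
directions it thus has an affine minorant with an error seen only through L, which makes it lower
semicontinuous when u converges weakly and L u strongly. -/
lemma energyReg_lower {δ : ℝ} (hδ : 0 < δ) {u v : X} (h : D.P (v - u) = v - u) :
    D.energyReg δ u + inner ℝ (v - u) (D.K u + D.A δ u) - D.C / 2 * ‖D.L (v - u)‖ ^ 2
      ≤ D.energyReg δ v := by
  have h1 := D.Ψ_subgrad δ hδ u v
  have h2 := D.K_coercive (v - u) h
  have h3 : inner ℝ (D.K v) v = inner ℝ (D.K u) u + 2 * inner ℝ (D.K u) (v - u)
      + inner ℝ (D.K (v - u)) (v - u) := by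
    have := D.K_symm v u
    have h4 := real_inner_comm v (D.K u)
    rw [map_sub]
    simp only [inner_sub_left, inner_sub_right]
    linarith
  have h5 := mul_nonneg D.c_pos.le (sq_nonneg ‖v - u‖)
  have h6 := inner_add_left (𝕜 := ℝ) (D.K u) (D.A δ u) (v - u)
  have h7 := real_inner_comm (v - u) (D.K u + D.A δ u)
  rw [energyReg, energyReg, h3]
  linarith

/-- A solution on `[0, T]` of the abstract flow. -/
structure IsSolution (T : ℝ) (u : ℝ → X) (y : ℝ → Y) (ξ : ℝ → X) : Prop where
  memLp : MemLp y 2 (volume.restrict (Ioc 0 T))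
  proj : ∀ t ∈ Icc 0 T, D.P (u t) = u t - D.m
  map_eq : ∀ t ∈ Icc 0 T, D.L (u t) = D.L (u 0) + ∫ s in (0 : ℝ)..t, y s
  eqn : ∀ᵐ t ∂volume.restrict (Ioc 0 T), D.L.adjoint (y t) + D.P (D.K (u t) + ξ t) = 0
  -- The inclusion of ξ in the subdifferential at u, in Yosida form: the resolvent of u + ξ with
  -- parameter 1 is u.
  rel : ∀ᵐ t ∂volume.restrict (Ioc 0 T), D.A 1 (u t + ξ t) = ξ t

/-- L*, P and K act pointwise in time as bounded linear operators on L² in time, so they preserve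
weak limits and the linear equation survives. -/
lemma ae_eqn_of_weakTendsto {μ : Measure ℝ} {l : Filter ℕ} [l.NeBot] {yn : ℕ → Lp Y 2 μ}
    {zn vn ξn : ℕ → Lp X 2 μ} {y : Lp Y 2 μ} {u ξ : Lp X 2 μ} (hy : WeakTendsto yn l y)
    (hz : Tendsto zn l (𝓝 0)) (hv : Tendsto vn l (𝓝 u)) (hξ : WeakTendsto ξn l ξ)
    (h : ∀ n, ∀ᵐ t ∂μ, D.L.adjoint (yn n t) + zn n t + D.P (D.K (vn n t) + ξn n t) = 0) :
    ∀ᵐ t ∂μ, D.L.adjoint (y t) + D.P (D.K (u t) + ξ t) = 0 := by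
  set TL := (D.L.adjoint).compLpL 2 μ
  set TP := (D.P).compLpL 2 μ
  set TK := (D.K).compLpL 2 μ
  have h1 : WeakTendsto (fun n => TL (yn n) + zn n + TP (TK (vn n) + ξn n)) l
      (TL y + 0 + TP (TK u + ξ)) := by
    have w1 : WeakTendsto (fun n => TL (yn n)) l (TL y) := hy.map TL
    have w2 : WeakTendsto zn l 0 := weakTendsto_of_tendsto hz
    have w3 : WeakTendsto (fun n => TK (vn n)) l (TK u) := (weakTendsto_of_tendsto hv).map TK
    have w4 : WeakTendsto (fun n => TK (vn n) + ξn n) l (TK u + ξ) := w3.add hξ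
    have w5 : WeakTendsto (fun n => TP (TK (vn n) + ξn n)) l (TP (TK u + ξ)) := w4.map TP
    have w6 : WeakTendsto (fun n => TL (yn n) + zn n) l (TL y + 0) := w1.add w2
    exact w6.add w5
  have h2 : ∀ n, TL (yn n) + zn n + TP (TK (vn n) + ξn n) = 0 := fun n => by
    refine Lp.ext ?_
    filter_upwards [Lp.coeFn_zero X 2 μ,
      Lp.coeFn_add (TL (yn n) + zn n) (TP (TK (vn n) + ξn n)),
      Lp.coeFn_add (TL (yn n)) (zn n), Lp.coeFn_add (TK (vn n)) (ξn n),
      D.L.adjoint.coeFn_compLpL (yn n), D.K.coeFn_compLpL (vn n),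
      D.P.coeFn_compLpL (TK (vn n) + ξn n), h n] with t g0 g1 g2 g3 g4 g5 g6 g7
    rw [g0, g1, Pi.add_apply, g2, Pi.add_apply, g4, g6, g3, Pi.add_apply, g5, g7, Pi.zero_apply]
  simp only [h2] at h1
  have h3 := h1.unique (weakTendsto_of_tendsto tendsto_const_nhds)
  filter_upwards [Lp.coeFn_zero X 2 μ, Lp.coeFn_add (TL y + 0) (TP (TK u + ξ)),
    Lp.coeFn_add (TK u) ξ, D.L.adjoint.coeFn_compLpL y, D.K.coeFn_compLpL u,
    D.P.coeFn_compLpL (TK u + ξ)] with t g0 g1 g2 g3 g4 g5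
  rw [h3, add_zero, g0, Pi.zero_apply, Pi.add_apply, g3, g5, g2, Pi.add_apply, g4] at g1
  exact g1.symm

/-- Minty's argument: the nonlinearity passes to weak limits. -/
lemma ae_rel_of_weakTendsto {μ : Measure ℝ} [IsFiniteMeasure μ] {l : Filter ℕ} [l.NeBot]
    {ε : ℕ → ℝ} (hε : ∀ n, 0 < ε n) (hεlim : Tendsto ε l (𝓝 0))
    {vn ξn : ℕ → Lp X 2 μ} {u ξ : Lp X 2 μ}
    (hv : Tendsto vn l (𝓝 u)) (hξ : WeakTendsto ξn l ξ) {B : ℝ} (hB : ∀ n, ‖ξn n‖ ≤ B)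
    (h : ∀ n, ∀ᵐ t ∂μ, ξn n t = D.A (ε n) (vn n t)) :
    ∀ᵐ t ∂μ, D.A 1 (u t + ξ t) = ξ t := by
  set g := u + ξ with hg
  have memG : MemLp (fun t => D.A 1 (g t)) 2 μ := by
    have h1 := D.A_lipschitzWith one_pos
    have hgn : MemLp (fun t => ‖g t‖) 2 μ := (Lp.memLp g).norm
    have hcn : MemLp (fun _ : ℝ => ‖D.A 1 0‖) 2 μ := memLp_const _
    have h2 : MemLp (fun t => ‖D.A 1 0‖ + ‖g t‖) 2 μ := hcn.add hgn
    refine h2.mono (h1.continuous.comp_aestronglyMeasurable (Lp.aestronglyMeasurable g))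
      (Eventually.of_forall fun t => ?_)
    have h3 := D.A_lipschitz one_pos (g t) 0
    rw [inv_one, one_mul, sub_zero] at h3
    have h4 := norm_le_norm_add_norm_sub' (D.A 1 (g t)) (D.A 1 0)
    rw [Real.norm_of_nonneg (by positivity)]
    linarith
  obtain ⟨G, hG⟩ : ∃ G : Lp X 2 μ, ∀ᵐ t ∂μ, G t = D.A 1 (g t) :=
    ⟨memG.toLp _, memG.coeFn_toLp⟩
  -- Monotonicity between the parameter ε n at v n and the parameter 1 at the fixed point g = u + ξ;
  -- the square ε n ‖ξn‖² has a sign and is dropped.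
  have h1 : ∀ n, -(ε n * inner ℝ (ξn n) G) ≤ inner ℝ (ξn n - G) (vn n - (g - G)) := fun n => by
    have h2 : 0 ≤ inner ℝ (ξn n - G) (vn n - ε n • ξn n - (g - G)) := by
      rw [L2.inner_def]
      refine integral_nonneg_of_ae ?_
      filter_upwards [Lp.coeFn_sub (ξn n) G, Lp.coeFn_sub (vn n - ε n • ξn n) (g - G),
        Lp.coeFn_sub (vn n) (ε n • ξn n), Lp.coeFn_sub g G, Lp.coeFn_smul (ε n) (ξn n), hG, h n]
        with t g1 g2 g3 g4 g5 g6 g8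
      rw [g1, g2, Pi.sub_apply, Pi.sub_apply, g3, g4, Pi.sub_apply, Pi.sub_apply, g5,
        Pi.smul_apply, g6, g8, Pi.zero_apply]
      have := D.A_mono (ε n) 1 (hε n) one_pos (vn n t) (g t)
      rwa [one_smul] at this
    have h3 : vn n - ε n • ξn n - (g - G) = (vn n - (g - G)) - ε n • ξn n := by abel
    have h4 : 0 ≤ ε n * ‖ξn n‖ ^ 2 := mul_nonneg (hε n).le (sq_nonneg _)
    rw [h3, inner_sub_right _ _ (ε n • ξn n), real_inner_smul_right, inner_sub_left _ G (ξn n),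
      real_inner_self_eq_norm_sq, real_inner_comm (ξn n) G] at h2
    linarith
  have h2 : Tendsto (fun n => inner ℝ (ξn n - G) (vn n - (g - G))) l
      (𝓝 (inner ℝ (ξ - G) (u - (g - G)))) := by
    refine WeakTendsto.tendsto_inner (C := B + ‖G‖) ?_
      (Eventually.of_forall fun n => (norm_sub_le _ _).trans (by linarith [hB n]))
      (hv.sub_const _)
    simp only [sub_eq_add_neg]
    exact hξ.add (weakTendsto_of_tendsto tendsto_const_nhds)
  have h3 : Tendsto (fun n => -(ε n * inner ℝ (ξn n) G)) l (𝓝 0) := by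
    simpa using (hεlim.mul (hξ G)).neg
  have h4 := le_of_tendsto_of_tendsto' h3 h2 h1
  -- The choice of g makes the two factors of the limiting inner product opposite, so its
  -- nonnegativity forces both to vanish.
  have h5 : ξ - G = -(u - (g - G)) := by rw [hg]; abel
  rw [h5, inner_neg_left, real_inner_self_eq_norm_sq] at h4
  have h6 : u - (g - G) = 0 := by
    rw [← norm_eq_zero, ← sq_eq_zero_iff]
    exact le_antisymm (by linarith) (sq_nonneg _)
  have h7 : G = ξ := by
    have : u - (u + ξ - G) = G - ξ := by abel
    rw [hg, this] at h6
    exact sub_eq_zero.1 h6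
  filter_upwards [hG, Lp.coeFn_add u ξ] with t g1 g2
  rw [hg, g2, Pi.add_apply, h7] at g1
  exact g1.symm

/-- Passing to the limit in the regularized flows. -/
theorem exists_solution {u₀ : X} (hu₀ : D.P u₀ = u₀ - D.m) {E : ℝ}
    (hE : ∀ ε, 0 < ε → D.energyReg ε u₀ ≤ E) :
    ∃ (u : ℝ → X) (y : ℝ → Y) (ξ : ℝ → X), u 0 = u₀ ∧ (∃ R, ∀ t, 0 ≤ t → ‖u t‖ ≤ R) ∧
      AEStronglyMeasurable u (volume.restrict (Ioi 0)) ∧ (∀ T, D.IsSolution T u y ξ) ∧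
      ∀ t, 0 ≤ t → ∀ δ, 0 < δ →
        D.energyReg δ (u t) + ∫ s in (0 : ℝ)..t, ‖y s‖ ^ 2 ≤ E := by
  set M := E + D.C₁ with hM
  set k := 2 * D.C + 1 with hk
  have hk0 : 0 < k := by have := D.C_nonneg; positivity
  have := isFiniteMeasure_expMeasure hk0
  set ρ := expMeasure k with hρ
  set ε : ℕ → ℝ := fun n => D.ε₀ / (n + 1) with hεdef
  have hε : ∀ n, 0 < ε n := fun n => div_pos D.ε₀_pos (by positivity)
  have hε' : ∀ n, ε n ≤ D.ε₀ := fun n =>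
    div_le_self D.ε₀_pos.le (by have := n.cast_nonneg (α := ℝ); linarith)
  have hεlim : Tendsto ε atTop (𝓝 0) := by
    have := (tendsto_one_div_add_atTop_nhds_zero_nat (𝕜 := ℝ)).const_mul D.ε₀
    simpa only [mul_zero, mul_one_div] using this
  choose v v' hv using fun n => D.exists_isApprox (hε n) hu₀
  have hMn : ∀ n, D.energyReg (ε n) u₀ + D.C₁ ≤ M := fun n => by
    have := hE (ε n) (hε n); linarith
  set R := √M with hR
  have hvR : ∀ n t, 0 ≤ t → ‖v n t‖ ≤ R := fun n t ht =>
    Real.le_sqrt_of_sq_le ((hv n).norm_sq_le (hε n) (hε' n) (hMn n) ht)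
  set w : ℕ → ℝ → ℝ := fun n s => 1 + ‖D.L (v' n s)‖ ^ 2 + ε n * ‖v' n s‖ ^ 2 with hw
  have cw : ∀ n, Continuous (w n) := fun n => by
    have := (hv n).cont'
    simp only [hw]
    fun_prop
  have wpos : ∀ n s, 0 ≤ w n s := fun n s => by
    have := (hε n).le
    simp only [hw]; positivity
  set B := 1 / k + M with hB
  have hwi : ∀ n, Integrable (w n) ρ ∧ ∫ t, w n t ∂ρ ≤ B := fun n =>
    integrable_expMeasure_of_bound (cw n) (wpos n) fun t ht =>
      (hv n).integral_exp_le (hε n) (hε' n) (hMn n) hk0 ht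
  have hpos : ∀ᵐ t ∂ρ, 0 < t := (ae_expMeasure_iff k).2 (ae_restrict_mem measurableSet_Ioi)
  obtain ⟨a, ha, hA⟩ := D.exists_norm_A_sq_le M
  -- membership in the weighted space
  have memv : ∀ n, MemLp (v n) 2 ρ := fun n =>
    MemLp.of_bound (hv n).cont.aestronglyMeasurable R
      (hpos.mono fun t ht => hvR n t ht.le)
  have bdy : ∀ n, ∀ᵐ t ∂ρ, ‖D.L (v' n t)‖ ^ 2 ≤ 1 * w n t := fun n => hpos.mono fun t _ => by
    have : 0 ≤ ε n * ‖v' n t‖ ^ 2 := mul_nonneg (hε n).le (sq_nonneg _)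
    simp only [hw]; linarith
  have bdξ : ∀ n, ∀ᵐ t ∂ρ, ‖D.A (ε n) (v n t)‖ ^ 2 ≤ a * w n t := fun n =>
    hpos.mono fun t ht => hA _ _ _ _ (hε n) (hε' n) (hv n) (hMn n) t ht.le
  have bdz : ∀ n, ∀ᵐ t ∂ρ, ‖ε n • v' n t‖ ^ 2 ≤ ε n * w n t := fun n => hpos.mono fun t _ => by
    have : 0 ≤ ‖D.L (v' n t)‖ ^ 2 := by positivity
    rw [norm_smul, Real.norm_of_nonneg (hε n).le, mul_pow, sq (ε n), mul_assoc]
    refine mul_le_mul_of_nonneg_left ?_ (hε n).le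
    simp only [hw]; linarith
  have memy : ∀ n, MemLp (fun t => D.L (v' n t)) 2 ρ := fun n =>
    memLp_of_norm_sq_le (hwi n).1 (D.L.continuous.comp (hv n).cont').aestronglyMeasurable (bdy n)
  have memξ : ∀ n, MemLp (fun t => D.A (ε n) (v n t)) 2 ρ := fun n =>
    memLp_of_norm_sq_le (hwi n).1
      ((D.A_lipschitzWith (hε n)).continuous.comp (hv n).cont).aestronglyMeasurable (bdξ n)
  have memz : ∀ n, MemLp (fun t => ε n • v' n t) 2 ρ := fun n =>
    memLp_of_norm_sq_le (hwi n).1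
      (continuous_const.smul (hv n).cont').aestronglyMeasurable (bdz n)
  -- strong convergence
  obtain ⟨a', ha', hC⟩ := D.exists_cauchy_bound M
  have hsq : Tendsto (fun n => √(ε n)) atTop (𝓝 0) := by
    have := (Real.continuous_sqrt.tendsto 0).comp hεlim
    rwa [Real.sqrt_zero] at this
  have hsq2 : Tendsto (fun p : ℕ × ℕ => a' * (√(ε p.1) + √(ε p.2))) atTop (𝓝 0) := by
    have h1 : Tendsto (fun p : ℕ × ℕ => √(ε p.1)) atTop (𝓝 0) := by
      rw [← prod_atTop_atTop_eq]; exact hsq.comp tendsto_fst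
    have h2 : Tendsto (fun p : ℕ × ℕ => √(ε p.2)) atTop (𝓝 0) := by
      rw [← prod_atTop_atTop_eq]; exact hsq.comp tendsto_snd
    simpa using (h1.add h2).const_mul a'
  have hCnm := fun n m => hC _ _ _ _ _ _ _ (hε n) (hε' n) (hε m) (hε' m) (hv n) (hv m)
    (hMn n) (hMn m)
  have cauchyL : ∀ t, 0 ≤ t → CauchySeq fun n => D.L (v n t) := fun t ht => by
    rw [cauchySeq_iff_tendsto_dist_atTop_0]
    have h1 : Tendsto (fun p : ℕ × ℕ => dist (D.L (v p.1 t)) (D.L (v p.2 t)) ^ 2) atTop (𝓝 0) := by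
      refine squeeze_zero (fun p => sq_nonneg _) (fun p => ?_)
        (by simpa using hsq2.const_mul (Real.exp (k * t)))
      have h2 := hCnm p.1 p.2 t ht
      have h3 : 0 ≤ 2 * D.c * ∫ s in (0 : ℝ)..t, Real.exp (-(k * s)) * ‖v p.1 s - v p.2 s‖ ^ 2 :=
        mul_nonneg (by have := D.c_pos; positivity)
          (intervalIntegral.integral_nonneg ht fun s _ => by positivity)
      have h4 : Real.exp (-(k * t)) * ‖D.L (v p.1 t - v p.2 t)‖ ^ 2
          ≤ a' * (√(ε p.1) + √(ε p.2)) := by linarith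
      rw [dist_eq_norm, ← map_sub]
      have h5 := mul_le_mul_of_nonneg_left h4 (Real.exp_pos (k * t)).le
      rwa [← mul_assoc, ← Real.exp_add, add_neg_cancel, Real.exp_zero, one_mul] at h5
    have h6 := (Real.continuous_sqrt.tendsto 0).comp h1
    simp only [Real.sqrt_zero] at h6
    refine h6.congr fun p => ?_
    exact Real.sqrt_sq dist_nonneg
  have cauchyv : CauchySeq fun n => (memv n).toLp (v n) := by
    rw [cauchySeq_iff_tendsto_dist_atTop_0]
    have h1 : Tendsto (fun p : ℕ × ℕ => dist ((memv p.1).toLp (v p.1))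
        ((memv p.2).toLp (v p.2)) ^ 2) atTop (𝓝 0) := by
      refine squeeze_zero (fun p => sq_nonneg _) (fun p => ?_)
        (by simpa using hsq2.const_mul (2 * D.c)⁻¹)
      rw [dist_eq_norm, ← MemLp.toLp_sub, norm_sq_toLp]
      refine (integrable_expMeasure_of_bound (F := fun s => ‖(v p.1 - v p.2) s‖ ^ 2) ?_
        (fun s => by positivity) fun t ht => ?_).2
      · have h1 := (hv p.1).cont
        have h2 := (hv p.2).cont
        fun_prop
      · have h2 := hCnm p.1 p.2 t ht
        have h3 : 0 ≤ Real.exp (-(k * t)) * ‖D.L (v p.1 t - v p.2 t)‖ ^ 2 := by positivity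
        have hc := D.c_pos
        rw [← mul_inv_rev, ← div_eq_inv_mul, le_div_iff₀ (by positivity)]
        simp only [Pi.sub_apply]
        linarith
    have h6 := (Real.continuous_sqrt.tendsto 0).comp h1
    simp only [Real.sqrt_zero] at h6
    refine h6.congr fun p => ?_
    exact Real.sqrt_sq dist_nonneg
  obtain ⟨uL, huL⟩ := cauchySeq_tendsto_of_complete cauchyv
  -- weak limits along an ultrafilter
  have hU : (hyperfilter ℕ : Filter ℕ) ≤ atTop := Nat.hyperfilter_le_atTop
  have norm_le_of_sq : ∀ {x b : ℝ}, x ^ 2 ≤ b → x ≤ √b := fun h => Real.le_sqrt_of_sq_le h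
  obtain ⟨y, hy, -⟩ := exists_weakTendsto (hyperfilter ℕ) (C := √(1 * B))
    (fun n => norm_le_of_sq (norm_sq_toLp_le (hwi n).1 (hwi n).2 zero_le_one (memy n) (bdy n)))
  obtain ⟨ξ, hξ, -⟩ := exists_weakTendsto (hyperfilter ℕ) (C := √(a * B))
    (fun n => norm_le_of_sq (norm_sq_toLp_le (hwi n).1 (hwi n).2 ha (memξ n) (bdξ n)))
  have hz : Tendsto (fun n => (memz n).toLp _) atTop (𝓝 0) := by
    rw [tendsto_zero_iff_norm_tendsto_zero]
    have h1 : Tendsto (fun n => √(ε n * B)) atTop (𝓝 0) := by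
      have h2 := hεlim.mul_const B
      rw [zero_mul] at h2
      have h3 := (Real.continuous_sqrt.tendsto 0).comp h2
      rwa [Real.sqrt_zero] at h3
    exact squeeze_zero (fun n => norm_nonneg _)
      (fun n => norm_le_of_sq (norm_sq_toLp_le (hwi n).1 (hwi n).2 (hε n).le (memz n) (bdz n))) h1
  -- The limit is defined at every time as a weak limit, since the initial value, the mean and the
  -- energy are all needed pointwise in time.
  choose! u hu huR using fun t (ht : 0 ≤ t) => exists_weakTendsto (hyperfilter ℕ)
    (fun n => hvR n t ht)
  have hu0 : u 0 = u₀ := (hu 0 le_rfl).unique (weakTendsto_of_tendsto (by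
    simp only [(hv _).init]; exact tendsto_const_nhds))
  have huP : ∀ t, 0 ≤ t → D.P (u t) = u t - D.m := fun t ht => by
    refine ((hu t ht).map D.P).unique ?_
    have h1 : WeakTendsto (fun n => v n t + -D.m) (hyperfilter ℕ) (u t + -D.m) :=
      (hu t ht).add (weakTendsto_of_tendsto tendsto_const_nhds)
    simpa only [(hv _).proj t ht, sub_eq_add_neg] using h1
  have hdP : ∀ n t, 0 ≤ t → D.P (v n t - u t) = v n t - u t := fun n t ht => by
    rw [map_sub, (hv n).proj t ht, huP t ht]; abel
  have hLu : ∀ t, 0 ≤ t → Tendsto (fun n => D.L (v n t - u t)) atTop (𝓝 0) := fun t ht => by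
    obtain ⟨z, hz⟩ := cauchySeq_tendsto_of_complete (cauchyL t ht)
    have h1 : D.L (u t) = z :=
      ((hu t ht).map D.L).unique (weakTendsto_of_tendsto (hz.mono_left hU))
    simp only [map_sub, h1]
    simpa using hz.sub_const z
  -- Strong convergence of L v(t), together with the injectivity of L on the range of P, promotes
  -- the ultrafilter limit to a weak limit of the whole sequence.
  have hweak : ∀ t, 0 ≤ t → WeakTendsto (fun n => v n t - u t) atTop 0 := fun t ht =>
    weakTendsto_zero_of_map D.P_symm D.L_inj (C := R + R)
      (Eventually.of_forall fun n => (norm_sub_le _ _).trans (add_le_add (hvR n t ht) (huR t ht)))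
      (Eventually.of_forall fun n => hdP n t ht) (hLu t ht)
  -- identification of the pointwise weak limit
  have hae : ∀ᵐ t ∂ρ, uL t = u t := by
    obtain ⟨ns, hns, hlim⟩ := (tendstoInMeasure_of_tendsto_Lp huL).exists_seq_tendsto_ae
    have hall : ∀ᵐ t ∂ρ, ∀ n, (memv n).toLp (v n) t = v n t :=
      ae_all_iff.2 fun n => (memv n).coeFn_toLp
    filter_upwards [hlim, hall, hpos] with t h1 h2 ht
    simp only [h2] at h1
    have h3 : WeakTendsto (fun i => v (ns i) t - u t) atTop 0 := fun g =>
      (hweak t ht.le g).comp hns.tendsto_atTop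
    have h4 := h3.unique (weakTendsto_of_tendsto (h1.sub_const (u t)))
    exact (sub_eq_zero.1 h4.symm)
  have humeas : AEStronglyMeasurable u (volume.restrict (Ioi 0)) := by
    have h1 : AEStronglyMeasurable u ρ := (Lp.aestronglyMeasurable uL).congr hae
    refine h1.mono_ac fun s hs => ?_
    have h2 : ∀ᵐ t ∂ρ, t ∉ s := by rwa [ae_iff, show {t | ¬t ∉ s} = s by ext; simp]
    have h3 := (ae_expMeasure_iff k).1 h2
    rwa [ae_iff, show {t | ¬t ∉ s} = s by ext; simp] at h3
  -- the equation
  have heqn : ∀ᵐ t ∂ρ, D.L.adjoint (y t) + D.P (D.K (u t) + ξ t) = 0 := by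
    filter_upwards [hae, D.ae_eqn_of_weakTendsto hy (hz.mono_left hU) (huL.mono_left hU) hξ
      fun n => by
        filter_upwards [(memy n).coeFn_toLp, (memz n).coeFn_toLp, (memξ n).coeFn_toLp,
          (memv n).coeFn_toLp] with t g7 g8 g9 g10
        rw [g7, g8, g9, g10]
        exact (hv n).eqn t] with t h1 h2
    rwa [← h1]
  have hrel : ∀ᵐ t ∂ρ, D.A 1 (u t + ξ t) = ξ t := by
    filter_upwards [hae, D.ae_rel_of_weakTendsto hε (hεlim.mono_left hU) (huL.mono_left hU) hξ
      (fun n => norm_le_of_sq (norm_sq_toLp_le (hwi n).1 (hwi n).2 ha (memξ n) (bdξ n)))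
      fun n => by
        filter_upwards [(memξ n).coeFn_toLp, (memv n).coeFn_toLp] with t g9 g10
        rw [g9, g10]] with t h1 h2
    rwa [← h1]
  have to_Ioc : ∀ {p : ℝ → Prop}, (∀ᵐ t ∂ρ, p t) → ∀ T, ∀ᵐ t ∂volume.restrict (Ioc 0 T), p t :=
    fun h T => ae_restrict_of_ae_restrict_of_subset Ioc_subset_Ioi_self ((ae_expMeasure_iff k).1 h)
  have memyL : MemLp y 2 ρ := Lp.memLp y
  refine ⟨u, y, ξ, hu0, ⟨R, huR⟩, humeas, fun T => ⟨memLp_restrict_Ioc hk0 memyL T,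
    fun t ht => huP t ht.1, fun t ht => ?_, to_Ioc heqn T, to_Ioc hrel T⟩, fun t ht δ hδ => ?_⟩
  · have hint : IntervalIntegrable y volume 0 t := by
      rw [intervalIntegrable_iff_integrableOn_Ioc_of_le ht.1]
      exact (memLp_restrict_Ioc hk0 memyL t).integrable one_le_two
    refine ext_inner_right ℝ fun η => ?_
    have h1 : ∀ n, inner ℝ (D.L (v n t)) η
        = inner ℝ (D.L u₀) η + ∫ s in (0 : ℝ)..t, inner ℝ (D.L (v' n s)) η := fun n => by
      have hc : Continuous fun s => D.L (v' n s) := D.L.continuous.comp (hv n).cont'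
      have h2 : ∀ s ∈ uIcc 0 t, HasDerivAt (fun s => D.L (v n s)) (D.L (v' n s)) s := fun s hs => by
        rw [uIcc_of_le ht.1] at hs
        exact D.L.hasFDerivAt.comp_hasDerivAt s ((hv n).deriv s hs.1)
      rw [intervalIntegral_inner_const (hc.intervalIntegrable _ _),
        intervalIntegral.integral_eq_sub_of_hasDerivAt h2 (hc.intervalIntegrable _ _), (hv n).init,
        inner_sub_left]
      ring
    have h2 := tendsto_integral_inner hk0 memy hy (memLp_const η) ht.1
    have h3 := ((hu t ht.1).map D.L) η
    simp only [h1] at h3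
    rw [tendsto_nhds_unique h3 (tendsto_const_nhds.add h2), intervalIntegral_inner_const hint, hu0,
      inner_add_left]
  -- Lower semicontinuity by linear minorants: the energy through `energyReg_lower` with δ fixed,
  -- the dissipation through 2(L v', y) - ‖y‖² ≤ ‖L v'‖². For ε n < δ the energy with parameter δ
  -- lies below the one with parameter ε n.
  · have h1 : Tendsto (fun n => D.energyReg δ (u t) + inner ℝ (v n t - u t) (D.K (u t) + D.A δ (u t))
        - D.C / 2 * ‖D.L (v n t - u t)‖ ^ 2 + (2 * (∫ s in (0 : ℝ)..t, inner ℝ (D.L (v' n s)) (y s))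
          - ∫ s in (0 : ℝ)..t, ‖y s‖ ^ 2)) (hyperfilter ℕ)
        (𝓝 (D.energyReg δ (u t) + 0 - D.C / 2 * 0 ^ 2
          + (2 * (∫ s in (0 : ℝ)..t, inner ℝ (y s) (y s)) - ∫ s in (0 : ℝ)..t, ‖y s‖ ^ 2))) := by
      have i1 := (hweak t ht (D.K (u t) + D.A δ (u t))).mono_left hU
      rw [inner_zero_left] at i1
      have i2 := ((hLu t ht).mono_left hU).norm
      rw [norm_zero] at i2
      have i3 := tendsto_integral_inner hk0 memy hy memyL ht
      exact ((tendsto_const_nhds.add i1).sub ((i2.pow 2).const_mul _)).add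
        ((i3.const_mul 2).sub_const _)
    have h2 : ∀ᶠ n in (hyperfilter ℕ : Filter ℕ), D.energyReg δ (u t)
        + inner ℝ (v n t - u t) (D.K (u t) + D.A δ (u t))
        - D.C / 2 * ‖D.L (v n t - u t)‖ ^ 2 + (2 * (∫ s in (0 : ℝ)..t, inner ℝ (D.L (v' n s)) (y s))
          - ∫ s in (0 : ℝ)..t, ‖y s‖ ^ 2) ≤ E := by
      filter_upwards [hU (hεlim.eventually (gt_mem_nhds hδ))] with n hn
      have j1 := D.energyReg_lower hδ (hdP n t ht)
      have j2 := D.Ψ_anti (ε n) δ (hε n) hn.le (v n t)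
      have j3 := (hv n).energy_eq (hε n) ht
      have j4 := hE (ε n) (hε n)
      have cv' := (hv n).cont'
      have memt := memLp_restrict_Ioc hk0 memyL t
      have memt' := memLp_restrict_Ioc hk0 (memy n) t
      have j5 : 2 * (∫ s in (0 : ℝ)..t, inner ℝ (D.L (v' n s)) (y s))
          - ∫ s in (0 : ℝ)..t, ‖y s‖ ^ 2
          ≤ ∫ s in (0 : ℝ)..t, (‖D.L (v' n s)‖ ^ 2 + ε n * ‖v' n s‖ ^ 2) := by
        have k1 : IntervalIntegrable (fun s => inner ℝ (D.L (v' n s)) (y s)) volume 0 t := by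
          rw [intervalIntegrable_iff_integrableOn_Ioc_of_le ht]
          exact integrable_inner_of_memLp memt' memt
        have k2 : IntervalIntegrable (fun s => ‖y s‖ ^ 2) volume 0 t := by
          rw [intervalIntegrable_iff_integrableOn_Ioc_of_le ht]
          exact (memLp_two_iff_integrable_sq_norm memt.1).1 memt
        rw [← intervalIntegral.integral_const_mul, ← intervalIntegral.integral_sub
          (k1.const_mul 2) k2]
        refine intervalIntegral.integral_mono_on ht ((k1.const_mul 2).sub k2)
          (Continuous.intervalIntegrable (by fun_prop) _ _) fun s _ => ?_
        have := real_inner_le_norm (D.L (v' n s)) (y s)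
        have := mul_nonneg (hε n).le (sq_nonneg ‖v' n s‖)
        nlinarith [sq_nonneg (‖D.L (v' n s)‖ - ‖y s‖)]
      have j6 : D.energyReg δ (v n t) ≤ D.energyReg (ε n) (v n t) := by
        rw [energyReg, energyReg]; linarith
      linarith
    have h3 := le_of_tendsto h1 h2
    simp only [real_inner_self_eq_norm_sq] at h3
    linarith

end FlowData

end NonlocalCH

/-! ### Uniqueness and the energy identity for the abstract flow -/

namespace NonlocalCH

namespace FlowData

variable {X Y : Type*} [NormedAddCommGroup X] [InnerProductSpace ℝ X] [CompleteSpace X]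
  [NormedAddCommGroup Y] [InnerProductSpace ℝ Y] [CompleteSpace Y] (D : FlowData X Y)

/-- In Yosida form u and v are the resolvents of u + ξ and v + η, and monotonicity of the Yosida
approximation is evaluated at resolvents. -/
lemma inner_rel_nonneg {u v ξ η : X} (h : D.A 1 (u + ξ) = ξ) (h' : D.A 1 (v + η) = η) :
    0 ≤ inner ℝ (ξ - η) (u - v) := by
  have := D.A_mono 1 1 one_pos one_pos (u + ξ) (v + η)
  rwa [h, h', one_smul, one_smul, add_sub_cancel_right, add_sub_cancel_right] at this

lemma eq_of_map_eq {u v : X} (hu : D.P u = u - D.m) (hv : D.P v = v - D.m)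
    (h : D.L u = D.L v) : u = v := by
  have h1 := D.L_inj (u - v) (by rw [map_sub, h, sub_self])
  rw [map_sub, hu, hv, sub_sub_sub_cancel_right] at h1
  exact sub_eq_zero.1 h1

variable {D}

namespace IsSolution

variable {T : ℝ} {u u' : ℝ → X} {y y' : ℝ → Y} {ξ ξ' : ℝ → X}

lemma intervalIntegrable (h : D.IsSolution T u y ξ) {a b : ℝ} (ha : a ∈ Icc 0 T)
    (hb : b ∈ Icc 0 T) : IntervalIntegrable y volume a b := by
  have h1 : IntegrableOn y (Ioc 0 T) := h.memLp.integrable one_le_two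
  rw [intervalIntegrable_iff]
  exact h1.mono_set (Ioc_subset_Ioc (le_min ha.1 hb.1) (max_le ha.2 hb.2))

lemma intervalIntegrable_sq (h : D.IsSolution T u y ξ) {a b : ℝ} (ha : a ∈ Icc 0 T)
    (hb : b ∈ Icc 0 T) : IntervalIntegrable (fun s => ‖y s‖ ^ 2) volume a b := by
  have h1 : IntegrableOn (fun s => ‖y s‖ ^ 2) (Ioc 0 T) :=
    (memLp_two_iff_integrable_sq_norm h.memLp.1).1 h.memLp
  rw [intervalIntegrable_iff]
  exact h1.mono_set (Ioc_subset_Ioc (le_min ha.1 hb.1) (max_le ha.2 hb.2))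

/-- With d = u - u', the equations give (d/dt)‖L d‖² / 2 = -(K d, d) - (ξ - ξ', d) ≤ C‖L d‖² by
monotonicity and coercivity. Grönwall yields L d = 0, hence d = 0 because d lies in the range of P.
-/
theorem unique (h : D.IsSolution T u y ξ) (h' : D.IsSolution T u' y' ξ') (h0 : u 0 = u' 0) :
    ∀ t ∈ Icc 0 T, u t = u' t := by
  intro t ht
  have hT : 0 ≤ T := ht.1.trans ht.2
  set ζ : ℝ → Y := fun s => y s - y' s with hζ
  have hi : ∀ s ∈ Icc 0 T, IntervalIntegrable ζ volume 0 s := fun s hs =>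
    (h.intervalIntegrable ⟨le_rfl, hT⟩ hs).sub (h'.intervalIntegrable ⟨le_rfl, hT⟩ hs)
  have hz : ∀ s ∈ Icc 0 T, ∫ r in (0 : ℝ)..s, ζ r = D.L (u s - u' s) := fun s hs => by
    rw [intervalIntegral.integral_sub (h.intervalIntegrable ⟨le_rfl, hT⟩ hs)
      (h'.intervalIntegrable ⟨le_rfl, hT⟩ hs), map_sub, h.map_eq s hs, h'.map_eq s hs, h0]
    abel
  have hP : ∀ s ∈ Icc 0 T, D.P (u s - u' s) = u s - u' s := fun s hs => by
    rw [map_sub, h.proj s hs, h'.proj s hs]; abel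
  set z : ℝ → Y := fun s => ∫ r in (0 : ℝ)..s, ζ r with hzdef
  have hcont : ContinuousOn z (Icc 0 T) := by
    have := intervalIntegral.continuousOn_primitive_interval' (hi T ⟨hT, le_rfl⟩)
      (by simp : (0 : ℝ) ∈ uIcc 0 T)
    rwa [uIcc_of_le hT] at this
  have key : ∀ s ∈ Icc 0 T, ‖z s‖ ^ 2 ≤ 2 * D.C * ∫ r in (0 : ℝ)..s, ‖z r‖ ^ 2 := by
    intro s hs
    rw [hzdef]
    simp only
    rw [norm_sq_integral_eq hs.1 (hi s hs), mul_assoc]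
    have hcs : ContinuousOn z (uIcc 0 s) := by
      rw [uIcc_of_le hs.1]; exact hcont.mono (Icc_subset_Icc_right hs.2)
    have i1 : IntervalIntegrable (fun r => inner ℝ (ζ r) (z r)) volume 0 s := by
      have hsub : Ioc 0 s ⊆ Ioc 0 T := Ioc_subset_Ioc_right hs.2
      have i2 : IntegrableOn ζ (Ioc 0 s) := (hi s hs).1
      rw [intervalIntegrable_iff_integrableOn_Ioc_of_le hs.1]
      obtain ⟨b, hb⟩ := isCompact_uIcc.exists_bound_of_continuousOn hcs
      refine (i2.norm.mul_const b).mono' (i2.1.inner ?_) ?_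
      · exact (hcs.mono (by rw [uIcc_of_le hs.1]; exact Ioc_subset_Icc_self)).aestronglyMeasurable
          measurableSet_Ioc
      · filter_upwards [ae_restrict_mem measurableSet_Ioc] with r hr
        refine (norm_inner_le_norm _ _).trans (mul_le_mul_of_nonneg_left ?_ (norm_nonneg _))
        exact hb r (by rw [uIcc_of_le hs.1]; exact Ioc_subset_Icc_self hr)
    refine mul_le_mul_of_nonneg_left ?_ (zero_le_two (α := ℝ))
    rw [← intervalIntegral.integral_const_mul]
    refine intervalIntegral.integral_mono_ae_restrict hs.1 i1
      ((hcs.norm.pow 2).intervalIntegrable.const_mul _) ?_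
    have hae : ∀ᵐ r ∂volume.restrict (Icc 0 s), r ∈ Ioc 0 s := by
      rw [← restrict_Ioc_eq_restrict_Icc]; exact ae_restrict_mem measurableSet_Ioc
    have mono : ∀ {p : ℝ → Prop}, (∀ᵐ r ∂volume.restrict (Ioc 0 T), p r) →
        ∀ᵐ r ∂volume.restrict (Icc 0 s), p r := fun hp => by
      rw [← restrict_Ioc_eq_restrict_Icc]
      exact ae_restrict_of_ae_restrict_of_subset (Ioc_subset_Ioc_right hs.2) hp
    filter_upwards [mono h.eqn, mono h'.eqn, mono h.rel, mono h'.rel, hae] with r e1 e2 r1 r2 hr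
    have hrT : r ∈ Icc 0 T := ⟨hr.1.le, hr.2.trans hs.2⟩
    have hzr : z r = D.L (u r - u' r) := hz r hrT
    have f1 := D.inner_rel_nonneg r1 r2
    have f2 := D.K_coercive _ (hP r hrT)
    have f3 : inner ℝ (ζ r) (z r)
        = -(inner ℝ (D.K (u r - u' r)) (u r - u' r) + inner ℝ (ξ r - ξ' r) (u r - u' r)) := by
      rw [hzr, ← ContinuousLinearMap.adjoint_inner_left, hζ]
      simp only
      rw [map_sub D.L.adjoint, eq_neg_of_add_eq_zero_left e1, eq_neg_of_add_eq_zero_left e2,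
        neg_sub_neg, ← map_sub, D.P_symm, hP r hrT, map_sub D.K]
      simp only [inner_sub_left, inner_add_left]
      ring
    have f4 := mul_nonneg D.c_pos.le (sq_nonneg ‖u r - u' r‖)
    change inner ℝ (ζ r) (z r) ≤ D.C * ‖z r‖ ^ 2
    rw [f3, hzr]
    linarith
  have h0 := eq_zero_of_le_integral hT (hcont.norm.pow 2) (fun s _ => sq_nonneg _)
    (mul_nonneg zero_le_two D.C_nonneg) key t ht
  have h1 : z t = 0 := norm_eq_zero.1 ((sq_eq_zero_iff).1 h0)
  refine D.eq_of_map_eq (h.proj t ht) (h'.proj t ht) (sub_eq_zero.1 ?_)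
  rw [← map_sub, ← hz t ht]
  exact h1

/-- Solutions can be translated in time. -/
lemma shift {t₀ : ℝ} (ht₀ : 0 ≤ t₀) (hT : 0 ≤ T) (h : D.IsSolution (t₀ + T) u y ξ) :
    D.IsSolution T (fun t => u (t₀ + t)) (fun t => y (t₀ + t)) (fun t => ξ (t₀ + t)) := by
  have hmp : MeasurePreserving (fun t : ℝ => t₀ + t) (volume.restrict (Ioc 0 T))
      (volume.restrict (Ioc t₀ (t₀ + T))) := by
    have := (measurePreserving_add_left volume t₀).restrict_preimage
      (measurableSet_Ioc (a := t₀) (b := t₀ + T))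
    simpa using this
  have hsub : Ioc t₀ (t₀ + T) ⊆ Ioc 0 (t₀ + T) := Ioc_subset_Ioc_left ht₀
  have hae : ∀ {p : ℝ → Prop}, (∀ᵐ t ∂volume.restrict (Ioc 0 (t₀ + T)), p t) →
      ∀ᵐ t ∂volume.restrict (Ioc 0 T), p (t₀ + t) := fun hp =>
    hmp.quasiMeasurePreserving.ae (ae_restrict_of_ae_restrict_of_subset hsub hp)
  have hmem : ∀ t ∈ Icc 0 T, t₀ + t ∈ Icc 0 (t₀ + T) := fun t ht =>
    ⟨add_nonneg ht₀ ht.1, add_le_add_right ht.2 _⟩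
  have hmem0 : t₀ ∈ Icc 0 (t₀ + T) := ⟨ht₀, le_add_of_nonneg_right hT⟩
  have h00 : (0 : ℝ) ∈ Icc 0 (t₀ + T) := ⟨le_rfl, add_nonneg ht₀ hT⟩
  refine ⟨(h.memLp.mono_measure (Measure.restrict_mono hsub le_rfl)).comp_measurePreserving hmp,
    fun t ht => h.proj _ (hmem t ht), fun t ht => ?_, hae h.eqn, hae h.rel⟩
  rw [h.map_eq _ (hmem t ht), add_zero, h.map_eq _ hmem0,
    intervalIntegral.integral_comp_add_left, add_zero, add_assoc,
    intervalIntegral.integral_add_adjacent_intervals (h.intervalIntegrable h00 hmem0)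
      (h.intervalIntegrable hmem0 (hmem t ht))]

end IsSolution

variable (D)

/-- `e` is the energy of `u`: the supremum of the regularized energies. -/
def HasEnergy (u : X) (e : ℝ) : Prop := IsLUB ((fun δ => D.energyReg δ u) '' Ioi 0) e

lemma energyReg_anti {ε δ : ℝ} (hε : 0 < ε) (h : ε ≤ δ) (u : X) :
    D.energyReg δ u ≤ D.energyReg ε u := by
  have := D.Ψ_anti ε δ hε h u
  rw [energyReg, energyReg]; linarith

lemma HasEnergy.le {u : X} {e : ℝ} (h : D.HasEnergy u e) {δ : ℝ} (hδ : 0 < δ) :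
    D.energyReg δ u ≤ e := h.1 ⟨δ, hδ, rfl⟩

lemma HasEnergy.le_of_forall {u : X} {e b : ℝ} (h : D.HasEnergy u e)
    (hb : ∀ δ, 0 < δ → D.energyReg δ u ≤ b) : e ≤ b := h.2 (by rintro _ ⟨δ, hδ, rfl⟩; exact hb δ hδ)

lemma exists_hasEnergy {u : X} {b : ℝ} (hb : ∀ δ, 0 < δ → D.energyReg δ u ≤ b) :
    ∃ e, D.HasEnergy u e :=
  ⟨_, isLUB_csSup ⟨_, 1, mem_Ioi.2 one_pos, rfl⟩ ⟨b, by rintro _ ⟨δ, hδ, rfl⟩; exact hb δ hδ⟩⟩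

/-- The subgradient inequality for the limit energy. -/
lemma HasEnergy.subgrad {u v ξ : X} {e e' : ℝ} (hu : D.HasEnergy u e) (hv : D.HasEnergy v e')
    (hrel : D.A 1 (u + ξ) = ξ) (hP : D.P (v - u) = v - u) :
    e + inner ℝ (D.K u + ξ) (v - u) - D.C / 2 * ‖D.L (v - u)‖ ^ 2 ≤ e' := by
  rw [sub_le_iff_le_add, ← le_sub_iff_add_le]
  refine hu.le_of_forall D fun δ' hδ' => ?_
  have main : ∀ δ, 0 < δ → δ ≤ δ' → D.energyReg δ' u
      ≤ e' + D.C / 2 * ‖D.L (v - u)‖ ^ 2 - inner ℝ (D.K u + ξ) (v - u) + δ * (3 * ‖ξ‖ ^ 2) := by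
    intro δ hδ hle
    have h0 := D.energyReg_anti hδ hle u
    have h1 := hv.le D hδ
    -- At the shifted point u + δ ξ the approximate subgradient is exactly ξ. Shifting back to u
    -- costs 2 δ‖ξ‖², and the displaced base point in the subgradient inequality another δ‖ξ‖²,
    -- whence the constant 3.
    have hA : D.A δ (u + δ • ξ) = ξ := by
      have := D.A_resolvent 1 δ one_pos hδ (u + ξ)
      rw [hrel, sub_smul, one_smul, add_add_sub_cancel] at this
      exact this
    have h2 := D.Ψ_subgrad δ hδ (u + δ • ξ) v
    have h3 := D.Ψ_subgrad δ hδ u (u + δ • ξ)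
    have h4 : ‖D.A δ u‖ ≤ 2 * ‖ξ‖ := by
      have f1 := D.A_lipschitz hδ u (u + δ • ξ)
      have f2 : ‖u - (u + δ • ξ)‖ = δ * ‖ξ‖ := by
        rw [sub_add_cancel_left, norm_neg, norm_smul, Real.norm_of_nonneg hδ.le]
      rw [hA, f2, ← mul_assoc, inv_mul_cancel₀ hδ.ne', one_mul] at f1
      have f3 := norm_le_norm_add_norm_sub' (D.A δ u) ξ
      linarith
    have h5 := abs_real_inner_le_norm (D.A δ u) ξ
    have h6 : |inner ℝ (D.A δ u) ξ| ≤ 2 * ‖ξ‖ ^ 2 := by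
      refine h5.trans ?_
      rw [sq, ← mul_assoc]
      exact mul_le_mul_of_nonneg_right h4 (norm_nonneg _)
    have h7 : -(δ * (2 * ‖ξ‖ ^ 2)) ≤ δ * inner ℝ (D.A δ u) ξ := by
      have := mul_le_mul_of_nonneg_left (abs_le.1 h6).1 hδ.le
      linarith
    have h8 := D.K_coercive (v - u) hP
    have h9 : inner ℝ (D.K v) v = inner ℝ (D.K u) u + 2 * inner ℝ (D.K u) (v - u)
        + inner ℝ (D.K (v - u)) (v - u) := by
      have := D.K_symm v u
      have h4 := real_inner_comm v (D.K u)
      rw [map_sub]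
      simp only [inner_sub_left, inner_sub_right]
      linarith
    have h10 := mul_nonneg D.c_pos.le (sq_nonneg ‖v - u‖)
    rw [hA, ← sub_sub, inner_sub_right, real_inner_smul_right, real_inner_self_eq_norm_sq] at h2
    rw [add_sub_cancel_left, real_inner_smul_right] at h3
    rw [inner_add_left]
    simp only [energyReg] at h0 h1 ⊢
    linarith
  have hlim : Tendsto (fun δ : ℝ => e' + D.C / 2 * ‖D.L (v - u)‖ ^ 2
      - inner ℝ (D.K u + ξ) (v - u) + δ * (3 * ‖ξ‖ ^ 2)) (𝓝[>] 0)
      (𝓝 (e' + D.C / 2 * ‖D.L (v - u)‖ ^ 2 - inner ℝ (D.K u + ξ) (v - u) + 0 * (3 * ‖ξ‖ ^ 2))) :=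
    (Continuous.tendsto (by fun_prop) 0).mono_left nhdsWithin_le_nhds
  have h1 := ge_of_tendsto hlim (by
    filter_upwards [Ioc_mem_nhdsGT hδ'] with δ hδ using main δ hδ.1 hδ.2)
  linarith

/-- Existence of a global solution together with the energy identity. -/
theorem exists_solution_energy {u₀ : X} (hu₀ : D.P u₀ = u₀ - D.m) {e₀ : ℝ}
    (he₀ : D.HasEnergy u₀ e₀) :
    ∃ (u : ℝ → X) (y : ℝ → Y) (ξ : ℝ → X), u 0 = u₀ ∧ (∃ R, ∀ t, 0 ≤ t → ‖u t‖ ≤ R) ∧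
      AEStronglyMeasurable u (volume.restrict (Ioi 0)) ∧ (∀ T, D.IsSolution T u y ξ) ∧
      ∀ t, 0 ≤ t → D.HasEnergy (u t) (e₀ - ∫ s in (0 : ℝ)..t, ‖y s‖ ^ 2) := by
  obtain ⟨u, y, ξ, h0, ⟨R, hR⟩, hmeas, hsol, hen⟩ := D.exists_solution hu₀
    (fun ε hε => he₀.le D hε)
  refine ⟨u, y, ξ, h0, ⟨R, hR⟩, hmeas, hsol, ?_⟩
  have hIcc : ∀ {a b : ℝ}, 0 ≤ a → a ≤ b → a ∈ Icc 0 b := fun h1 h2 => ⟨h1, h2⟩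
  have hiy : ∀ a b, 0 ≤ a → 0 ≤ b → IntervalIntegrable y volume a b := fun a b ha hb =>
    (hsol (max a b)).intervalIntegrable (hIcc ha (le_max_left _ _)) (hIcc hb (le_max_right _ _))
  have hisq : ∀ a b, 0 ≤ a → 0 ≤ b → IntervalIntegrable (fun s => ‖y s‖ ^ 2) volume a b :=
    fun a b ha hb => (hsol (max a b)).intervalIntegrable_sq (hIcc ha (le_max_left _ _))
      (hIcc hb (le_max_right _ _))
  have hproj : ∀ t, 0 ≤ t → D.P (u t) = u t - D.m := fun t ht =>
    (hsol t).proj t ⟨ht, le_rfl⟩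
  have hmap : ∀ t, 0 ≤ t → D.L (u t) = D.L (u 0) + ∫ s in (0 : ℝ)..t, y s := fun t ht =>
    (hsol t).map_eq t ⟨ht, le_rfl⟩
  have hP : ∀ s t, 0 ≤ s → 0 ≤ t → D.P (u t - u s) = u t - u s := fun s t hs ht => by
    rw [map_sub, hproj t ht, hproj s hs]; abel
  have hLd : ∀ s t, 0 ≤ s → 0 ≤ t → D.L (u t - u s) = ∫ r in s..t, y r := fun s t hs ht => by
    rw [map_sub, hmap t ht, hmap s hs, add_sub_add_left_eq_sub,
      intervalIntegral.integral_interval_sub_left (hiy 0 t le_rfl ht) (hiy 0 s le_rfl hs)]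
  set Y2 : ℝ → ℝ := fun t => ∫ s in (0 : ℝ)..t, ‖y s‖ ^ 2 with hY2
  have hY2sub : ∀ s t, 0 ≤ s → 0 ≤ t → Y2 t - Y2 s = ∫ r in s..t, ‖y r‖ ^ 2 := fun s t hs ht =>
    intervalIntegral.integral_interval_sub_left (hisq 0 t le_rfl ht) (hisq 0 s le_rfl hs)
  have hY2mono : ∀ s t, 0 ≤ s → s ≤ t → Y2 s ≤ Y2 t := fun s t hs hst => by
    have h1 := hY2sub s t hs (hs.trans hst)
    have h2 : 0 ≤ ∫ r in s..t, ‖y r‖ ^ 2 :=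
      intervalIntegral.integral_nonneg hst fun r _ => by positivity
    linarith
  have hY2nonneg : ∀ t, 0 ≤ t → 0 ≤ Y2 t := fun t ht =>
    intervalIntegral.integral_nonneg ht fun r _ => by positivity
  have hex : ∀ t, 0 ≤ t → ∃ e, D.HasEnergy (u t) e := fun t ht =>
    D.exists_hasEnergy (b := e₀) fun δ hδ => by
      have := hen t ht δ hδ
      have := hY2nonneg t ht
      simp only [hY2] at this
      linarith
  choose! e he using hex
  have he_le : ∀ t, 0 ≤ t → e t ≤ e₀ - Y2 t := fun t ht =>
    (he t ht).le_of_forall D fun δ hδ => by have := hen t ht δ hδ; simp only [hY2]; linarith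
  -- The flow is restarted from u(s); by uniqueness the new solution is the translate of the old
  -- one, so the energy inequality holds from time s as well.
  have heanti : ∀ s t, 0 ≤ s → s ≤ t → e t ≤ e s := by
    intro s t hs hst
    obtain ⟨v, z, η, hv0, -, -, hvsol, hven⟩ := D.exists_solution (hproj s hs)
      (fun ε hε => (he s hs).le D hε)
    have hT : 0 ≤ t - s := sub_nonneg.2 hst
    have h1 := ((hsol (s + (t - s))).shift hs hT).unique (hvsol (t - s))
      (by simp only [add_zero]; exact hv0.symm) (t - s) ⟨hT, le_rfl⟩
    simp only [add_sub_cancel] at h1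
    refine (he t (hs.trans hst)).le_of_forall D fun δ hδ => ?_
    have h2 := hven (t - s) hT δ hδ
    rw [← h1] at h2
    have h3 : 0 ≤ ∫ r in (0 : ℝ)..(t - s), ‖z r‖ ^ 2 :=
      intervalIntegral.integral_nonneg hT fun r _ => by positivity
    linarith
  have hie : ∀ a b, 0 ≤ a → 0 ≤ b → IntervalIntegrable e volume a b := fun a b ha hb => by
    refine AntitoneOn.intervalIntegrable fun s hs t _ hst => heanti s t ?_ hst
    exact (le_min ha hb).trans hs.1
  have hiY2 : ∀ a b, 0 ≤ a → 0 ≤ b → IntervalIntegrable Y2 volume a b := fun a b ha hb => by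
    refine MonotoneOn.intervalIntegrable fun s hs t _ hst => hY2mono s t ?_ hst
    exact (le_min ha hb).trans hs.1
  -- quantitative estimates of increments
  have hinner : ∀ s h, 0 ≤ s → 0 ≤ h → ∀ b : Y, inner ℝ b (∫ r in s..(s + h), y r)
      ≤ 1 / 2 * (h * ‖b‖ ^ 2 + (Y2 (s + h) - Y2 s)) := by
    intro s h hs hh b
    have hsh := add_nonneg hs hh
    rw [real_inner_comm, ← intervalIntegral_inner_const (hiy _ _ hs hsh), hY2sub _ _ hs hsh]
    have i1 : IntervalIntegrable (fun r => inner ℝ (y r) b) volume s (s + h) := by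
      have h1 := hiy _ _ hs hsh
      rw [intervalIntegrable_iff] at h1 ⊢
      exact h1.inner_const b
    have i2 := hisq _ _ hs hsh
    have h2 : ∫ r in s..(s + h), inner ℝ (y r) b
        ≤ ∫ r in s..(s + h), 1 / 2 * (‖b‖ ^ 2 + ‖y r‖ ^ 2) := by
      refine intervalIntegral.integral_mono_on (le_add_of_nonneg_right hh) i1
        ((intervalIntegrable_const.add i2).const_mul _) fun r _ => ?_
      have := real_inner_le_norm (y r) b
      nlinarith [sq_nonneg (‖y r‖ - ‖b‖)]
    rw [intervalIntegral.integral_const_mul,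
      intervalIntegral.integral_add intervalIntegrable_const i2, intervalIntegral.integral_const,
      add_sub_cancel_left, smul_eq_mul] at h2
    exact h2
  have hincr : ∀ s h, 0 ≤ s → 0 < h → ‖∫ r in s..(s + h), y r‖ ^ 2 ≤ h * (Y2 (s + h) - Y2 s) := by
    intro s h hs hh
    -- The mean of y over the interval is the optimal b, and reproduces the Cauchy–Schwarz
    -- inequality.
    have h1 := hinner s h hs hh.le (h⁻¹ • ∫ r in s..(s + h), y r)
    rw [real_inner_smul_left, real_inner_self_eq_norm_sq, norm_smul, mul_pow,
      Real.norm_of_nonneg (inv_nonneg.2 hh.le)] at h1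
    have h2 : h * (h⁻¹ ^ 2 * ‖∫ r in s..(s + h), y r‖ ^ 2) = h⁻¹ * ‖∫ r in s..(s + h), y r‖ ^ 2 := by
      field_simp
    rw [h2] at h1
    have h3 : h⁻¹ * ‖∫ r in s..(s + h), y r‖ ^ 2 ≤ Y2 (s + h) - Y2 s := by linarith
    rwa [← div_eq_inv_mul, div_le_iff₀' hh] at h3
  -- lower semicontinuity at the initial time
  have hlsc : ∀ η, 0 < η → ∀ᶠ s in 𝓝[>] (0 : ℝ), e₀ - η ≤ e s := by
    intro η hη
    obtain ⟨_, ⟨δ, hδ, rfl⟩, hδ'⟩ := he₀.exists_between (sub_lt_self e₀ (half_pos hη))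
    have hpos : ∀ᶠ s in 𝓝[>] (0 : ℝ), 0 < s := self_mem_nhdsWithin
    have hL0 : Tendsto (fun s => D.L (u s - u 0)) (𝓝[>] 0) (𝓝 0) := by
      have hc : ContinuousOn (fun s => ∫ r in (0 : ℝ)..s, y r) (uIcc 0 1) :=
        intervalIntegral.continuousOn_primitive_interval' (hiy 0 1 le_rfl zero_le_one) (by simp)
      have h1 := hc 0 (by simp)
      rw [uIcc_of_le zero_le_one] at h1
      have h2 : Tendsto (fun s => ∫ r in (0 : ℝ)..s, y r) (𝓝[>] 0) (𝓝 0) := by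
        have := h1.tendsto
        rw [intervalIntegral.integral_same] at this
        refine this.mono_left (nhdsWithin_le_iff.2 ?_)
        filter_upwards [Ioo_mem_nhdsGT zero_lt_one] with s hs using Ioo_subset_Icc_self hs
      refine h2.congr' ?_
      filter_upwards [hpos] with s hs
      rw [hLd 0 s le_rfl hs.le]
    have hw : WeakTendsto (fun s => u s - u 0) (𝓝[>] 0) 0 :=
      weakTendsto_zero_of_map D.P_symm D.L_inj (C := R + R)
        (hpos.mono fun s hs => (norm_sub_le _ _).trans (add_le_add (hR s hs.le) (hR 0 le_rfl)))
        (hpos.mono fun s hs => hP 0 s le_rfl hs.le) hL0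
    have h1 : Tendsto (fun s => D.energyReg δ (u 0)
        + inner ℝ (u s - u 0) (D.K (u 0) + D.A δ (u 0)) - D.C / 2 * ‖D.L (u s - u 0)‖ ^ 2)
        (𝓝[>] 0) (𝓝 (D.energyReg δ (u 0) + 0 - D.C / 2 * 0 ^ 2)) := by
      have i1 := hw (D.K (u 0) + D.A δ (u 0))
      rw [inner_zero_left] at i1
      have i2 := hL0.norm
      rw [norm_zero] at i2
      exact (tendsto_const_nhds.add i1).sub ((i2.pow 2).const_mul _)
    have h2 : e₀ - η < D.energyReg δ (u 0) + 0 - D.C / 2 * 0 ^ 2 := by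
      have := hδ'.1
      rw [h0]
      simp only at this
      linarith
    filter_upwards [h1.eventually (lt_mem_nhds h2), hpos] with s hs hs0
    have h3 := D.energyReg_lower hδ (hP 0 s le_rfl hs0.le)
    have h4 := (he s hs0.le).le D hδ
    linarith
  -- the averaged chain rule
  have havg : ∀ t h, 0 ≤ t → 0 < h → (∫ s in (0 : ℝ)..h, e s)
      - h * (1 / 2 * Y2 t + 1 / 2 * (1 + D.C * h) * Y2 (t + h)) ≤ h * e t := by
    intro t h ht hh
    have hth := add_nonneg ht hh.le
    have hC := D.C_nonneg
    have hshift : ∀ f : ℝ → ℝ, (∀ a b, 0 ≤ a → 0 ≤ b → IntervalIntegrable f volume a b) →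
        IntervalIntegrable (fun s => f (s + h)) volume 0 t ∧
        (∫ s in (0 : ℝ)..t, f (s + h)) - ∫ s in (0 : ℝ)..t, f s
          = (∫ s in t..(t + h), f s) - ∫ s in (0 : ℝ)..h, f s := by
      intro f hf
      constructor
      · have := (hf h (t + h) hh.le hth).comp_add_right h
        simpa using this
      · rw [intervalIntegral.integral_comp_add_right, zero_add]
        have h1 := intervalIntegral.integral_add_adjacent_intervals (hf 0 h le_rfl hh.le)
          (hf h (t + h) hh.le hth)
        have h2 := intervalIntegral.integral_add_adjacent_intervals (hf 0 t le_rfl ht)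
          (hf t (t + h) ht hth)
        linarith
    obtain ⟨se1, se2⟩ := hshift e hie
    obtain ⟨sY1, sY2⟩ := hshift Y2 hiY2
    -- The subgradient inequality at u(s) tested with u(s + h). The equation turns its linear term
    -- into -(y(s), ∫ y), estimated by Young's inequality; integrated over [0, t] the increments
    -- telescope to averages near the two end times.
    have hpt : ∀ᵐ s ∂volume.restrict (Icc 0 t),
        -(h / 2 * ‖y s‖ ^ 2 + 1 / 2 * (1 + D.C * h) * (Y2 (s + h) - Y2 s)) ≤ e (s + h) - e s := by
      rw [← restrict_Ioc_eq_restrict_Icc]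
      filter_upwards [(hsol t).eqn, (hsol t).rel, ae_restrict_mem measurableSet_Ioc]
        with s e1 e2 hs
      have hs0 := hs.1.le
      have hsh := add_nonneg hs0 hh.le
      have h1 := (he s hs0).subgrad D (he (s + h) hsh) e2 (hP _ _ hs0 hsh)
      have h2 : inner ℝ (D.K (u s) + ξ s) (u (s + h) - u s)
          = -inner ℝ (y s) (∫ r in s..(s + h), y r) := by
        rw [← hP _ _ hs0 hsh, ← D.P_symm, eq_neg_of_add_eq_zero_right e1, inner_neg_left,
          ContinuousLinearMap.adjoint_inner_left, hLd _ _ hs0 hsh]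
      have h3 := hinner s h hs0 hh.le (y s)
      have h4 := hincr s h hs0 hh
      rw [h2, hLd _ _ hs0 hsh] at h1
      have h5 := mul_le_mul_of_nonneg_left h4 hC
      linarith
    have hint := intervalIntegral.integral_mono_ae_restrict (f := fun s =>
        -(h / 2 * ‖y s‖ ^ 2 + 1 / 2 * (1 + D.C * h) * (Y2 (s + h) - Y2 s)))
      (g := fun s => e (s + h) - e s) ht
      (((hisq 0 t le_rfl ht).const_mul (h / 2)).add
        ((sY1.sub (hiY2 0 t le_rfl ht)).const_mul (1 / 2 * (1 + D.C * h)))).neg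
      (se1.sub (hie 0 t le_rfl ht)) hpt
    rw [intervalIntegral.integral_neg, intervalIntegral.integral_add
      ((hisq 0 t le_rfl ht).const_mul (h / 2))
      ((sY1.sub (hiY2 0 t le_rfl ht)).const_mul (1 / 2 * (1 + D.C * h))),
      intervalIntegral.integral_const_mul, intervalIntegral.integral_const_mul,
      intervalIntegral.integral_sub sY1 (hiY2 0 t le_rfl ht),
      intervalIntegral.integral_sub se1 (hie 0 t le_rfl ht), se2, sY2] at hint
    -- Monotonicity of the energy replaces its average after time t by its value at t, so no
    -- continuity of the energy at t is required.
    have b1 : ∫ s in t..(t + h), e s ≤ h * e t := by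
      have := intervalIntegral.integral_mono_on (le_add_of_nonneg_right hh.le)
        (hie t (t + h) ht hth) (intervalIntegrable_const (c := e t))
        fun s hs => heanti t s ht hs.1
      rwa [intervalIntegral.integral_const, add_sub_cancel_left, smul_eq_mul] at this
    have b2 : ∫ s in t..(t + h), Y2 s ≤ h * Y2 (t + h) := by
      have := intervalIntegral.integral_mono_on (le_add_of_nonneg_right hh.le)
        (hiY2 t (t + h) ht hth) (intervalIntegrable_const (c := Y2 (t + h)))
        fun s hs => hY2mono s (t + h) (ht.trans hs.1) hs.2
      rwa [intervalIntegral.integral_const, add_sub_cancel_left, smul_eq_mul] at this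
    have b3 : 0 ≤ ∫ s in (0 : ℝ)..h, Y2 s :=
      intervalIntegral.integral_nonneg hh.le fun s hs => hY2nonneg s hs.1
    have b4 : 1 / 2 * (1 + D.C * h) * ((∫ s in t..(t + h), Y2 s) - ∫ s in (0 : ℝ)..h, Y2 s)
        ≤ 1 / 2 * (1 + D.C * h) * (h * Y2 (t + h)) :=
      mul_le_mul_of_nonneg_left (by linarith) (by positivity)
    simp only [hY2] at hint b4 ⊢
    linarith
  -- As h tends to 0 the two coefficients 1 / 2 of the dissipation add up to 1. Lower semicontinuity
  -- at time 0 bounds the average of the energy over (0, h) from below by e₀ - η.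
  have hge : ∀ t, 0 ≤ t → e₀ - Y2 t ≤ e t := by
    intro t ht
    refine le_of_forall_pos_sub_le fun η hη => ?_
    have hY2c : Tendsto (fun h => 1 / 2 * Y2 t + 1 / 2 * (1 + D.C * h) * Y2 (t + h)) (𝓝[>] 0)
        (𝓝 (1 / 2 * Y2 t + 1 / 2 * (1 + D.C * 0) * Y2 t)) := by
      have hc : ContinuousOn Y2 (uIcc 0 (t + 1)) :=
        intervalIntegral.continuousOn_primitive_interval'
          (hisq 0 (t + 1) le_rfl (by linarith)) (by simp)
      rw [uIcc_of_le (by linarith)] at hc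
      have h1 := (hc t ⟨ht, by linarith⟩).tendsto
      have h2 : Tendsto (fun h => t + h) (𝓝[>] 0) (𝓝[Icc 0 (t + 1)] t) := by
        refine tendsto_nhdsWithin_iff.2 ⟨?_, ?_⟩
        · have : Tendsto (fun h => t + h) (𝓝 0) (𝓝 (t + 0)) :=
            (continuous_const.add continuous_id).tendsto 0
          rw [add_zero] at this
          exact this.mono_left nhdsWithin_le_nhds
        · filter_upwards [Ioo_mem_nhdsGT zero_lt_one] with h hh
          exact ⟨by linarith [hh.1], by linarith [hh.2]⟩
      have h3 : Tendsto (fun h : ℝ => 1 / 2 * (1 + D.C * h)) (𝓝[>] 0)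
          (𝓝 (1 / 2 * (1 + D.C * 0))) :=
        (Continuous.tendsto (by fun_prop) 0).mono_left nhdsWithin_le_nhds
      exact tendsto_const_nhds.add (h3.mul (h1.comp h2))
    obtain ⟨h₁, hh₁, hlow⟩ := mem_nhdsGT_iff_exists_Ioo_subset.1 (hlsc η hη)
    have hev : ∀ᶠ h in 𝓝[>] (0 : ℝ), e₀ - η
        - (1 / 2 * Y2 t + 1 / 2 * (1 + D.C * h) * Y2 (t + h)) ≤ e t := by
      filter_upwards [Ioo_mem_nhdsGT (mem_Ioi.1 hh₁)] with h hh
      have h1 := havg t h ht hh.1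
      have h2 : h * (e₀ - η) ≤ ∫ s in (0 : ℝ)..h, e s := by
        have := intervalIntegral.integral_mono_on_of_le_Ioo hh.1.le
          (intervalIntegrable_const (c := e₀ - η)) (hie 0 h le_rfl hh.1.le)
          fun s hs => hlow ⟨hs.1, hs.2.trans hh.2⟩
        rwa [intervalIntegral.integral_const, sub_zero, smul_eq_mul] at this
      have h3 : h * (e₀ - η - (1 / 2 * Y2 t + 1 / 2 * (1 + D.C * h) * Y2 (t + h))) ≤ h * e t := by
        linarith
      exact le_of_mul_le_mul_left h3 hh.1
    have h4 := le_of_tendsto (tendsto_const_nhds.sub hY2c) hev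
    linarith
  intro t ht
  have := le_antisymm (he_le t ht) (hge t ht)
  have h1 := he t ht
  rwa [this] at h1

end FlowData

end NonlocalCH

/-! ### Density of test functions and translations of Sobolev functions -/

namespace NonlocalCH

section Lebesgue

variable {X G : Type*} [MeasurableSpace X] {μ : Measure X} [NormedAddCommGroup G]

lemma lintegral_enorm_sq (f : X → G) : ∫⁻ x, ‖f x‖ₑ ^ 2 ∂μ = eLpNorm f 2 μ ^ 2 := by
  have h := eLpNorm_nnreal_pow_eq_lintegral (μ := μ) (f := f) (p := 2) two_ne_zero
  simp only [NNReal.coe_ofNat, ENNReal.coe_ofNat, ENNReal.rpow_ofNat] at h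
  exact h.symm

lemma abs_integral_mul_le {f g : X → ℝ} (hf : MemLp f 2 μ) (hg : MemLp g 2 μ) :
    |∫ x, f x * g x ∂μ| ≤ (eLpNorm f 2 μ).toReal * (eLpNorm g 2 μ).toReal := by
  have h := abs_real_inner_le_norm (hg.toLp g) (hf.toLp f)
  rw [Lp.norm_toLp, Lp.norm_toLp, L2.inner_def, mul_comm (eLpNorm g 2 μ).toReal] at h
  convert h using 2
  refine integral_congr_ae ?_
  filter_upwards [hf.coeFn_toLp, hg.coeFn_toLp] with x h1 h2
  rw [h1, h2]
  rfl

end Lebesgue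

variable {d : ℕ} {Ω : Set (E d)}

/-- The subspace of `L²(S)` of smooth functions with compact support in `S`. -/
def testSpace (S : Set (E d)) : Submodule ℝ (H S) where
  carrier := {f | ∃ ψ : E d → ℝ, ContDiff ℝ ∞ ψ ∧ HasCompactSupport ψ ∧ tsupport ψ ⊆ S ∧
    f =ᵐ[volume.restrict S] ψ}
  zero_mem' := ⟨fun _ => 0, contDiff_const, HasCompactSupport.zero, by simp [tsupport],
    Lp.coeFn_zero ℝ 2 _⟩
  add_mem' := by
    rintro f g ⟨ψ, h1, h2, h3, h4⟩ ⟨χ, k1, k2, k3, k4⟩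
    exact ⟨ψ + χ, h1.add k1, h2.add k2, (tsupport_add ψ χ).trans (union_subset h3 k3),
      (Lp.coeFn_add f g).trans (h4.add k4)⟩
  smul_mem' := by
    rintro c f ⟨ψ, h1, h2, h3, h4⟩
    exact ⟨c • ψ, contDiff_const.smul h1, h2.smul_left (f := fun _ => c),
      (tsupport_smul_subset_right (fun _ => c) ψ).trans h3,
      (Lp.coeFn_smul c f).trans (h4.const_smul c)⟩

/-- A function orthogonal to all test functions vanishes by the fundamental lemma of the calculus of
variations. -/
lemma testSpace_dense {S : Set (E d)} (hS : IsOpen S) : Dense (testSpace S : Set (H S)) := by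
  rw [Submodule.dense_iff_topologicalClosure_eq_top, Submodule.topologicalClosure_eq_top_iff,
    Submodule.eq_bot_iff]
  intro w hw
  rw [Submodule.mem_orthogonal] at hw
  have hloc : LocallyIntegrableOn w S volume :=
    LocallyIntegrableOn.mono_set
      (s := S) (fun x hx => by
        obtain ⟨K, hK, hxK, hKS⟩ := exists_compact_subset hS hx
        refine ⟨S ∩ K, inter_mem_nhdsWithin _ (mem_interior_iff_mem_nhds.1 hxK), ?_⟩
        have h1 : MemLp w 2 (volume.restrict (S ∩ K)) :=
          (Lp.memLp w).mono_measure (Measure.restrict_mono inter_subset_left le_rfl)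
        have : IsFiniteMeasure (volume.restrict (S ∩ K)) :=
          ⟨by rw [Measure.restrict_apply_univ]
              exact (measure_mono inter_subset_right).trans_lt hK.measure_lt_top⟩
        exact h1.integrable one_le_two) subset_rfl
  have h := hS.ae_eq_zero_of_integral_contDiff_smul_eq_zero hloc fun g h1 h2 h3 => by
    have hm : MemLp g 2 (volume.restrict S) :=
      (h1.continuous.memLp_of_hasCompactSupport h2).restrict S
    have := hw (hm.toLp g) ⟨g, h1, h2, h3, hm.coeFn_toLp⟩
    rw [L2.inner_def] at this
    rw [← this, ← setIntegral_eq_integral_of_forall_compl_eq_zero (s := S)]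
    · refine integral_congr_ae ?_
      filter_upwards [hm.coeFn_toLp] with x hx
      rw [hx, smul_eq_mul, mul_comm]
      rfl
    · intro x hx
      rw [image_eq_zero_of_notMem_tsupport fun h => hx (h3 h), zero_smul]
  rw [Lp.eq_zero_iff_ae_eq_zero]
  exact (ae_restrict_iff' hS.measurableSet).2 h

/-- Duality: by density the bound extends to all g in L²(S), and g = w gives the claim. -/
lemma norm_le_of_forall_test {S : Set (E d)} (hS : IsOpen S) (w : H S) {M : ℝ} (hM : 0 ≤ M)
    (h : ∀ ψ : E d → ℝ, ContDiff ℝ ∞ ψ → HasCompactSupport ψ → tsupport ψ ⊆ S →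
      |∫ x in S, w x * ψ x| ≤ M * (eLpNorm ψ 2 (volume.restrict S)).toReal) : ‖w‖ ≤ M := by
  have key : ∀ g : H S, |inner ℝ w g| ≤ M * ‖g‖ := by
    refine isClosed_property (testSpace_dense hS).denseRange_val
      (isClosed_le (by fun_prop) (by fun_prop)) ?_
    rintro ⟨g, ψ, h1, h2, h3, h4⟩
    have := h ψ h1 h2 h3
    rw [← eLpNorm_congr_ae h4, ← Lp.norm_def] at this
    refine le_trans (le_of_eq ?_) this
    rw [L2.inner_def]
    congr 1
    refine integral_congr_ae ?_
    filter_upwards [h4] with x hx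
    rw [hx, mul_comm]
    rfl
  rcases (norm_nonneg w).eq_or_lt with h0 | h0
  · rwa [← h0]
  · have := key w
    rw [real_inner_self_eq_norm_sq, abs_of_nonneg (sq_nonneg _), sq] at this
    exact le_of_mul_le_mul_right this h0

lemma hasWeakGradient_mem (p : V Ω) : HasWeakGradient Ω (toH Ω p) (grad Ω p) := p.2

/-- The translation is carried by the smooth factor, so v need not be differentiable. -/
lemma hasDerivAt_integral_mul_translate [IsFiniteMeasure (volume.restrict Ω)] {v : E d → ℝ}
    (hv : MemLp v 2 (volume.restrict Ω)) {ψ : E d → ℝ} (h1 : ContDiff ℝ ∞ ψ)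
    (h2 : HasCompactSupport ψ) (h : E d) (t : ℝ) :
    HasDerivAt (fun t : ℝ => ∫ y in Ω, v y * ψ (y - t • h))
      (∫ y in Ω, v y * fderiv ℝ ψ (y - t • h) (-h)) t := by
  obtain ⟨b, hb⟩ := (h2.fderiv (𝕜 := ℝ)).exists_bound_of_continuous
    (h1.continuous_fderiv (by simp))
  have hsh : ∀ t : ℝ, MemLp (fun y => ψ (y - t • h)) 2 (volume.restrict Ω) := fun t =>
    (Continuous.memLp_of_hasCompactSupport (h1.continuous.comp (by fun_prop))
      (h2.comp_homeomorph (Homeomorph.subRight (t • h)))).restrict Ω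
  have hm : AEStronglyMeasurable (fun y => fderiv ℝ ψ (y - t • h) (-h)) (volume.restrict Ω) :=
    (((h1.continuous_fderiv (by simp)).comp (continuous_id.sub continuous_const)).clm_apply
      continuous_const).aestronglyMeasurable
  refine (hasDerivAt_integral_of_dominated_loc_of_deriv_le
    (μ := volume.restrict Ω) (F := fun t y => v y * ψ (y - t • h)) (s := univ)
    (F' := fun t y => v y * fderiv ℝ ψ (y - t • h) (-h)) (x₀ := t)
    (bound := fun y => ‖v y‖ * (b * ‖h‖)) univ_mem
    (Eventually.of_forall fun t => hv.1.mul (hsh t).1)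
    (hv.integrable_mul (hsh t)) (hv.1.mul hm)
    (Eventually.of_forall fun y s _ => ?_) ((hv.integrable one_le_two).norm.mul_const _)
    (Eventually.of_forall fun y s _ => ?_)).2
  · rw [norm_mul]
    refine mul_le_mul_of_nonneg_left ?_ (norm_nonneg _)
    refine (ContinuousLinearMap.le_opNorm _ _).trans ?_
    rw [norm_neg]
    exact mul_le_mul_of_nonneg_right (hb _) (norm_nonneg _)
  · have e1 : HasDerivAt (fun s : ℝ => y - s • h) (-h) s := by
      simpa using ((hasDerivAt_id s).smul_const h).const_sub y
    exact (((h1.differentiable (by simp)) _).hasFDerivAt.comp_hasDerivAt s e1).const_mul (v y)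

/-- Difference quotients of Sobolev functions are controlled by the gradient. -/
theorem eLpNorm_translate_sub_le [IsFiniteMeasure (volume.restrict Ω)] (hΩ : IsOpen Ω) (p : V Ω)
    {S : Set (E d)} (hS : IsOpen S)
    {h : E d} (hSh : ∀ x ∈ S, ∀ t ∈ Icc (0 : ℝ) 1, x + t • h ∈ Ω) :
    eLpNorm (fun x => toH Ω p (x + h) - toH Ω p x) 2 (volume.restrict S)
      ≤ ‖h‖ₑ * ‖grad Ω p‖ₑ := by
  have hvm : MemLp (⇑(toH Ω p)) 2 (volume.restrict Ω) := Lp.memLp _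
  have hgrad := hasWeakGradient_mem p
  have hGm : MemLp (⇑(grad Ω p)) 2 (volume.restrict Ω) := Lp.memLp _
  rw [Lp.enorm_def]
  generalize (⇑(toH Ω p) : E d → ℝ) = v at *
  generalize (⇑(grad Ω p) : E d → E d) = G at *
  have hSΩ : S ⊆ Ω := fun x hx => by simpa using hSh x hx 0 ⟨le_rfl, zero_le_one⟩
  have hSΩ' : S ⊆ (fun x => x + h) ⁻¹' Ω := fun x hx => by
    simpa using hSh x hx 1 ⟨zero_le_one, le_rfl⟩
  have hmp : MeasurePreserving (fun x : E d => x + h) (volume.restrict ((fun x => x + h) ⁻¹' Ω))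
      (volume.restrict Ω) :=
    (measurePreserving_add_right volume h).restrict_preimage hΩ.measurableSet
  have hv1 : MemLp v 2 (volume.restrict S) :=
    hvm.mono_measure (Measure.restrict_mono hSΩ le_rfl)
  have hv2 : MemLp (fun x => v (x + h)) 2 (volume.restrict S) :=
    (hvm.comp_measurePreserving hmp).mono_measure (Measure.restrict_mono hSΩ' le_rfl)
  have hw : MemLp (fun x => v (x + h) - v x) 2 (volume.restrict S) := hv2.sub hv1
  have main : ∀ ψ : E d → ℝ, ContDiff ℝ ∞ ψ → HasCompactSupport ψ → tsupport ψ ⊆ S →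
      |∫ x in S, hw.toLp (fun x => v (x + h) - v x) x * ψ x|
        ≤ ‖h‖ * (eLpNorm G 2 (volume.restrict Ω)).toReal * (eLpNorm ψ 2 (volume.restrict S)).toReal := by
    intro ψ h1 h2 h3
    have hψ2 : MemLp ψ 2 (volume.restrict S) :=
      (h1.continuous.memLp_of_hasCompactSupport h2).restrict S
    have hψS : ∀ x, x ∉ S → ψ x = 0 := fun x hx =>
      image_eq_zero_of_notMem_tsupport fun h => hx (h3 h)
    -- f(1) - f(0) is the difference v(x + h) - v(x) tested with ψ. The translates of ψ stay
    -- supported in Ω by the segment hypothesis, so the weak gradient computes f'.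
    obtain ⟨f, hf⟩ : ∃ f : ℝ → ℝ, f = fun t => ∫ y in Ω, v y * ψ (y - t • h) := ⟨_, rfl⟩
    have hsh1 : ∀ t : ℝ, ContDiff ℝ ∞ fun y => ψ (y - t • h) := fun t =>
      h1.comp (contDiff_id.sub contDiff_const)
    have hsh2 : ∀ t : ℝ, HasCompactSupport fun y => ψ (y - t • h) := fun t =>
      h2.comp_homeomorph (Homeomorph.subRight (t • h))
    have hsh3 : ∀ t ∈ Icc (0 : ℝ) 1, tsupport (fun y => ψ (y - t • h)) ⊆ Ω := fun t ht y hy => by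
      have h4 : y - t • h ∈ tsupport ψ :=
        tsupport_comp_subset_preimage ψ (f := fun y => y - t • h) (by fun_prop) hy
      simpa using hSh _ (h3 h4) t ht
    have hL2 : ∀ t : ℝ, (eLpNorm (fun y => ψ (y - t • h)) 2 (volume.restrict Ω)).toReal
        ≤ (eLpNorm ψ 2 (volume.restrict S)).toReal := fun t => by
      refine ENNReal.toReal_mono hψ2.2.ne ?_
      refine (eLpNorm_mono_measure _ Measure.restrict_le_self).trans ?_
      have h4 := eLpNorm_comp_measurePreserving (p := 2)
        h1.continuous.aestronglyMeasurable (measurePreserving_sub_right (volume : Measure (E d))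
          (t • h))
      rw [eLpNorm_restrict_eq_of_support_subset fun x hx => by_contra fun h => hx (hψS x h)]
      exact h4.le
    have hderiv : ∀ t ∈ Icc (0 : ℝ) 1, HasDerivAt f
        (∫ y in Ω, inner ℝ (G y) h * ψ (y - t • h)) t := by
      intro t ht
      have h4 := hasDerivAt_integral_mul_translate hvm h1 h2 h t
      rw [hf]
      convert h4 using 1
      have h5 := hgrad _ (hsh1 t) (hsh2 t) (hsh3 t ht) h
      rw [← neg_eq_iff_eq_neg, ← integral_neg] at h5
      rw [← h5]
      refine integral_congr_ae (Eventually.of_forall fun y => ?_)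
      simp only [map_neg, mul_neg, fderiv_comp_sub]
    have hbound : ∀ t ∈ Ico (0 : ℝ) 1, ‖∫ y in Ω, inner ℝ (G y) h * ψ (y - t • h)‖
        ≤ ‖h‖ * (eLpNorm G 2 (volume.restrict Ω)).toReal * (eLpNorm ψ 2 (volume.restrict S)).toReal := by
      intro t ht
      have hG : MemLp (fun y => inner ℝ (G y) h) 2 (volume.restrict Ω) :=
        hGm.inner_const h
      refine (abs_integral_mul_le hG
        (((hsh1 t).continuous.memLp_of_hasCompactSupport (hsh2 t)).restrict Ω)).trans ?_
      refine mul_le_mul ?_ (hL2 t) ENNReal.toReal_nonneg (by positivity)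
      have h6 : eLpNorm (fun y => inner ℝ (G y) h) 2 (volume.restrict Ω)
          ≤ ENNReal.ofReal ‖h‖ * eLpNorm G 2 (volume.restrict Ω) :=
        eLpNorm_le_mul_eLpNorm_of_ae_le_mul (Eventually.of_forall fun y => by
          rw [mul_comm]; exact norm_inner_le_norm _ _) 2
      have h7 := ENNReal.toReal_mono (ENNReal.mul_ne_top ENNReal.ofReal_ne_top
        hGm.2.ne) h6
      rwa [ENNReal.toReal_mul, ENNReal.toReal_ofReal (norm_nonneg _)] at h7
    have h8 := norm_image_sub_le_of_norm_deriv_le_segment_01'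
      (fun t ht => (hderiv t ht).hasDerivWithinAt) hbound
    have h9 : f 1 - f 0 = ∫ x in S, hw.toLp (fun x => v (x + h) - v x) x * ψ x := by
      have f0 : f 0 = ∫ x in S, v x * ψ x := by
        simp only [hf, zero_smul, sub_zero]
        exact (setIntegral_eq_of_subset_of_forall_sdiff_eq_zero hΩ.measurableSet hSΩ
          fun x hx => by rw [hψS x hx.2, mul_zero])
      have f1 : f 1 = ∫ x in S, v (x + h) * ψ x := by
        simp only [hf, one_smul]
        rw [setIntegral_eq_integral_of_forall_compl_eq_zero (s := Ω) fun x hx => by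
          rw [hψS (x - h) fun hxS => hx (by simpa using hSΩ' hxS), mul_zero],
          setIntegral_eq_integral_of_forall_compl_eq_zero (s := S) fun x hx => by
          rw [hψS x hx, mul_zero],
          ← integral_add_right_eq_self _ h]
        simp only [add_sub_cancel_right]
      have e1 : Integrable (fun x => v (x + h) * ψ x) (volume.restrict S) := hv2.integrable_mul hψ2
      have e2 : Integrable (fun x => v x * ψ x) (volume.restrict S) := hv1.integrable_mul hψ2
      rw [f0, f1, ← integral_sub e1 e2]
      refine integral_congr_ae ?_
      filter_upwards [hw.coeFn_toLp] with x hx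
      rw [hx, sub_mul]
    rwa [h9] at h8
  replace main := norm_le_of_forall_test hS (hw.toLp _) (by positivity) main
  rw [Lp.norm_toLp] at main
  rw [← ENNReal.ofReal_toReal hw.2.ne]
  refine (ENNReal.ofReal_le_ofReal main).trans ?_
  rw [ENNReal.ofReal_mul (norm_nonneg _), ofReal_norm, ENNReal.ofReal_toReal hGm.2.ne]

end NonlocalCH

/-! ### The Poincaré inequality on bounded Lipschitz domains -/

namespace NonlocalCH

variable {d : ℕ} {Ω : Set (E d)}

/-- The mean square difference of `v` between `U` and `W`. -/
noncomputable def sqDiff (v : E d → ℝ) (U W : Set (E d)) : ℝ≥0∞ :=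
  ∫⁻ x in U, ∫⁻ y in W, ‖v x - v y‖ₑ ^ 2

lemma enorm_sub_sq_le (a b c : ℝ) : ‖a - c‖ₑ ^ 2 ≤ 2 * (‖a - b‖ₑ ^ 2 + ‖b - c‖ₑ ^ 2) := by
  have e : ∀ x : ℝ, ‖x‖ₑ ^ 2 = ENNReal.ofReal (x ^ 2) := fun x => by
    rw [← ofReal_norm, ← ENNReal.ofReal_pow (norm_nonneg _), Real.norm_eq_abs, sq_abs]
  have h2 : (2 : ℝ≥0∞) = ENNReal.ofReal 2 := by simp
  rw [e, e, e, ← ENNReal.ofReal_add (sq_nonneg _) (sq_nonneg _), h2,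
    ← ENNReal.ofReal_mul zero_le_two]
  exact ENNReal.ofReal_le_ofReal (by nlinarith [sq_nonneg ((a - b) - (b - c))])

lemma measurable_sq_diff {v : E d → ℝ} (hv : Measurable v) :
    Measurable fun z : E d × E d => ‖v z.1 - v z.2‖ₑ ^ 2 := by fun_prop

lemma sqDiff_mono (v : E d → ℝ) {U U' W W' : Set (E d)} (h : U ⊆ U') (h' : W ⊆ W') :
    sqDiff v U W ≤ sqDiff v U' W' :=
  lintegral_mono' (Measure.restrict_mono h le_rfl)
    fun _ => lintegral_mono' (Measure.restrict_mono h' le_rfl) le_rfl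

lemma sqDiff_comm {v : E d → ℝ} (hv : Measurable v) (U W : Set (E d)) :
    sqDiff v U W = sqDiff v W U := by
  rw [sqDiff, lintegral_lintegral_swap (measurable_sq_diff hv).aemeasurable]
  simp only [sqDiff, enorm_sub_rev (v _) (v _)]

lemma sqDiff_union_le (v : E d → ℝ) (U U' W : Set (E d)) :
    sqDiff v (U ∪ U') W ≤ sqDiff v U W + sqDiff v U' W := by
  rw [sqDiff, sqDiff, sqDiff, ← lintegral_add_measure]
  exact lintegral_mono' (Measure.restrict_union_le _ _) le_rfl

/-- An intermediate point y in W is inserted between x and z by the quadratic triangle inequality,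
and the result is integrated over all three points. -/
lemma volume_mul_sqDiff_le {v : E d → ℝ} (hv : Measurable v) (U W Z : Set (E d)) :
    volume W * sqDiff v U Z
      ≤ 2 * (volume Z * sqDiff v U W + volume U * sqDiff v W Z) := by
  have hm := measurable_sq_diff hv
  have m1 : ∀ S : Set (E d), Measurable fun x => ∫⁻ y in S, ‖v x - v y‖ₑ ^ 2 := fun S =>
    hm.lintegral_prod_right'
  have m2 : ∀ a : ℝ, Measurable fun y => ‖a - v y‖ₑ ^ 2 := fun a => by fun_prop
  have h1 : ∀ x z, ∫⁻ y in W, ‖v x - v z‖ₑ ^ 2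
      ≤ 2 * ((∫⁻ y in W, ‖v x - v y‖ₑ ^ 2) + ∫⁻ y in W, ‖v z - v y‖ₑ ^ 2) := fun x z => by
    rw [← lintegral_add_left (m2 _), ← lintegral_const_mul' _ _ ENNReal.ofNat_ne_top]
    refine lintegral_mono fun y => (enorm_sub_sq_le _ (v y) _).trans ?_
    rw [enorm_sub_rev (v y)]
  calc volume W * sqDiff v U Z
      = ∫⁻ x in U, ∫⁻ z in Z, ∫⁻ y in W, ‖v x - v z‖ₑ ^ 2 := by
        simp only [lintegral_const, Measure.restrict_apply_univ]
        rw [sqDiff, ← lintegral_const_mul _ (m1 Z)]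
        refine lintegral_congr fun x => ?_
        rw [← lintegral_const_mul _ (m2 _)]
        simp only [mul_comm]
    _ ≤ ∫⁻ x in U, ∫⁻ z in Z, 2 * ((∫⁻ y in W, ‖v x - v y‖ₑ ^ 2)
          + ∫⁻ y in W, ‖v z - v y‖ₑ ^ 2) :=
        lintegral_mono fun x => lintegral_mono fun z => h1 x z
    _ = 2 * (volume Z * sqDiff v U W + volume U * sqDiff v W Z) := by
        rw [sqDiff_comm hv W Z, sqDiff, sqDiff]
        have : ∀ x, ∫⁻ z in Z, 2 * ((∫⁻ y in W, ‖v x - v y‖ₑ ^ 2)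
            + ∫⁻ y in W, ‖v z - v y‖ₑ ^ 2) = 2 * (volume Z * (∫⁻ y in W, ‖v x - v y‖ₑ ^ 2)
            + ∫⁻ z in Z, ∫⁻ y in W, ‖v z - v y‖ₑ ^ 2) := fun x => by
          rw [lintegral_const_mul _ ((m1 W).const_add _), lintegral_add_left measurable_const,
            lintegral_const, Measure.restrict_apply_univ, mul_comm (volume Z)]
        simp only [this]
        rw [lintegral_const_mul, lintegral_add_right _ measurable_const, lintegral_const,
          Measure.restrict_apply_univ, lintegral_const_mul _ (m1 W), mul_comm (volume U)]
        exact ((m1 W).const_mul _).add_const _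

lemma measurable_toH (p : V Ω) : Measurable (toH Ω p) := (Lp.stronglyMeasurable _).measurable

lemma lintegral_translate_sub_sq_le [IsFiniteMeasure (volume.restrict Ω)] (hΩ : IsOpen Ω) (p : V Ω)
    {S : Set (E d)} (hS : IsOpen S)
    {h : E d} (hSh : ∀ x ∈ S, ∀ t ∈ Icc (0 : ℝ) 1, x + t • h ∈ Ω) :
    ∫⁻ x in S, ‖toH Ω p (x + h) - toH Ω p x‖ₑ ^ 2 ≤ ‖h‖ₑ ^ 2 * ‖grad Ω p‖ₑ ^ 2 := by
  rw [lintegral_enorm_sq, ← mul_pow]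
  exact pow_le_pow_left' (eLpNorm_translate_sub_le hΩ p hS hSh) 2

/-- A Poincaré inequality for differences between `U` and `W`. -/
def PoincarePair (Ω U W : Set (E d)) : Prop :=
  ∃ C : ℝ≥0, ∀ p : V Ω, sqDiff (toH Ω p) U W ≤ C * ‖grad Ω p‖ₑ ^ 2

namespace PoincarePair

variable {U U' W W' Z : Set (E d)}

lemma mono (h : PoincarePair Ω U' W') (hU : U ⊆ U') (hW : W ⊆ W') : PoincarePair Ω U W := by
  obtain ⟨C, hC⟩ := h
  exact ⟨C, fun p => (sqDiff_mono _ hU hW).trans (hC p)⟩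

lemma symm (h : PoincarePair Ω U W) : PoincarePair Ω W U := by
  obtain ⟨C, hC⟩ := h
  exact ⟨C, fun p => (sqDiff_comm (measurable_toH p) _ _).trans_le (hC p)⟩

lemma union (h : PoincarePair Ω U W) (h' : PoincarePair Ω U' W) : PoincarePair Ω (U ∪ U') W := by
  obtain ⟨C, hC⟩ := h
  obtain ⟨C', hC'⟩ := h'
  refine ⟨C + C', fun p => (sqDiff_union_le _ _ _ _).trans ?_⟩
  rw [ENNReal.coe_add, add_mul]
  exact add_le_add (hC p) (hC' p)

/-- Chaining through a middle set needs that set to have positive measure, by which the three-point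
inequality is divided. -/
lemma trans (h : PoincarePair Ω U W) (h' : PoincarePair Ω W Z) (hU : volume U ≠ ⊤)
    (hZ : volume Z ≠ ⊤) (hW : volume W ≠ 0) (hW' : volume W ≠ ⊤) : PoincarePair Ω U Z := by
  obtain ⟨C, hC⟩ := h
  obtain ⟨C', hC'⟩ := h'
  refine ⟨(volume W).toNNReal⁻¹ * (2 * ((volume Z).toNNReal * C + (volume U).toNNReal * C')),
    fun p => ?_⟩
  have h1 := (volume_mul_sqDiff_le (measurable_toH p) U W Z).trans (mul_le_mul_right
    (add_le_add (mul_le_mul_right (hC p) _) (mul_le_mul_right (hC' p) _)) _)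
  have hw : (volume W).toNNReal ≠ 0 := by
    exact (ENNReal.toNNReal_pos hW hW').ne'
  rw [ENNReal.coe_mul, ENNReal.coe_inv hw, ENNReal.coe_toNNReal hW', mul_assoc, mul_comm,
    ← div_eq_mul_inv, ENNReal.le_div_iff_mul_le (.inl hW) (.inl hW'), mul_comm]
  push_cast
  rw [ENNReal.coe_toNNReal hU, ENNReal.coe_toNNReal hZ]
  refine h1.trans (le_of_eq ?_)
  ring

end PoincarePair

/-- With y = x + h and Fubini's theorem, the double integral becomes an integral over displacements
h, all of length less than 2 r, of squared translation differences. -/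
lemma sqDiff_ball_le {v : E d → ℝ} (hv : Measurable v) (c : E d) (r : ℝ) {M : ℝ≥0∞}
    (hM : ∀ h : E d, ∫⁻ x in Metric.ball c r ∩ (fun x => x + h) ⁻¹' Metric.ball c r,
      ‖v (x + h) - v x‖ₑ ^ 2 ≤ ‖h‖ₑ ^ 2 * M) :
    sqDiff v (Metric.ball c r) (Metric.ball c r)
      ≤ ‖r + r‖ₑ ^ 2 * volume (Metric.ball (0 : E d) (r + r)) * M := by
  have hBm : MeasurableSet (Metric.ball c r) := measurableSet_ball
  have hmem : ∀ x h, x ∈ Metric.ball c r → x + h ∈ Metric.ball c r →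
      h ∈ Metric.ball (0 : E d) (r + r) := fun x h h1 h2 => by
    have h3 := dist_triangle_right (x + h) x c
    rw [dist_eq_norm, add_sub_cancel_left] at h3
    rw [mem_ball_zero_iff]
    linarith [Metric.mem_ball.1 h1, Metric.mem_ball.1 h2]
  generalize Metric.ball c r = B at *
  have hTm : MeasurableSet {z : E d × E d | z.1 ∈ B ∧ z.1 + z.2 ∈ B} :=
    (hBm.preimage measurable_fst).inter (hBm.preimage (measurable_fst.add measurable_snd))
  obtain ⟨f, hf⟩ : ∃ f : E d → E d → ℝ≥0∞, f = fun x h =>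
    {z : E d × E d | z.1 ∈ B ∧ z.1 + z.2 ∈ B}.indicator
      (fun z => ‖v (z.1 + z.2) - v z.1‖ₑ ^ 2) (x, h) := ⟨_, rfl⟩
  have hfm : Measurable (Function.uncurry f) := by
    have : Measurable fun z : E d × E d => ‖v (z.1 + z.2) - v z.1‖ₑ ^ 2 := by fun_prop
    rw [hf]
    exact this.indicator hTm
  have e1 : sqDiff v B B = ∫⁻ x, ∫⁻ h, f x h := by
    rw [sqDiff, ← lintegral_indicator hBm]
    refine lintegral_congr fun x => ?_
    by_cases hx : x ∈ B
    · rw [indicator_of_mem hx, ← lintegral_indicator hBm, ← lintegral_add_left_eq_self _ x]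
      refine lintegral_congr fun h => ?_
      by_cases hh : x + h ∈ B
      · rw [indicator_of_mem hh, hf]
        simp only
        rw [indicator_of_mem (by exact ⟨hx, hh⟩), enorm_sub_rev]
      · rw [indicator_of_notMem hh, hf]
        simp only
        rw [indicator_of_notMem (by exact fun hc => hh hc.2)]
    · rw [indicator_of_notMem hx]
      have : ∀ h, f x h = 0 := fun h => by
        rw [hf]; exact indicator_of_notMem (fun hc => hx hc.1) _
      simp only [this, lintegral_zero]
  rw [e1, lintegral_lintegral_swap hfm.aemeasurable]
  have e2 : ∀ h, ∫⁻ x, f x h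
      ≤ (Metric.ball (0 : E d) (r + r)).indicator (fun _ => ‖r + r‖ₑ ^ 2 * M) h := by
    intro h
    have e3 : ∀ x, f x h = (B ∩ (fun x => x + h) ⁻¹' B).indicator
        (fun x => ‖v (x + h) - v x‖ₑ ^ 2) x := fun x => by rw [hf]; rfl
    simp only [e3]
    rw [lintegral_indicator (hBm.inter (hBm.preimage (measurable_add_const h)))]
    by_cases hh : h ∈ Metric.ball (0 : E d) (r + r)
    · rw [indicator_of_mem hh]
      refine (hM h).trans (mul_le_mul_left (pow_le_pow_left' ?_ 2) _)
      rw [← ofReal_norm, ← ofReal_norm]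
      rw [mem_ball_zero_iff] at hh
      exact ENNReal.ofReal_le_ofReal (hh.le.trans (le_abs_self _))
    · have : B ∩ (fun x => x + h) ⁻¹' B = ∅ :=
        eq_empty_of_forall_notMem fun x hx => hh (hmem x h hx.1 hx.2)
      rw [this, Measure.restrict_empty, lintegral_zero_measure]
      exact zero_le
  refine (lintegral_mono e2).trans ?_
  rw [lintegral_indicator measurableSet_ball, lintegral_const, Measure.restrict_apply_univ]
  refine le_of_eq ?_
  ring

lemma poincarePair_ball [IsFiniteMeasure (volume.restrict Ω)] (hΩ : IsOpen Ω) {c : E d} {r : ℝ}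
    (h : Metric.ball c r ⊆ Ω) : PoincarePair Ω (Metric.ball c r) (Metric.ball c r) := by
  refine ⟨(‖r + r‖ₑ ^ 2 * volume (Metric.ball (0 : E d) (r + r))).toNNReal, fun p => ?_⟩
  rw [ENNReal.coe_toNNReal (ENNReal.mul_ne_top (by finiteness) measure_ball_lt_top.ne)]
  refine sqDiff_ball_le (measurable_toH p) c r fun y => ?_
  have hy : Continuous fun x : E d => x + y := continuous_id.add continuous_const
  refine lintegral_translate_sub_sq_le hΩ p (Metric.isOpen_ball.inter
    (Metric.isOpen_ball.preimage hy)) fun x hx t ht => h ?_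
  have := (convex_ball c r) hx.1 hx.2 (sub_nonneg.2 ht.2) ht.1 (by ring)
  convert this using 1
  module

/-- A point x of W is compared first with its translate x + h in B, along a segment inside Ω, and
then with the other points of B. -/
lemma PoincarePair.of_translate [IsFiniteMeasure (volume.restrict Ω)] (hΩ : IsOpen Ω)
    {W B : Set (E d)} (hW : IsOpen W) (hB : MeasurableSet B)
    (hBf : volume B ≠ ⊤) {h : E d}
    (hWh : ∀ x ∈ W, ∀ t ∈ Icc (0 : ℝ) 1, x + t • h ∈ Ω) (hWB : ∀ x ∈ W, x + h ∈ B)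
    (hBB : PoincarePair Ω B B) : PoincarePair Ω W B := by
  obtain ⟨C, hC⟩ := hBB
  refine ⟨2 * ((volume B * ‖h‖ₑ ^ 2).toNNReal + C), fun p => ?_⟩
  have hG := lintegral_translate_sub_sq_le hΩ p hW hWh
  have hC := hC p
  have hv := measurable_toH p
  push_cast
  rw [ENNReal.coe_toNNReal (ENNReal.mul_ne_top hBf (by finiteness))]
  generalize (⇑(toH Ω p) : E d → ℝ) = v at *
  have m1 : Measurable fun x => ∫⁻ y in B, ‖v x - v y‖ₑ ^ 2 :=
    (measurable_sq_diff hv).lintegral_prod_right'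
  have m2 : ∀ a : ℝ, Measurable fun y => ‖a - v y‖ₑ ^ 2 := fun a => by fun_prop
  have h1 : ∀ x, ∫⁻ y in B, ‖v x - v y‖ₑ ^ 2
      ≤ 2 * (volume B * ‖v (x + h) - v x‖ₑ ^ 2 + ∫⁻ y in B, ‖v (x + h) - v y‖ₑ ^ 2) := by
    intro x
    rw [mul_comm (volume B), ← Measure.restrict_apply_univ B, ← lintegral_const,
      ← lintegral_add_left measurable_const,
      ← lintegral_const_mul' _ _ ENNReal.ofNat_ne_top]
    refine lintegral_mono fun y => (enorm_sub_sq_le _ (v (x + h)) _).trans ?_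
    rw [enorm_sub_rev (v x)]
  have m3 : Measurable fun x => ‖v (x + h) - v x‖ₑ ^ 2 := by fun_prop
  have h2 : ∫⁻ x in W, ∫⁻ y in B, ‖v (x + h) - v y‖ₑ ^ 2 ≤ sqDiff v B B := by
    rw [sqDiff, ← (measurePreserving_add_right (volume : Measure (E d)) h).setLIntegral_comp_preimage
      hB m1]
    exact lintegral_mono_set hWB
  calc sqDiff v W B ≤ ∫⁻ x in W, 2 * (volume B * ‖v (x + h) - v x‖ₑ ^ 2
        + ∫⁻ y in B, ‖v (x + h) - v y‖ₑ ^ 2) := lintegral_mono h1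
    _ = 2 * (volume B * (∫⁻ x in W, ‖v (x + h) - v x‖ₑ ^ 2)
        + ∫⁻ x in W, ∫⁻ y in B, ‖v (x + h) - v y‖ₑ ^ 2) := by
        rw [lintegral_const_mul' _ _ ENNReal.ofNat_ne_top,
          lintegral_add_left (m3.const_mul _), lintegral_const_mul _ m3]
    _ ≤ 2 * (volume B * (‖h‖ₑ ^ 2 * ‖grad Ω p‖ₑ ^ 2) + C * ‖grad Ω p‖ₑ ^ 2) := by
        gcongr
        exact h2.trans hC
    _ = _ := by ring

/-- Near a boundary point, a Lipschitz domain admits a Poincaré inequality with some inner ball. -/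
lemma exists_poincarePair_of_mem_frontier [IsFiniteMeasure (volume.restrict Ω)] (hΩ : IsOpen Ω)
    (hL : HasLipschitzBoundary Ω) {p : E d} (hp : p ∈ frontier Ω) :
    ∃ δ > 0, ∃ c : E d, Metric.ball c δ ⊆ Ω ∧
      PoincarePair Ω (Ω ∩ Metric.ball p δ) (Metric.ball c δ) := by
  obtain ⟨ν, r, K, γ, hν, hr, hγ, hloc⟩ := hL p hp
  have hK : (0 : ℝ) ≤ K := K.2
  -- With s = (2 + 2 K) δ one has s + δ = r, so the ball of radius δ around p - s ν stays inside the
  -- chart. A displacement z with ‖z‖ < δ changes ν-height by less than δ and the graph by at most 2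
  -- K δ, so the descent s keeps it below the graph.
  set δ : ℝ := r / (3 + 2 * K) with hδ
  have hδ0 : 0 < δ := by positivity
  have hδr : (3 + 2 * K) * δ = r := by rw [hδ]; field_simp
  set s : ℝ := (2 + 2 * K) * δ with hs
  have hs0 : 0 ≤ s := by positivity
  have hsr : s + δ = r := by rw [← hδr, hs]; ring
  have hνν : inner ℝ ν ν = (1 : ℝ) := by rw [real_inner_self_eq_norm_sq, hν, one_pow]
  set π : E d → E d := fun x => x - inner ℝ ν x • ν with hπ
  have hπc : Continuous π := by fun_prop
  have hπν : ∀ x (t : ℝ), π (x + t • ν) = π x := fun x t => by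
    simp only [hπ, inner_add_right, real_inner_smul_right, hνν, mul_one, add_smul]
    abel
  -- A boundary point lies on the graph: it is a limit of points below it, and it is not itself
  -- below because Ω is open.
  have hpγ : inner ℝ ν p = γ (π p) := by
    refine le_antisymm ?_ ?_
    · have hcl : IsClosed {x | inner ℝ ν x ≤ γ (π x)} :=
        isClosed_le (by fun_prop) (hγ.continuous.comp hπc)
      have h1 : p ∈ closure (Ω ∩ Metric.ball p r) := by
        rw [mem_closure_iff_nhds]
        intro U hU
        have h2 := mem_closure_iff_nhds.1 (frontier_subset_closure hp) (U ∩ Metric.ball p r)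
          (inter_mem hU (Metric.ball_mem_nhds p hr))
        exact h2.mono fun x hx => ⟨hx.1.1, hx.2, hx.1.2⟩
      exact hcl.closure_subset_iff.2 (fun x hx => ((hloc x hx.2).1 hx.1).le) h1
    · have h1 : p ∉ Ω := fun h => by
        rw [hΩ.frontier_eq] at hp
        exact hp.2 h
      exact not_lt.1 fun h => h1 ((hloc p (Metric.mem_ball_self hr)).2 h)
  have hBΩ : Metric.ball (p + (-s) • ν) δ ⊆ Ω := by
    intro y hy
    set z := y - (p + (-s) • ν) with hz
    have hzδ : ‖z‖ < δ := by rw [hz, ← dist_eq_norm]; exact hy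
    have hyz : y = p + z + (-s) • ν := by rw [hz]; abel
    have hiz : |inner ℝ ν z| ≤ ‖z‖ := by
      have := abs_real_inner_le_norm ν z
      rwa [hν, one_mul] at this
    refine (hloc y ?_).2 ?_
    · rw [Metric.mem_ball, dist_eq_norm, hyz, add_sub_right_comm, add_sub_cancel_left]
      refine (norm_add_le _ _).trans_lt ?_
      rw [norm_smul, hν, mul_one, norm_neg, Real.norm_of_nonneg hs0]
      linarith
    · change _ < γ (π y)
      rw [hyz, hπν, inner_add_right, inner_add_right, real_inner_smul_right, hνν, hpγ]
      have h1 : π (p + z) - π p = π z := by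
        simp only [hπ, inner_add_right, add_smul]; abel
      have h2 : ‖π z‖ ≤ 2 * ‖z‖ := by
        refine (norm_sub_le _ _).trans ?_
        rw [norm_smul, hν, mul_one, Real.norm_eq_abs]
        linarith
      have h3 := hγ.dist_le_mul (π (p + z)) (π p)
      rw [Real.dist_eq, dist_eq_norm, h1] at h3
      have h4 := (abs_le.1 h3).1
      have h5 := mul_le_mul_of_nonneg_left h2 hK
      have h6 := (abs_le.1 hiz).2
      have h7 := mul_le_mul_of_nonneg_left hzδ.le hK
      rw [hs]
      linarith
  refine ⟨δ, hδ0, p + (-s) • ν, hBΩ, ?_⟩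
  refine PoincarePair.of_translate hΩ (hΩ.inter Metric.isOpen_ball) measurableSet_ball
    measure_ball_lt_top.ne (h := (-s) • ν) (fun x hx t ht => ?_) (fun x hx => ?_)
    (poincarePair_ball hΩ hBΩ)
  · have hxδ : ‖x - p‖ < δ := by rw [← dist_eq_norm]; exact hx.2
    have hxr : x ∈ Metric.ball p r := Metric.ball_subset_ball (by linarith) hx.2
    have h1 := (hloc x hxr).1 hx.1
    have hts : t * s ≤ s := mul_le_of_le_one_left hs0 ht.2
    have hts0 : 0 ≤ t * s := mul_nonneg ht.1 hs0
    rw [smul_smul, mul_neg]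
    refine (hloc _ ?_).2 ?_
    · rw [Metric.mem_ball, dist_eq_norm, add_sub_right_comm]
      refine (norm_add_le _ _).trans_lt ?_
      rw [norm_smul, hν, mul_one, norm_neg, Real.norm_of_nonneg hts0]
      linarith
    · change _ < γ (π _)
      rw [hπν, inner_add_right, real_inner_smul_right, hνν]
      change _ < γ (π x) at h1
      linarith
  · rw [Metric.mem_ball, dist_add_right]
    exact hx.2

/-- The Poincaré inequality on a bounded Lipschitz domain, for differences. -/
theorem IsBoundedLipschitzDomain.poincarePair (hΩ : IsBoundedLipschitzDomain Ω) :
    PoincarePair Ω Ω Ω := by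
  have hfin : volume Ω ≠ ⊤ := hΩ.isBounded.measure_lt_top.ne
  have : IsFiniteMeasure (volume.restrict Ω) := ⟨by simpa using hfin.lt_top⟩
  have hsub : ∀ {U : Set (E d)}, U ⊆ Ω → volume U ≠ ⊤ := fun h =>
    ((measure_mono h).trans_lt hfin.lt_top).ne
  -- Being joined by open neighbourhoods that satisfy the inequality is symmetric, transitive and
  -- locally true, hence true for all pairs of points of the connected set Ω.
  set R : E d → E d → Prop := fun x y => ∃ U W : Set (E d), IsOpen U ∧ IsOpen W ∧ x ∈ U ∧ y ∈ W ∧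
    U ⊆ Ω ∧ W ⊆ Ω ∧ PoincarePair Ω U W with hR
  have hball : ∀ x ∈ Ω, ∃ r > 0, Metric.ball x r ⊆ Ω := fun x hx =>
    Metric.isOpen_iff.1 hΩ.isOpen x hx
  have hconn : ∀ x ∈ Ω, ∀ y ∈ Ω, R x y := by
    intro x hx y hy
    refine hΩ.isConnected.isPreconnected.induction₂ R (fun x hx => ?_) ?_ ?_ hx hy
    · obtain ⟨r, hr, h⟩ := hball x hx
      filter_upwards [mem_nhdsWithin_of_mem_nhds (Metric.ball_mem_nhds x hr)] with y hy
      exact ⟨_, _, Metric.isOpen_ball, Metric.isOpen_ball, Metric.mem_ball_self hr, hy, h, h,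
        poincarePair_ball hΩ.isOpen h⟩
    · rintro x y z - hy - ⟨U, W, hU, hW, hxU, hyW, hUΩ, hWΩ, h1⟩
        ⟨W', Z, hW', hZ, hyW', hzZ, hW'Ω, hZΩ, h2⟩
      have hne : (W ∩ W').Nonempty := ⟨y, hyW, hyW'⟩
      exact ⟨U, Z, hU, hZ, hxU, hzZ, hUΩ, hZΩ, (h1.mono subset_rfl inter_subset_left).trans
        (h2.mono inter_subset_right subset_rfl) (hsub hUΩ) (hsub hZΩ)
        ((hW.inter hW').measure_pos volume hne).ne' (hsub (inter_subset_left.trans hWΩ))⟩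
    · rintro x y - - ⟨U, W, hU, hW, hx, hy, hUΩ, hWΩ, h⟩
      exact ⟨W, U, hW, hU, hy, hx, hWΩ, hUΩ, h.symm⟩
  obtain ⟨x₀, hx₀⟩ := hΩ.isConnected.nonempty
  obtain ⟨r₀, hr₀, hB₀⟩ := hball x₀ hx₀
  set B₀ := Metric.ball x₀ r₀ with hB₀def
  have hpt : ∀ x ∈ Ω, ∃ U : Set (E d), IsOpen U ∧ x ∈ U ∧ U ⊆ Ω ∧ PoincarePair Ω U B₀ := by
    intro x hx
    obtain ⟨U, W, hU, hW, hxU, hyW, hUΩ, hWΩ, h⟩ := hconn x hx x₀ hx₀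
    have hne : (W ∩ B₀).Nonempty := ⟨x₀, hyW, Metric.mem_ball_self hr₀⟩
    exact ⟨U, hU, hxU, hUΩ, (h.mono subset_rfl inter_subset_left).trans
      ((poincarePair_ball hΩ.isOpen hB₀).mono inter_subset_right subset_rfl) (hsub hUΩ) (hsub hB₀)
      ((hW.inter Metric.isOpen_ball).measure_pos volume hne).ne'
      (hsub (inter_subset_left.trans hWΩ))⟩
  -- Compactness of the closure: interior points use the chains just built, while boundary points
  -- are first pushed into an inner ball and then joined to B₀.
  have hcl : PoincarePair Ω (Ω ∩ closure Ω) B₀ := by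
    refine (hΩ.isBounded.isCompact_closure).induction_on
      (p := fun s => PoincarePair Ω (Ω ∩ s) B₀) ?_ ?_ ?_ ?_
    · exact ⟨0, fun p => by simp [sqDiff]⟩
    · exact fun s t hst h => h.mono (inter_subset_inter_right _ hst) subset_rfl
    · intro s t h1 h2
      simp only [inter_union_distrib_left]
      exact h1.union h2
    · intro x hx
      by_cases hxΩ : x ∈ Ω
      · obtain ⟨U, hU, hxU, hUΩ, h⟩ := hpt x hxΩ
        exact ⟨U, mem_nhdsWithin_of_mem_nhds (hU.mem_nhds hxU), h.mono inter_subset_right subset_rfl⟩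
      · obtain ⟨δ, hδ, c, hc, h⟩ := exists_poincarePair_of_mem_frontier hΩ.isOpen hΩ.lipschitz
          (hΩ.isOpen.frontier_eq ▸ ⟨hx, hxΩ⟩ : x ∈ frontier Ω)
        obtain ⟨U, hU, hcU, hUΩ, h'⟩ := hpt c (hc (Metric.mem_ball_self hδ))
        have hne : (Metric.ball c δ ∩ U).Nonempty := ⟨c, Metric.mem_ball_self hδ, hcU⟩
        exact ⟨Metric.ball x δ, mem_nhdsWithin_of_mem_nhds (Metric.ball_mem_nhds x hδ),
          (h.mono subset_rfl inter_subset_left).trans (h'.mono inter_subset_right subset_rfl)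
            (hsub inter_subset_left) (hsub hB₀)
            ((Metric.isOpen_ball.inter hU).measure_pos volume hne).ne'
            (hsub (inter_subset_right.trans hUΩ))⟩
  rw [inter_eq_left.2 subset_closure] at hcl
  exact hcl.trans hcl.symm hfin hfin
    (Metric.isOpen_ball.measure_pos volume ⟨x₀, Metric.mem_ball_self hr₀⟩).ne' (hsub hB₀)

/-- For fixed x the square is expanded and integrated in y: the cross term vanishes by the zero
mean, and the remaining ∫ v² is nonnegative. -/
lemma volume_mul_lintegral_sq_le_sqDiff [IsFiniteMeasure (volume.restrict Ω)] {v : E d → ℝ}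
    (hm : MemLp v 2 (volume.restrict Ω)) (hv : Measurable v) (h0 : ∫ x in Ω, v x = 0) :
    volume Ω * ∫⁻ x in Ω, ‖v x‖ₑ ^ 2 ≤ sqDiff v Ω Ω := by
  have hfin : volume Ω ≠ ⊤ := by
    have := measure_ne_top (volume.restrict Ω) univ
    rwa [Measure.restrict_apply_univ] at this
  rw [sqDiff, ← lintegral_const_mul _ (by fun_prop)]
  refine lintegral_mono fun x => ?_
  have i0 : Integrable (fun _ => v x ^ 2) (volume.restrict Ω) := integrable_const _
  have i1 : Integrable (fun y => 2 * v x * v y) (volume.restrict Ω) :=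
    (hm.integrable one_le_two).const_mul _
  have i2 : Integrable (fun y => v y ^ 2) (volume.restrict Ω) := hm.integrable_sq
  have i3 : Integrable (fun y => v x ^ 2 - 2 * v x * v y) (volume.restrict Ω) := i0.sub i1
  have e : ∀ a : ℝ, ‖a‖ₑ ^ 2 = ENNReal.ofReal (a ^ 2) := fun a => by
    rw [← ofReal_norm, ← ENNReal.ofReal_pow (norm_nonneg _), Real.norm_eq_abs, sq_abs]
  have e3 : ∀ y, (v x - v y) ^ 2 = v x ^ 2 - 2 * v x * v y + v y ^ 2 := fun y => by ring
  have i4 : Integrable (fun y => (v x - v y) ^ 2) (volume.restrict Ω) := by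
    simp only [e3]; exact i3.add i2
  simp only [e]
  rw [← ofReal_integral_eq_lintegral_ofReal i4 (Eventually.of_forall fun y => sq_nonneg _),
    ← ENNReal.ofReal_toReal hfin, ← ENNReal.ofReal_mul ENNReal.toReal_nonneg]
  refine ENNReal.ofReal_le_ofReal ?_
  have e2 : ∫ y in Ω, (v x - v y) ^ 2
      = (volume Ω).toReal * v x ^ 2 + ∫ y in Ω, v y ^ 2 := by
    simp only [e3]
    rw [integral_add i3 i2, integral_sub i0 i1, integral_const_mul, h0,
      integral_const, Measure.real, Measure.restrict_apply_univ, smul_eq_mul]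
    ring
  rw [e2]
  have : 0 ≤ ∫ y in Ω, v y ^ 2 := integral_nonneg fun y => sq_nonneg _
  linarith

lemma norm_le_of_mul_enorm_sq_le {X Y : Type*} [NormedAddCommGroup X] [NormedAddCommGroup Y]
    {a : X} {b : Y} {M : ℝ≥0∞} (hM0 : M ≠ 0) (hMt : M ≠ ⊤) {C : ℝ≥0}
    (h : M * ‖a‖ₑ ^ 2 ≤ C * ‖b‖ₑ ^ 2) : ‖a‖ ≤ √(C / M.toReal) * ‖b‖ := by
  have hM : 0 < M.toReal := ENNReal.toReal_pos hM0 hMt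
  rw [← ofReal_norm, ← ofReal_norm, ← ENNReal.ofReal_toReal hMt,
    ← ENNReal.ofReal_pow (norm_nonneg _), ← ENNReal.ofReal_pow (norm_nonneg _),
    ← ENNReal.ofReal_mul hM.le, ← ENNReal.ofReal_coe_nnreal, ← ENNReal.ofReal_mul C.coe_nonneg,
    ENNReal.ofReal_le_ofReal_iff (by positivity)] at h
  rw [← Real.sqrt_sq (norm_nonneg b), ← Real.sqrt_mul (by positivity)]
  refine Real.le_sqrt_of_sq_le ?_
  rw [div_mul_eq_mul_div, le_div_iff₀ hM]
  linarith

/-- The Poincaré inequality for functions of mean zero. -/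
theorem IsBoundedLipschitzDomain.poincare (hΩ : IsBoundedLipschitzDomain Ω) :
    ∃ C : ℝ, 0 ≤ C ∧ ∀ p : V Ω, ∫ x in Ω, toH Ω p x = 0 → ‖toH Ω p‖ ≤ C * ‖grad Ω p‖ := by
  obtain ⟨C, hC⟩ := hΩ.poincarePair
  have hfin : volume Ω ≠ ⊤ := hΩ.isBounded.measure_lt_top.ne
  have : IsFiniteMeasure (volume.restrict Ω) := ⟨by simpa using hfin.lt_top⟩
  have hpos : volume Ω ≠ 0 := (hΩ.isOpen.measure_pos volume hΩ.isConnected.nonempty).ne'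
  refine ⟨√(C / (volume Ω).toReal), Real.sqrt_nonneg _, fun p hp =>
    norm_le_of_mul_enorm_sq_le hpos hfin (le_trans ?_ (hC p))⟩
  rw [Lp.enorm_def (toH Ω p), ← lintegral_enorm_sq]
  exact volume_mul_lintegral_sq_le_sqDiff (Lp.memLp _) (measurable_toH p) hp

end NonlocalCH

/-! ### Completeness of H¹(Ω), smooth functions and constants -/

namespace NonlocalCH

variable {d : ℕ} {Ω : Set (E d)}

/-- Every tested identity equates two continuous linear functionals of (u, G), so V is an
intersection of closed sets and thereby a Hilbert space. -/
lemma isClosed_V : IsClosed (V Ω : Set (WithLp 2 (H Ω × HVec Ω))) := by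
  have e : (V Ω : Set (WithLp 2 (H Ω × HVec Ω))) = ⋂ (ψ : E d → ℝ) (_ : ContDiff ℝ ∞ ψ)
      (_ : HasCompactSupport ψ) (_ : tsupport ψ ⊆ Ω) (e : E d),
      {p : WithLp 2 (H Ω × HVec Ω) | ∫ x in Ω, p.fst x * fderiv ℝ ψ x e
        = -∫ x in Ω, inner ℝ (p.snd x) e * ψ x} := by
    ext p
    simp only [mem_iInter, mem_ofPred_eq]
    rfl
  rw [e]
  refine isClosed_iInter fun ψ => isClosed_iInter fun h1 => isClosed_iInter fun h2 =>
    isClosed_iInter fun h3 => isClosed_iInter fun e => ?_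
  have hm1 : MemLp (fun x => fderiv ℝ ψ x e) 2 (volume.restrict Ω) :=
    (Continuous.memLp_of_hasCompactSupport ((h1.continuous_fderiv (by simp)).clm_apply
      continuous_const) (h2.fderiv_apply (𝕜 := ℝ) e)).restrict Ω
  have hm2 : MemLp (fun x => ψ x • e) 2 (volume.restrict Ω) :=
    (Continuous.memLp_of_hasCompactSupport (h1.continuous.smul continuous_const)
      (h2.smul_right (f' := fun _ => e))).restrict Ω
  have e1 : ∀ u : H Ω, ∫ x in Ω, u x * fderiv ℝ ψ x e = inner ℝ (hm1.toLp _) u := fun u => by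
    rw [L2.inner_def]
    refine integral_congr_ae ?_
    filter_upwards [hm1.coeFn_toLp] with x hx
    rw [hx]; rfl
  have e2 : ∀ G : HVec Ω, ∫ x in Ω, inner ℝ (G x) e * ψ x = inner ℝ (hm2.toLp _) G := fun G => by
    rw [L2.inner_def]
    refine integral_congr_ae ?_
    filter_upwards [hm2.coeFn_toLp] with x hx
    rw [hx, real_inner_smul_left, mul_comm, real_inner_comm]
  simp only [e1, e2]
  have c1 : Continuous fun p : WithLp 2 (H Ω × HVec Ω) => p.fst :=
    continuous_fst.comp (WithLp.prod_continuous_ofLp 2 _ _)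
  have c2 : Continuous fun p : WithLp 2 (H Ω × HVec Ω) => p.snd :=
    continuous_snd.comp (WithLp.prod_continuous_ofLp 2 _ _)
  exact isClosed_eq (continuous_const.inner c1) (continuous_const.inner c2).neg

instance : CompleteSpace (V Ω) := isClosed_V.completeSpace_coe

lemma norm_sq_V (p : V Ω) : ‖p‖ ^ 2 = ‖toH Ω p‖ ^ 2 + ‖grad Ω p‖ ^ 2 :=
  WithLp.prod_norm_sq_eq_of_L2 p.1

/-- A weakly differentiable function in `L²(Ω)` as an element of `V`. -/
noncomputable def V.mk (u : H Ω) (G : HVec Ω) (h : HasWeakGradient Ω u G) : V Ω :=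
  ⟨WithLp.toLp 2 (u, G), h⟩

lemma HasWeakGradient.congr_ae {u u' : E d → ℝ} {G G' : E d → E d} (h : HasWeakGradient Ω u G)
    (hu : u =ᵐ[volume.restrict Ω] u') (hG : G =ᵐ[volume.restrict Ω] G') :
    HasWeakGradient Ω u' G' := by
  intro ψ h1 h2 h3 e
  have := h ψ h1 h2 h3 e
  rw [integral_congr_ae (g := fun x => u' x * fderiv ℝ ψ x e)
    (by filter_upwards [hu] with x hx; rw [hx]),
    integral_congr_ae (f := fun x => inner ℝ (G x) e * ψ x) (g := fun x => inner ℝ (G' x) e * ψ x)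
    (by filter_upwards [hG] with x hx; rw [hx])] at this
  exact this

/-- Smooth functions have their gradient as weak gradient. -/
lemma hasWeakGradient_of_contDiff {f : E d → ℝ} (hf : ContDiff ℝ ∞ f) :
    HasWeakGradient Ω f (fun x => (InnerProductSpace.toDual ℝ (E d)).symm (fderiv ℝ f x)) := by
  intro ψ h1 h2 h3 e
  have hψ : ∀ x, x ∉ Ω → ψ x = 0 := fun x hx =>
    image_eq_zero_of_notMem_tsupport fun h => hx (h3 h)
  have hψ' : ∀ x, x ∉ Ω → fderiv ℝ ψ x e = 0 := fun x hx => by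
    rw [fderiv_of_notMem_tsupport (𝕜 := ℝ) fun h => hx (h3 h), zero_apply]
  simp only [InnerProductSpace.toDual_symm_apply]
  rw [setIntegral_eq_integral_of_forall_compl_eq_zero fun x hx => by rw [hψ' x hx, mul_zero],
    setIntegral_eq_integral_of_forall_compl_eq_zero fun x hx => by rw [hψ x hx, mul_zero]]
  have cf : Continuous fun x => fderiv ℝ f x e :=
    (hf.continuous_fderiv (by simp)).clm_apply continuous_const
  have cψ : Continuous fun x => fderiv ℝ ψ x e :=
    (h1.continuous_fderiv (by simp)).clm_apply continuous_const
  exact integral_mul_fderiv_eq_neg_fderiv_mul_of_integrable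
    ((cf.mul h1.continuous).integrable_of_hasCompactSupport h2.mul_left)
    ((hf.continuous.mul cψ).integrable_of_hasCompactSupport (h2.fderiv_apply (𝕜 := ℝ) e).mul_left)
    ((hf.continuous.mul h1.continuous).integrable_of_hasCompactSupport h2.mul_left)
    (fun x _ => hf.differentiable (by simp) x) (fun x _ => h1.differentiable (by simp) x)

lemma testSpace_le_range_toH : (testSpace Ω : Set (H Ω)) ⊆ range (toH Ω) := by
  rintro f ⟨ψ, h1, h2, -, h4⟩
  have hm : MemLp (fun x => (InnerProductSpace.toDual ℝ (E d)).symm (fderiv ℝ ψ x)) 2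
      (volume.restrict Ω) :=
    (Continuous.memLp_of_hasCompactSupport ((LinearIsometryEquiv.continuous _).comp
      (h1.continuous_fderiv (by simp)))
      ((h2.fderiv (𝕜 := ℝ)).comp_left (map_zero _))).restrict Ω
  exact ⟨V.mk f (hm.toLp _) ((hasWeakGradient_of_contDiff h1).congr_ae h4.symm
    hm.coeFn_toLp.symm), rfl⟩

lemma denseRange_toH (hΩ : IsOpen Ω) : DenseRange (toH Ω) :=
  (testSpace_dense hΩ).mono testSpace_le_range_toH

section Mean

variable [IsFiniteMeasure (volume.restrict Ω)]

/-- The constant function one. -/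
noncomputable def oneH (Ω : Set (E d)) [IsFiniteMeasure (volume.restrict Ω)] : H Ω :=
  MemLp.toLp (fun _ => 1) (memLp_const 1)

lemma coeFn_oneH : oneH Ω =ᵐ[volume.restrict Ω] fun _ => 1 := MemLp.coeFn_toLp _

lemma inner_oneH (u : H Ω) : inner ℝ (oneH Ω) u = ∫ x in Ω, u x := by
  rw [L2.inner_def]
  refine integral_congr_ae ?_
  filter_upwards [coeFn_oneH] with x hx
  rw [hx]
  simp

lemma inner_oneH_self : inner ℝ (oneH Ω) (oneH Ω) = (volume Ω).toReal := by
  rw [inner_oneH, integral_congr_ae coeFn_oneH]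
  simp [Measure.real]

/-- The constant function one, as an element of `V`. -/
noncomputable def oneV (Ω : Set (E d)) [IsFiniteMeasure (volume.restrict Ω)] : V Ω :=
  V.mk (oneH Ω) 0 ((hasWeakGradient_of_contDiff (f := fun _ => (1 : ℝ)) contDiff_const).congr_ae
    coeFn_oneH.symm (by
      filter_upwards [Lp.coeFn_zero (E d) 2 (volume.restrict Ω)] with x hx
      rw [hx]; simp))

@[simp] lemma grad_oneV : grad Ω (oneV Ω) = 0 := rfl

end Mean

end NonlocalCH

/-! ### The inverse Neumann Laplacian and the metric of the flow -/

namespace NonlocalCH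

/-- The real inner product as a bilinear map. -/
noncomputable def innerBilin (X : Type*) [NormedAddCommGroup X] [InnerProductSpace ℝ X] :
    X →L[ℝ] X →L[ℝ] ℝ :=
  LinearMap.mkContinuous₂ (innerₗ X) 1 fun x y => by
    rw [one_mul]; exact norm_inner_le_norm x y

@[simp] lemma innerBilin_apply {X : Type*} [NormedAddCommGroup X] [InnerProductSpace ℝ X]
    (x y : X) : innerBilin X x y = inner ℝ x y := rfl

/-- An abstract model of `H¹(Ω) ⊆ L²(Ω)` with its gradient `D`, in which a Poincaré inequality holds
on the complement of the constants, which are the multiples of `e`. -/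
structure SobolevTriple (V H G : Type*) [NormedAddCommGroup V] [InnerProductSpace ℝ V]
    [CompleteSpace V] [NormedAddCommGroup H] [InnerProductSpace ℝ H] [CompleteSpace H]
    [NormedAddCommGroup G] [InnerProductSpace ℝ G] [CompleteSpace G] where
  T : V →L[ℝ] H
  D : V →L[ℝ] G
  e : V
  C : ℝ
  D_e : D e = 0
  T_e : T e ≠ 0
  norm_sq : ∀ p, ‖p‖ ^ 2 = ‖T p‖ ^ 2 + ‖D p‖ ^ 2
  dense : DenseRange T
  poincare : ∀ p, inner ℝ (T e) (T p) = 0 → ‖T p‖ ≤ C * ‖D p‖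

namespace SobolevTriple

variable {V H G : Type*} [NormedAddCommGroup V] [InnerProductSpace ℝ V]
    [CompleteSpace V] [NormedAddCommGroup H] [InnerProductSpace ℝ H] [CompleteSpace H]
    [NormedAddCommGroup G] [InnerProductSpace ℝ G] [CompleteSpace G] (S : SobolevTriple V H G)

/-- The square of the norm of the constant `e`. -/
noncomputable def M : ℝ := inner ℝ (S.T S.e) (S.T S.e)

lemma M_pos : 0 < S.M := real_inner_self_pos.2 S.T_e

/-- The orthogonal projection onto the complement of the constants. -/
noncomputable def proj : H →L[ℝ] H :=
  ContinuousLinearMap.id ℝ H - S.M⁻¹ • (innerSL ℝ (S.T S.e)).smulRight (S.T S.e)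

lemma proj_apply (u : H) : S.proj u = u - (S.M⁻¹ * inner ℝ (S.T S.e) u) • S.T S.e := by
  simp [proj, smul_smul]

lemma proj_symm (u v : H) : inner ℝ (S.proj u) v = inner ℝ u (S.proj v) := by
  simp only [proj_apply, inner_sub_left, inner_sub_right, real_inner_smul_left,
    real_inner_smul_right, real_inner_comm u (S.T S.e)]
  ring

lemma inner_proj (u : H) : inner ℝ (S.T S.e) (S.proj u) = 0 := by
  have := S.M_pos.ne'
  rw [proj_apply, inner_sub_right, real_inner_smul_right, ← M]
  field_simp
  ring

lemma proj_of_inner_eq_zero {u : H} (h : inner ℝ (S.T S.e) u = 0) : S.proj u = u := by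
  rw [proj_apply, h, mul_zero, zero_smul, sub_zero]

lemma proj_idem (u : H) : S.proj (S.proj u) = S.proj u := S.proj_of_inner_eq_zero (S.inner_proj u)

lemma proj_e : S.proj (S.T S.e) = 0 := by
  rw [proj_apply, ← M, inv_mul_cancel₀ S.M_pos.ne', one_smul, sub_self]

lemma eq_zero_of_forall_inner {u : H} (h : ∀ v, inner ℝ u (S.T v) = 0) : u = 0 :=
  Dense.eq_zero_of_inner_left ℝ S.dense (by rintro _ ⟨p, rfl⟩; exact h p)

/-- The bilinear form `(D p, D v) + (e, p) (e, v)`. -/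
noncomputable def form : V →L[ℝ] V →L[ℝ] ℝ :=
  (innerBilin G).bilinearComp S.D S.D
    + ((innerSL ℝ (S.T S.e)).comp S.T).smulRight ((innerSL ℝ (S.T S.e)).comp S.T)

lemma form_apply (p v : V) : S.form p v = inner ℝ (S.D p) (S.D v)
    + inner ℝ (S.T S.e) (S.T p) * inner ℝ (S.T S.e) (S.T v) := by
  simp [form]

lemma form_e (p : V) : S.form p S.e = inner ℝ (S.T S.e) (S.T p) * S.M := by
  rw [form_apply, D_e, inner_zero_right, zero_add, M]

/-- The arithmetic of coercivity: x and g stand for the norms of p and its gradient, b for the inner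
product of p with the constant e, and o for the norm of the constant part. -/
lemma sq_add_sq_le_of_poincare {x g o b C M : ℝ} (hM : 0 < M) (hx0 : 0 ≤ x)
    (hx : x ≤ C * g + o) (ho : o ^ 2 = M⁻¹ * (b * b)) :
    x ^ 2 + g ^ 2 ≤ (2 * C ^ 2 + 2 * M⁻¹ + 1) * (g ^ 2 + b * b) := by
  have h4 : x ^ 2 ≤ 2 * (C * g) ^ 2 + 2 * o ^ 2 :=
    (pow_le_pow_left₀ hx0 hx 2).trans (by nlinarith [sq_nonneg (C * g - o)])
  have h5 : 0 ≤ b * b := mul_self_nonneg b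
  have h7 : 0 ≤ M⁻¹ := (inv_pos.2 hM).le
  nlinarith [mul_nonneg h7 (sq_nonneg g), mul_nonneg (sq_nonneg C) h5]

/-- The Poincaré inequality is applied to p minus its mean; the rank-one term of the form controls
the mean itself. -/
lemma isCoercive_form : IsCoercive S.form := by
  have hM := S.M_pos
  refine ⟨(2 * S.C ^ 2 + 2 * S.M⁻¹ + 1)⁻¹, by positivity, fun p => ?_⟩
  have h1 := S.poincare (p - (S.M⁻¹ * inner ℝ (S.T S.e) (S.T p)) • S.e) (by
    rw [map_sub, map_smul, ← proj_apply, inner_proj])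
  rw [map_sub, map_sub, map_smul, map_smul, S.D_e, smul_zero, sub_zero] at h1
  rw [mul_assoc, ← sq, inv_mul_le_iff₀ (by positivity), S.norm_sq, form_apply,
    real_inner_self_eq_norm_sq]
  refine sq_add_sq_le_of_poincare hM (norm_nonneg _)
    (o := ‖(S.M⁻¹ * inner ℝ (S.T S.e) (S.T p)) • S.T S.e‖)
    ((norm_le_norm_sub_add _ _).trans (add_le_add_left h1 _)) ?_
  rw [norm_smul, mul_pow, ← real_inner_self_eq_norm_sq (S.T S.e), ← M, Real.norm_eq_abs,
    sq_abs]
  field_simp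

/-- The solution operator of the variational problem for `form`. -/
noncomputable def solve : (V →L[ℝ] ℝ) →L[ℝ] V :=
  (S.isCoercive_form.continuousLinearEquivOfBilin.symm : V →L[ℝ] V).comp
    (InnerProductSpace.toDual ℝ V).symm.toContinuousLinearEquiv.toContinuousLinearMap

lemma form_solve (l : V →L[ℝ] ℝ) (v : V) : S.form (S.solve l) v = l v := by
  rw [← S.isCoercive_form.continuousLinearEquivOfBilin_apply, solve,
    ContinuousLinearMap.comp_apply, ContinuousLinearEquiv.coe_coe,
    ContinuousLinearEquiv.apply_symm_apply]
  exact InnerProductSpace.toDual_symm_apply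

lemma inner_solve_of_e {l : V →L[ℝ] ℝ} (hl : l S.e = 0) :
    inner ℝ (S.T S.e) (S.T (S.solve l)) = 0 := by
  have h := S.form_solve l S.e
  rw [form_e, hl] at h
  exact (mul_eq_zero.1 h).resolve_right S.M_pos.ne'

lemma inner_D_solve {l : V →L[ℝ] ℝ} (hl : l S.e = 0) (v : V) :
    inner ℝ (S.D (S.solve l)) (S.D v) = l v := by
  rw [← S.form_solve l v, form_apply, S.inner_solve_of_e hl, zero_mul, add_zero]

/-- The embedding of `H` into the dual of `V`. -/
noncomputable def dual : H →L[ℝ] V →L[ℝ] ℝ :=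
  ((ContinuousLinearMap.compL ℝ V H ℝ).flip S.T).comp (innerBilin H)

@[simp] lemma dual_apply (u : H) (v : V) : S.dual u v = inner ℝ u (S.T v) := rfl

/-- The functional `v ↦ (g, D v)`. -/
noncomputable def dualD : G →L[ℝ] V →L[ℝ] ℝ :=
  ((ContinuousLinearMap.compL ℝ V G ℝ).flip S.D).comp (innerBilin G)

@[simp] lemma dualD_apply (g : G) (v : V) : S.dualD g v = inner ℝ g (S.D v) := rfl

/-- The inverse Neumann Laplacian, composed with the projection. -/
noncomputable def inv : H →L[ℝ] V := S.solve.comp (S.dual.comp S.proj)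

/-- The potential of the gradient part of a field. -/
noncomputable def lift : G →L[ℝ] V := S.solve.comp S.dualD

lemma inner_D_inv (u : H) (v : V) :
    inner ℝ (S.D (S.inv u)) (S.D v) = inner ℝ (S.proj u) (S.T v) :=
  S.inner_D_solve (l := S.dual (S.proj u)) (by rw [dual_apply, real_inner_comm, inner_proj]) v

lemma inner_T_lift (g : G) : inner ℝ (S.T S.e) (S.T (S.lift g)) = 0 :=
  S.inner_solve_of_e (l := S.dualD g) (by rw [dualD_apply, S.D_e, inner_zero_right])

lemma inner_D_lift (g : G) (v : V) : inner ℝ (S.D (S.lift g)) (S.D v) = inner ℝ g (S.D v) :=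
  S.inner_D_solve (l := S.dualD g) (by rw [dualD_apply, S.D_e, inner_zero_right]) v

lemma D_lift_D (v : V) : S.D (S.lift (S.D v)) = S.D v := by
  refine sub_eq_zero.1 (inner_self_eq_zero (𝕜 := ℝ).1 ?_)
  rw [inner_sub_left, ← map_sub, inner_D_lift, sub_self]

lemma inv_proj (u : H) : S.inv (S.proj u) = S.inv u := by
  rw [inv, ContinuousLinearMap.comp_apply, ContinuousLinearMap.comp_apply, proj_idem]
  rfl

variable (α : ℝ)

/-- The linear map defining the metric of the gradient flow. -/
noncomputable def flowMap : H →L[ℝ] WithLp 2 (G × H) :=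
  (WithLp.prodContinuousLinearEquiv 2 ℝ G H).symm.toContinuousLinearMap.comp
    ((S.D.comp S.inv).prod (√α • S.proj))

/-- The space of velocities. -/
abbrev Vel : Type _ := ↥(LinearMap.range (S.flowMap α).toLinearMap).topologicalClosure

instance : CompleteSpace (S.Vel α) :=
  (Submodule.isClosed_topologicalClosure _).completeSpace_coe

/-- The linear map defining the metric, as a map into the space of velocities. -/
noncomputable def flowL : H →L[ℝ] S.Vel α :=
  (S.flowMap α).codRestrict _ fun u => Submodule.le_topologicalClosure _ ⟨u, rfl⟩

/-- The first component of a velocity. -/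
noncomputable def velFst : S.Vel α →L[ℝ] G :=
  (ContinuousLinearMap.fst ℝ G H).comp
    ((WithLp.prodContinuousLinearEquiv 2 ℝ G H).toContinuousLinearMap.comp (Submodule.subtypeL _))

/-- The second component of a velocity. -/
noncomputable def velSnd : S.Vel α →L[ℝ] H :=
  (ContinuousLinearMap.snd ℝ G H).comp
    ((WithLp.prodContinuousLinearEquiv 2 ℝ G H).toContinuousLinearMap.comp (Submodule.subtypeL _))

@[simp] lemma velFst_flowL (u : H) : S.velFst α (S.flowL α u) = S.D (S.inv u) := rfl

@[simp] lemma velSnd_flowL (u : H) : S.velSnd α (S.flowL α u) = √α • S.proj u := rfl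

lemma norm_sq_vel (y : S.Vel α) : ‖y‖ ^ 2 = ‖S.velFst α y‖ ^ 2 + ‖S.velSnd α y‖ ^ 2 :=
  WithLp.prod_norm_sq_eq_of_L2 y.1

lemma inner_vel (y z : S.Vel α) : inner ℝ y z
    = inner ℝ (S.velFst α y) (S.velFst α z) + inner ℝ (S.velSnd α y) (S.velSnd α z) :=
  WithLp.prod_inner_apply y.1 z.1

/-- The space of velocities is the closure of this range, so identities valid for L u, such as being
a gradient or having mean zero, extend by continuity to all velocities and thus to weak limits. -/
lemma denseRange_flowL : DenseRange (S.flowL α) := by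
  intro y
  have hy := y.2
  rw [← SetLike.mem_coe, Submodule.topologicalClosure_coe, mem_closure_iff_seq_limit] at hy
  obtain ⟨x, hx, hxy⟩ := hy
  rw [mem_closure_iff_seq_limit]
  choose u hu using hx
  refine ⟨fun n => S.flowL α (u n), fun n => ⟨u n, rfl⟩, tendsto_subtype_rng.2 ?_⟩
  convert hxy using 2 with n
  exact hu n

lemma D_lift_velFst (y : S.Vel α) : S.D (S.lift (S.velFst α y)) = S.velFst α y :=
  (S.denseRange_flowL α).induction_on (p := fun y => S.D (S.lift (S.velFst α y)) = S.velFst α y) y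
    (isClosed_eq (by fun_prop) (by fun_prop)) fun u => by
      rw [velFst_flowL, D_lift_D]

lemma proj_velSnd (y : S.Vel α) : S.proj (S.velSnd α y) = S.velSnd α y :=
  (S.denseRange_flowL α).induction_on (p := fun y => S.proj (S.velSnd α y) = S.velSnd α y) y
    (isClosed_eq (by fun_prop) (by fun_prop)) fun u => by
      rw [velSnd_flowL, map_smul, proj_idem]

/-- The link between the two components of a velocity: when the first represents ∂ₜφ in V', the
second is √α ∂ₜφ in H. This is what remains of the relation after a weak limit. -/
lemma dual_velSnd (y : S.Vel α) : S.dual (S.velSnd α y) = √α • S.dualD (S.velFst α y) :=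
  (S.denseRange_flowL α).induction_on
    (p := fun y => S.dual (S.velSnd α y) = √α • S.dualD (S.velFst α y)) y
    (isClosed_eq (by fun_prop) (by fun_prop)) fun u => by
      ext v
      rw [velSnd_flowL, velFst_flowL, map_smul, smul_apply,
        smul_apply, dual_apply, dualD_apply, inner_D_inv]

lemma dualD_flowL (u : H) : S.dualD (S.velFst α (S.flowL α u)) = S.dual (S.proj u) := by
  ext v
  rw [velFst_flowL, dualD_apply, dual_apply, inner_D_inv]

lemma flowL_proj (u : H) : S.flowL α (S.proj u) = S.flowL α u := by
  refine Subtype.ext ((WithLp.ofLp_injective 2) (Prod.ext ?_ ?_))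
  · exact congrArg S.D (S.inv_proj u)
  · exact congrArg (√α • ·) (S.proj_idem u)

lemma proj_eq_zero_of_flowL {u : H} (h : S.flowL α u = 0) : S.proj u = 0 := by
  refine S.eq_zero_of_forall_inner fun v => ?_
  rw [← inner_D_inv, ← S.velFst_flowL α, h, map_zero, inner_zero_left]

/-- This computes the adjoint: L* y is the mean-zero part of lift(y₁) + √α y₂, where y₁ and y₂ are
the components of y. -/
lemma inner_flowL (y : S.Vel α) (u : H) : inner ℝ y (S.flowL α u)
    = inner ℝ (S.T (S.lift (S.velFst α y)) + √α • S.velSnd α y) (S.proj u) := by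
  rw [inner_vel, velFst_flowL, velSnd_flowL, inner_add_left, real_inner_smul_left,
    real_inner_smul_right, ← S.inner_D_lift, real_inner_comm, inner_D_inv, real_inner_comm]

end SobolevTriple

end NonlocalCH

/-! ### Distributional time derivatives and integral representations -/

namespace NonlocalCH

section TimeDerivative

variable {T : ℝ}

lemma eq_zero_of_tsupport_subset_Ioo {θ : ℝ → ℝ} (h : tsupport θ ⊆ Ioo 0 T) {x : ℝ}
    (hx : x ∉ Ioo 0 T) : θ x = 0 := image_eq_zero_of_notMem_tsupport fun hc => hx (h hc)

/-- Integration by parts for an indefinite integral and a test function. -/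
lemma integral_deriv_mul_of_eq_integral (hT : 0 < T) {f g : ℝ → ℝ}
    (hg : IntervalIntegrable g volume 0 T)
    (hf : ∀ t ∈ Icc 0 T, f t = f 0 + ∫ s in (0 : ℝ)..t, g s) {θ : ℝ → ℝ} (h1 : ContDiff ℝ ∞ θ)
    (h3 : tsupport θ ⊆ Ioo 0 T) :
    ∫ t in Ioo 0 T, deriv θ t * f t = -∫ t in Ioo 0 T, θ t * g t := by
  have hθ0 : θ 0 = 0 := eq_zero_of_tsupport_subset_Ioo h3 (by simp)
  have hθT : θ T = 0 := eq_zero_of_tsupport_subset_Ioo h3 (by simp)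
  have hcd : Continuous (deriv θ) := h1.continuous_deriv (by simp)
  simp only [← integral_Ioc_eq_integral_Ioo, ← intervalIntegral.integral_of_le hT.le]
  have hFc : ContinuousOn (fun t => ∫ s in (0 : ℝ)..t, g s) (uIcc 0 T) :=
    intervalIntegral.continuousOn_primitive_interval' hg (by simp)
  have hac := hg.absolutelyContinuousOnInterval_intervalIntegral (c := 0) (by simp)
  have hθac : AbsolutelyContinuousOnInterval θ 0 T :=
    (h1.of_le (by simp)).contDiffOn.absolutelyContinuousOnInterval
  have h4 := hac.integral_mul_deriv_eq_deriv_mul hθac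
  rw [hθ0, hθT, mul_zero, mul_zero, sub_zero, zero_sub] at h4
  have e1 : ∫ t in (0 : ℝ)..T, deriv θ t * f t
      = ∫ t in (0 : ℝ)..T, (f 0 * deriv θ t + (∫ s in (0 : ℝ)..t, g s) * deriv θ t) := by
    refine intervalIntegral.integral_congr fun t ht => ?_
    rw [uIcc_of_le hT.le] at ht
    rw [hf t ht]
    ring
  have i1 : IntervalIntegrable (fun t => f 0 * deriv θ t) volume 0 T :=
    (continuous_const.mul hcd).intervalIntegrable _ _
  have i2 : IntervalIntegrable (fun t => (∫ s in (0 : ℝ)..t, g s) * deriv θ t) volume 0 T :=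
    (hFc.mul hcd.continuousOn).intervalIntegrable
  rw [e1, intervalIntegral.integral_add i1 i2, intervalIntegral.integral_const_mul,
    intervalIntegral.integral_deriv_eq_sub (fun x _ => h1.differentiable (by simp) x)
      (hcd.intervalIntegrable _ _), hθ0, hθT, sub_zero, mul_zero, zero_add, h4]
  congr 1
  refine intervalIntegral.integral_congr_ae ?_
  filter_upwards [hg.ae_hasDerivAt_integral] with t ht htm
  rw [(ht (uIoc_subset_uIcc htm) 0 (by simp)).deriv, mul_comm]

/-- The primitive starting at 0 vanishes beyond the support of χ exactly because χ has integral
zero. -/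
lemma exists_deriv_eq_of_integral_eq_zero {χ : ℝ → ℝ} (h1 : ContDiff ℝ ∞ χ)
    (h2 : HasCompactSupport χ) (h3 : tsupport χ ⊆ Ioo 0 T) (h0 : ∫ t in Ioo 0 T, χ t = 0) :
    ∃ θ : ℝ → ℝ, ContDiff ℝ ∞ θ ∧ HasCompactSupport θ ∧ tsupport θ ⊆ Ioo 0 T ∧ deriv θ = χ := by
  obtain ⟨a, b, ha, hb, hab⟩ : ∃ a b, 0 < a ∧ b < T ∧ tsupport χ ⊆ Icc a b := by
    rcases (tsupport χ).eq_empty_or_nonempty with he | hne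
    · exact ⟨1, T - 1, one_pos, by linarith, by simp [he]⟩
    · obtain ⟨a, ha, ha'⟩ := h2.isCompact.exists_isLeast hne
      obtain ⟨b, hb, hb'⟩ := h2.isCompact.exists_isGreatest hne
      exact ⟨a, b, (h3 ha).1, (h3 hb).2, fun x hx => ⟨ha' hx, hb' hx⟩⟩
  have hχ : ∀ x, x ∉ Icc a b → χ x = 0 := fun x hx =>
    image_eq_zero_of_notMem_tsupport fun h => hx (hab h)
  have hd : ∀ x, HasDerivAt (fun x => ∫ s in (0 : ℝ)..x, χ s) (χ x) x := fun x =>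
    intervalIntegral.integral_hasDerivAt_right (h1.continuous.intervalIntegrable _ _)
      (h1.continuous.stronglyMeasurableAtFilter _ _) h1.continuous.continuousAt
  have hderiv : deriv (fun x => ∫ s in (0 : ℝ)..x, χ s) = χ := funext fun x => (hd x).deriv
  have hsupp : ∀ x, x ∉ Icc a b → ∫ s in (0 : ℝ)..x, χ s = 0 := by
    intro x hx
    rcases lt_or_ge x a with hxa | hxa
    · refine intervalIntegral.integral_zero_ae (Eventually.of_forall fun s hs => hχ s fun h => ?_)
      exact absurd h.1 (not_le.2 (hs.2.trans_lt (max_lt ha hxa)))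
    · have hxb : b < x := by
        by_contra hc
        exact hx ⟨hxa, not_lt.1 hc⟩
      have e1 : ∀ c, b < c → 0 ≤ c → ∫ s in (0 : ℝ)..c, χ s = ∫ s, χ s := fun c hc hc0 => by
        rw [intervalIntegral.integral_of_le hc0]
        refine setIntegral_eq_integral_of_forall_compl_eq_zero fun s hs => hχ s fun h => hs ?_
        exact ⟨ha.trans_le h.1, h.2.trans hc.le⟩
      have e2 : ∫ t in Ioo 0 T, χ t = ∫ s, χ s :=
        setIntegral_eq_integral_of_forall_compl_eq_zero fun s hs => hχ s fun h => hs
          ⟨ha.trans_le h.1, h.2.trans_lt hb⟩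
      rw [e1 x hxb (ha.le.trans hxa), ← e2, h0]
  have hts : tsupport (fun x => ∫ s in (0 : ℝ)..x, χ s) ⊆ Icc a b :=
    closure_minimal (fun x hx => by_contra fun h => hx (hsupp x h)) isClosed_Icc
  refine ⟨_, ?_, HasCompactSupport.of_support_subset_isCompact isCompact_Icc
    (subset_closure.trans hts), hts.trans fun x hx => ⟨ha.trans_le hx.1, hx.2.trans_lt hb⟩, hderiv⟩
  rw [contDiff_infty_iff_deriv, hderiv]
  exact ⟨fun x => (hd x).differentiableAt, h1⟩

/-- The lemma of du Bois-Reymond. -/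
lemma eq_of_forall_integral_deriv_mul_eq_zero (hT : 0 < T) {r : ℝ → ℝ}
    (hr : ContinuousOn r (Icc 0 T))
    (h : ∀ θ : ℝ → ℝ, ContDiff ℝ ∞ θ → HasCompactSupport θ → tsupport θ ⊆ Ioo 0 T →
      ∫ t in Ioo 0 T, deriv θ t * r t = 0) : ∀ t ∈ Icc 0 T, r t = r 0 := by
  have hri : IntegrableOn r (Ioo 0 T) :=
    (hr.integrableOn_compact isCompact_Icc).mono_set Ioo_subset_Icc_self
  have hbd : ∀ χ : ℝ → ℝ, Continuous χ → IntegrableOn (fun t => χ t * r t) (Ioo 0 T) :=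
    fun χ hχ => ((hχ.continuousOn.mul hr).integrableOn_compact isCompact_Icc).mono_set
      Ioo_subset_Icc_self
  let B : ContDiffBump (T / 2) := ⟨T / 8, T / 4, by linarith, by linarith⟩
  obtain ⟨η, e1, e2, e3, e4⟩ : ∃ η : ℝ → ℝ, ContDiff ℝ ∞ η ∧ HasCompactSupport η ∧
      tsupport η ⊆ Ioo 0 T ∧ ∫ t in Ioo 0 T, η t = 1 := by
    have hs : tsupport (B.normed volume) ⊆ Ioo 0 T := by
      rw [B.tsupport_normed_eq, Real.closedBall_eq_Icc]
      intro x hx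
      have : B.rOut = T / 4 := rfl
      rw [this] at hx
      exact ⟨by linarith [hx.1], by linarith [hx.2]⟩
    refine ⟨B.normed volume, B.contDiff_normed, B.hasCompactSupport_normed, hs, ?_⟩
    rw [setIntegral_eq_integral_of_forall_compl_eq_zero fun x hx =>
      eq_zero_of_tsupport_subset_Ioo hs hx, B.integral_normed]
  set k := ∫ t in Ioo 0 T, η t * r t with hk
  have hae := isOpen_Ioo.ae_eq_zero_of_integral_contDiff_smul_eq_zero (μ := volume)
    (U := Ioo 0 T) (f := fun t => r t - k)
    ((hri.sub (integrableOn_const (by simp))).locallyIntegrableOn) fun χ c1 c2 c3 => by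
      -- Subtracting m times the normalized bump η gives integral zero, hence a derivative of a test
      -- function to which the hypothesis applies; the bump contributes the constant k.
      set m := ∫ t in Ioo 0 T, χ t with hm
      have hχi : IntegrableOn χ (Ioo 0 T) :=
        (c1.continuous.integrable_of_hasCompactSupport c2).integrableOn
      have hηi : IntegrableOn η (Ioo 0 T) :=
        (e1.continuous.integrable_of_hasCompactSupport e2).integrableOn
      have d3 : tsupport (fun t => χ t - m * η t) ⊆ Ioo 0 T :=
        (tsupport_sub χ (fun t => m * η t)).trans (union_subset c3
          ((tsupport_mul_subset_right (f := fun _ => m) (g := η)).trans e3))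
      obtain ⟨θ, t1, t2, t3, t4⟩ := exists_deriv_eq_of_integral_eq_zero (T := T)
        (χ := fun t => χ t - m * η t) (c1.sub (contDiff_const.mul e1))
        (c2.sub (e2.mul_left (f := fun _ => m))) d3 (by
          rw [integral_sub hχi (hηi.const_mul m), integral_const_mul, e4, mul_one, ← hm, sub_self])
      have h5 := h θ t1 t2 t3
      rw [t4] at h5
      rw [← setIntegral_eq_integral_of_forall_compl_eq_zero (s := Ioo 0 T) fun x hx => by
        rw [eq_zero_of_tsupport_subset_Ioo c3 hx, zero_smul]]
      have i1 := hbd χ c1.continuous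
      have i2 := hbd η e1.continuous
      have e5 : ∀ t, (χ t - m * η t) * r t = χ t * r t - m * (η t * r t) := fun t => by ring
      simp only [e5] at h5
      rw [integral_sub i1 (i2.const_mul m), integral_const_mul, ← hk] at h5
      have e6 : ∀ t, χ t • (r t - k) = χ t * r t - χ t * k := fun t => by
        rw [smul_eq_mul, mul_sub]
      simp only [e6]
      rw [integral_sub i1 (hχi.mul_const k), integral_mul_const, ← hm]
      exact h5
  have hae' : r =ᵐ[volume.restrict (Icc 0 T)] fun _ => k := by
    rw [← restrict_Ioo_eq_restrict_Icc, EventuallyEq, ae_restrict_iff' measurableSet_Ioo]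
    filter_upwards [hae] with t ht htm using sub_eq_zero.1 (ht htm)
  have heq := Measure.eqOn_Icc_of_ae_eq volume hT.ne hae' hr continuousOn_const
  intro t ht
  rw [heq ht, heq ⟨le_rfl, hT.le⟩]

/-- The difference of f and the primitive of g has vanishing weak derivative and is continuous,
hence constant. -/
lemma eq_integral_of_forall_test (hT : 0 < T) {f g : ℝ → ℝ} (hf : ContinuousOn f (Icc 0 T))
    (hg : IntervalIntegrable g volume 0 T)
    (h : ∀ θ : ℝ → ℝ, ContDiff ℝ ∞ θ → HasCompactSupport θ → tsupport θ ⊆ Ioo 0 T →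
      ∫ t in Ioo 0 T, deriv θ t * f t = -∫ t in Ioo 0 T, θ t * g t) :
    ∀ t ∈ Icc 0 T, f t = f 0 + ∫ s in (0 : ℝ)..t, g s := by
  have hFc : ContinuousOn (fun t => ∫ s in (0 : ℝ)..t, g s) (Icc 0 T) := by
    have := intervalIntegral.continuousOn_primitive_interval' hg (left_mem_uIcc)
    rwa [uIcc_of_le hT.le] at this
  have h5 := eq_of_forall_integral_deriv_mul_eq_zero hT (hf.sub hFc) fun θ h1 h2 h3 => by
    have hcd : Continuous (deriv θ) := h1.continuous_deriv (by simp)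
    have i1 : IntegrableOn (fun t => deriv θ t * f t) (Ioo 0 T) :=
      ((hcd.continuousOn.mul hf).integrableOn_compact isCompact_Icc).mono_set Ioo_subset_Icc_self
    have i2 : IntegrableOn (fun t => deriv θ t * ∫ s in (0 : ℝ)..t, g s) (Ioo 0 T) :=
      ((hcd.continuousOn.mul hFc).integrableOn_compact isCompact_Icc).mono_set Ioo_subset_Icc_self
    have e1 : ∀ t, deriv θ t * (f - fun t => ∫ s in (0 : ℝ)..t, g s) t
        = deriv θ t * f t - deriv θ t * ∫ s in (0 : ℝ)..t, g s := fun t => mul_sub _ _ _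
    simp only [e1]
    rw [integral_sub i1 i2, h θ h1 h2 h3, integral_deriv_mul_of_eq_integral hT hg
      (f := fun t => ∫ s in (0 : ℝ)..t, g s) (fun t _ => by simp) h1 h3, sub_self]
  intro t ht
  have := h5 t ht
  simp only [Pi.sub_apply, intervalIntegral.integral_same, sub_zero] at this
  linarith

variable {V : Type*} [NormedAddCommGroup V] [NormedSpace ℝ V]

lemma integral_smul_deriv_of_eq_integral (hT : 0 < T) {z w : ℝ → V →L[ℝ] ℝ}
    (hw : IntervalIntegrable w volume 0 T)
    (hz : ∀ t ∈ Icc 0 T, z t = z 0 + ∫ s in (0 : ℝ)..t, w s) {θ : ℝ → ℝ} (h1 : ContDiff ℝ ∞ θ)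
    (h3 : tsupport θ ⊆ Ioo 0 T) :
    ∫ t in Ioo 0 T, deriv θ t • z t = -∫ t in Ioo 0 T, θ t • w t := by
  have hcd : Continuous (deriv θ) := h1.continuous_deriv (by simp)
  have hzc : ContinuousOn z (Icc 0 T) := by
    have h4 := intervalIntegral.continuousOn_primitive_interval' hw left_mem_uIcc
    rw [uIcc_of_le hT.le] at h4
    exact (continuousOn_const.add h4).congr hz
  have i1 : IntegrableOn (fun t => deriv θ t • z t) (Ioo 0 T) :=
    ((hcd.continuousOn.smul hzc).integrableOn_compact isCompact_Icc).mono_set Ioo_subset_Icc_self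
  have i2 : IntegrableOn (fun t => θ t • w t) (Ioo 0 T) := by
    have := (hw.continuousOn_smul h1.continuous.continuousOn).1
    exact this.mono_set Ioo_subset_Ioc_self
  ext v
  rw [neg_apply, ContinuousLinearMap.integral_apply i1, ContinuousLinearMap.integral_apply i2]
  simp only [smul_apply, smul_eq_mul]
  have hwv : IntervalIntegrable (fun t => w t v) volume 0 T :=
    ⟨(ContinuousLinearMap.apply ℝ ℝ v).integrable_comp hw.1,
      (ContinuousLinearMap.apply ℝ ℝ v).integrable_comp hw.2⟩
  refine integral_deriv_mul_of_eq_integral hT hwv (f := fun t => z t v) (fun t ht => ?_) h1 h3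
  have hwt : IntervalIntegrable w volume 0 t := hw.mono_set
    (uIcc_subset_uIcc_left (by rwa [uIcc_of_le hT.le]))
  rw [hz t ht, add_apply, ← ContinuousLinearMap.intervalIntegral_apply hwt]

lemma apply_eq_integral_of_forall_test (hT : 0 < T) {z w : ℝ → V →L[ℝ] ℝ}
    (hz : ContinuousOn z (Icc 0 T)) (hw : IntervalIntegrable w volume 0 T)
    (h : ∀ θ : ℝ → ℝ, ContDiff ℝ ∞ θ → HasCompactSupport θ → tsupport θ ⊆ Ioo 0 T →
      ∫ t in Ioo 0 T, deriv θ t • z t = -∫ t in Ioo 0 T, θ t • w t) (v : V) :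
    ∀ t ∈ Icc 0 T, z t v = z 0 v + ∫ s in (0 : ℝ)..t, w s v := by
  have hwv : IntervalIntegrable (fun t => w t v) volume 0 T :=
    ⟨(ContinuousLinearMap.apply ℝ ℝ v).integrable_comp hw.1,
      (ContinuousLinearMap.apply ℝ ℝ v).integrable_comp hw.2⟩
  refine eq_integral_of_forall_test hT (f := fun t => z t v)
    ((ContinuousLinearMap.apply ℝ ℝ v).continuous.comp_continuousOn hz) hwv fun θ h1 h2 h3 => ?_
  have hcd : Continuous (deriv θ) := h1.continuous_deriv (by simp)
  have i1 : IntegrableOn (fun t => deriv θ t • z t) (Ioo 0 T) :=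
    ((hcd.continuousOn.smul hz).integrableOn_compact isCompact_Icc).mono_set Ioo_subset_Icc_self
  have i2 : IntegrableOn (fun t => θ t • w t) (Ioo 0 T) := by
    have := (hw.continuousOn_smul h1.continuous.continuousOn).1
    exact this.mono_set Ioo_subset_Ioc_self
  have h5 := congrArg (fun l : V →L[ℝ] ℝ => l v) (h θ h1 h2 h3)
  simp only [neg_apply] at h5
  rw [ContinuousLinearMap.integral_apply i1, ContinuousLinearMap.integral_apply i2] at h5
  exact h5

end TimeDerivative

end NonlocalCH

/-! ### Velocities, chemical potentials and weak formulations -/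

namespace NonlocalCH

lemma intervalIntegrable_of_memLp {Z : Type*} [NormedAddCommGroup Z] {f : ℝ → Z} {T : ℝ}
    (hf : MemLp f 2 (volume.restrict (Ioc 0 T))) {t : ℝ} (ht : t ∈ Icc 0 T) :
    IntervalIntegrable f volume 0 t := by
  rw [intervalIntegrable_iff_integrableOn_Ioc_of_le ht.1]
  have : IntegrableOn f (Ioc 0 T) := hf.integrable one_le_two
  exact this.mono_set (Ioc_subset_Ioc_right ht.2)

namespace SobolevTriple

variable {V H G : Type*} [NormedAddCommGroup V] [InnerProductSpace ℝ V]
    [CompleteSpace V] [NormedAddCommGroup H] [InnerProductSpace ℝ H] [CompleteSpace H]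
    [NormedAddCommGroup G] [InnerProductSpace ℝ G] [CompleteSpace G] (S : SobolevTriple V H G)
    {α : ℝ} {𝓓 : FlowData H (S.Vel α)}

/-- Coercivity, up to the metric, of a bounded perturbation with values in `V`. -/
lemma coercive_sub {m j : H →L[ℝ] H} {J : H →L[ℝ] V} (hj : ∀ u, j u = S.T (J u)) {c : ℝ}
    (hc : 0 < c) (hm : ∀ u, c * ‖u‖ ^ 2 ≤ inner ℝ (m u) u) {u : H} (hu : S.proj u = u) :
    c / 2 * ‖u‖ ^ 2 - ‖J‖ ^ 2 / (2 * c) * ‖S.flowL α u‖ ^ 2 ≤ inner ℝ ((m - j) u) u := by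
  have h1 : inner ℝ (j u) u ≤ ‖S.flowL α u‖ * (‖J‖ * ‖u‖) := by
    -- As u has mean zero, the inverse Laplacian moves one derivative onto J u: u enters only
    -- through the metric, at the price of the H¹ norm of J u.
    have h2 : inner ℝ (j u) u = inner ℝ (S.D (S.inv u)) (S.D (J u)) := by
      rw [inner_D_inv, hu, hj, real_inner_comm]
    rw [h2]
    refine (real_inner_le_norm _ _).trans (mul_le_mul ?_ ?_ (norm_nonneg _) (norm_nonneg _))
    · refine le_of_sq_le_sq ?_ (norm_nonneg _)
      have h3 := S.norm_sq_vel α (S.flowL α u)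
      rw [velFst_flowL] at h3
      nlinarith [sq_nonneg ‖S.velSnd α (S.flowL α u)‖]
    · refine le_trans (le_of_sq_le_sq ?_ (norm_nonneg _)) (J.le_opNorm u)
      have h3 := S.norm_sq (J u)
      nlinarith [sq_nonneg ‖S.T (J u)‖]
  rw [sub_apply, inner_sub_left]
  have h4 := hm u
  have h5 : ‖S.flowL α u‖ * (‖J‖ * ‖u‖)
      ≤ c / 2 * ‖u‖ ^ 2 + ‖J‖ ^ 2 / (2 * c) * ‖S.flowL α u‖ ^ 2 := by
    have h6 : c / 2 * ‖u‖ ^ 2 + ‖J‖ ^ 2 / (2 * c) * ‖S.flowL α u‖ ^ 2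
        - ‖S.flowL α u‖ * (‖J‖ * ‖u‖) = (c * ‖u‖ - ‖J‖ * ‖S.flowL α u‖) ^ 2 / (2 * c) := by
      field_simp
      ring
    have h7 : 0 ≤ (c * ‖u‖ - ‖J‖ * ‖S.flowL α u‖) ^ 2 / (2 * c) := by positivity
    linarith
  linarith

/-- The chemical potential recovered from a velocity and the variation of the energy. -/
noncomputable def potential (y : S.Vel α) (z : H) : V :=
  -S.lift (S.velFst α y) + (S.M⁻¹ * inner ℝ (S.T S.e) z) • S.e

lemma D_potential (y : S.Vel α) (z : H) : S.D (S.potential y z) = -S.velFst α y := by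
  rw [potential, map_add, map_neg, map_smul, S.D_e, smul_zero, add_zero, D_lift_velFst]

lemma inner_velSnd (y : S.Vel α) : inner ℝ (S.T S.e) (S.velSnd α y) = 0 := by
  rw [← proj_velSnd, inner_proj]

/-- The flow equation says only that lift(y₁) + √α y₂ + z is a constant. The first two terms have
mean zero, so the constant is the mean of z, which is the one built into the potential. -/
lemma T_potential (hL : 𝓓.L = S.flowL α) (hP : 𝓓.P = S.proj) {y : S.Vel α} {z : H}
    (h : 𝓓.L.adjoint y + 𝓓.P z = 0) : S.T (S.potential y z) = z + √α • S.velSnd α y := by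
  have h1 : S.proj (S.T (S.lift (S.velFst α y)) + √α • S.velSnd α y + z) = 0 := by
    refine ext_inner_right ℝ fun v => ?_
    have h2 := congrArg (fun x => inner ℝ x v) h
    simp only [inner_add_left, ContinuousLinearMap.adjoint_inner_left, inner_zero_left] at h2
    rw [hL, hP, inner_flowL, proj_symm, ← inner_add_left] at h2
    rw [proj_symm, h2, inner_zero_left]
  rw [proj_apply, inner_add_right, inner_add_right, inner_T_lift, real_inner_smul_right,
    inner_velSnd, mul_zero, zero_add, zero_add, sub_eq_zero] at h1
  rw [potential, map_add, map_neg, map_smul, ← h1]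
  abel

lemma dualD_velFst_eq_integral (hL : 𝓓.L = S.flowL α) (hP : 𝓓.P = S.proj) {T : ℝ} {u : ℝ → H}
    {y : ℝ → S.Vel α} {ξ : ℝ → H} (h : 𝓓.IsSolution T u y ξ) {t : ℝ} (ht : t ∈ Icc 0 T) :
    S.dual (u t) = S.dual (u 0) + ∫ s in (0 : ℝ)..t, S.dualD (S.velFst α (y s)) := by
  have h0 : (0 : ℝ) ∈ Icc 0 T := ⟨le_rfl, ht.1.trans ht.2⟩
  have h1 := congrArg (fun y => S.dualD (S.velFst α y)) (h.map_eq t ht)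
  simp only [map_add, hL, dualD_flowL] at h1
  have h2 : S.dualD (S.velFst α (∫ s in (0 : ℝ)..t, y s))
      = ∫ s in (0 : ℝ)..t, S.dualD (S.velFst α (y s)) :=
    (((S.dualD.comp (S.velFst α))).intervalIntegral_comp_comm (h.intervalIntegrable h0 ht)).symm
  rw [h2, ← hP, h.proj t ht, h.proj 0 h0, map_sub, map_sub] at h1
  rw [sub_eq_iff_eq_add] at h1
  rw [h1]
  abel

/-- A field in `G × H` as a velocity. -/
noncomputable def toVel (α : ℝ) (g : G) (h : H) : S.Vel α :=
  (Submodule.subtypeL _).adjoint (WithLp.toLp 2 (g, h))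

lemma inner_toVel (g : G) (h : H) (u : H) : inner ℝ (S.toVel α g h) (S.flowL α u)
    = inner ℝ g (S.D (S.inv u)) + √α * inner ℝ h (S.proj u) := by
  rw [toVel, ContinuousLinearMap.adjoint_inner_left]
  change inner ℝ (WithLp.toLp 2 (g, h)) (S.flowMap α u) = _
  rw [WithLp.prod_inner_apply]
  change inner ℝ g (S.D (S.inv u)) + inner ℝ h (√α • S.proj u) = _
  rw [real_inner_smul_right]

lemma memLp_toVel {μ : Measure ℝ} {g : ℝ → G} {h : ℝ → H} (hg : MemLp g 2 μ) (hh : MemLp h 2 μ) :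
    MemLp (fun t => S.toVel α (g t) (h t)) 2 μ := by
  let A := (WithLp.prodContinuousLinearEquiv 2 ℝ G H).symm.toContinuousLinearMap
  have h1 := ((((Submodule.subtypeL _).adjoint.comp (A.comp
    (ContinuousLinearMap.inl ℝ G H)) : G →L[ℝ] S.Vel α)).comp_memLp' hg).add
    (((Submodule.subtypeL _).adjoint.comp (A.comp
    (ContinuousLinearMap.inr ℝ G H)) : H →L[ℝ] S.Vel α).comp_memLp' hh)
  have e : (fun t => S.toVel α (g t) (h t)) = fun t =>
      (Submodule.subtypeL _).adjoint (A (ContinuousLinearMap.inl ℝ G H (g t)))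
        + (Submodule.subtypeL _).adjoint (A (ContinuousLinearMap.inr ℝ G H (h t))) := by
    funext t
    rw [toVel, ← map_add, ← map_add, ContinuousLinearMap.inl_apply, ContinuousLinearMap.inr_apply,
      Prod.mk_add_mk, add_zero, zero_add]
    rfl
  rw [e]
  exact h1

/-- Weak formulations with test functions in `V` yield solutions of the gradient flow. -/
theorem isSolution_of_weak (hL : 𝓓.L = S.flowL α) (hP : 𝓓.P = S.proj) {T : ℝ} {φ : ℝ → H}
    {w : ℝ → V →L[ℝ] ℝ} {h : ℝ → H} {μ : ℝ → V} {ξ : ℝ → H} (h0 : 𝓓.P (φ 0) = φ 0 - 𝓓.m)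
    (hh : MemLp h 2 (volume.restrict (Ioc 0 T)))
    (hμ : MemLp μ 2 (volume.restrict (Ioc 0 T)))
    (heq : ∀ v, ∀ t ∈ Icc 0 T, S.dual (φ t) v = S.dual (φ 0) v + ∫ s in (0 : ℝ)..t, w s v)
    (hhw : ∀ᵐ t ∂volume.restrict (Ioc 0 T), S.dual (h t) = √α • w t)
    (hwμ : ∀ v, ∀ᵐ t ∂volume.restrict (Ioc 0 T), w t v + inner ℝ (S.D (μ t)) (S.D v) = 0)
    (hTμ : ∀ᵐ t ∂volume.restrict (Ioc 0 T), S.T (μ t) = 𝓓.K (φ t) + ξ t + √α • h t)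
    (hrel : ∀ᵐ t ∂volume.restrict (Ioc 0 T), 𝓓.A 1 (φ t + ξ t) = ξ t) :
    𝓓.IsSolution T φ (fun t => S.toVel α (-S.D (μ t)) (h t)) ξ := by
  have hy : MemLp (fun t => S.toVel α (-S.D (μ t)) (h t)) 2 (volume.restrict (Ioc 0 T)) :=
    S.memLp_toVel (S.D.comp_memLp' hμ).neg hh
  have hae : ∀ {p : ℝ → Prop}, (∀ᵐ t ∂volume.restrict (Ioc 0 T), p t) → ∀ t ∈ Icc 0 T,
      ∀ᵐ s ∂volume, s ∈ uIoc 0 t → p s := fun {p} hp t ht => by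
    rw [uIoc_of_le ht.1, ← ae_restrict_iff' measurableSet_Ioc]
    exact ae_restrict_of_ae_restrict_of_subset (Ioc_subset_Ioc_right ht.2) hp
  have hz : ∀ v, ∀ t ∈ Icc 0 T, inner ℝ (φ t - φ 0) (S.T v)
      = ∫ s in (0 : ℝ)..t, -inner ℝ (S.D (μ s)) (S.D v) := fun v t ht => by
    have h1 := heq v t ht
    rw [dual_apply, dual_apply] at h1
    rw [inner_sub_left, h1, add_sub_cancel_left]
    refine intervalIntegral.integral_congr_ae ?_
    filter_upwards [hae (hwμ v) t ht] with s hs hst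
    linarith [hs hst]
  have hzh : ∀ t ∈ Icc 0 T, √α • (φ t - φ 0) = ∫ s in (0 : ℝ)..t, h s := fun t ht => by
    refine sub_eq_zero.1 (S.eq_zero_of_forall_inner fun v => ?_)
    have h1 := heq v t ht
    rw [dual_apply, dual_apply] at h1
    rw [inner_sub_left, real_inner_smul_left, inner_sub_left, h1, add_sub_cancel_left,
      ← intervalIntegral_inner_const (intervalIntegrable_of_memLp hh ht), ← intervalIntegral.integral_const_mul,
      sub_eq_zero]
    refine intervalIntegral.integral_congr_ae ?_
    filter_upwards [hae hhw t ht] with s hs hst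
    rw [← dual_apply, hs hst]
    rfl
  have hPz : ∀ t ∈ Icc 0 T, S.proj (φ t - φ 0) = φ t - φ 0 := fun t ht => by
    refine S.proj_of_inner_eq_zero ?_
    rw [real_inner_comm, hz _ t ht, S.D_e]
    simp
  refine ⟨hy, fun t ht => ?_, fun t ht => ?_, ?_, hrel⟩
  · have h1 := hPz t ht
    rw [← hP, map_sub, h0] at h1
    rw [sub_eq_iff_eq_add] at h1
    rw [h1]
    abel
  · rw [← sub_eq_iff_eq_add', ← map_sub, hL]
    -- Velocities form the closure of the range of L, so it suffices to test with L v; against these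
    -- the orthogonal projection in `toVel` is invisible.
    refine sub_eq_zero.1 (Dense.eq_zero_of_inner_left ℝ (S.denseRange_flowL α) ?_)
    rintro _ ⟨v, rfl⟩
    have i1 : IntervalIntegrable (fun s => -inner ℝ (S.D (μ s)) (S.D (S.inv v))) volume 0 t := by
      have := intervalIntegrable_of_memLp (S.D.comp_memLp' hμ) ht
      rw [intervalIntegrable_iff] at this ⊢
      exact (this.inner_const _).neg
    have i2 : IntervalIntegrable (fun s => inner ℝ (h s) (S.proj v)) volume 0 t := by
      have := intervalIntegrable_of_memLp hh ht
      rw [intervalIntegrable_iff] at this ⊢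
      exact this.inner_const _
    rw [inner_sub_left, sub_eq_zero, ← intervalIntegral_inner_const (intervalIntegrable_of_memLp hy ht)]
    simp only [inner_toVel, inner_neg_left]
    rw [intervalIntegral.integral_add i1 (i2.const_mul _), intervalIntegral.integral_const_mul,
      intervalIntegral_inner_const (intervalIntegrable_of_memLp hh ht), ← hzh t ht, ← hz _ t ht, inner_vel, velFst_flowL,
      velFst_flowL, velSnd_flowL, velSnd_flowL, inner_D_inv, hPz t ht, real_inner_smul_left,
      real_inner_smul_left, real_inner_smul_right]
  · filter_upwards [hTμ] with t ht
    refine ext_inner_right ℝ fun v => ?_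
    rw [inner_add_left, ContinuousLinearMap.adjoint_inner_left, hL, hP, inner_toVel, proj_symm,
      inner_neg_left, real_inner_comm, inner_D_inv, ht, inner_zero_left, inner_add_right,
      real_inner_smul_right, real_inner_comm (S.proj v), real_inner_comm (S.proj v)]
    ring

end SobolevTriple

end NonlocalCH

/-! ### Singular monotone functions: resolvent, Yosida approximation, Moreau envelope -/

namespace NonlocalCH

/-- A convex potential `B` on `(-1, 1)` with singular derivative `b`. -/
structure SingularPotential (b B : ℝ → ℝ) : Prop where
  cont : ContinuousOn b (Ioo (-1) 1)
  mono : MonotoneOn b (Ioo (-1) 1)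
  top : Tendsto b (𝓝[<] 1) atTop
  bot : Tendsto b (𝓝[>] (-1)) atBot
  hasDeriv : ∀ s ∈ Ioo (-1 : ℝ) 1, HasDerivAt B (b s) s

namespace SingularPotential

variable {b B : ℝ → ℝ} (h : SingularPotential b B)

lemma mul_nonneg {s t : ℝ} (hs : s ∈ Ioo (-1) 1) (ht : t ∈ Ioo (-1) 1)
    (h : SingularPotential b B) : 0 ≤ (b s - b t) * (s - t) := by
  rcases le_total s t with hst | hst
  · exact mul_nonneg_of_nonpos_of_nonpos (sub_nonpos.2 (h.mono hs ht hst)) (sub_nonpos.2 hst)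
  · exact _root_.mul_nonneg (sub_nonneg.2 (h.mono ht hs hst)) (sub_nonneg.2 hst)

lemma contB (h : SingularPotential b B) : ContinuousOn B (Ioo (-1) 1) := fun s hs =>
  (h.hasDeriv s hs).continuousAt.continuousWithinAt

lemma subgrad (h : SingularPotential b B) {s t : ℝ} (hs : s ∈ Ioo (-1) 1) (ht : t ∈ Ioo (-1) 1) :
    B s + b s * (t - s) ≤ B t := by
  rcases lt_trichotomy s t with hst | rfl | hst
  · have hsub : Icc s t ⊆ Ioo (-1) 1 := fun x hx => ⟨hs.1.trans_le hx.1, hx.2.trans_lt ht.2⟩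
    obtain ⟨c, hc, e⟩ := exists_hasDerivAt_eq_slope B b hst (h.contB.mono hsub)
      fun x hx => h.hasDeriv x (hsub (Ioo_subset_Icc_self hx))
    have h1 := h.mono hs (hsub (Ioo_subset_Icc_self hc)) hc.1.le
    rw [e, le_div_iff₀ (sub_pos.2 hst)] at h1
    linarith
  · simp
  · have hsub : Icc t s ⊆ Ioo (-1) 1 := fun x hx => ⟨ht.1.trans_le hx.1, hx.2.trans_lt hs.2⟩
    obtain ⟨c, hc, e⟩ := exists_hasDerivAt_eq_slope B b hst (h.contB.mono hsub)
      fun x hx => h.hasDeriv x (hsub (Ioo_subset_Icc_self hx))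
    have h1 := h.mono (hsub (Ioo_subset_Icc_self hc)) hs hc.2.le
    rw [e, div_le_iff₀ (sub_pos.2 hst)] at h1
    linarith

/-- The map r ↦ r + ε b(r) is continuous and tends to ±∞ at the ends of (-1, 1), so the intermediate
value theorem applies. The singularities keep the resolvent strictly inside the interval for every
real s. -/
lemma exists_res (h : SingularPotential b B) {ε : ℝ} (hε : 0 < ε) (s : ℝ) :
    ∃ r ∈ Ioo (-1 : ℝ) 1, r + ε * b r = s := by
  have hc : ContinuousOn (fun r => r + ε * b r) (Ioo (-1) 1) :=
    continuousOn_id.add (continuousOn_const.mul h.cont)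
  have h1 : Tendsto (fun r => r + ε * b r) (𝓝[<] 1) atTop :=
    Tendsto.add_atTop (tendsto_id.mono_left nhdsWithin_le_nhds) (h.top.const_mul_atTop hε)
  have h2 : Tendsto (fun r => r + ε * b r) (𝓝[>] (-1)) atBot :=
    Tendsto.add_atBot (tendsto_id.mono_left nhdsWithin_le_nhds) (h.bot.const_mul_atBot hε)
  exact isPreconnected_Ioo.intermediate_value_Iii
    (le_principal_iff.2 (Ioo_mem_nhdsGT (by norm_num)))
    (le_principal_iff.2 (Ioo_mem_nhdsLT (by norm_num))) hc h2 h1 (mem_univ s)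

open Classical in
/-- The resolvent of `b`. -/
noncomputable def res (b : ℝ → ℝ) (ε s : ℝ) : ℝ :=
  if h : ∃ r ∈ Ioo (-1 : ℝ) 1, r + ε * b r = s then h.choose else 0

lemma res_mem (h : SingularPotential b B) {ε : ℝ} (hε : 0 < ε) (s : ℝ) :
    res b ε s ∈ Ioo (-1 : ℝ) 1 := by
  have h1 := h.exists_res hε s
  rw [res, dif_pos h1]
  exact h1.choose_spec.1

lemma res_add (h : SingularPotential b B) {ε : ℝ} (hε : 0 < ε) (s : ℝ) :
    res b ε s + ε * b (res b ε s) = s := by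
  have h1 := h.exists_res hε s
  rw [res, dif_pos h1]
  exact h1.choose_spec.2

/-- Uniqueness: multiplying the difference of the two equations by r' - r yields a sum of
nonnegative terms equal to zero. -/
lemma res_eq (h : SingularPotential b B) {ε : ℝ} (hε : 0 < ε) {s r : ℝ} (hr : r ∈ Ioo (-1) 1)
    (e : r + ε * b r = s) : res b ε s = r := by
  have h1 := h.mul_nonneg (h.res_mem hε s) hr
  have h2 := h.res_add hε s
  set r' := res b ε s
  have h3 : (r' - r) + ε * (b r' - b r) = 0 := by linarith
  have h4 : (r' - r) ^ 2 + ε * ((b r' - b r) * (r' - r)) = 0 := by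
    have := congrArg (· * (r' - r)) h3
    simp only [zero_mul] at this
    linarith
  have h5 := _root_.mul_nonneg hε.le h1
  have h6 : (r' - r) ^ 2 = 0 := le_antisymm (by linarith) (sq_nonneg _)
  exact sub_eq_zero.1 (pow_eq_zero_iff two_ne_zero |>.1 h6)

/-- The Yosida approximation. -/
noncomputable def yos (b : ℝ → ℝ) (ε s : ℝ) : ℝ := b (res b ε s)

lemma yos_def (b : ℝ → ℝ) (ε s : ℝ) : b (res b ε s) = yos b ε s := rfl

/-- The Moreau envelope. -/
noncomputable def env (b B : ℝ → ℝ) (ε s : ℝ) : ℝ := B (res b ε s) + ε / 2 * yos b ε s ^ 2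

lemma res_eq_sub (h : SingularPotential b B) {ε : ℝ} (hε : 0 < ε) (s : ℝ) :
    res b ε s = s - ε * yos b ε s := by
  have := h.res_add hε s
  rw [yos]; linarith

lemma yos_mono (h : SingularPotential b B) {ε δ : ℝ} (hε : 0 < ε) (hδ : 0 < δ) (s t : ℝ) :
    0 ≤ (yos b ε s - yos b δ t) * ((s - ε * yos b ε s) - (t - δ * yos b δ t)) := by
  rw [← h.res_eq_sub hε, ← h.res_eq_sub hδ]
  exact h.mul_nonneg (h.res_mem hε s) (h.res_mem hδ t)

/-- The shifted argument is chosen so that its resolvent with parameter δ is the resolvent of s with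
parameter ε. -/
lemma yos_resolvent (h : SingularPotential b B) {ε δ : ℝ} (hε : 0 < ε) (hδ : 0 < δ) (s : ℝ) :
    yos b δ (s + (δ - ε) * yos b ε s) = yos b ε s := by
  have : res b δ (s + (δ - ε) * yos b ε s) = res b ε s :=
    h.res_eq hδ (h.res_mem hε s) (by have := h.res_eq_sub hε s; rw [yos_def b ε s]; linarith)
  rw [yos, this, yos]

/-- The Yosida approximation detects the graph of `b`. -/
lemma yos_one_iff (h : SingularPotential b B) {s x : ℝ} :
    yos b 1 (s + x) = x ↔ s ∈ Ioo (-1 : ℝ) 1 ∧ b s = x := by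
  constructor
  · intro e
    have h1 := h.res_eq_sub one_pos (s + x)
    rw [e, one_mul, add_sub_cancel_right] at h1
    rw [yos, h1] at e
    exact ⟨h1 ▸ h.res_mem one_pos (s + x), e⟩
  · rintro ⟨hs, rfl⟩
    rw [yos, h.res_eq one_pos hs (by rw [one_mul])]

/-- The subgradient inequality for B at the resolvents leaves the surplus (ε / 2)(yos t - yos s)².
-/
lemma env_subgrad (h : SingularPotential b B) {ε : ℝ} (hε : 0 < ε) (s t : ℝ) :
    env b B ε s + yos b ε s * (t - s) ≤ env b B ε t := by
  have h1 := h.subgrad (h.res_mem hε s) (h.res_mem hε t)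
  have h2 := h.res_eq_sub hε s
  have h3 := h.res_eq_sub hε t
  rw [yos_def b ε s] at h1
  have h4 : res b ε t - res b ε s = (t - s) - ε * (yos b ε t - yos b ε s) := by linarith
  rw [h4] at h1
  rw [env, env]
  nlinarith [_root_.mul_nonneg hε.le (sq_nonneg (yos b ε t - yos b ε s))]

lemma env_eq (h : SingularPotential b B) {ε : ℝ} (hε : 0 < ε) (s : ℝ) :
    env b B ε s = B (res b ε s) + (s - res b ε s) ^ 2 / (2 * ε) := by
  rw [env, h.res_eq_sub hε]
  field_simp
  ring

/-- The envelope is the infimal convolution of B with a parabola, and its minimizer is the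
resolvent. -/
lemma env_le (h : SingularPotential b B) {ε : ℝ} (hε : 0 < ε) (s : ℝ) {t : ℝ}
    (ht : t ∈ Ioo (-1) 1) : env b B ε s ≤ B t + (s - t) ^ 2 / (2 * ε) := by
  have h1 := h.subgrad (h.res_mem hε s) ht
  have h2 := h.res_eq_sub hε s
  rw [yos_def b ε s] at h1
  have h3 : yos b ε s = (s - res b ε s) / ε := by rw [h2]; field_simp; ring
  rw [h.env_eq hε]
  rw [h3] at h1
  set r := res b ε s
  have h4 : (s - t) ^ 2 / (2 * ε) = (s - r) ^ 2 / (2 * ε) - (s - r) / ε * (t - r)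
      + (t - r) ^ 2 / (2 * ε) := by field_simp; ring
  have h5 : 0 ≤ (t - r) ^ 2 / (2 * ε) := by positivity
  linarith

lemma env_anti (h : SingularPotential b B) {ε δ : ℝ} (hε : 0 < ε) (hεδ : ε ≤ δ) (s : ℝ) :
    env b B δ s ≤ env b B ε s := by
  refine (h.env_le (hε.trans_le hεδ) s (h.res_mem hε s)).trans ?_
  rw [h.env_eq hε]
  gcongr

lemma lower_bound (h : SingularPotential b B) {s : ℝ} (hs : s ∈ Ioo (-1) 1) :
    B 0 - |b 0| ≤ B s := by
  have h1 := h.subgrad (s := 0) (by simp) hs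
  have h2 : |b 0 * (s - 0)| ≤ |b 0| * 1 := by
    rw [abs_mul, sub_zero]
    exact mul_le_mul_of_nonneg_left (abs_lt.2 hs).le (abs_nonneg _)
  have h3 := (abs_le.1 h2).1
  linarith

lemma le_env (h : SingularPotential b B) {ε : ℝ} (hε : 0 < ε) (s : ℝ) :
    B (res b ε s) ≤ env b B ε s := by
  rw [h.env_eq hε]
  have : 0 ≤ (s - res b ε s) ^ 2 / (2 * ε) := by positivity
  linarith

lemma env_lower (h : SingularPotential b B) {ε : ℝ} (hε : 0 < ε) (s : ℝ) :
    B 0 - |b 0| ≤ env b B ε s := (h.lower_bound (h.res_mem hε s)).trans (h.le_env hε s)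

/-- The resolvent stays in (-1, 1), so (s - res)² ≥ s² / 2 - 1. The growth rate 1 / (4 ε) later
dominates the quadratic form of K for small ε. -/
lemma env_coercive (h : SingularPotential b B) {ε : ℝ} (hε : 0 < ε) (s : ℝ) :
    B 0 - |b 0| + (s ^ 2 / 2 - 1) / (2 * ε) ≤ env b B ε s := by
  rw [h.env_eq hε]
  have hr := h.res_mem hε s
  refine add_le_add (h.lower_bound hr) ?_
  gcongr
  have : res b ε s ^ 2 ≤ 1 := by
    rw [sq_le_one_iff_abs_le_one]; exact (abs_lt.2 hr).le
  nlinarith [sq_nonneg (s - 2 * res b ε s)]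

lemma yos_lipschitz (h : SingularPotential b B) {ε : ℝ} (hε : 0 < ε) (s t : ℝ) :
    |yos b ε s - yos b ε t| ≤ ε⁻¹ * |s - t| := by
  have h1 := h.yos_mono hε hε s t
  rw [← div_eq_inv_mul, le_div_iff₀ hε]
  set x := yos b ε s - yos b ε t with hx
  have h2 : ε * (x * x) ≤ x * (s - t) := by rw [hx]; linarith
  by_contra hlt
  push Not at hlt
  have h3 : 0 < |x| := by
    by_contra h0
    rw [le_antisymm (not_lt.1 h0) (abs_nonneg x), zero_mul] at hlt
    exact absurd hlt (not_lt.2 (abs_nonneg _))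
  have h4 : x * (s - t) ≤ |x| * |s - t| := by rw [← abs_mul]; exact le_abs_self _
  rw [← abs_mul_abs_self x] at h2
  nlinarith

lemma continuous_yos (h : SingularPotential b B) {ε : ℝ} (hε : 0 < ε) : Continuous (yos b ε) :=
  (LipschitzWith.of_dist_le_mul (K := Real.toNNReal ε⁻¹) fun s t => by
    rw [Real.dist_eq, Real.dist_eq, Real.coe_toNNReal _ (inv_nonneg.2 hε.le)]
    exact h.yos_lipschitz hε s t).continuous

lemma continuous_res (h : SingularPotential b B) {ε : ℝ} (hε : 0 < ε) : Continuous (res b ε) := by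
  have : res b ε = fun s => s - ε * yos b ε s := funext fun s => h.res_eq_sub hε s
  rw [this]
  exact continuous_id.sub (continuous_const.mul (h.continuous_yos hε))

lemma continuous_env (h : SingularPotential b B) {ε : ℝ} (hε : 0 < ε) : Continuous (env b B ε) :=
  (h.contB.comp_continuous (h.continuous_res hε) fun s => h.res_mem hε s).add
    (continuous_const.mul ((h.continuous_yos hε).pow 2))

/-- The singularities of `b` control its sign away from an interior value. -/
lemma exists_le_mul_sub (h : SingularPotential b B) {m : ℝ} (hm : |m| < 1) :
    ∃ δ > 0, ∃ C, 0 ≤ C ∧ ∀ r ∈ Ioo (-1 : ℝ) 1, δ * |b r| - C ≤ b r * (r - m) := by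
  -- Half the distance of |m| to 1, so that m + δ and m - δ are interior points where b is finite.
  set δ := (1 - |m|) / 2 with hδ
  have hm' := abs_lt.1 hm
  have hδ0 : 0 < δ := by rw [hδ]; linarith
  have hmem : ∀ σ, |σ| = δ → m + σ ∈ Ioo (-1 : ℝ) 1 := fun σ hσ => by
    have h1 := abs_add_le m σ
    exact abs_lt.1 (by rw [hσ] at h1; rw [hδ] at h1; linarith)
  refine ⟨δ, hδ0, 3 * (|b (m + δ)| + |b (m - δ)|), by positivity, fun r hr => ?_⟩
  -- Monotonicity is tested at m + σ, with σ = ±δ chosen to have the sign of b(r), so that b(r) σ =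
  -- δ |b(r)|. The factor 3 is a crude bound for |r - (m + σ)|.
  have key : ∀ σ, |σ| = δ → |b (m + σ)| ≤ |b (m + δ)| + |b (m - δ)| →
      b r * σ - 3 * (|b (m + δ)| + |b (m - δ)|) ≤ b r * (r - m) := fun σ hσ hb => by
    have h1 := h.mul_nonneg hr (hmem σ hσ)
    have h2 : |b (m + σ) * (r - (m + σ))| ≤ (|b (m + δ)| + |b (m - δ)|) * 3 := by
      rw [abs_mul]
      refine mul_le_mul hb ?_ (abs_nonneg _) (by positivity)
      have h3 := abs_sub r (m + σ)
      have h4 := abs_lt.2 hr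
      have h5 := abs_lt.2 (hmem σ hσ)
      linarith
    have h6 := (abs_le.1 h2).1
    linarith
  rcases le_total 0 (b r) with hb | hb
  · have := key δ (abs_of_pos hδ0) (by linarith [abs_nonneg (b (m - δ))])
    rw [abs_of_nonneg hb]; linarith
  · have := key (-δ) (by rw [abs_neg, abs_of_pos hδ0])
      (by rw [← sub_eq_add_neg]; linarith [abs_nonneg (b (m + δ))])
    rw [abs_of_nonpos hb]; linarith

lemma exists_le_yos_mul_sub (h : SingularPotential b B) {m : ℝ} (hm : |m| < 1) :
    ∃ δ > 0, ∃ C, 0 ≤ C ∧ ∀ ε, 0 < ε → ∀ s, δ * |yos b ε s| - C ≤ yos b ε s * (s - m) := by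
  obtain ⟨δ, hδ, C, hC, hb⟩ := h.exists_le_mul_sub hm
  refine ⟨δ, hδ, C, hC, fun ε hε s => (hb _ (h.res_mem hε s)).trans ?_⟩
  rw [yos_def b ε s, h.res_eq_sub hε]
  nlinarith [_root_.mul_nonneg hε.le (sq_nonneg (yos b ε s))]

/-- Comparing the envelope at s with an interior point t near s gives (s - res)² ≤ 2 ε c + (s - t)²,
where c depends on t only. The endpoints ±1 are thus included. -/
lemma tendsto_res (h : SingularPotential b B) {s : ℝ} (hs : s ∈ Icc (-1) 1) :
    Tendsto (fun ε => res b ε s) (𝓝[>] 0) (𝓝[Ioo (-1) 1] s) := by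
  refine tendsto_nhdsWithin_iff.2 ⟨?_, eventually_nhdsWithin_of_forall fun ε hε => h.res_mem hε s⟩
  rw [Metric.tendsto_nhds]
  intro η hη
  have hcl : s ∈ closure (Ioo (-1 : ℝ) 1) := by rwa [closure_Ioo (by norm_num)]
  obtain ⟨t, ht, hst⟩ := Metric.mem_closure_iff.1 hcl (η / 2) (half_pos hη)
  rw [Real.dist_eq] at hst
  set c := B t - (B 0 - |b 0|) with hc
  have hc0 : 0 ≤ c := sub_nonneg.2 (h.lower_bound ht)
  have hlim : Tendsto (fun ε : ℝ => 2 * ε * c) (𝓝[>] 0) (𝓝 (2 * 0 * c)) :=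
    (Continuous.tendsto (by fun_prop) 0).mono_left nhdsWithin_le_nhds
  have hev := hlim.eventually (gt_mem_nhds (show 2 * 0 * c < η ^ 2 / 2 by
    rw [mul_zero, zero_mul]; positivity))
  filter_upwards [hev, self_mem_nhdsWithin] with ε h1 hε
  have hε : 0 < ε := hε
  have h2 := h.env_le hε s ht
  rw [h.env_eq hε] at h2
  have h3 := h.lower_bound (h.res_mem hε s)
  have h4 : (s - res b ε s) ^ 2 / (2 * ε) ≤ c + (s - t) ^ 2 / (2 * ε) := by linarith
  have h5 : (s - res b ε s) ^ 2 ≤ 2 * ε * c + (s - t) ^ 2 := by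
    have := mul_le_mul_of_nonneg_left h4 (by positivity : 0 ≤ 2 * ε)
    rw [mul_add] at this
    field_simp at this
    linarith
  have h6 : (s - t) ^ 2 ≤ (η / 2) ^ 2 := sq_le_sq' (by linarith [(abs_lt.1 hst).1])
    (abs_lt.1 hst).2.le
  rw [Real.dist_eq, abs_sub_comm]
  refine abs_lt_of_sq_lt_sq ?_ hη.le
  nlinarith

/-- Convergence of the Moreau envelopes at points of `[-1, 1]`. -/
lemma tendsto_env (h : SingularPotential b B) {s : ℝ} (hs : s ∈ Icc (-1) 1) {l : EReal}
    (hl : Tendsto (fun t => (B t : EReal)) (𝓝[Ioo (-1) 1] s) (𝓝 l)) :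
    Tendsto (fun ε => (env b B ε s : EReal)) (𝓝[>] 0) (𝓝 l) := by
  have hne : (𝓝[Ioo (-1 : ℝ) 1] s).NeBot := by
    rw [← mem_closure_iff_nhdsWithin_neBot, closure_Ioo (by norm_num)]; exact hs
  -- The envelope lies between B at the resolvent, which tends to l, and l itself. The upper bound
  -- is `env_le` with t tending to s.
  refine tendsto_of_tendsto_of_tendsto_of_le_of_le' (hl.comp (h.tendsto_res hs))
    tendsto_const_nhds ?_ ?_
  · filter_upwards [self_mem_nhdsWithin] with ε hε
    exact EReal.coe_le_coe_iff.2 (h.le_env hε s)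
  · filter_upwards [self_mem_nhdsWithin] with ε hε
    have h1 : Tendsto (fun t => ((env b B ε s - (s - t) ^ 2 / (2 * ε) : ℝ) : EReal))
        (𝓝[Ioo (-1) 1] s) (𝓝 (env b B ε s : EReal)) := by
      have h2 : Tendsto (fun t => env b B ε s - (s - t) ^ 2 / (2 * ε)) (𝓝 s)
          (𝓝 (env b B ε s - (s - s) ^ 2 / (2 * ε))) := Continuous.tendsto (by fun_prop) s
      rw [sub_self, zero_pow two_ne_zero, zero_div, sub_zero] at h2
      exact (continuous_coe_real_ereal.tendsto _).comp (h2.mono_left nhdsWithin_le_nhds)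
    refine le_of_tendsto_of_tendsto h1 hl ?_
    filter_upwards [self_mem_nhdsWithin] with t ht
    have := h.env_le hε s ht
    exact EReal.coe_le_coe_iff.2 (by linarith)

/-- Outside [-1, 1] the distance from s to its resolvent is at least |s| - 1, and its square is
divided by 2 ε. -/
lemma tendsto_env_atTop (h : SingularPotential b B) {s : ℝ} (hs : s ∉ Icc (-1) 1) :
    Tendsto (fun ε => env b B ε s) (𝓝[>] 0) atTop := by
  have hs1 : 1 < |s| := by
    by_contra hc
    exact hs (abs_le.1 (not_lt.1 hc))
  have h1 : Tendsto (fun ε : ℝ => B 0 - |b 0| + (|s| - 1) ^ 2 / 2 * ε⁻¹) (𝓝[>] 0) atTop :=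
    tendsto_atTop_add_const_left _ _ (tendsto_inv_nhdsGT_zero.const_mul_atTop
      (by have := sub_pos.2 hs1; positivity))
  refine tendsto_atTop_mono' _ ?_ h1
  filter_upwards [self_mem_nhdsWithin] with ε hε
  have hε : 0 < ε := hε
  have hr := h.res_mem hε s
  rw [h.env_eq hε]
  refine add_le_add (h.lower_bound hr) ?_
  have h2 : (|s| - 1) ^ 2 ≤ (s - res b ε s) ^ 2 := by
    rw [← sq_abs (s - res b ε s)]
    refine pow_le_pow_left₀ (by linarith) ?_ 2
    have := abs_sub_abs_le_abs_sub s (res b ε s)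
    linarith [abs_lt.2 hr]
  rw [div_mul_eq_mul_div, div_eq_mul_inv _ (2 * ε), mul_inv, div_eq_mul_inv]
  have h3 : 0 < ε⁻¹ := inv_pos.2 hε
  nlinarith

/-- The potential has limits at all points of `[-1, 1]`. -/
lemma exists_tendsto (h : SingularPotential b B) {s : ℝ} (hs : s ∈ Icc (-1) 1) :
    ∃ l : EReal, Tendsto (fun t => (B t : EReal)) (𝓝[Ioo (-1) 1] s) (𝓝 l) := by
  have hc : ∀ t ∈ Ioo (-1 : ℝ) 1, ContinuousAt B t := fun t ht => (h.hasDeriv t ht).continuousAt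
  rcases eq_or_lt_of_le hs.1 with h1 | h1
  · rw [← h1]
    -- Near -1 the derivative b is nonpositive, so B is antitone there and has a one-sided limit in
    -- the extended reals.
    obtain ⟨c, hc1, hcs⟩ := mem_nhdsGT_iff_exists_Ioo_subset.1
      (inter_mem (h.bot (Iic_mem_atBot 0)) (Ioo_mem_nhdsGT (show (-1 : ℝ) < 1 by norm_num)))
    have hc1 : -1 < c := hc1
    have hanti : AntitoneOn B (Ioo (-1) c) := by
      refine antitoneOn_of_deriv_nonpos (convex_Ioo _ _)
        (fun t ht => (hc t (hcs ht).2).continuousWithinAt) ?_ ?_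
      · rw [interior_Ioo]
        exact fun t ht => (h.hasDeriv t (hcs ht).2).differentiableAt.differentiableWithinAt
      · rw [interior_Ioo]
        intro t ht
        rw [(h.hasDeriv t (hcs ht).2).deriv]
        exact (hcs ht).1
    have hanti' : AntitoneOn (fun t => (B t : EReal)) (Ioo (-1) c) := fun x hx y hy hxy =>
      EReal.coe_le_coe_iff.2 (hanti hx hy hxy)
    rw [nhdsWithin_Ioo_eq_nhdsGT (by norm_num)]
    exact ⟨_, hanti'.tendsto_nhdsWithin_Ioo_right (nonempty_Ioo.2 hc1) (OrderTop.bddAbove _)⟩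
  rcases eq_or_lt_of_le hs.2 with h2 | h2
  · rw [h2]
    obtain ⟨c, hc1, hcs⟩ := mem_nhdsLT_iff_exists_Ioo_subset.1
      (inter_mem (h.top (Ici_mem_atTop 0)) (Ioo_mem_nhdsLT (show (-1 : ℝ) < 1 by norm_num)))
    have hc1 : c < 1 := hc1
    have hmono : MonotoneOn B (Ioo c 1) := by
      refine monotoneOn_of_deriv_nonneg (convex_Ioo _ _)
        (fun t ht => (hc t (hcs ht).2).continuousWithinAt) ?_ ?_
      · rw [interior_Ioo]
        exact fun t ht => (h.hasDeriv t (hcs ht).2).differentiableAt.differentiableWithinAt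
      · rw [interior_Ioo]
        intro t ht
        rw [(h.hasDeriv t (hcs ht).2).deriv]
        exact (hcs ht).1
    have hmono' : MonotoneOn (fun t => (B t : EReal)) (Ioo c 1) := fun x hx y hy hxy =>
      EReal.coe_le_coe_iff.2 (hmono hx hy hxy)
    rw [nhdsWithin_Ioo_eq_nhdsLT (by norm_num)]
    exact ⟨_, hmono'.tendsto_nhdsWithin_Ioo_left (nonempty_Ioo.2 hc1) (OrderTop.bddAbove _)⟩
  · exact ⟨_, (continuous_coe_real_ereal.tendsto _).comp
      ((hc s ⟨h1, h2⟩).tendsto.mono_left nhdsWithin_le_nhds)⟩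

end SingularPotential

end NonlocalCH

/-! ### Convex splitting and the extended potential -/

namespace NonlocalCH

lemma contDiffOn_two_facts {f : ℝ → ℝ} (hf : ContDiffOn ℝ 2 f (Ioo (-1) 1)) {s : ℝ}
    (hs : s ∈ Ioo (-1) 1) :
    HasDerivAt f (deriv f s) s ∧ HasDerivAt (deriv f) (iteratedDeriv 2 f s) s := by
  have h1 : DifferentiableOn ℝ f (Ioo (-1) 1) := hf.differentiableOn (by simp)
  have h2 : ContDiffOn ℝ 1 (deriv f) (Ioo (-1) 1) := hf.deriv_of_isOpen isOpen_Ioo (by norm_num)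
  have h3 : DifferentiableOn ℝ (deriv f) (Ioo (-1) 1) := h2.differentiableOn (by simp)
  refine ⟨(h1.differentiableAt (isOpen_Ioo.mem_nhds hs)).hasDerivAt, ?_⟩
  rw [iteratedDeriv_succ, iteratedDeriv_one]
  exact (h3.differentiableAt (isOpen_Ioo.mem_nhds hs)).hasDerivAt

/-- The choice κ = α₁ + min F₂'' works on both sides: F'' ≥ κ makes F' - κ s nondecreasing, while a
+ κ ≥ α₁ + β + min F₂'' > 0 is the strict convexity assumption. -/
lemma IsAdmissiblePotential.exists_singular {d : ℕ} {Ω : Set (E d)} {J : E d → ℝ} {q : ℕ}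
    {F₁ F₂ F : ℝ → ℝ} (hF : F = fun s => F₁ s + F₂ s) (h : IsAdmissiblePotential Ω J q F₁ F₂) :
    ∃ κ c : ℝ, 0 < c ∧ (∀ᵐ x ∂volume.restrict Ω, c ≤ aFun Ω J x + κ) ∧
      SingularPotential (fun s => deriv F s - κ * s) (fun s => F s - κ / 2 * s ^ 2) := by
  obtain ⟨α₁, β, m, hm, hpos, hα, hβ⟩ := h.convex
  have g1 : ContDiffOn ℝ 2 F₁ (Ioo (-1) 1) :=
    h.smooth₁.of_le (by exact_mod_cast Nat.le_add_right 2 (2 * q))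
  have g2 : ContDiffOn ℝ 2 F₂ (Ioo (-1) 1) := h.smooth₂.mono Ioo_subset_Icc_self
  have hd : ∀ s ∈ Ioo (-1 : ℝ) 1, HasDerivAt F (deriv F s) s ∧
      HasDerivAt (deriv F) (iteratedDeriv 2 F₁ s + iteratedDeriv 2 F₂ s) s := by
    intro s hs
    have e1 : ∀ t ∈ Ioo (-1 : ℝ) 1, HasDerivAt F (deriv F₁ t + deriv F₂ t) t := fun t ht => by
      rw [hF]; exact (contDiffOn_two_facts g1 ht).1.add (contDiffOn_two_facts g2 ht).1
    refine ⟨(e1 s hs).differentiableAt.hasDerivAt, ?_⟩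
    have e2 : deriv F =ᶠ[𝓝 s] fun t => deriv F₁ t + deriv F₂ t := by
      filter_upwards [isOpen_Ioo.mem_nhds hs] with t ht using (e1 t ht).deriv
    exact ((contDiffOn_two_facts g1 hs).2.add (contDiffOn_two_facts g2 hs).2).congr_of_eventuallyEq
      e2
  have hm2 : ∀ s ∈ Ioo (-1 : ℝ) 1, m ≤ iteratedDeriv 2 F₂ s := fun s hs => by
    have e : iteratedDerivWithin 2 F₂ (Icc (-1) 1) s = iteratedDeriv 2 F₂ s := by
      exact iteratedDerivWithin_eq_iteratedDeriv (uniqueDiffOn_Icc (by norm_num))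
        (h.smooth₂.contDiffAt (Icc_mem_nhds hs.1 hs.2)) (Ioo_subset_Icc_self hs)
    rw [← e]
    exact hm.2 ⟨s, Ioo_subset_Icc_self hs, rfl⟩
  refine ⟨α₁ + m, α₁ + β + m, by linarith, ?_, ?_⟩
  · filter_upwards [hβ] with x hx
    linarith
  have hb : ∀ s ∈ Ioo (-1 : ℝ) 1, HasDerivAt (fun s => deriv F s - (α₁ + m) * s)
      (iteratedDeriv 2 F₁ s + iteratedDeriv 2 F₂ s - (α₁ + m) * 1) s := fun s hs =>
    (hd s hs).2.sub ((hasDerivAt_id s).const_mul _)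
  refine ⟨fun s hs => (hb s hs).continuousAt.continuousWithinAt, ?_, ?_, ?_, ?_⟩
  · refine monotoneOn_of_deriv_nonneg (convex_Ioo _ _)
      (fun s hs => (hb s hs).continuousAt.continuousWithinAt) ?_ ?_
    · rw [interior_Ioo]
      exact fun s hs => (hb s hs).differentiableAt.differentiableWithinAt
    · rw [interior_Ioo]
      intro s hs
      rw [(hb s hs).deriv]
      linarith [hα s hs, hm2 s hs]
  · have h1 := h.deriv_right
    rw [← hF] at h1
    refine h1.atTop_add (C := -((α₁ + m) * 1)) ?_
    exact ((continuous_const.mul continuous_id).neg.tendsto 1).mono_left nhdsWithin_le_nhds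
  · have h1 := h.deriv_left
    rw [← hF] at h1
    refine h1.atBot_add (C := -((α₁ + m) * (-1))) ?_
    exact ((continuous_const.mul continuous_id).neg.tendsto (-1)).mono_left nhdsWithin_le_nhds
  · intro s hs
    refine ((hd s hs).1.sub ((hasDerivAt_pow 2 s).const_mul ((α₁ + m) / 2))).congr_deriv ?_
    push_cast
    ring

lemma extPotential_of_tendsto {F : ℝ → ℝ} {s : ℝ} (hs : s ∈ Icc (-1) 1) {l : EReal}
    (hl : Tendsto (fun t => (F t : EReal)) (𝓝[Ioo (-1) 1] s) (𝓝 l)) : extPotential F s = l := by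
  rw [extPotential, if_pos hs]
  exact extendFrom_eq (by rwa [closure_Ioo (by norm_num)]) hl

lemma tendsto_ereal_add_coe {ι : Type*} {f : Filter ι} {u : ι → EReal} {v : ι → ℝ} {a : EReal}
    {b : ℝ} (hu : Tendsto u f (𝓝 a)) (hv : Tendsto v f (𝓝 b)) :
    Tendsto (fun i => u i + (v i : EReal)) f (𝓝 (a + b)) :=
  (EReal.continuousAt_add (p := (a, (b : EReal))) (Or.inr (EReal.coe_ne_bot b))
    (Or.inr (EReal.coe_ne_top b))).tendsto.comp
    (hu.prodMk_nhds ((continuous_coe_real_ereal.tendsto b).comp hv))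

namespace SingularPotential

variable {F : ℝ → ℝ} {κ : ℝ} {b : ℝ → ℝ}

/-- The regularized potentials converge to the extended potential. -/
lemma tendsto_extPotential (h : SingularPotential b (fun s => F s - κ / 2 * s ^ 2)) (s : ℝ) :
    Tendsto (fun ε => ((env b (fun s => F s - κ / 2 * s ^ 2) ε s + κ / 2 * s ^ 2 : ℝ) : EReal))
      (𝓝[>] 0) (𝓝 (extPotential F s)) := by
  by_cases hs : s ∈ Icc (-1 : ℝ) 1
  · obtain ⟨l, hl⟩ := h.exists_tendsto hs
    have h1 : Tendsto (fun t => (F t : EReal)) (𝓝[Ioo (-1) 1] s)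
        (𝓝 (l + ((κ / 2 * s ^ 2 : ℝ) : EReal))) := by
      have h2 : Tendsto (fun t : ℝ => κ / 2 * t ^ 2) (𝓝[Ioo (-1) 1] s) (𝓝 (κ / 2 * s ^ 2)) :=
        (Continuous.tendsto (by fun_prop) s).mono_left nhdsWithin_le_nhds
      refine (tendsto_ereal_add_coe hl h2).congr fun t => ?_
      rw [← EReal.coe_add, sub_add_cancel]
    rw [extPotential_of_tendsto hs h1]
    simp only [EReal.coe_add]
    exact tendsto_ereal_add_coe (h.tendsto_env hs hl) tendsto_const_nhds
  · have e : extPotential F s = ⊤ := by rw [extPotential, if_neg hs]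
    rw [e]
    exact EReal.tendsto_coe_nhds_top_iff.2
      (tendsto_atTop_add_const_right _ _ (h.tendsto_env_atTop hs))

/-- The envelopes are bounded below uniformly in ε. Excluding -∞ lets convergence in the extended
reals pass to real values. -/
lemma extPotential_ne_bot (h : SingularPotential b (fun s => F s - κ / 2 * s ^ 2)) (s : ℝ) :
    extPotential F s ≠ ⊥ := by
  have h1 := ge_of_tendsto (h.tendsto_extPotential s) (b := ((F 0 - κ / 2 * 0 ^ 2 - |b 0|
    + κ / 2 * s ^ 2 : ℝ) : EReal)) (by
      filter_upwards [self_mem_nhdsWithin] with ε hε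
      exact EReal.coe_le_coe_iff.2 (add_le_add_left (h.env_lower hε s) _))
  exact fun hc => by rw [hc, le_bot_iff] at h1; exact EReal.coe_ne_bot _ h1

end SingularPotential

end NonlocalCH

/-! ### Multiplication and convolution operators on L²(Ω) -/

namespace NonlocalCH

/-- Weighted Cauchy–Schwarz: ∫ (u - t)² k is a nonnegative quadratic polynomial in t, so its
discriminant is not positive. -/
lemma sq_integral_mul_le {X : Type*} [MeasurableSpace X] {μ : Measure X} {k u : X → ℝ}
    (hk : 0 ≤ k) (h0 : Integrable k μ) (h1 : Integrable (fun x => u x * k x) μ)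
    (h2 : Integrable (fun x => u x ^ 2 * k x) μ) :
    (∫ x, u x * k x ∂μ) ^ 2 ≤ (∫ x, k x ∂μ) * ∫ x, u x ^ 2 * k x ∂μ := by
  have key : ∀ t : ℝ, 0 ≤ (∫ x, k x ∂μ) * (t * t) + (-(2 * ∫ x, u x * k x ∂μ)) * t
      + ∫ x, u x ^ 2 * k x ∂μ := fun t => by
    have i1 : Integrable (fun x => t * t * k x) μ := h0.const_mul _
    have i2 : Integrable (fun x => 2 * t * (u x * k x)) μ := h1.const_mul _
    have i3 : Integrable (fun x => t * t * k x - 2 * t * (u x * k x)) μ := i1.sub i2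
    have e : ∫ x, (t * t * k x - 2 * t * (u x * k x) + u x ^ 2 * k x) ∂μ
        = (∫ x, k x ∂μ) * (t * t) + (-(2 * ∫ x, u x * k x ∂μ)) * t + ∫ x, u x ^ 2 * k x ∂μ := by
      rw [integral_add i3 h2, integral_sub i1 i2, integral_const_mul, integral_const_mul]
      ring
    rw [← e]
    refine integral_nonneg fun x => ?_
    have : t * t * k x - 2 * t * (u x * k x) + u x ^ 2 * k x = (u x - t) ^ 2 * k x := by ring
    rw [Pi.zero_apply, this]
    exact mul_nonneg (sq_nonneg _) (hk x)
  have h := discrim_le_zero key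
  rw [discrim] at h
  nlinarith

section Operators

variable {X : Type*} [MeasurableSpace X] {μ : Measure X} {F : Type*} [NormedAddCommGroup F]
  [InnerProductSpace ℝ F]

lemma norm_sq_toLp_eq_integral {f : X → F} (hf : MemLp f 2 μ) :
    ‖hf.toLp f‖ ^ 2 = ∫ x, ‖f x‖ ^ 2 ∂μ := by
  rw [← real_inner_self_eq_norm_sq, L2.inner_def]
  refine integral_congr_ae ?_
  filter_upwards [hf.coeFn_toLp] with x hx
  rw [hx, real_inner_self_eq_norm_sq]

lemma norm_sq_Lp (f : Lp F 2 μ) : ‖f‖ ^ 2 = ∫ x, ‖f x‖ ^ 2 ∂μ := by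
  conv_lhs => rw [← Lp.toLp_coeFn f (Lp.memLp f)]
  exact norm_sq_toLp_eq_integral (Lp.memLp f)

lemma integrable_norm_sq_Lp (f : Lp F 2 μ) : Integrable (fun x => ‖f x‖ ^ 2) μ :=
  (memLp_two_iff_integrable_sq_norm (Lp.memLp f).1).1 (Lp.memLp f)

/-- A linear operator on `L²` that is bounded, given by its pointwise values. -/
lemma exists_clm_of_memLp {Φ : Lp ℝ 2 μ → X → F} {C : ℝ} (hC : 0 ≤ C) (hm : ∀ u, MemLp (Φ u) 2 μ)
    (hadd : ∀ u v, Φ (u + v) =ᵐ[μ] fun x => Φ u x + Φ v x)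
    (hsmul : ∀ (c : ℝ) u, Φ (c • u) =ᵐ[μ] fun x => c • Φ u x)
    (hb : ∀ u, ∫ x, ‖Φ u x‖ ^ 2 ∂μ ≤ C ^ 2 * ‖u‖ ^ 2) :
    ∃ A : Lp ℝ 2 μ →L[ℝ] Lp F 2 μ, ∀ u, A u =ᵐ[μ] Φ u := by
  refine ⟨LinearMap.mkContinuous
    { toFun := fun u => (hm u).toLp _
      map_add' := fun u v => ?_
      map_smul' := fun c u => ?_ } C fun u => ?_, fun u => (hm u).coeFn_toLp⟩
  · rw [← MemLp.toLp_add]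
    exact MemLp.toLp_congr _ _ (hadd u v)
  · rw [RingHom.id_apply, ← MemLp.toLp_const_smul]
    exact MemLp.toLp_congr _ _ (hsmul c u)
  · refine le_of_sq_le_sq ?_ (by positivity)
    rw [mul_pow]
    change ‖(hm u).toLp _‖ ^ 2 ≤ _
    rw [norm_sq_toLp_eq_integral]
    exact hb u

/-- Multiplication by a bounded function. -/
lemma exists_mul_clm {k : X → ℝ} (hk : AEStronglyMeasurable k μ) {C : ℝ} (hC : 0 ≤ C)
    (hb : ∀ x, ‖k x‖ ≤ C) : ∃ A : Lp ℝ 2 μ →L[ℝ] Lp ℝ 2 μ, ∀ u, A u =ᵐ[μ] fun x => k x * u x := by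
  have hm : ∀ u : Lp ℝ 2 μ, MemLp (fun x => k x * u x) 2 μ := fun u =>
    (Lp.memLp u).of_le_mul (hk.mul (Lp.memLp u).1) (Eventually.of_forall fun x => by
      rw [norm_mul]; exact mul_le_mul_of_nonneg_right (hb x) (norm_nonneg _))
  refine exists_clm_of_memLp hC hm (fun u v => ?_) (fun c u => ?_) fun u => ?_
  · filter_upwards [Lp.coeFn_add u v] with x hx
    rw [hx, Pi.add_apply, mul_add]
  · filter_upwards [Lp.coeFn_smul c u] with x hx
    rw [hx, Pi.smul_apply, smul_eq_mul, smul_eq_mul, mul_left_comm]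
  · rw [norm_sq_Lp, ← integral_const_mul]
    refine integral_mono ((memLp_two_iff_integrable_sq_norm (hm u).1).1 (hm u))
      ((integrable_norm_sq_Lp u).const_mul _) fun x => ?_
    change ‖k x * u x‖ ^ 2 ≤ C ^ 2 * ‖u x‖ ^ 2
    rw [norm_mul, mul_pow]
    gcongr
    exact hb x

end Operators

section Convolution

variable {d : ℕ} {Ω : Set (E d)} {F : Type*} [NormedAddCommGroup F] [InnerProductSpace ℝ F]
  {k : E d → F}

lemma integrable_kernel_smul (hk : Integrable k) {f : E d → ℝ}
    (hf : Integrable f (volume.restrict Ω)) :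
    Integrable (fun p : E d × E d => f p.2 • k (p.1 - p.2))
      ((volume.restrict Ω).prod (volume.restrict Ω)) := by
  have h := hf.convolution_integrand (ContinuousLinearMap.lsmul ℝ ℝ) hk
  exact h.mono_measure (Measure.prod_mono Measure.restrict_le_self le_rfl)

lemma integrable_kernel_norm_mul (hk : Integrable k) {f : E d → ℝ}
    (hf : Integrable f (volume.restrict Ω)) :
    Integrable (fun p : E d × E d => f p.2 * ‖k (p.1 - p.2)‖)
      ((volume.restrict Ω).prod (volume.restrict Ω)) :=
  integrable_kernel_smul hk.norm hf

lemma integrable_kernel (hk : Integrable k) (x : E d) :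
    Integrable (fun y => k (x - y)) (volume.restrict Ω) :=
  (hk.comp_sub_left x).restrict

lemma integral_norm_kernel_le (hk : Integrable k) (x : E d) :
    ∫ y in Ω, ‖k (x - y)‖ ≤ ∫ z, ‖k z‖ := by
  rw [← integral_sub_left_eq_self (fun z => ‖k z‖) volume x]
  exact setIntegral_le_integral (hk.norm.comp_sub_left x)
    (Eventually.of_forall fun y => norm_nonneg _)

variable [IsFiniteMeasure (volume.restrict Ω)]

lemma ae_integrable_kernel_smul (hk : Integrable k) (u : H Ω) :
    ∀ᵐ x ∂volume.restrict Ω, Integrable (fun y => u y • k (x - y)) (volume.restrict Ω) :=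
  (integrable_kernel_smul hk ((Lp.memLp u).integrable one_le_two)).prod_right_ae

/-- The pointwise half of Young's inequality: Cauchy–Schwarz with weight ‖k(x - y)‖ leaves a
convolution of ‖k‖ with ‖u‖², whose integral Fubini's theorem controls. -/
lemma ae_norm_sq_kernel_le (hk : Integrable k) (u : H Ω) :
    ∀ᵐ x ∂volume.restrict Ω, ‖∫ y in Ω, u y • k (x - y)‖ ^ 2
      ≤ (∫ z, ‖k z‖) * ∫ y in Ω, ‖u y‖ ^ 2 * ‖k (x - y)‖ := by
  filter_upwards [ae_integrable_kernel_smul hk u,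
    (integrable_kernel_norm_mul hk (integrable_norm_sq_Lp u)).prod_right_ae] with x h1 h2
  have h3 : Integrable (fun y => ‖u y‖ * ‖k (x - y)‖) (volume.restrict Ω) :=
    h1.norm.congr (Eventually.of_forall fun y => norm_smul _ _)
  have h4 : ‖∫ y in Ω, u y • k (x - y)‖ ≤ ∫ y in Ω, ‖u y‖ * ‖k (x - y)‖ :=
    (norm_integral_le_integral_norm _).trans_eq (by simp only [norm_smul])
  refine (pow_le_pow_left₀ (norm_nonneg _) h4 2).trans
    ((sq_integral_mul_le (fun y => norm_nonneg _) (integrable_kernel hk x).norm h3 h2).trans ?_)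
  exact mul_le_mul_of_nonneg_right (integral_norm_kernel_le hk x)
    (integral_nonneg fun y => by positivity)

lemma aestronglyMeasurable_kernel (hk : Integrable k) (u : H Ω) :
    AEStronglyMeasurable (fun x => ∫ y in Ω, u y • k (x - y)) (volume.restrict Ω) :=
  (integrable_kernel_smul hk ((Lp.memLp u).integrable one_le_two)).1.integral_prod_right'

lemma integral_integral_kernel_le (hk : Integrable k) {f : E d → ℝ} (hf0 : 0 ≤ f)
    (hf : Integrable f (volume.restrict Ω)) :
    ∫ x in Ω, ∫ y in Ω, f y * ‖k (x - y)‖ ≤ (∫ z, ‖k z‖) * ∫ y in Ω, f y := by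
  have h := integrable_kernel_norm_mul hk hf
  rw [integral_integral_swap h, ← integral_const_mul]
  refine integral_mono h.integral_prod_right (hf.const_mul _) fun y => ?_
  change ∫ x in Ω, f y * ‖k (x - y)‖ ≤ (∫ z, ‖k z‖) * f y
  rw [integral_const_mul, mul_comm]
  refine mul_le_mul_of_nonneg_right ?_ (hf0 y)
  rw [← integral_sub_right_eq_self (fun z => ‖k z‖) y]
  exact setIntegral_le_integral (hk.norm.comp_sub_right y)
    (Eventually.of_forall fun y => norm_nonneg _)

/-- Young's inequality `L¹ * L² → L²`. -/
lemma exists_conv_clm (hk : Integrable k) :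
    ∃ A : H Ω →L[ℝ] Lp F 2 (volume.restrict Ω), ∀ u, A u =ᵐ[volume.restrict Ω]
      fun x => ∫ y in Ω, u y • k (x - y) := by
  have hsq : ∀ u : H Ω, Integrable (fun x => (∫ z, ‖k z‖) * ∫ y in Ω, ‖u y‖ ^ 2 * ‖k (x - y)‖)
      (volume.restrict Ω) := fun u =>
    (integrable_kernel_norm_mul hk (integrable_norm_sq_Lp u)).integral_prod_left.const_mul _
  have hint : ∀ u : H Ω, Integrable (fun x => ‖∫ y in Ω, u y • k (x - y)‖ ^ 2)
      (volume.restrict Ω) := fun u =>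
    (hsq u).mono' ((aestronglyMeasurable_kernel hk u).norm.pow 2) (by
      filter_upwards [ae_norm_sq_kernel_le hk u] with x hx
      rwa [norm_pow, norm_norm])
  refine exists_clm_of_memLp (C := ∫ z, ‖k z‖) (by positivity)
    (fun u => (memLp_two_iff_integrable_sq_norm (aestronglyMeasurable_kernel hk u)).2 (hint u))
    (fun u v => ?_) (fun c u => ?_) fun u => ?_
  · filter_upwards [ae_integrable_kernel_smul hk u, ae_integrable_kernel_smul hk v] with x h1 h2
    rw [← integral_add h1 h2]
    refine integral_congr_ae ?_
    filter_upwards [Lp.coeFn_add u v] with y hy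
    rw [hy, Pi.add_apply, add_smul]
  · refine Eventually.of_forall fun x => ?_
    change _ = c • ∫ y in Ω, u y • k (x - y)
    rw [← integral_smul]
    refine integral_congr_ae ?_
    filter_upwards [Lp.coeFn_smul c u] with y hy
    rw [hy, Pi.smul_apply, smul_eq_mul, mul_smul]
  · refine (integral_mono_ae (hint u) (hsq u) (ae_norm_sq_kernel_le hk u)).trans ?_
    rw [integral_const_mul, norm_sq_Lp, sq (∫ z, ‖k z‖), mul_assoc]
    exact mul_le_mul_of_nonneg_left
      (integral_integral_kernel_le hk (fun y => by positivity) (integrable_norm_sq_Lp u))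
      (by positivity)

end Convolution

section Kernel

variable {d : ℕ} {Ω : Set (E d)} {J : E d → ℝ}

lemma even_ae_sub (he : ∀ᵐ x, J (-x) = J x) (x : E d) :
    ∀ᵐ y ∂volume.restrict Ω, J (y - x) = J (x - y) := by
  have h := (Measure.measurePreserving_sub_left (volume : Measure (E d)) x).quasiMeasurePreserving.ae he
  filter_upwards [ae_restrict_of_ae h] with y hy
  rw [← hy, neg_sub]

lemma norm_aFun_le (hJ : Integrable J) (x : E d) : ‖aFun Ω J x‖ ≤ ∫ z, ‖J z‖ :=
  (norm_integral_le_integral_norm _).trans (integral_norm_kernel_le hJ x)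

variable [IsFiniteMeasure (volume.restrict Ω)]

lemma aestronglyMeasurable_aFun (hJ : Integrable J) :
    AEStronglyMeasurable (aFun Ω J) (volume.restrict Ω) := by
  have h := (integrable_kernel_smul hJ (integrable_const (1 : ℝ))
    (Ω := Ω)).1.integral_prod_right'
  exact h.congr (ae_of_all _ fun x => by simp only [one_smul, aFun])

lemma integral_kernel_mul_fderiv {G : E d → E d} (h : HasWeakGradient univ J G) {ψ : E d → ℝ}
    (h1 : ContDiff ℝ ∞ ψ) (h2 : HasCompactSupport ψ) (e : E d) (y : E d) :
    ∫ x, J (x - y) * fderiv ℝ ψ x e = -∫ x, inner ℝ (G (x - y)) e * ψ x := by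
  have h3 := h (fun z => ψ (z + y)) (h1.comp (contDiff_id.add contDiff_const))
    (h2.comp_homeomorph (Homeomorph.addRight y)) (subset_univ _) e
  simp only [Measure.restrict_univ, fderiv_comp_add_right] at h3
  rw [← integral_add_right_eq_self _ y, ← integral_add_right_eq_self (fun x => _ * ψ x) y]
  simpa only [add_sub_cancel_right] using h3

/-- Fubini's theorem moves the tested identity onto the kernel. As ψ is supported in Ω, the integral
in x extends to the whole space, where J has its weak gradient. -/
lemma hasWeakGradient_conv (hJ : Integrable J) {G : E d → E d} (hG : Integrable G)
    (h : HasWeakGradient univ J G) (u : H Ω) :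
    HasWeakGradient Ω (fun x => ∫ y in Ω, u y • J (x - y))
      (fun x => ∫ y in Ω, u y • G (x - y)) := by
  intro ψ h1 h2 h3 e
  have hu : Integrable u (volume.restrict Ω) := (Lp.memLp u).integrable one_le_two
  have cψ : Continuous fun x => fderiv ℝ ψ x e :=
    (h1.continuous_fderiv (by simp)).clm_apply continuous_const
  obtain ⟨C₀, hC₀⟩ := h1.continuous.bounded_above_of_compact_support h2
  obtain ⟨C₁, hC₁⟩ := cψ.bounded_above_of_compact_support (h2.fderiv_apply (𝕜 := ℝ) e)
  have i1 : Integrable (fun p : E d × E d => (u p.2 • J (p.1 - p.2)) * fderiv ℝ ψ p.1 e)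
      ((volume.restrict Ω).prod (volume.restrict Ω)) :=
    (integrable_kernel_smul hJ hu).mul_bdd (c := C₁)
      (cψ.comp continuous_fst).aestronglyMeasurable (Eventually.of_forall fun p => hC₁ p.1)
  have i2 : Integrable (fun p : E d × E d => inner ℝ (u p.2 • G (p.1 - p.2)) e * ψ p.1)
      ((volume.restrict Ω).prod (volume.restrict Ω)) :=
    ((integrable_kernel_smul hG hu).inner_const e).mul_bdd (c := C₀)
      (h1.continuous.comp continuous_fst).aestronglyMeasurable
      (Eventually.of_forall fun p => hC₀ p.1)
  have e1 : ∫ x in Ω, (∫ y in Ω, u y • J (x - y)) * fderiv ℝ ψ x e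
      = ∫ y in Ω, u y * ∫ x in Ω, J (x - y) * fderiv ℝ ψ x e := by
    simp only [← integral_mul_const, ← integral_const_mul]
    rw [integral_integral_swap i1]
    simp only [smul_eq_mul, mul_assoc]
  have e2 : ∫ x in Ω, inner ℝ (∫ y in Ω, u y • G (x - y)) e * ψ x
      = ∫ y in Ω, u y * ∫ x in Ω, inner ℝ (G (x - y)) e * ψ x := by
    have : ∫ x in Ω, inner ℝ (∫ y in Ω, u y • G (x - y)) e * ψ x
        = ∫ x in Ω, ∫ y in Ω, inner ℝ (u y • G (x - y)) e * ψ x := by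
      refine integral_congr_ae ?_
      filter_upwards [ae_integrable_kernel_smul hG u] with x hx
      rw [integral_mul_const, real_inner_comm, ← integral_inner hx]
      simp only [real_inner_comm e]
    rw [this, integral_integral_swap i2]
    simp only [real_inner_smul_left, mul_assoc, integral_const_mul]
  rw [e1, e2, ← integral_neg]
  refine integral_congr_ae (Eventually.of_forall fun y => ?_)
  have hψ : ∀ x, x ∉ Ω → ψ x = 0 := fun x hx =>
    image_eq_zero_of_notMem_tsupport fun h => hx (h3 h)
  have hψ' : ∀ x, x ∉ Ω → fderiv ℝ ψ x e = 0 := fun x hx => by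
    rw [fderiv_of_notMem_tsupport (𝕜 := ℝ) fun h => hx (h3 h), zero_apply]
  change u y * _ = -(u y * _)
  rw [setIntegral_eq_integral_of_forall_compl_eq_zero fun x hx => by rw [hψ' x hx, mul_zero],
    setIntegral_eq_integral_of_forall_compl_eq_zero fun x hx => by rw [hψ x hx, mul_zero],
    integral_kernel_mul_fderiv h h1 h2 e y, mul_neg]

/-- The convolution with a `W^{1,1}` kernel maps `L²(Ω)` to `H¹(Ω)`. -/
lemma exists_conv_toV (hJ : MemW11 J) :
    ∃ A : H Ω →L[ℝ] V Ω, ∀ u, toH Ω (A u) =ᵐ[volume.restrict Ω] conv Ω J u := by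
  obtain ⟨hJ, G, hG, h⟩ := hJ
  obtain ⟨A, hA⟩ := exists_conv_clm (Ω := Ω) hJ
  obtain ⟨B, hB⟩ := exists_conv_clm (Ω := Ω) hG
  have hw : ∀ u, HasWeakGradient Ω (A u) (B u) := fun u =>
    (hasWeakGradient_conv hJ hG h u).congr_ae (hA u).symm (hB u).symm
  refine ⟨((WithLp.prodContinuousLinearEquiv 2 ℝ (H Ω) (HVec Ω)).symm.toContinuousLinearMap.comp
    (A.prod B)).codRestrict (V Ω) hw, fun u => ?_⟩
  refine (hA u).trans (Eventually.of_forall fun x => ?_)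
  simp only [conv, smul_eq_mul, mul_comm]

/-- Domination by (u(y)² + v(x)²)|J(x - y)|, each term of which is integrable by Fubini. This
justifies the exchanges of integrals behind symmetry and the energy formula. -/
lemma integrable_kernel_mul_mul (hJ : Integrable J) (u v : H Ω) :
    Integrable (fun p : E d × E d => J (p.1 - p.2) * (u p.2 * v p.1))
      ((volume.restrict Ω).prod (volume.restrict Ω)) := by
  have i1 : Integrable (fun p : E d × E d => ‖u p.2‖ ^ 2 * ‖J (p.1 - p.2)‖)
      ((volume.restrict Ω).prod (volume.restrict Ω)) :=
    integrable_kernel_norm_mul hJ (integrable_norm_sq_Lp u)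
  have i2 : Integrable (fun p : E d × E d => ‖v p.1‖ ^ 2 * ‖J (-(p.2 - p.1))‖)
      ((volume.restrict Ω).prod (volume.restrict Ω)) :=
    (integrable_kernel_norm_mul hJ.comp_neg (integrable_norm_sq_Lp v)).swap
  refine (i1.add i2).mono' ?_ (ae_of_all _ fun p => ?_)
  · have h1 := (integrable_kernel_smul hJ (integrable_const (1 : ℝ)) (Ω := Ω)).1
    simp only [one_smul] at h1
    exact h1.mul ((Lp.memLp u).1.comp_snd.mul (Lp.memLp v).1.comp_fst)
  · change _ ≤ ‖u p.2‖ ^ 2 * ‖J (p.1 - p.2)‖ + ‖v p.1‖ ^ 2 * ‖J (-(p.2 - p.1))‖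
    rw [neg_sub, ← add_mul, mul_comm, norm_mul]
    refine mul_le_mul_of_nonneg_right ?_ (norm_nonneg _)
    rw [norm_mul]
    nlinarith [sq_nonneg (‖u p.2‖ - ‖v p.1‖), sq_nonneg ‖u p.2‖, sq_nonneg ‖v p.1‖]

lemma inner_conv_eq (u v : H Ω) {w : H Ω}
    (hw : w =ᵐ[volume.restrict Ω] conv Ω J u) :
    inner ℝ w v = ∫ x in Ω, ∫ y in Ω, J (x - y) * (u y * v x) := by
  rw [L2.inner_def]
  refine integral_congr_ae ?_
  filter_upwards [hw] with x hx
  rw [hx, RCLike.inner_apply, conj_trivial, conv, ← integral_const_mul]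
  refine integral_congr_ae (ae_of_all _ fun y => ?_)
  change v x * (J (x - y) * u y) = _
  ring

lemma integral_kernel_symm (he : ∀ᵐ x, J (-x) = J x) {f : E d → E d → ℝ}
    (hf : Integrable (fun p : E d × E d => J (p.1 - p.2) * f p.1 p.2)
      ((volume.restrict Ω).prod (volume.restrict Ω))) :
    ∫ x in Ω, ∫ y in Ω, J (x - y) * f x y = ∫ x in Ω, ∫ y in Ω, J (x - y) * f y x := by
  rw [integral_integral_swap hf]
  refine integral_congr_ae (ae_of_all _ fun x => integral_congr_ae ?_)
  filter_upwards [even_ae_sub he x] with y hy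
  rw [hy]

lemma inner_conv_symm (hJ : Integrable J) (he : ∀ᵐ x, J (-x) = J x) {A : H Ω → H Ω}
    (hA : ∀ u, A u =ᵐ[volume.restrict Ω] conv Ω J u) (u v : H Ω) :
    inner ℝ (A u) v = inner ℝ u (A v) := by
  rw [real_inner_comm _ u, inner_conv_eq u v (hA u), inner_conv_eq v u (hA v),
    integral_kernel_symm he (f := fun x y => u y * v x) (integrable_kernel_mul_mul hJ u v)]
  simp only [mul_comm]

/-- The interaction energy as a quadratic form. -/
lemma interaction_eq (hJ : Integrable J) (he : ∀ᵐ x, J (-x) = J x) {A : H Ω → H Ω}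
    (hA : ∀ u, A u =ᵐ[volume.restrict Ω] conv Ω J u) (u : H Ω) :
    1 / 4 * (∫ x in Ω, ∫ y in Ω, J (x - y) * (u x - u y) ^ 2)
      = 1 / 2 * ((∫ x in Ω, aFun Ω J x * u x ^ 2) - inner ℝ (A u) u) := by
  have hsq : Integrable (fun x => u x ^ 2) (volume.restrict Ω) :=
    (integrable_norm_sq_Lp u).congr (ae_of_all _ fun x => by
      change ‖u x‖ ^ 2 = u x ^ 2
      rw [Real.norm_eq_abs, sq_abs])
  have i1 : Integrable (fun p : E d × E d => J (p.1 - p.2) * u p.2 ^ 2)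
      ((volume.restrict Ω).prod (volume.restrict Ω)) :=
    (integrable_kernel_smul hJ hsq).congr (ae_of_all _ fun p => mul_comm _ _)
  have i2 : Integrable (fun p : E d × E d => J (p.1 - p.2) * u p.1 ^ 2)
      ((volume.restrict Ω).prod (volume.restrict Ω)) := by
    refine (integrable_kernel_smul hJ.comp_neg hsq).swap.congr (ae_of_all _ fun p => ?_)
    change u p.1 ^ 2 • J (-(p.2 - p.1)) = _
    rw [neg_sub, smul_eq_mul, mul_comm]
  have i3 : Integrable (fun p : E d × E d => J (p.1 - p.2) * (u p.2 * u p.1))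
      ((volume.restrict Ω).prod (volume.restrict Ω)) := integrable_kernel_mul_mul hJ u u
  have i4 : Integrable (fun p : E d × E d => J (p.1 - p.2) * u p.1 ^ 2
      + J (p.1 - p.2) * u p.2 ^ 2) ((volume.restrict Ω).prod (volume.restrict Ω)) := i2.add i1
  have e1 : ∫ x in Ω, ∫ y in Ω, J (x - y) * (u x - u y) ^ 2
      = (∫ x in Ω, ∫ y in Ω, (J (x - y) * u x ^ 2 + J (x - y) * u y ^ 2))
        - 2 * ∫ x in Ω, ∫ y in Ω, J (x - y) * (u y * u x) := by
    have i5 : Integrable (fun p : E d × E d => J (p.1 - p.2) * u p.1 ^ 2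
      + J (p.1 - p.2) * u p.2 ^ 2 - 2 * (J (p.1 - p.2) * (u p.2 * u p.1)))
      ((volume.restrict Ω).prod (volume.restrict Ω)) := i4.sub (i3.const_mul 2)
    have e0 : ∫ x in Ω, ∫ y in Ω, J (x - y) * (u x - u y) ^ 2
        = ∫ x in Ω, ∫ y in Ω, (J (x - y) * u x ^ 2 + J (x - y) * u y ^ 2
          - 2 * (J (x - y) * (u y * u x))) := by
      congr! 4
      ring
    rw [e0, integral_integral i5, integral_integral i4, integral_integral i3,
      ← integral_const_mul, ← integral_sub i4 (i3.const_mul 2)]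
  have e2 : ∫ x in Ω, ∫ y in Ω, (J (x - y) * u x ^ 2 + J (x - y) * u y ^ 2)
      = (∫ x in Ω, ∫ y in Ω, J (x - y) * u x ^ 2) + ∫ x in Ω, ∫ y in Ω, J (x - y) * u y ^ 2 := by
    rw [integral_integral i4, integral_integral i2, integral_integral i1, ← integral_add i2 i1]
  have e3 : ∫ x in Ω, ∫ y in Ω, J (x - y) * u y ^ 2 = ∫ x in Ω, ∫ y in Ω, J (x - y) * u x ^ 2 :=
    integral_kernel_symm he (f := fun x y => u y ^ 2) i1
  have e4 : ∫ x in Ω, ∫ y in Ω, J (x - y) * u x ^ 2 = ∫ x in Ω, aFun Ω J x * u x ^ 2 := by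
    simp only [integral_mul_const, aFun]
  rw [e1, e2, e3, e4, inner_conv_eq u u (hA u)]
  ring

end Kernel

end NonlocalCH

/-! ### Nemytskii operators and convergence of the potential energies -/

namespace NonlocalCH

namespace SingularPotential

variable {X : Type*} [MeasurableSpace X] {μ : Measure X} [IsFiniteMeasure μ] {b B : ℝ → ℝ}

lemma memLp_yos (h : SingularPotential b B) {ε : ℝ} (hε : 0 < ε) {u : X → ℝ} (hu : MemLp u 2 μ) :
    MemLp (fun x => yos b ε (u x)) 2 μ := by
  have h1 : MemLp (fun x => yos b ε (u x) - yos b ε 0) 2 μ :=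
    hu.of_le_mul (c := ε⁻¹) (((h.continuous_yos hε).comp_aestronglyMeasurable hu.1).sub
      aestronglyMeasurable_const) (ae_of_all _ fun x => by
        have := h.yos_lipschitz hε (u x) 0
        rwa [sub_zero] at this)
  exact (h1.add (memLp_const (yos b ε 0))).ae_eq (ae_of_all _ fun x => sub_add_cancel _ _)

/-- The Nemytskii operator of the Yosida approximation on `L²`. -/
noncomputable def yosL (μ : Measure X) (b : ℝ → ℝ) (ε : ℝ) (u : Lp ℝ 2 μ) : Lp ℝ 2 μ :=
  open Classical in if h : MemLp (fun x => yos b ε (u x)) 2 μ then h.toLp _ else 0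

lemma coeFn_yosL (h : SingularPotential b B) {ε : ℝ} (hε : 0 < ε) (u : Lp ℝ 2 μ) :
    yosL μ b ε u =ᵐ[μ] fun x => yos b ε (u x) := by
  have h1 := h.memLp_yos hε (Lp.memLp u)
  rw [yosL, dif_pos h1]
  exact h1.coeFn_toLp

lemma integrable_env (h : SingularPotential b B) {ε : ℝ} (hε : 0 < ε) {u : X → ℝ}
    (hu : MemLp u 2 μ) : Integrable (fun x => env b B ε (u x)) μ := by
  have h0 : Integrable (fun x => |B 0 - abs (b 0)| + |B 0| + u x ^ 2 / (2 * ε)) μ :=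
    (integrable_const _).add (hu.integrable_sq.div_const _)
  refine h0.mono' ((h.continuous_env hε).comp_aestronglyMeasurable hu.1) (ae_of_all _ fun x => ?_)
  have h1 := h.env_lower hε (u x)
  have h2 := h.env_le hε (u x) (t := 0) (by simp)
  rw [sub_zero] at h2
  have h3 : 0 ≤ u x ^ 2 / (2 * ε) := by positivity
  rw [Real.norm_eq_abs, abs_le]
  constructor
  · linarith [neg_abs_le (B 0 - |b 0|), abs_nonneg (B 0)]
  · linarith [le_abs_self (B 0), abs_nonneg (B 0 - |b 0|)]

lemma yosL_mono (h : SingularPotential b B) {ε δ : ℝ} (hε : 0 < ε) (hδ : 0 < δ) (u v : Lp ℝ 2 μ) :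
    0 ≤ inner ℝ (yosL μ b ε u - yosL μ b δ v)
      ((u - ε • yosL μ b ε u) - (v - δ • yosL μ b δ v)) := by
  rw [L2.inner_def]
  refine integral_nonneg_of_ae ?_
  filter_upwards [h.coeFn_yosL hε u, h.coeFn_yosL hδ v,
    Lp.coeFn_sub (yosL μ b ε u) (yosL μ b δ v),
    Lp.coeFn_sub (u - ε • yosL μ b ε u) (v - δ • yosL μ b δ v),
    Lp.coeFn_sub u (ε • yosL μ b ε u), Lp.coeFn_sub v (δ • yosL μ b δ v),
    Lp.coeFn_smul ε (yosL μ b ε u), Lp.coeFn_smul δ (yosL μ b δ v)] with x h1 h2 h3 h4 h5 h6 h7 h8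
  rw [h3, h4, Pi.sub_apply, Pi.sub_apply, h5, h6, Pi.sub_apply, Pi.sub_apply, h7, h8,
    Pi.smul_apply, Pi.smul_apply, h1, h2, RCLike.inner_apply, conj_trivial, mul_comm]
  exact h.yos_mono hε hδ _ _

lemma yosL_resolvent (h : SingularPotential b B) {ε δ : ℝ} (hε : 0 < ε) (hδ : 0 < δ)
    (u : Lp ℝ 2 μ) : yosL μ b δ (u + (δ - ε) • yosL μ b ε u) = yosL μ b ε u := by
  refine Lp.ext ?_
  filter_upwards [h.coeFn_yosL hδ (u + (δ - ε) • yosL μ b ε u), h.coeFn_yosL hε u,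
    Lp.coeFn_add u ((δ - ε) • yosL μ b ε u), Lp.coeFn_smul (δ - ε) (yosL μ b ε u)]
    with x h1 h2 h3 h4
  rw [h1, h3, Pi.add_apply, h4, Pi.smul_apply, h2]
  exact h.yos_resolvent hε hδ _

lemma yosL_subgrad (h : SingularPotential b B) {ε : ℝ} (hε : 0 < ε) (u v : Lp ℝ 2 μ) :
    (∫ x, env b B ε (u x) ∂μ) + inner ℝ (yosL μ b ε u) (v - u) ≤ ∫ x, env b B ε (v x) ∂μ := by
  rw [L2.inner_def, ← integral_add (h.integrable_env hε (Lp.memLp u))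
    (L2.integrable_inner (𝕜 := ℝ) (yosL μ b ε u) (v - u))]
  refine integral_mono_ae ((h.integrable_env hε (Lp.memLp u)).add
    (L2.integrable_inner (𝕜 := ℝ) (yosL μ b ε u) (v - u))) (h.integrable_env hε (Lp.memLp v)) ?_
  filter_upwards [h.coeFn_yosL hε u, Lp.coeFn_sub v u] with x h1 h2
  rw [h1, h2, Pi.sub_apply, RCLike.inner_apply, conj_trivial, mul_comm]
  exact h.env_subgrad hε _ _

lemma integral_env_anti (h : SingularPotential b B) {ε δ : ℝ} (hε : 0 < ε) (hεδ : ε ≤ δ)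
    {u : X → ℝ} (hu : MemLp u 2 μ) :
    ∫ x, env b B δ (u x) ∂μ ≤ ∫ x, env b B ε (u x) ∂μ :=
  integral_mono (h.integrable_env (hε.trans_le hεδ) hu) (h.integrable_env hε hu)
    fun x => h.env_anti hε hεδ (u x)

lemma integral_env_coercive (h : SingularPotential b B) {ε δ : ℝ} (hε : 0 < ε) (hεδ : ε ≤ δ)
    (u : Lp ℝ 2 μ) :
    (B 0 - |b 0| - 1 / (2 * δ)) * μ.real univ + ‖u‖ ^ 2 / (4 * δ) ≤ ∫ x, env b B ε (u x) ∂μ := by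
  have hδ := hε.trans_le hεδ
  have i2 : Integrable (fun x => ‖u x‖ ^ 2 / (4 * δ)) μ := (integrable_norm_sq_Lp u).div_const _
  have e : ∫ x, (B 0 - |b 0| - 1 / (2 * δ) + ‖u x‖ ^ 2 / (4 * δ)) ∂μ
      = (B 0 - |b 0| - 1 / (2 * δ)) * μ.real univ + ‖u‖ ^ 2 / (4 * δ) := by
    rw [integral_add (integrable_const _) i2, integral_const, integral_div, norm_sq_Lp,
      smul_eq_mul, mul_comm]
  rw [← e]
  refine (integral_mono ((integrable_const _).add i2) (h.integrable_env hδ (Lp.memLp u))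
    fun x => ?_).trans (h.integral_env_anti hε hεδ (Lp.memLp u))
  refine le_trans (le_of_eq ?_) (h.env_coercive hδ (u x))
  change B 0 - |b 0| - 1 / (2 * δ) + ‖u x‖ ^ 2 / (4 * δ) = _
  rw [Real.norm_eq_abs, sq_abs]
  field_simp
  ring

/-- The Yosida approximations are dominated by the limit. -/
lemma abs_yos_le (h : SingularPotential b B) {ε : ℝ} (hε : 0 < ε) {s : ℝ} (hs : s ∈ Ioo (-1) 1) :
    |yos b ε s| ≤ |b s| := by
  -- Monotonicity between the resolvent of s with parameter ε and s itself, which is the resolvent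
  -- of s + b(s) with parameter 1.
  have h1 := h.yos_mono hε one_pos s (s + b s)
  rw [h.yos_one_iff.2 ⟨hs, rfl⟩] at h1
  have h2 : 0 ≤ (yos b ε s - b s) * -yos b ε s := by
    have : ε * ((yos b ε s - b s) * -yos b ε s)
        = (yos b ε s - b s) * (s - ε * yos b ε s - (s + b s - 1 * b s)) := by ring
    exact nonneg_of_mul_nonneg_right (this ▸ h1) hε
  have h3 : |yos b ε s| * |yos b ε s| ≤ |b s| * |yos b ε s| := by
    rw [abs_mul_abs_self, ← abs_mul]
    exact le_trans (by linarith) (le_abs_self _)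
  rcases (abs_nonneg (yos b ε s)).eq_or_lt with h4 | h4
  · rw [← h4]; exact abs_nonneg _
  · exact le_of_mul_le_mul_right h3 h4

lemma tendsto_yos (h : SingularPotential b B) {s : ℝ} (hs : s ∈ Ioo (-1) 1) :
    Tendsto (fun ε => yos b ε s) (𝓝[>] 0) (𝓝 (b s)) :=
  (h.cont s hs).tendsto.comp (h.tendsto_res (Ioo_subset_Icc_self hs))

/-- Dominated convergence, since Yosida values never exceed the limit in modulus. It exhibits the
mean of ξ as a limit of means of Lipschitz functions of u. -/
lemma tendsto_integral_yos (h : SingularPotential b B) {u ξ : X → ℝ}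
    (hu : AEStronglyMeasurable u μ) (hξ : Integrable ξ μ)
    (hb : ∀ᵐ x ∂μ, u x ∈ Ioo (-1 : ℝ) 1 ∧ b (u x) = ξ x) {e : ℕ → ℝ} (he0 : ∀ n, 0 < e n)
    (he : Tendsto e atTop (𝓝 0)) :
    Tendsto (fun n => ∫ x, yos b (e n) (u x) ∂μ) atTop (𝓝 (∫ x, ξ x ∂μ)) := by
  refine tendsto_integral_of_dominated_convergence (fun x => ‖ξ x‖)
    (fun n => (h.continuous_yos (he0 n)).comp_aestronglyMeasurable hu) hξ.norm (fun n => ?_) ?_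
  · filter_upwards [hb] with x hx
    rw [← hx.2]
    exact h.abs_yos_le (he0 n) hx.1
  · filter_upwards [hb] with x hx
    rw [← hx.2]
    exact (h.tendsto_yos hx.1).comp (tendsto_nhdsWithin_iff.2 ⟨he, Eventually.of_forall he0⟩)

section Potential

variable {F : ℝ → ℝ} {κ : ℝ}

/-- The regularized potential. -/
noncomputable def regPot (F b : ℝ → ℝ) (κ ε s : ℝ) : ℝ :=
  env b (fun s => F s - κ / 2 * s ^ 2) ε s + κ / 2 * s ^ 2

lemma integrable_regPot (h : SingularPotential b (fun s => F s - κ / 2 * s ^ 2)) {ε : ℝ}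
    (hε : 0 < ε) {u : X → ℝ} (hu : MemLp u 2 μ) :
    Integrable (fun x => regPot F b κ ε (u x)) μ :=
  (h.integrable_env hε hu).add (hu.integrable_sq.const_mul _)

lemma integral_regPot (h : SingularPotential b (fun s => F s - κ / 2 * s ^ 2)) {ε : ℝ}
    (hε : 0 < ε) {u : X → ℝ} (hu : MemLp u 2 μ) : ∫ x, regPot F b κ ε (u x) ∂μ
      = (∫ x, env b (fun s => F s - κ / 2 * s ^ 2) ε (u x) ∂μ) + κ / 2 * ∫ x, u x ^ 2 ∂μ := by
  rw [← integral_const_mul, ← integral_add (h.integrable_env hε hu) (hu.integrable_sq.const_mul _)]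
  rfl

lemma regPot_anti (h : SingularPotential b (fun s => F s - κ / 2 * s ^ 2)) {ε δ : ℝ} (hε : 0 < ε)
    (hεδ : ε ≤ δ) (s : ℝ) : regPot F b κ δ s ≤ regPot F b κ ε s :=
  add_le_add_left (h.env_anti hε hεδ s) _

lemma tendsto_regPot (h : SingularPotential b (fun s => F s - κ / 2 * s ^ 2)) {s : ℝ}
    (hs : extPotential F s ≠ ⊤) :
    Tendsto (fun ε => regPot F b κ ε s) (𝓝[>] 0) (𝓝 (extPotential F s).toReal) := by
  have h1 := h.tendsto_extPotential s
  exact (EReal.tendsto_toReal hs (h.extPotential_ne_bot s)).comp h1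

lemma regPot_le (h : SingularPotential b (fun s => F s - κ / 2 * s ^ 2)) {s : ℝ}
    (hs : extPotential F s ≠ ⊤) {ε : ℝ} (hε : 0 < ε) :
    regPot F b κ ε s ≤ (extPotential F s).toReal :=
  ge_of_tendsto (h.tendsto_regPot hs) (by
    filter_upwards [Ioo_mem_nhdsGT hε] with δ hδ
    exact h.regPot_anti hδ.1 hδ.2.le s)

lemma tendsto_nhdsGT_one_div : Tendsto (fun n : ℕ => 1 / ((n : ℝ) + 1)) atTop (𝓝[>] 0) :=
  tendsto_nhdsWithin_iff.2 ⟨tendsto_one_div_add_atTop_nhds_zero_nat,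
    Eventually.of_forall fun n => mem_Ioi.2 (Nat.one_div_pos_of_nat (n := n))⟩

/-- Boundedness of the regularized potential energies yields `F(u) ∈ L¹`. -/
lemma integrable_of_integral_regPot_le (h : SingularPotential b (fun s => F s - κ / 2 * s ^ 2))
    {u : X → ℝ} (hu : MemLp u 2 μ) {e : ℝ} (he : ∀ ε > 0, ∫ x, regPot F b κ ε (u x) ∂μ ≤ e) :
    (∀ᵐ x ∂μ, extPotential F (u x) ≠ ⊤) ∧
      Integrable (fun x => (extPotential F (u x)).toReal) μ := by
  set δ : ℕ → ℝ := fun n => 1 / ((n : ℝ) + 1) with hδ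
  have hδ0 : ∀ n, 0 < δ n := fun n => Nat.one_div_pos_of_nat
  have hδ1 : ∀ n, δ n ≤ 1 := fun n => by
    rw [hδ]
    exact (div_le_one (by positivity)).2 (by linarith [(Nat.cast_nonneg n : (0 : ℝ) ≤ n)])
  have hi : ∀ n, Integrable (fun x => regPot F b κ (δ n) (u x) - regPot F b κ 1 (u x)) μ :=
    fun n => (h.integrable_regPot (hδ0 n) hu).sub (h.integrable_regPot one_pos hu)
  have hn : ∀ n x, 0 ≤ regPot F b κ (δ n) (u x) - regPot F b κ 1 (u x) := fun n x =>
    sub_nonneg.2 (h.regPot_anti (hδ0 n) (hδ1 n) (u x))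
  have hb : ∀ n, ∫⁻ x, ‖regPot F b κ (δ n) (u x) - regPot F b κ 1 (u x)‖ₑ ∂μ
      ≤ ENNReal.ofReal (e - ∫ x, regPot F b κ 1 (u x) ∂μ) := fun n => by
    rw [← ofReal_integral_norm_eq_lintegral_enorm (hi n)]
    refine ENNReal.ofReal_le_ofReal ?_
    simp only [Real.norm_of_nonneg (hn n _)]
    rw [integral_sub (h.integrable_regPot (hδ0 n) hu) (h.integrable_regPot one_pos hu)]
    linarith [he _ (hδ0 n)]
  -- Fatou's lemma for the envelopes, normalized by the one with parameter 1 to be nonnegative. A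
  -- finite limit inferior excludes the value +∞ almost everywhere and gives integrability.
  have hlim : liminf (fun n => ∫⁻ x, ‖regPot F b κ (δ n) (u x) - regPot F b κ 1 (u x)‖ₑ ∂μ) atTop
      < ⊤ := (liminf_le_of_le (by isBoundedDefault) fun c hc => by
        obtain ⟨n, hn⟩ := hc.exists
        exact hn.trans (hb n)).trans_lt ENNReal.ofReal_lt_top
  have hfin : ∀ᵐ x ∂μ, liminf (fun n =>
      ‖regPot F b κ (δ n) (u x) - regPot F b κ 1 (u x)‖ₑ) atTop < ⊤ := by
    refine ae_lt_top' ?_ ((lintegral_liminf_le' fun n => (hi n).1.enorm).trans_lt hlim).ne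
    refine ⟨_, Measurable.liminf fun n => (hi n).1.enorm.measurable_mk, ?_⟩
    filter_upwards [ae_all_iff.2 fun n => (hi n).1.enorm.ae_eq_mk] with x hx
    simp only [hx]
  have h1 : ∀ᵐ x ∂μ, extPotential F (u x) ≠ ⊤ := by
    filter_upwards [hfin] with x hx hc
    have h2 := (h.tendsto_extPotential (u x)).comp tendsto_nhdsGT_one_div
    rw [hc] at h2
    have h3 : Tendsto (fun n => regPot F b κ (δ n) (u x)) atTop atTop :=
      EReal.tendsto_coe_nhds_top_iff.1 h2
    have h4 : Tendsto (fun n => ‖regPot F b κ (δ n) (u x) - regPot F b κ 1 (u x)‖ₑ) atTop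
        (𝓝 ⊤) := by
      have h5 : Tendsto (fun n => ENNReal.ofReal
          (regPot F b κ (δ n) (u x) - regPot F b κ 1 (u x))) atTop (𝓝 ⊤) :=
        ENNReal.tendsto_ofReal_atTop.comp
          (tendsto_atTop_add_const_right _ (-regPot F b κ 1 (u x)) h3)
      refine h5.congr fun n => ?_
      rw [Real.enorm_of_nonneg (hn n x)]
    rw [h4.liminf_eq] at hx
    exact lt_irrefl _ hx
  refine ⟨h1, ?_⟩
  have h2 : Integrable (fun x => (extPotential F (u x)).toReal - regPot F b κ 1 (u x)) μ := by
    have h3 : ∀ᵐ x ∂μ, Tendsto (fun n => regPot F b κ (δ n) (u x) - regPot F b κ 1 (u x)) atTop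
        (𝓝 ((extPotential F (u x)).toReal - regPot F b κ 1 (u x))) := by
      filter_upwards [h1] with x hx
      exact ((h.tendsto_regPot hx).comp tendsto_nhdsGT_one_div).sub_const _
    refine ⟨aestronglyMeasurable_of_tendsto_ae atTop (fun n => (hi n).1) h3, ?_⟩
    refine lt_of_le_of_lt ?_ hlim
    rw [lintegral_congr_ae (by filter_upwards [h3] with x hx using hx.enorm.liminf_eq.symm)]
    exact lintegral_liminf_le' fun n => (hi n).1.enorm
  exact (h2.add (h.integrable_regPot one_pos hu)).congr (ae_of_all _ fun x => sub_add_cancel _ _)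

/-- The regularized potentials increase to F as ε decreases, so monotone convergence identifies the
supremum. -/
lemma isLUB_integral_regPot (h : SingularPotential b (fun s => F s - κ / 2 * s ^ 2))
    {u : X → ℝ} (hu : MemLp u 2 μ) (h1 : ∀ᵐ x ∂μ, extPotential F (u x) ≠ ⊤)
    (h2 : Integrable (fun x => (extPotential F (u x)).toReal) μ) :
    IsLUB ((fun ε => ∫ x, regPot F b κ ε (u x) ∂μ) '' Ioi 0)
      (∫ x, (extPotential F (u x)).toReal ∂μ) := by
  refine ⟨?_, fun e he => ?_⟩
  · rintro _ ⟨ε, hε, rfl⟩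
    refine integral_mono_ae (h.integrable_regPot hε hu) h2 ?_
    filter_upwards [h1] with x hx
    exact h.regPot_le hx hε
  · have h3 := integral_tendsto_of_tendsto_of_monotone
      (f := fun (n : ℕ) x => regPot F b κ (1 / ((n : ℝ) + 1)) (u x))
      (fun n => h.integrable_regPot Nat.one_div_pos_of_nat hu) h2
      (ae_of_all _ fun x n m hnm => h.regPot_anti Nat.one_div_pos_of_nat
        (Nat.one_div_le_one_div hnm) _) (by
        filter_upwards [h1] with x hx
        exact (h.tendsto_regPot hx).comp tendsto_nhdsGT_one_div)
    exact le_of_tendsto' h3 fun n => he ⟨_, mem_Ioi.2 (Nat.one_div_pos_of_nat (n := n)), rfl⟩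

end Potential

end SingularPotential

end NonlocalCH

/-! ### The nonlocal Cahn–Hilliard flow as an abstract gradient flow -/

namespace NonlocalCH

variable {V G X : Type*} [NormedAddCommGroup V] [InnerProductSpace ℝ V] [CompleteSpace V]
  [NormedAddCommGroup G] [InnerProductSpace ℝ G] [CompleteSpace G] [MeasurableSpace X]
  {ν : Measure X} [IsFiniteMeasure ν]

/-- The data of the nonlocal Cahn–Hilliard flow with mean value `m`: the multiplication operator
`k`, the convolution `J` and the singular nonlinearity `b`. -/
structure NonlocalData (S : SobolevTriple V (Lp ℝ 2 ν) G) where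
  k : Lp ℝ 2 ν →L[ℝ] Lp ℝ 2 ν
  J : Lp ℝ 2 ν →L[ℝ] V
  b : ℝ → ℝ
  B : ℝ → ℝ
  c : ℝ
  m : ℝ
  one : S.T S.e =ᵐ[ν] fun _ => 1
  sing : SingularPotential b B
  c_pos : 0 < c
  k_symm : ∀ u v, inner ℝ (k u) v = inner ℝ u (k v)
  k_coercive : ∀ u, c * ‖u‖ ^ 2 ≤ inner ℝ (k u) u
  J_symm : ∀ u v, inner ℝ (S.T (J u)) v = inner ℝ u (S.T (J v))
  abs_m : |m| < 1

namespace NonlocalData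

variable {S : SobolevTriple V (Lp ℝ 2 ν) G}

lemma inner_one (N : NonlocalData S) (u : Lp ℝ 2 ν) :
    inner ℝ (S.T S.e) u = ∫ x, u x ∂ν := by
  rw [L2.inner_def]
  refine integral_congr_ae ?_
  filter_upwards [N.one] with x hx
  rw [hx]
  simp

variable (N : NonlocalData S)

/-- Integrating δ|a| - C ≤ a (u - m) bounds the L¹ norm of a. Since u - m has mean zero, its product
with a sees only the mean-zero part of a, which the equation controls. -/
lemma abs_inner_one_le {a u : Lp ℝ 2 ν} {δ C R : ℝ} (hδ : 0 < δ)
    (h : ∀ᵐ x ∂ν, δ * |a x| - C ≤ a x * (u x - N.m)) (hu : S.proj u = u - N.m • S.T S.e)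
    (hR : ‖S.proj u‖ ≤ R) :
    |inner ℝ (S.T S.e) a| ≤ (C * ν.real univ + R * ‖S.proj a‖) / δ := by
  have ia : Integrable (fun x => a x) ν := (Lp.memLp a).integrable one_le_two
  have h1 : ∫ x, (δ * |a x| - C) ∂ν ≤ inner ℝ (S.proj a) (S.proj u) := by
    rw [S.proj_symm, S.proj_idem, hu, L2.inner_def]
    refine integral_mono_ae ((ia.abs.const_mul δ).sub (integrable_const C))
      (L2.integrable_inner (𝕜 := ℝ) a _) ?_
    filter_upwards [h, N.one, Lp.coeFn_sub u (N.m • S.T S.e), Lp.coeFn_smul N.m (S.T S.e)]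
      with x h1 h2 h3 h4
    rw [h3, Pi.sub_apply, h4, Pi.smul_apply, h2, RCLike.inner_apply, conj_trivial,
      smul_eq_mul, mul_one, mul_comm (u x - N.m)]
    exact h1
  rw [integral_sub (ia.abs.const_mul δ) (integrable_const C), integral_const_mul, integral_const,
    smul_eq_mul] at h1
  have h2 : inner ℝ (S.proj a) (S.proj u) ≤ R * ‖S.proj a‖ :=
    (real_inner_le_norm _ _).trans (by rw [mul_comm]; gcongr)
  have h3 : |inner ℝ (S.T S.e) a| ≤ ∫ x, |a x| ∂ν := by
    rw [N.inner_one]; exact abs_integral_le_integral_abs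
  rw [le_div_iff₀ hδ]
  nlinarith

lemma norm_proj_le (u : Lp ℝ 2 ν) : ‖S.proj u‖ ≤ ‖u‖ := by
  have h1 : inner ℝ (S.proj u) (S.proj u) = inner ℝ u (S.proj u) := by
    rw [S.proj_symm, S.proj_idem]
  rw [real_inner_self_eq_norm_sq] at h1
  have h2 := real_inner_le_norm u (S.proj u)
  rcases (norm_nonneg (S.proj u)).eq_or_lt with h3 | h3
  · rw [← h3]; exact norm_nonneg _
  · nlinarith

lemma norm_le_add (a : Lp ℝ 2 ν) :
    ‖a‖ ≤ ‖S.proj a‖ + S.M⁻¹ * |inner ℝ (S.T S.e) a| * ‖S.T S.e‖ := by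
  have h1 : a = S.proj a + (S.M⁻¹ * inner ℝ (S.T S.e) a) • S.T S.e := by
    rw [S.proj_apply, sub_add_cancel]
  conv_lhs => rw [h1]
  refine (norm_add_le _ _).trans ?_
  rw [norm_smul, norm_mul, norm_inv, Real.norm_eq_abs, Real.norm_eq_abs, abs_of_pos S.M_pos]

/-- The operator `u ↦ k u - J * u`. -/
noncomputable def K : Lp ℝ 2 ν →L[ℝ] Lp ℝ 2 ν := N.k - S.T.comp N.J

lemma K_apply (u : Lp ℝ 2 ν) : N.K u = N.k u - S.T (N.J u) := rfl

/-- The regularization parameters used are smaller than this. -/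
noncomputable def ε₀ : ℝ := (4 * (1 + ‖N.K‖))⁻¹

lemma ε₀_pos : 0 < N.ε₀ := by rw [ε₀]; positivity

lemma exists_bound (R : ℝ) : ∃ C', 0 ≤ C' ∧ ∀ ε, 0 < ε → ∀ u : Lp ℝ 2 ν, ‖u‖ ≤ R →
    S.proj u = u - N.m • S.T S.e →
    ‖SingularPotential.yosL ν N.b ε u‖
      ≤ C' * (1 + ‖S.proj (SingularPotential.yosL ν N.b ε u)‖) := by
  obtain ⟨δ, hδ, C, hC, hb⟩ := N.sing.exists_le_yos_mul_sub N.abs_m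
  have hM := S.M_pos
  refine ⟨1 + S.M⁻¹ * ‖S.T S.e‖ * ((C * ν.real univ + |R|) / δ), by positivity,
    fun ε hε u hu hP => ?_⟩
  set a := SingularPotential.yosL ν N.b ε u with ha
  have h1 := N.abs_inner_one_le (a := a) (R := |R|) hδ (by
    filter_upwards [N.sing.coeFn_yosL hε u] with x hx
    rw [hx]
    exact hb ε hε _) hP (((norm_proj_le u).trans hu).trans (le_abs_self R))
  have h2 : (C * ν.real univ + |R| * ‖S.proj a‖) / δ
      ≤ (C * ν.real univ + |R|) / δ * (1 + ‖S.proj a‖) := by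
    rw [div_mul_eq_mul_div]
    gcongr
    nlinarith [mul_nonneg (mul_nonneg hC (measureReal_nonneg (μ := ν) (s := univ)))
      (norm_nonneg (S.proj a)), abs_nonneg R]
  refine (norm_le_add (S := S) a).trans ?_
  have h3 : S.M⁻¹ * |inner ℝ (S.T S.e) a| * ‖S.T S.e‖
      ≤ S.M⁻¹ * ((C * ν.real univ + |R|) / δ * (1 + ‖S.proj a‖)) * ‖S.T S.e‖ := by
    gcongr
    exact h1.trans h2
  nlinarith [norm_nonneg (S.proj a)]

/-- The abstract gradient flow. -/
noncomputable def flow (α : ℝ) : FlowData (Lp ℝ 2 ν) (S.Vel α) where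
  L := S.flowL α
  P := S.proj
  K := N.K
  m := N.m • S.T S.e
  A := SingularPotential.yosL ν N.b
  Ψ ε u := ∫ x, SingularPotential.env N.b N.B ε (u x) ∂ν
  c := N.c / 2
  C := ‖N.J‖ ^ 2 / (2 * N.c)
  C₁ := -((N.B 0 - |N.b 0| - 1 / (2 * N.ε₀)) * ν.real univ)
  ε₀ := N.ε₀
  c_pos := half_pos N.c_pos
  C_nonneg := by have := N.c_pos; positivity
  ε₀_pos := N.ε₀_pos
  ε₀_le_one := by
    rw [ε₀]
    exact inv_le_one_of_one_le₀ (by linarith [norm_nonneg N.K])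
  P_symm := S.proj_symm
  P_idem := S.proj_idem
  L_P := S.flowL_proj α
  L_inj u hu := S.proj_eq_zero_of_flowL α hu
  K_symm u v := by
    rw [N.K_apply, N.K_apply, inner_sub_left, inner_sub_right, N.k_symm, N.J_symm]
  K_coercive u hu := S.coercive_sub (J := N.J) (j := S.T.comp N.J) (fun u => rfl) N.c_pos
    N.k_coercive hu
  A_mono ε δ hε hδ u v := N.sing.yosL_mono hε hδ u v
  A_resolvent ε δ hε hδ u := N.sing.yosL_resolvent hε hδ u
  Ψ_subgrad ε hε u v := N.sing.yosL_subgrad hε u v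
  Ψ_anti ε δ hε hεδ u := N.sing.integral_env_anti hε hεδ (Lp.memLp u)
  Ψ_coercive ε hε hε₀ u := by
    have h1 := N.sing.integral_env_coercive hε hε₀ u
    have h2 : |inner ℝ (N.K u) u| ≤ ‖N.K‖ * ‖u‖ ^ 2 :=
      (abs_real_inner_le_norm _ _).trans (by
        rw [sq, ← mul_assoc]
        exact mul_le_mul_of_nonneg_right (N.K.le_opNorm u) (norm_nonneg u))
    -- The value of ε₀ is chosen so that the growth of the envelope exceeds the operator norm of K
    -- by 1.
    have h3 : ‖u‖ ^ 2 / (4 * N.ε₀) = (1 + ‖N.K‖) * ‖u‖ ^ 2 := by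
      rw [ε₀]
      have : 0 < 1 + ‖N.K‖ := by positivity
      field_simp
    rw [h3] at h1
    have h4 := neg_abs_le (inner ℝ (N.K u) u)
    nlinarith [mul_nonneg (norm_nonneg N.K) (sq_nonneg ‖u‖)]
  A_bound R := by
    obtain ⟨C', h0, h⟩ := N.exists_bound R
    exact ⟨C', h0, fun ε hε _ u hu hP => h ε hε u hu hP⟩

/-- The abstract inclusion holds pointwise: a solution takes values strictly inside (-1, 1) almost
everywhere, and ξ is b(u) there. -/
lemma rel_iff {α : ℝ} {u ξ : Lp ℝ 2 ν} :
    (N.flow α).A 1 (u + ξ) = ξ ↔ ∀ᵐ x ∂ν, u x ∈ Ioo (-1 : ℝ) 1 ∧ N.b (u x) = ξ x := by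
  change SingularPotential.yosL ν N.b 1 (u + ξ) = ξ ↔ _
  have h1 := N.sing.coeFn_yosL one_pos (u + ξ)
  have h2 := Lp.coeFn_add u ξ
  constructor
  · intro h
    rw [h] at h1
    filter_upwards [h1, h2] with x hx hx2
    rw [hx2, Pi.add_apply] at hx
    exact N.sing.yos_one_iff.1 hx.symm
  · intro h
    refine Lp.ext ?_
    filter_upwards [h, h1, h2] with x hx hx1 hx2
    rw [hx1, hx2, Pi.add_apply]
    exact N.sing.yos_one_iff.2 hx

section Solution

variable {α : ℝ} {T R : ℝ} {u : ℝ → Lp ℝ 2 ν} {y : ℝ → S.Vel α} {ξ : ℝ → Lp ℝ 2 ν}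

/-- Measurability in time of ξ is not part of a solution, but its mean is a limit of means of Yosida
approximations, which depend continuously on u(t). -/
lemma aestronglyMeasurable_inner_one (h : (N.flow α).IsSolution T u y ξ)
    (hu : AEStronglyMeasurable u (volume.restrict (Ioc 0 T))) :
    AEStronglyMeasurable (fun t => (inner ℝ (S.T S.e) (ξ t) : ℝ)) (volume.restrict (Ioc 0 T)) := by
  refine aestronglyMeasurable_of_tendsto_ae atTop
    (f := fun (n : ℕ) t => inner ℝ (S.T S.e) ((N.flow α).A (1 / ((n : ℝ) + 1)) (u t)))
    (fun n => ?_) ?_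
  · have hc : Continuous ((N.flow α).A (1 / ((n : ℝ) + 1))) :=
      ((N.flow α).A_lipschitzWith Nat.one_div_pos_of_nat).continuous
    exact (continuous_const.inner hc).comp_aestronglyMeasurable hu
  · filter_upwards [h.rel] with t ht
    have h1 := N.sing.tendsto_integral_yos (Lp.memLp (u t)).1
      ((Lp.memLp (ξ t)).integrable one_le_two) (N.rel_iff.1 ht)
      (fun n : ℕ => Nat.one_div_pos_of_nat) tendsto_one_div_add_atTop_nhds_zero_nat
    rw [← N.inner_one] at h1
    refine h1.congr fun n => ?_
    rw [N.inner_one]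
    exact integral_congr_ae (N.sing.coeFn_yosL Nat.one_div_pos_of_nat (u t)).symm

/-- The chemical potential belongs to `L²(0, T; V)`. -/
lemma memLp_potential (h : (N.flow α).IsSolution T u y ξ)
    (hu : AEStronglyMeasurable u (volume.restrict (Ioc 0 T))) (hR : ∀ t ∈ Icc 0 T, ‖u t‖ ≤ R) :
    MemLp (fun t => S.potential (y t) (N.K (u t) + ξ t)) 2 (volume.restrict (Ioc 0 T)) := by
  obtain ⟨δ, hδ, C, hC, hb⟩ := N.sing.exists_le_mul_sub N.abs_m
  -- The gradient of the potential is the velocity; only its mean needs an estimate, and this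
  -- follows from the mean bound together with P ξ = -L* y - P(K u).
  have hξ : MemLp (fun t => (inner ℝ (S.T S.e) (ξ t) : ℝ)) 2 (volume.restrict (Ioc 0 T)) := by
    have hg : MemLp (fun t => (C * ν.real univ + |R| * (‖S.flowL α‖ * ‖y t‖ + ‖N.K‖ * |R|)) / δ) 2
        (volume.restrict (Ioc 0 T)) := by
      have h1 := (((h.memLp.norm.const_mul ‖S.flowL α‖).add
        (memLp_const (‖N.K‖ * |R|))).const_mul |R|)
      have h2 := ((memLp_const (C * ν.real univ)).add h1).const_mul δ⁻¹
      refine h2.ae_eq (ae_of_all _ fun t => ?_)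
      change δ⁻¹ * (C * ν.real univ + |R| * (‖S.flowL α‖ * ‖y t‖ + ‖N.K‖ * |R|)) = _
      rw [← div_eq_inv_mul]
    refine hg.mono' (N.aestronglyMeasurable_inner_one h hu) ?_
    filter_upwards [h.rel, h.eqn, ae_restrict_mem measurableSet_Ioc] with t h1 h2 h3
    have ht : t ∈ Icc 0 T := Ioc_subset_Icc_self h3
    have h4 : ‖u t‖ ≤ |R| := (hR t ht).trans (le_abs_self R)
    refine (N.abs_inner_one_le (C := C) (R := |R|) hδ ?_ (h.proj t ht)
      ((norm_proj_le (u t)).trans h4)).trans ?_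
    · filter_upwards [N.rel_iff.1 h1] with x hx
      rw [← hx.2]
      exact hb _ hx.1
    · have h5 : S.proj (ξ t) = -((N.flow α).L.adjoint (y t)) - S.proj (N.K (u t)) := by
        have h6 : (N.flow α).L.adjoint (y t) + S.proj (N.K (u t) + ξ t) = 0 := h2
        rw [map_add, ← add_assoc] at h6
        rw [eq_neg_of_add_eq_zero_right h6]
        abel
      have h7 : ‖S.proj (ξ t)‖ ≤ ‖S.flowL α‖ * ‖y t‖ + ‖N.K‖ * |R| := by
        rw [h5]
        refine (norm_sub_le _ _).trans (add_le_add ?_ ?_)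
        · rw [norm_neg]
          refine (ContinuousLinearMap.le_opNorm _ _).trans (le_of_eq ?_)
          rw [LinearIsometryEquiv.norm_map]
          rfl
        · exact (norm_proj_le _).trans ((N.K.le_opNorm _).trans (by gcongr))
      gcongr
  have hK : MemLp (fun t => (inner ℝ (S.T S.e) (N.K (u t)) : ℝ)) 2 (volume.restrict (Ioc 0 T)) := by
    have hu2 : MemLp u 2 (volume.restrict (Ioc 0 T)) := MemLp.of_bound hu R (by
      filter_upwards [ae_restrict_mem measurableSet_Ioc] with t ht
      exact hR t (Ioc_subset_Icc_self ht))
    exact ((innerSL ℝ (S.T S.e)).comp N.K).comp_memLp' hu2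
  have h1 : MemLp (fun t => S.lift (S.velFst α (y t))) 2 (volume.restrict (Ioc 0 T)) :=
    (S.lift.comp (S.velFst α)).comp_memLp' h.memLp
  have h2 : MemLp (fun t => (S.M⁻¹ * (inner ℝ (S.T S.e) (N.K (u t)) + inner ℝ (S.T S.e) (ξ t)))
      • S.e) 2 (volume.restrict (Ioc 0 T)) :=
    ((ContinuousLinearMap.id ℝ ℝ).smulRight S.e).comp_memLp' ((hK.add hξ).const_mul S.M⁻¹)
  refine (h1.neg.add h2).ae_eq (ae_of_all _ fun t => ?_)
  change -S.lift (S.velFst α (y t)) + _ = S.potential (y t) (N.K (u t) + ξ t)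
  rw [SobolevTriple.potential, inner_add_right]

end Solution

lemma inner_K_self (u : Lp ℝ 2 ν) :
    inner ℝ (N.K u) u = inner ℝ (N.k u) u - inner ℝ (S.T (N.J u)) u := by
  rw [N.K_apply, inner_sub_left]

lemma coeFn_K (u : Lp ℝ 2 ν) : N.K u =ᵐ[ν] fun x => N.k u x - S.T (N.J u) x :=
  Lp.coeFn_sub _ _

lemma integral_of_proj {v : Lp ℝ 2 ν} (hv : S.proj v = v - N.m • S.T S.e) :
    ∫ x, v x ∂ν = N.m * S.M := by
  have h1 := S.inner_proj v
  rwa [hv, inner_sub_right, real_inner_smul_right, N.inner_one, sub_eq_zero] at h1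

lemma proj_of_integral {v : Lp ℝ 2 ν} (hv : S.M⁻¹ * ∫ x, v x ∂ν = N.m) :
    S.proj v = v - N.m • S.T S.e := by
  rw [S.proj_apply, N.inner_one, hv]

section Weak

variable {α : ℝ} {T : ℝ} {u : ℝ → Lp ℝ 2 ν} {y : ℝ → S.Vel α} {ξ : ℝ → Lp ℝ 2 ν}

lemma memLp_dualD (h : (N.flow α).IsSolution T u y ξ) :
    MemLp (fun t => S.dualD (S.velFst α (y t))) 2 (volume.restrict (Ioc 0 T)) :=
  (S.dualD.comp (S.velFst α)).comp_memLp' h.memLp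

lemma memLp_velSnd (h : (N.flow α).IsSolution T u y ξ) :
    MemLp (fun t => S.velSnd α (y t)) 2 (volume.restrict (Ioc 0 T)) :=
  (S.velSnd α).comp_memLp' h.memLp

lemma dual_eq_integral (h : (N.flow α).IsSolution T u y ξ) {t : ℝ} (ht : t ∈ Icc 0 T) :
    S.dual (u t) = S.dual (u 0) + ∫ s in (0 : ℝ)..t, S.dualD (S.velFst α (y s)) :=
  S.dualD_velFst_eq_integral rfl rfl h ht

lemma rel_of_isSolution (h : (N.flow α).IsSolution T u y ξ) :
    ∀ᵐ t ∂volume.restrict (Ioc 0 T), ∀ᵐ x ∂ν, u t x ∈ Ioo (-1 : ℝ) 1 ∧ N.b (u t x) = ξ t x :=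
  h.rel.mono fun _ ht => N.rel_iff.1 ht

/-- The pointwise equation for the chemical potential. -/
lemma ae_potential (h : (N.flow α).IsSolution T u y ξ) :
    ∀ᵐ t ∂volume.restrict (Ioc 0 T), S.T (S.potential (y t) (N.K (u t) + ξ t)) =ᵐ[ν]
      fun x => N.K (u t) x + N.b (u t x) + √α * S.velSnd α (y t) x := by
  filter_upwards [h.eqn, N.rel_of_isSolution h] with t h1 h2
  have h3 : S.T (S.potential (y t) (N.K (u t) + ξ t)) = N.K (u t) + ξ t + √α • S.velSnd α (y t) :=
    S.T_potential (𝓓 := N.flow α) rfl rfl h1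
  rw [h3]
  filter_upwards [h2, Lp.coeFn_add (N.K (u t) + ξ t) (√α • S.velSnd α (y t)),
    Lp.coeFn_add (N.K (u t)) (ξ t), Lp.coeFn_smul (√α) (S.velSnd α (y t))] with x g1 g2 g3 g4
  rw [g2, Pi.add_apply, g3, Pi.add_apply, g4, Pi.smul_apply, g1.2, smul_eq_mul]

/-- Weak formulations yield solutions of the abstract flow. -/
lemma exists_isSolution_of_weak {φ h : ℝ → Lp ℝ 2 ν} {w : ℝ → V →L[ℝ] ℝ} {μ : ℝ → V}
    (h0 : S.proj (φ 0) = φ 0 - N.m • S.T S.e) (hh : MemLp h 2 (volume.restrict (Ioc 0 T)))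
    (hμ : MemLp μ 2 (volume.restrict (Ioc 0 T)))
    (heq : ∀ v, ∀ t ∈ Icc 0 T, S.dual (φ t) v = S.dual (φ 0) v + ∫ s in (0 : ℝ)..t, w s v)
    (hhw : ∀ᵐ t ∂volume.restrict (Ioc 0 T), S.dual (h t) = √α • w t)
    (hwμ : ∀ v, ∀ᵐ t ∂volume.restrict (Ioc 0 T), w t v + inner ℝ (S.D (μ t)) (S.D v) = 0)
    (hTμ : ∀ᵐ t ∂volume.restrict (Ioc 0 T), S.T (μ t) =ᵐ[ν]
      fun x => N.K (φ t) x + N.b (φ t x) + √α * h t x)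
    (hφ : ∀ᵐ t ∂volume.restrict (Ioc 0 T), ∀ᵐ x ∂ν, φ t x ∈ Ioo (-1 : ℝ) 1) :
    ∃ y ξ, (N.flow α).IsSolution T φ y ξ := by
  refine ⟨_, fun t => S.T (μ t) - N.K (φ t) - √α • h t,
    S.isSolution_of_weak (𝓓 := N.flow α) rfl rfl h0 hh hμ heq hhw hwμ (ae_of_all _ fun t => ?_) ?_⟩
  · change S.T (μ t) = N.K (φ t) + (S.T (μ t) - N.K (φ t) - √α • h t) + √α • h t
    abel
  · filter_upwards [hTμ, hφ] with t h1 h2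
    refine N.rel_iff.2 ?_
    filter_upwards [h1, h2, Lp.coeFn_sub (S.T (μ t) - N.K (φ t)) (√α • h t),
      Lp.coeFn_sub (S.T (μ t)) (N.K (φ t)), Lp.coeFn_smul (√α) (h t)] with x g1 g2 g3 g4 g5
    refine ⟨g2, ?_⟩
    rw [g3, Pi.sub_apply, g4, Pi.sub_apply, g5, Pi.smul_apply, g1, smul_eq_mul]
    ring

lemma norm_sq_D_potential (y : S.Vel α) (z : Lp ℝ 2 ν) :
    ‖S.D (S.potential y z)‖ ^ 2 + ‖S.velSnd α y‖ ^ 2 = ‖y‖ ^ 2 := by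
  rw [S.D_potential, norm_neg, S.norm_sq_vel]

lemma dualD_add_inner_potential (y : S.Vel α) (z : Lp ℝ 2 ν) (v : V) :
    S.dualD (S.velFst α y) v + inner ℝ (S.D (S.potential y z)) (S.D v) = 0 := by
  rw [S.D_potential, inner_neg_left, S.dualD_apply, add_neg_cancel]

/-- Weak solutions of the flow, in terms of the abstract Sobolev triple. -/
structure IsWeak (α T : ℝ) (q : ℕ) (φ : ℝ → Lp ℝ 2 ν) (w : ℝ → V →L[ℝ] ℝ) (h : ℝ → Lp ℝ 2 ν)
    (μ : ℝ → V) : Prop where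
  memH : MemLp φ ⊤ (volume.restrict (Ioo 0 T))
  memLq : ∃ C : ℝ≥0, ∀ᵐ t ∂volume.restrict (Ioo 0 T),
    eLpNorm (φ t) ((2 + 2 * q : ℕ) : ℝ≥0∞) ν ≤ C
  weakDeriv : ∀ θ : ℝ → ℝ, ContDiff ℝ ∞ θ → HasCompactSupport θ → tsupport θ ⊆ Ioo 0 T →
    ∫ t in Ioo 0 T, deriv θ t • S.dual (φ t) = -∫ t in Ioo 0 T, θ t • w t
  deriv_memDual : MemLp w 2 (volume.restrict (Ioo 0 T))
  sqrt_deriv_memH : MemLp h 2 (volume.restrict (Ioo 0 T))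
  sqrt_deriv_eq : ∀ᵐ t ∂volume.restrict (Ioo 0 T), S.dual (h t) = √α • w t
  mu_memV : MemLp μ 2 (volume.restrict (Ioo 0 T))
  mu_eq : ∀ᵐ t ∂volume.restrict (Ioo 0 T), S.T (μ t) =ᵐ[ν]
    fun x => N.K (φ t) x + N.b (φ t x) + √α * h t x
  abs_lt_one : ∀ᵐ t ∂volume.restrict (Ioo 0 T), ∀ᵐ x ∂ν, |φ t x| < 1
  weakForm : ∀ v, ∀ᵐ t ∂volume.restrict (Ioo 0 T), w t v + inner ℝ (S.D (μ t)) (S.D v) = 0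
  continuous : ContinuousOn (fun t => S.dual (φ t)) (Icc 0 T)

theorem isWeak_of_isSolution {R : ℝ} (q : ℕ) (hT : 0 < T) (h : (N.flow α).IsSolution T u y ξ)
    (hu : AEStronglyMeasurable u (volume.restrict (Ioi 0))) (hR : ∀ t, 0 ≤ t → ‖u t‖ ≤ R) :
    N.IsWeak α T q u (fun t => S.dualD (S.velFst α (y t))) (fun t => S.velSnd α (y t))
      (fun t => S.potential (y t) (N.K (u t) + ξ t)) := by
  have hmono : volume.restrict (Ioo 0 T) ≤ volume.restrict (Ioc 0 T) :=
    Measure.restrict_mono_set _ Ioo_subset_Ioc_self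
  have hle : ∀ {p : ℝ → Prop}, (∀ᵐ t ∂volume.restrict (Ioc 0 T), p t) →
      ∀ᵐ t ∂volume.restrict (Ioo 0 T), p t := fun hp => ae_mono hmono hp
  have huT : AEStronglyMeasurable u (volume.restrict (Ioc 0 T)) :=
    hu.mono_measure (Measure.restrict_mono_set _ Ioc_subset_Ioi_self)
  have hwi := intervalIntegrable_of_memLp (N.memLp_dualD h) (t := T) ⟨hT.le, le_rfl⟩
  have heq := fun t ht => N.dual_eq_integral h (t := t) ht
  have hlt : ∀ᵐ t ∂volume.restrict (Ioo 0 T), ∀ᵐ x ∂ν, |u t x| < 1 := by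
    filter_upwards [hle (N.rel_of_isSolution h)] with t ht
    filter_upwards [ht] with x hx
    exact abs_lt.2 hx.1
  refine ⟨?_, ?_, fun θ h1 _ h3 => integral_smul_deriv_of_eq_integral hT hwi heq h1 h3,
    (N.memLp_dualD h).mono_measure hmono, (N.memLp_velSnd h).mono_measure hmono,
    ae_of_all _ fun t => S.dual_velSnd α (y t),
    (N.memLp_potential h huT fun t ht => hR t ht.1).mono_measure hmono,
    hle (N.ae_potential h), hlt, fun v => ae_of_all _ fun t => dualD_add_inner_potential _ _ _, ?_⟩
  · refine memLp_top_of_bound (huT.mono_measure hmono) R ?_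
    filter_upwards [ae_restrict_mem measurableSet_Ioo] with t ht
    exact hR t ht.1.le
  -- As |u| < 1 and the measure is finite, every Lebesgue norm is bounded by a constant independent
  -- of time.
  · set c := ν univ ^ (((2 + 2 * q : ℕ) : ℝ≥0∞).toReal)⁻¹ * ENNReal.ofReal 1
    have hct : c ≠ ⊤ := ENNReal.mul_ne_top
      (ENNReal.rpow_ne_top_of_nonneg (by positivity) (measure_ne_top _ _)) ENNReal.ofReal_ne_top
    refine ⟨c.toNNReal, ?_⟩
    rw [ENNReal.coe_toNNReal hct]
    filter_upwards [hlt] with t ht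
    exact eLpNorm_le_of_ae_bound (ht.mono fun x hx => hx.le)
  · have h4 := intervalIntegral.continuousOn_primitive_interval' hwi left_mem_uIcc
    rw [uIcc_of_le hT.le] at h4
    exact (continuousOn_const.add h4).congr heq

variable {N} in
theorem IsWeak.exists_isSolution {q : ℕ} {φ h : ℝ → Lp ℝ 2 ν} {w : ℝ → V →L[ℝ] ℝ} {μ : ℝ → V}
    (hs : N.IsWeak α T q φ w h μ) (hT : 0 < T) (h0 : S.proj (φ 0) = φ 0 - N.m • S.T S.e) :
    ∃ y ξ, (N.flow α).IsSolution T φ y ξ := by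
  have e : volume.restrict (Ioc 0 T) = volume.restrict (Ioo 0 T) :=
    Measure.restrict_congr_set Ioo_ae_eq_Ioc.symm
  have hw : MemLp w 2 (volume.restrict (Ioc 0 T)) := by rw [e]; exact hs.deriv_memDual
  have hwi := intervalIntegrable_of_memLp hw (t := T) ⟨hT.le, le_rfl⟩
  refine N.exists_isSolution_of_weak (w := w) (h := h) (μ := μ) h0 ?_ ?_ ?_ ?_ ?_ ?_ ?_
  · rw [e]; exact hs.sqrt_deriv_memH
  · rw [e]; exact hs.mu_memV
  · exact apply_eq_integral_of_forall_test hT hs.continuous hwi hs.weakDeriv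
  · rw [e]; exact hs.sqrt_deriv_eq
  · rw [e]; exact hs.weakForm
  · rw [e]; exact hs.mu_eq
  · rw [e]
    filter_upwards [hs.abs_lt_one] with t h1
    filter_upwards [h1] with x hx
    exact abs_lt.1 hx

end Weak

/-- The energy of the flow is finite exactly when the potential energy is. -/
lemma hasEnergy_iff {F : ℝ → ℝ} {κ : ℝ} (hB : N.B = fun s => F s - κ / 2 * s ^ 2) {α : ℝ}
    {u : Lp ℝ 2 ν} {e : ℝ} : (N.flow α).HasEnergy u e ↔
      ((∀ᵐ x ∂ν, extPotential F (u x) ≠ ⊤) ∧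
        Integrable (fun x => (extPotential F (u x)).toReal) ν) ∧
      e = 1 / 2 * (inner ℝ (N.K u) u - κ * ‖u‖ ^ 2)
        + ∫ x, (extPotential F (u x)).toReal ∂ν := by
  have hs : SingularPotential N.b (fun s => F s - κ / 2 * s ^ 2) := hB ▸ N.sing
  -- The quadratic term κ‖u‖² / 2 is moved from the form of K back to the potential, turning the
  -- Moreau envelope of the convex part into an approximation of F.
  have hreg : ∀ ε, 0 < ε → (N.flow α).energyReg ε u
      = 1 / 2 * (inner ℝ (N.K u) u - κ * ‖u‖ ^ 2)
        + ∫ x, SingularPotential.regPot F N.b κ ε (u x) ∂ν := fun ε hε => by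
    rw [hs.integral_regPot hε (Lp.memLp u), norm_sq_Lp]
    simp only [Real.norm_eq_abs, sq_abs, ← hB]
    change 1 / 2 * inner ℝ (N.K u) u + ∫ x, SingularPotential.env N.b N.B ε (u x) ∂ν = _
    ring
  have hlub : ∀ {a : ℝ}, IsLUB ((fun ε => ∫ x, SingularPotential.regPot F N.b κ ε (u x) ∂ν) '' Ioi 0)
      a → (N.flow α).HasEnergy u (1 / 2 * (inner ℝ (N.K u) u - κ * ‖u‖ ^ 2) + a) := by
    intro a ha
    refine ⟨?_, fun x hx => ?_⟩
    · rintro _ ⟨ε, hε, rfl⟩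
      change (N.flow α).energyReg ε u ≤ _
      rw [hreg ε hε]
      exact add_le_add_right (ha.1 ⟨ε, hε, rfl⟩) _
    · have : a ≤ x - 1 / 2 * (inner ℝ (N.K u) u - κ * ‖u‖ ^ 2) := ha.2 (by
        rintro _ ⟨ε, hε, rfl⟩
        have := hx ⟨ε, hε, rfl⟩
        change (N.flow α).energyReg ε u ≤ x at this
        rw [hreg ε hε] at this
        change ∫ x, SingularPotential.regPot F N.b κ ε (u x) ∂ν ≤ _
        linarith)
      linarith
  constructor
  · intro h
    have h1 := hs.integrable_of_integral_regPot_le (Lp.memLp u)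
      (e := e - 1 / 2 * (inner ℝ (N.K u) u - κ * ‖u‖ ^ 2)) fun ε hε => by
        have := h.le _ hε
        rw [hreg ε hε] at this
        linarith
    exact ⟨h1, h.unique (hlub (hs.isLUB_integral_regPot (Lp.memLp u) h1.1 h1.2))⟩
  · rintro ⟨h1, rfl⟩
    exact hlub (hs.isLUB_integral_regPot (Lp.memLp u) h1.1 h1.2)

end NonlocalData

end NonlocalCH

/-! ### Realization on the domain Ω -/

namespace NonlocalCH

variable {d : ℕ} {Ω : Set (E d)}

lemma IsBoundedLipschitzDomain.isFiniteMeasure (hΩ : IsBoundedLipschitzDomain Ω) :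
    IsFiniteMeasure (volume.restrict Ω) :=
  ⟨by rw [Measure.restrict_apply_univ]; exact hΩ.isBounded.measure_lt_top⟩

variable [IsFiniteMeasure (volume.restrict Ω)]

lemma IsBoundedLipschitzDomain.oneH_ne_zero (hΩ : IsBoundedLipschitzDomain Ω) : oneH Ω ≠ 0 := by
  intro h
  have h1 : (volume Ω).toReal = 0 := by rw [← inner_oneH_self, h, inner_zero_left]
  exact (ENNReal.toReal_pos (hΩ.isOpen.measure_pos volume hΩ.isConnected.nonempty).ne'
    hΩ.isBounded.measure_lt_top.ne).ne' h1

set_option maxHeartbeats 1000000 in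
lemma IsBoundedLipschitzDomain.exists_triple (hΩ : IsBoundedLipschitzDomain Ω) :
    ∃ S : SobolevTriple (V Ω) (H Ω) (HVec Ω),
      (∀ p, S.T p = toH Ω p) ∧ (∀ p, S.D p = grad Ω p) ∧ S.T S.e = oneH Ω := by
  obtain ⟨C, -, hC⟩ := hΩ.poincare
  exact ⟨{ T := toH Ω
           D := grad Ω
           e := oneV Ω
           C := C
           D_e := grad_oneV
           T_e := hΩ.oneH_ne_zero
           norm_sq := norm_sq_V
           dense := denseRange_toH hΩ.isOpen
           poincare := fun p hp => hC p (by rw [← inner_oneH]; exact hp) }, fun _ => rfl, fun _ => rfl, rfl⟩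

section Data

variable {J : E d → ℝ} {q : ℕ} {F₁ F₂ F : ℝ → ℝ}

/-- Multiplication by a + κ is the coercive part of K and convolution the compensating one.
Subtracting κ‖u‖² leaves the double integral of J against squared differences. -/
lemma exists_nonlocalData {W G : Type*} [NormedAddCommGroup W] [InnerProductSpace ℝ W]
    [CompleteSpace W] [NormedAddCommGroup G] [InnerProductSpace ℝ G] [CompleteSpace G]
    {S : SobolevTriple W (H Ω) G} (hone : S.T S.e = oneH Ω) (A : H Ω →L[ℝ] W)
    (hA : ∀ u, S.T (A u) =ᵐ[volume.restrict Ω] conv Ω J u) (hJ : IsAdmissibleKernel Ω J)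
    (hF : F = fun s => F₁ s + F₂ s) (hpot : IsAdmissiblePotential Ω J q F₁ F₂) {m : ℝ}
    (hm : |m| < 1) : ∃ (N : NonlocalData S) (κ : ℝ), N.m = m ∧
      N.b = (fun s => deriv F s - κ * s) ∧ N.B = (fun s => F s - κ / 2 * s ^ 2) ∧
      (∀ u, N.K u =ᵐ[volume.restrict Ω] fun x => aFun Ω J x * u x + κ * u x - conv Ω J u x) ∧
      ∀ u, 1 / 2 * (inner ℝ (N.K u) u - κ * ‖u‖ ^ 2)
        = 1 / 4 * ∫ x in Ω, ∫ y in Ω, J (x - y) * (u x - u y) ^ 2 := by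
  obtain ⟨κ, c, hc, hac, hsing⟩ := hpot.exists_singular hF
  have hJi := hJ.memW11.1
  obtain ⟨k, hk⟩ := exists_mul_clm (k := fun x => aFun Ω J x + κ) (C := (∫ z, ‖J z‖) + |κ|)
    ((aestronglyMeasurable_aFun hJi).add aestronglyMeasurable_const) (by positivity) fun x =>
      (norm_add_le _ _).trans (add_le_add (norm_aFun_le hJi x) le_rfl)
  have hkin : ∀ u v : H Ω, inner ℝ (k u) v = ∫ x in Ω, (aFun Ω J x + κ) * (u x * v x) := by
    intro u v
    rw [L2.inner_def]
    refine integral_congr_ae ?_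
    filter_upwards [hk u] with x hx
    rw [hx, RCLike.inner_apply, conj_trivial]
    ring
  have hi : ∀ u : H Ω, Integrable (fun x => u x ^ 2) (volume.restrict Ω) := fun u =>
    (Lp.memLp u).integrable_sq
  have hia : ∀ u : H Ω, Integrable (fun x => aFun Ω J x * u x ^ 2) (volume.restrict Ω) := fun u =>
    (hi u).bdd_mul (aestronglyMeasurable_aFun hJi) (ae_of_all _ (norm_aFun_le hJi))
  have hn : ∀ u : H Ω, ‖u‖ ^ 2 = ∫ x in Ω, u x ^ 2 := fun u => by
    rw [norm_sq_Lp]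
    simp only [Real.norm_eq_abs, sq_abs]
  have hkk : ∀ u : H Ω, inner ℝ (k u) u = (∫ x in Ω, aFun Ω J x * u x ^ 2) + κ * ‖u‖ ^ 2 := by
    intro u
    rw [hkin, hn, ← integral_const_mul, ← integral_add (hia u) ((hi u).const_mul κ)]
    refine integral_congr_ae (ae_of_all _ fun x => ?_)
    change (aFun Ω J x + κ) * (u x * u x) = aFun Ω J x * u x ^ 2 + κ * u x ^ 2
    ring
  obtain ⟨N, hNk, hNJ, hNb, hNB, hNm⟩ : ∃ N : NonlocalData S, N.k = k ∧ N.J = A ∧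
      N.b = (fun s => deriv F s - κ * s) ∧ N.B = (fun s => F s - κ / 2 * s ^ 2) ∧ N.m = m :=
    ⟨{ k := k
       J := A
       b := fun s => deriv F s - κ * s
       B := fun s => F s - κ / 2 * s ^ 2
       c := c
       m := m
       one := by rw [hone]; exact coeFn_oneH
       sing := hsing
       c_pos := hc
       k_symm := fun u v => by
         rw [real_inner_comm (k v) u, hkin, hkin]
         simp only [mul_comm]
       k_coercive := fun u => by
         rw [hkk, hn, ← integral_const_mul, ← integral_const_mul,
           ← integral_add (hia u) ((hi u).const_mul κ)]
         refine integral_mono_ae ((hi u).const_mul c) ((hia u).add ((hi u).const_mul κ)) ?_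
         filter_upwards [hac] with x hx
         change c * u x ^ 2 ≤ aFun Ω J x * u x ^ 2 + κ * u x ^ 2
         rw [← add_mul]
         exact mul_le_mul_of_nonneg_right hx (sq_nonneg _)
       J_symm := fun u v => inner_conv_symm hJi hJ.even (A := fun u => S.T (A u)) hA u v
       abs_m := hm }, rfl, rfl, rfl, rfl, rfl⟩
  refine ⟨N, κ, hNm, hNb, hNB, fun u => ?_, fun u => ?_⟩
  · filter_upwards [N.coeFn_K u, hk u, hA u] with x h1 h2 h3
    rw [h1, hNk, hNJ, h2, h3, add_mul]
  · rw [interaction_eq hJi hJ.even (A := fun u => S.T (A u)) hA u, N.inner_K_self, hNk, hNJ, hkk]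
    ring

end Data

section Weak

variable {S : SobolevTriple (V Ω) (H Ω) (HVec Ω)} {J : E d → ℝ} {F : ℝ → ℝ} {N : NonlocalData S}
  {κ : ℝ} {q : ℕ} {α T R : ℝ} {φ₀ : E d → ℝ}

set_option maxHeartbeats 1000000 in
theorem isWeakSolution_of_isWeak (hST : ∀ p, S.T p = toH Ω p) (hSD : ∀ p, S.D p = grad Ω p)
    (hb : N.b = fun s => deriv F s - κ * s)
    (hK : ∀ u, N.K u =ᵐ[volume.restrict Ω]
      fun x => aFun Ω J x * u x + κ * u x - conv Ω J u x)
    {φ : ℝ → H Ω} {w : ℝ → VDual Ω} {h : ℝ → H Ω} {μ : ℝ → V Ω} (hs : N.IsWeak α T q φ w h μ)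
    (h0 : φ 0 =ᵐ[volume.restrict Ω] φ₀) : IsWeakSolution Ω J F q α φ₀ T φ w h μ := by
  have hd : ∀ u, toDual Ω u = S.dual u := fun u =>
    ContinuousLinearMap.ext fun v => (congrArg (inner ℝ u) (hST v)).symm
  exact
    { memH := hs.memH
      memLq := hs.memLq
      weakDeriv := fun θ h1 h2 h3 =>
        (integral_congr_ae (ae_of_all _ fun t => congrArg (deriv θ t • ·) (hd (φ t)))).trans
          (hs.weakDeriv θ h1 h2 h3)
      deriv_memDual := hs.deriv_memDual
      sqrt_deriv_memH := hs.sqrt_deriv_memH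
      sqrt_deriv_eq := hs.sqrt_deriv_eq.mono fun t ht => (hd (h t)).trans ht
      mu_memV := hs.mu_memV
      mu_eq := hs.mu_eq.mono fun t ht => by
        have h1 := hST (μ t)
        generalize toH Ω (μ t) = z at h1 ⊢
        subst h1
        filter_upwards [ht, hK (φ t)] with x g1 g2
        rw [g1, g2, hb]
        ring
      abs_lt_one := hs.abs_lt_one
      weakForm := fun v => (hs.weakForm v).mono fun t ht =>
        (congrArg (fun z => w t v + z) (congrArg₂ (inner ℝ) (hSD (μ t)) (hSD v)).symm).trans ht
      continuous := hs.continuous.congr fun t _ => hd (φ t)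
      initial := h0 }

set_option maxHeartbeats 1000000 in
theorem isWeak_of_isWeakSolution (hST : ∀ p, S.T p = toH Ω p) (hSD : ∀ p, S.D p = grad Ω p)
    (hb : N.b = fun s => deriv F s - κ * s)
    (hK : ∀ u, N.K u =ᵐ[volume.restrict Ω]
      fun x => aFun Ω J x * u x + κ * u x - conv Ω J u x)
    {φ : ℝ → H Ω} {w : ℝ → VDual Ω} {h : ℝ → H Ω} {μ : ℝ → V Ω}
    (hs : IsWeakSolution Ω J F q α φ₀ T φ w h μ) : N.IsWeak α T q φ w h μ := by
  have hd : ∀ u, toDual Ω u = S.dual u := fun u =>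
    ContinuousLinearMap.ext fun v => (congrArg (inner ℝ u) (hST v)).symm
  exact
    { memH := hs.memH
      memLq := hs.memLq
      weakDeriv := fun θ h1 h2 h3 =>
        (integral_congr_ae (ae_of_all _ fun t =>
          congrArg (deriv θ t • ·) (hd (φ t)).symm)).trans (hs.weakDeriv θ h1 h2 h3)
      deriv_memDual := hs.deriv_memDual
      sqrt_deriv_memH := hs.sqrt_deriv_memH
      sqrt_deriv_eq := hs.sqrt_deriv_eq.mono fun t ht => (hd (h t)).symm.trans ht
      mu_memV := hs.mu_memV
      mu_eq := hs.mu_eq.mono fun t ht => by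
        have h1 := hST (μ t)
        generalize toH Ω (μ t) = z at h1 ht
        subst h1
        filter_upwards [ht, hK (φ t)] with x g1 g2
        rw [g1, g2, hb]
        ring
      abs_lt_one := hs.abs_lt_one
      weakForm := fun v => (hs.weakForm v).mono fun t ht =>
        (congrArg (fun z => w t v + z) (congrArg₂ (inner ℝ) (hSD (μ t)) (hSD v))).trans ht
      continuous := hs.continuous.congr fun t _ => (hd (φ t)).symm }

end Weak

lemma PotentialInL1.congr_ae {F : ℝ → ℝ} {u v : E d → ℝ} (h : PotentialInL1 Ω F u)
    (huv : u =ᵐ[volume.restrict Ω] v) : PotentialInL1 Ω F v := by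
  refine ⟨?_, h.2.congr ?_⟩
  · filter_upwards [h.1, huv] with x h1 h2
    rwa [← h2]
  · filter_upwards [huv] with x h2
    rw [h2]

lemma energy_congr_ae (J : E d → ℝ) (F : ℝ → ℝ) {u v : E d → ℝ}
    (huv : u =ᵐ[volume.restrict Ω] v) : energy Ω J F u = energy Ω J F v := by
  have e1 : ∫ x in Ω, ∫ y in Ω, J (x - y) * (u x - u y) ^ 2
      = ∫ x in Ω, ∫ y in Ω, J (x - y) * (v x - v y) ^ 2 := by
    refine integral_congr_ae ?_
    filter_upwards [huv] with x hx
    refine integral_congr_ae ?_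
    filter_upwards [huv] with y hy
    rw [hx, hy]
  have e2 : ∫ x in Ω, (extPotential F (u x)).toReal = ∫ x in Ω, (extPotential F (v x)).toReal := by
    refine integral_congr_ae ?_
    filter_upwards [huv] with x hx
    rw [hx]
  rw [energy, energy, e1, e2]

end NonlocalCH

/-! ### Existence, uniqueness and energy identity -/

open NonlocalCH

set_option maxHeartbeats 1000000

theorem theorem3p1 {d : ℕ} (hd : d = 2 ∨ d = 3)
    (Ω : Set (E d)) (hΩ : IsBoundedLipschitzDomain Ω)
    (J : E d → ℝ) (hJ : IsAdmissibleKernel Ω J)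
    (q : ℕ) (hq : 1 ≤ q) (F₁ F₂ F : ℝ → ℝ) (hF : F = fun s => F₁ s + F₂ s)
    (hpot : IsAdmissiblePotential Ω J q F₁ F₂)
    (α : ℝ) (hα : 0 ≤ α)
    (φ₀ : E d → ℝ) (hφ₀ : MemLp φ₀ ∞ (volume.restrict Ω))
    (hmean : |⨍ x in Ω, φ₀ x| < 1) (hFφ₀ : PotentialInL1 Ω F φ₀) :
    ∃ (φ : ℝ → H Ω) (w : ℝ → VDual Ω) (h : ℝ → H Ω) (μ : ℝ → V Ω),
      (∀ T > 0, IsWeakSolution Ω J F q α φ₀ T φ w h μ) ∧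
      (∀ t ≥ 0, ∫ x in Ω, φ t x = ∫ x in Ω, φ₀ x) ∧
      (∀ t ≥ 0, PotentialInL1 Ω F (φ t) ∧
        energy Ω J F (φ t) + (∫ s in (0 : ℝ)..t, (‖grad Ω (μ s)‖ ^ 2 + ‖h s‖ ^ 2)) =
          energy Ω J F φ₀) ∧
      (∀ T > 0, ∀ (φ' : ℝ → H Ω) (w' : ℝ → VDual Ω) (h' : ℝ → H Ω) (μ' : ℝ → V Ω),
        IsWeakSolution Ω J F q α φ₀ T φ' w' h' μ' → ∀ t ∈ Icc 0 T, φ' t = φ t) := by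
  have := hΩ.isFiniteMeasure
  obtain ⟨S, hST, hSD, hSe⟩ := hΩ.exists_triple
  obtain ⟨A, hA⟩ := exists_conv_toV (Ω := Ω) hJ.memW11
  obtain ⟨N, κ, hm, hb, hB, hK, hen⟩ := exists_nonlocalData hSe A
    (fun u => (hST (A u)).symm ▸ hA u) hJ hF hpot hmean
  have hφ₂ : MemLp φ₀ 2 (volume.restrict Ω) := hφ₀.mono_exponent le_top
  obtain ⟨u₀, hu₀φ⟩ : ∃ u₀ : H Ω, u₀ =ᵐ[volume.restrict Ω] φ₀ := ⟨hφ₂.toLp φ₀, hφ₂.coeFn_toLp⟩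
  -- The constant `N.m` is the mean of φ₀, so u₀ lies in the affine space on which the flow takes
  -- place.
  have hP₀ : S.proj u₀ = u₀ - N.m • S.T S.e := by
    refine N.proj_of_integral ?_
    have hM : S.M = (volume Ω).toReal := by
      rw [SobolevTriple.M, hSe, inner_oneH_self]
    rw [hM, hm, integral_congr_ae hu₀φ, setAverage_eq, smul_eq_mul]
    rfl
  have henergy : ∀ u : H Ω, 1 / 2 * (inner ℝ (N.K u) u - κ * ‖u‖ ^ 2)
      + ∫ x in Ω, (extPotential F (u x)).toReal = energy Ω J F u := fun u => by
    rw [hen u]; rfl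
  have he₀ : (N.flow α).HasEnergy u₀ (energy Ω J F φ₀) :=
    (N.hasEnergy_iff hB).2 ⟨hFφ₀.congr_ae hu₀φ.symm,
      by rw [henergy]; exact (energy_congr_ae J F hu₀φ).symm⟩
  obtain ⟨u, y, ξ, h0, ⟨R, hR⟩, hmeas, hsol, hE⟩ :=
    (N.flow α).exists_solution_energy (u₀ := u₀) hP₀ he₀
  refine ⟨u, fun t => S.dualD (S.velFst α (y t)), fun t => S.velSnd α (y t),
    fun t => S.potential (y t) (N.K (u t) + ξ t), fun T hT => ?_, fun t ht => ?_,
    fun t ht => ?_, fun T hT φ' w' h' μ' hs t ht => ?_⟩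
  · exact isWeakSolution_of_isWeak hST hSD hb hK (N.isWeak_of_isSolution q hT (hsol T) hmeas hR)
      (h0 ▸ hu₀φ)
  · rw [← integral_congr_ae hu₀φ, N.integral_of_proj hP₀,
      N.integral_of_proj ((hsol t).proj t ⟨ht, le_rfl⟩)]
  · obtain ⟨h1, h2⟩ := (N.hasEnergy_iff hB).1 (hE t ht)
    refine ⟨h1, ?_⟩
    rw [henergy] at h2
    -- The squared norm of a velocity is the physical dissipation: its first component is -∇μ and
    -- its second is √α ∂ₜφ.
    have h3 : ∀ s, ‖grad Ω (S.potential (y s) (N.K (u s) + ξ s))‖ ^ 2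
        + ‖S.velSnd α (y s)‖ ^ 2 = ‖y s‖ ^ 2 := fun s =>
      (congrArg (fun z => ‖z‖ ^ 2 + ‖S.velSnd α (y s)‖ ^ 2) (hSD _).symm).trans
        (NonlocalData.norm_sq_D_potential _ _)
    rw [← h2, intervalIntegral.integral_congr fun s _ => h3 s, sub_add_cancel]
  · have h1 : φ' 0 = u₀ := Lp.ext (by
      filter_upwards [hs.initial, hu₀φ] with x g1 g2
      rw [g1, g2])
    -- Any weak solution solves the abstract flow with the same initial value, so abstract
    -- uniqueness applies at every time.
    obtain ⟨y', ξ', hsol'⟩ :=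
      (isWeak_of_isWeakSolution hST hSD hb hK hs).exists_isSolution hT (by rw [h1]; exact hP₀)
    exact hsol'.unique (hsol T) (h1.trans h0.symm) t ht
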